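/- Let $k$ be a field and let $\pi\colon E\to B$ be a Serre fibration with $B$ simply connected; let $b\in B$ and $F=\pi^{-1}(b)$. Let $C_*(E)$ be the singular chain complex of $E$ with coefficients in $k$, filtered by letting $F^pC_n(E)$ be the span of the simplices $\alpha\colon\Delta^n\to E$ for which $\pi\circ\alpha$ factors through a degeneracy $\Delta^n\to\Delta^m$ (induced by a monotone surjection $\{0,\dots,n\}\to\{0,\dots,m\}$) for some $m\le p$. The spectral sequence $(E^r,d^r)_{r\ge 0}$ of this filtered complex is the homological Serre spectral sequence of $\pi$ with coefficients in $k$. Then: (1) $(E^r,d^r)$ is a spectral sequence of $k$-coalgebras: each page $E^r=\bigoplus_{p,q}E^r_{p,q}$ ($r\ge 0$) is a coassociative, counital, bigraded $k$-coalgebra with comultiplication $\triangle^r$ and counit $\varepsilon^r$; the co-Leibniz rule $\triangle^r\circ d^r=(d^r\otimes 1\pm 1\otimes d^r)\circ\triangle^r$ holds, where the sign on $E^r_{a,c}\otimes E^r_{b,d}$ is $(-1)^{a+c}$, and $\varepsilon^r\circ d^r=0$; and $\triangle^{r+1}$, $\varepsilon^{r+1}$ are induced by $\triangle^r$, $\varepsilon^r$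 under $E^{r+1}\cong H(E^r)$ and the Künneth isomorphism $H(E^r)\otimes H(E^r)\cong H(E^r\otimes E^r)$. Moreover $\triangle^0$ and $\varepsilon^0$ are induced by the Alexander--Whitney diagonal $\alpha\mapsto\sum_j(\alpha\circ[0,\dots,j])\otimes(\alpha\circ[j,\dots,n])$ and the augmentation of $C_*(E)$. (2) The standard identification $$E^2_{p,q}\;\cong\; H_p(B;H_q(F;k))\;\cong\; H_p(B;k)\otimes H_q(F;k)$$ is an isomorphism of bigraded coalgebras from $E^2$ to the tensor product of the graded coalgebras $H_*(B;k)$ and $H_*(F;k)$. Here $H_*(X;k)$ carries its usual comultiplication (the map induced by the Alexander--Whitney diagonal, followed by the inverse of the Künneth isomorphism) and the counit given by the augmentation; the tensor product has the comultiplication $(1\otimes T\otimes 1)\circ(\triangle_B\otimes\triangle_F)$ with $T(x\otimes y)=(-1)^{|x||y|}y\otimes x$. The standard identification is the one induced by $$\alpha\mapsto(-1)^{pq}\,(\pi\circ\alpha\circ[q,\dots,p+q])\otimes(\alpha\circ[0,\dots,q])$$ on simplices $\alpha\colon\Delta^{p+q}\to E$ in $F^p$, where the first factor is taken in the normalized chains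 of $B$ (degenerate simplices are $0$), the second factor is a simplex in the fiber over the initial vertex of the first (whenever the first is non-degenerate), and the homology of all fibers of $\pi$ is identified with $H_*(F;k)$ by transport along paths in $B$. -/

import Mathlib

open CategoryTheory DirectSum TensorProduct

noncomputable section

namespace SerreCoalgebra

universe u v w

/-! ### Differential graded modules and filtered differential graded modules -/

/-- A (homologically `ℤ`-graded) differential graded module: a `k`-module `C` which is the
internal direct sum of submodules `gr n`, with a differential of degree `-1`. -/
structure DGModule (k : Type v) [Field k] (C : Type w) [AddCommGroup C] [Module k C] where
  gr : ℤ → Submodule k C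
  isInternal : DirectSum.IsInternal gr
  d : C →ₗ[k] C
  d_d : ∀ x, d (d x) = 0
  d_mem_gr : ∀ n, ∀ x ∈ gr n, d x ∈ gr (n - 1)

/-- A filtered differential graded module: the differential preserves an increasing filtration. -/
structure FilteredDGModule (k : Type v) [Field k] (C : Type w) [AddCommGroup C] [Module k C]
    extends DGModule k C where
  fil : ℤ → Submodule k C
  fil_mono : Monotone fil
  d_mem_fil : ∀ p, ∀ x ∈ fil p, d x ∈ fil p

namespace DGModule

variable {k : Type v} [Field k] {C : Type w} [AddCommGroup C] [Module k C] (M : DGModule k C)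

/-- The cycles of degree `n`. -/
def cycles (n : ℤ) : Submodule k C := LinearMap.ker M.d ⊓ M.gr n

/-- The homology in degree `n`: cycles of degree `n` modulo boundaries. -/
abbrev Homology (n : ℤ) : Type w :=
  (M.cycles n) ⧸ (LinearMap.range M.d).submoduleOf (M.cycles n)

/-- The class of a cycle. -/
abbrev homologyClass (n : ℤ) : M.cycles n →ₗ[k] M.Homology n := Submodule.mkQ _

/-- The total (graded) homology. -/
abbrev TotalHomology : Type w := ⨁ n : ℤ, M.Homology n

end DGModule

namespace FilteredDGModule

variable {k : Type v} [Field k] {C : Type w} [AddCommGroup C] [Module k C]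
  (M : FilteredDGModule k C)

/-- `F^p_{p+q}`, the part of degree `p + q` of the `p`-th step of the filtration. -/
def filGr (x : ℤ × ℤ) : Submodule k C := M.fil x.1 ⊓ M.gr (x.1 + x.2)

/-- The almost cycles `Z^r_{p,q} = F^p_{p+q} ∩ d⁻¹(F^{p-r})`. -/
def almostCycles (r : ℤ) (x : ℤ × ℤ) : Submodule k C :=
  M.filGr x ⊓ (M.fil (x.1 - r)).comap M.d

/-- The almost boundaries `B^r_{p,q} = F^p_{p+q} ∩ d(F^{p+r}_{p+q+1})`. -/
def almostBoundaries (r : ℤ) (x : ℤ × ℤ) : Submodule k C :=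
  M.filGr x ⊓ (M.filGr (x.1 + r, x.2 - r + 1)).map M.d

/-- `B^{r-1}_{p,q} + F^{p-1}_{p+q}`. -/
def pageDenominator (r : ℤ) (x : ℤ × ℤ) : Submodule k C :=
  M.almostBoundaries (r - 1) x ⊔ M.filGr (x.1 - 1, x.2 + 1)

/-- The term `E^r_{p,q} = (Z^r_{p,q} + F^{p-1}_{p+q}) / (B^{r-1}_{p,q} + F^{p-1}_{p+q})` of the
spectral sequence of a filtered differential graded module, written (second isomorphism theorem)
as the quotient of `Z^r_{p,q}` by its intersection with `B^{r-1}_{p,q} + F^{p-1}_{p+q}`. -/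
abbrev Page (r : ℤ) (x : ℤ × ℤ) : Type w :=
  (M.almostCycles r x) ⧸ (M.pageDenominator r x).submoduleOf (M.almostCycles r x)

/-- The class in `E^r_{p,q}` of an almost cycle. -/
abbrev pageMk (r : ℤ) (x : ℤ × ℤ) : M.almostCycles r x →ₗ[k] M.Page r x := Submodule.mkQ _

lemma d_mem_almostCycles (r : ℤ) {x y : ℤ × ℤ} (h : x + (-r, r - 1) = y) {c : C}
    (hc : c ∈ M.almostCycles r x) : M.d c ∈ M.almostCycles r y := by
  subst h
  obtain ⟨⟨h1, h2⟩, h3⟩ := hc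
  refine ⟨⟨?_, ?_⟩, ?_⟩
  · simpa [sub_eq_add_neg] using h3
  · have := M.d_mem_gr _ _ h2
    have e : (x + (-r, r - 1)).1 + (x + (-r, r - 1)).2 = x.1 + x.2 - 1 := by
      simp only [Prod.fst_add, Prod.snd_add]; ring
    rw [← e] at this
    exact this
  · simp [M.d_d]

/-- The restriction of the differential to almost cycles. -/
def dAlmostCycles (r : ℤ) {x y : ℤ × ℤ} (h : x + (-r, r - 1) = y) :
    M.almostCycles r x →ₗ[k] M.almostCycles r y :=
  M.d.restrict fun _ hc => M.d_mem_almostCycles r h hc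

lemma pageDenominator_le (r : ℤ) {x y : ℤ × ℤ} (h : x + (-r, r - 1) = y) :
    (M.pageDenominator r x).submoduleOf (M.almostCycles r x) ≤
      ((M.pageDenominator r y).submoduleOf (M.almostCycles r y)).comap (M.dAlmostCycles r h) := by
  rintro ⟨c, hc⟩ hcd
  have hy := M.d_mem_almostCycles r h hc
  simp only [Submodule.submoduleOf, Submodule.mem_comap, Submodule.subtype_apply,
    pageDenominator, Submodule.mem_sup] at hcd ⊢
  obtain ⟨b, ⟨_, b', _, rfl⟩, f, hf, hbf⟩ := hcd
  subst h
  refine ⟨M.d f, ⟨?_, f, ?_, rfl⟩, 0, Submodule.zero_mem _, ?_⟩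
  · have : M.d f = M.d c := by rw [← hbf, map_add, M.d_d, zero_add]
    rw [this]; exact hy.1
  · have e : ((x + (-r, r - 1)).1 + (r - 1), (x + (-r, r - 1)).2 - (r - 1) + 1) =
        (x.1 - 1, x.2 + 1) := by
      ext <;> simp only [Prod.fst_add, Prod.snd_add] <;> ring
    rw [← e] at hf
    exact hf
  · rw [add_zero]
    change _ = M.d c
    rw [← hbf, map_add, M.d_d, zero_add]

/-- The differential `d^r : E^r_{p,q} → E^r_{p-r,q+r-1}`, induced by the differential. -/
def pageD (r : ℤ) {x y : ℤ × ℤ} (h : x + (-r, r - 1) = y) : M.Page r x →ₗ[k] M.Page r y :=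
  Submodule.mapQ _ _ (M.dAlmostCycles r h) (M.pageDenominator_le r h)

open Classical in
/-- The `r`-th page as a complex of `k`-modules. -/
def pageComplex (r : ℤ) :
    HomologicalComplex (ModuleCat.{w} k) (ComplexShape.up' ((-r, r - 1) : ℤ × ℤ)) where
  X x := ModuleCat.of k (M.Page r x)
  d x y := if h : x + (-r, r - 1) = y then ModuleCat.ofHom (M.pageD r h) else 0
  shape x y h := dif_neg h
  d_comp_d' x y z hxy hyz := by
    rw [dif_pos (show x + (-r, r - 1) = y from hxy), dif_pos (show y + (-r, r - 1) = z from hyz), ← ModuleCat.ofHom_comp]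
    ext c
    change M.pageMk r z (M.dAlmostCycles r hyz (M.dAlmostCycles r hxy c)) = 0
    have : M.dAlmostCycles r hyz (M.dAlmostCycles r hxy c) = 0 := Subtype.ext (M.d_d _)
    rw [this, map_zero]

lemma almostCycles_succ_le (r : ℤ) (x : ℤ × ℤ) :
    M.almostCycles (r + 1) x ≤ M.almostCycles r x :=
  inf_le_inf_left _ (Submodule.comap_mono (M.fil_mono (by lia)))

lemma pageComplex_d (r : ℤ) {x y : ℤ × ℤ} (h : x + (-r, r - 1) = y) :
    (M.pageComplex r).d x y = ModuleCat.ofHom (M.pageD r h) := dif_pos h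

/-- `Z^{r+1}_{p,q}` maps to the cycles of the `r`-th page. -/
def toKer (r : ℤ) (x : ℤ × ℤ) :
    M.almostCycles (r + 1) x →ₗ[k] LinearMap.ker ((M.pageComplex r).sc x).g.hom :=
  ((M.pageMk r x).comp (Submodule.inclusion (M.almostCycles_succ_le r x))).codRestrict _ <| by
    rintro ⟨c, hc⟩
    have hn : (ComplexShape.up' ((-r, r - 1) : ℤ × ℤ)).next x = x + (-r, r - 1) :=
      (ComplexShape.up' ((-r, r - 1) : ℤ × ℤ)).next_eq' rfl
    change ((M.pageComplex r).d x _).hom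
      (M.pageMk r x ⟨c, M.almostCycles_succ_le r x hc⟩) = 0
    rw [M.pageComplex_d r hn.symm]
    change M.pageMk r _ (M.dAlmostCycles r hn.symm _) = 0
    rw [Submodule.mkQ_apply, Submodule.Quotient.mk_eq_zero]
    refine Submodule.mem_sup_right (?_ : M.d c ∈ _)
    have h1 := M.d_mem_almostCycles (r + 1) rfl hc
    rw [hn]
    have e1 : x.1 + -(r + 1) = (x + (-r, r - 1)).1 - 1 := by simp only [Prod.fst_add]; ring
    have e2 : x.2 + (r + 1 - 1) = (x + (-r, r - 1)).2 + 1 := by simp only [Prod.snd_add]; ring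
    rw [← e1, ← e2]
    exact h1.1

/-- `Z^{r+1}_{p,q}` maps to the homology of the `r`-th page. -/
def toPageHomology (r : ℤ) (x : ℤ × ℤ) : M.almostCycles (r + 1) x →ₗ[k]
    ((M.pageComplex r).sc x).moduleCatLeftHomologyData.H :=
  (Submodule.mkQ _).comp (M.toKer r x)

lemma toPageHomology_surjective (r : ℤ) (x : ℤ × ℤ) :
    Function.Surjective (M.toPageHomology r x) := by
  refine (Submodule.mkQ_surjective _).comp ?_
  rintro ⟨c, hc⟩
  obtain ⟨⟨c, hcZ⟩, rfl⟩ := Submodule.mkQ_surjective _ c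
  have hn : (ComplexShape.up' ((-r, r - 1) : ℤ × ℤ)).next x = x + (-r, r - 1) :=
    (ComplexShape.up' ((-r, r - 1) : ℤ × ℤ)).next_eq' rfl
  have hc' := LinearMap.mem_ker.1 hc
  change ((M.pageComplex r).d x _).hom _ = 0 at hc'
  rw [M.pageComplex_d r hn.symm] at hc'
  change M.pageMk r _ (M.dAlmostCycles r hn.symm _) = 0 at hc'
  rw [Submodule.mkQ_apply, Submodule.Quotient.mk_eq_zero] at hc'
  change M.d c ∈ M.pageDenominator r _ at hc'
  rw [hn] at hc'
  obtain ⟨_, ⟨-, b, hb, rfl⟩, f, hf, hbf⟩ := Submodule.mem_sup.1 hc'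
  have e : ((x + (-r, r - 1)).1 + (r - 1), (x + (-r, r - 1)).2 - (r - 1) + 1) =
      (x.1 - 1, x.2 + 1) := by
    ext <;> simp only [Prod.fst_add, Prod.snd_add] <;> ring
  rw [e] at hb
  have hb' : b ∈ M.filGr x := by
    refine ⟨M.fil_mono (by lia) hb.1, ?_⟩
    have := hb.2
    simpa only [show x.1 - 1 + (x.2 + 1) = x.1 + x.2 by ring] using this
  have hdb : M.d (c - b) = f := by rw [map_sub, ← hbf]; abel
  have hZ' : c - b ∈ M.almostCycles (r + 1) x := by
    refine ⟨Submodule.sub_mem _ hcZ.1 hb', ?_⟩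
    change M.d (c - b) ∈ M.fil (x.1 - (r + 1))
    rw [hdb]
    have this : f ∈ M.fil _ := hf.1
    simpa only [Prod.fst_add, show x.1 + -r - 1 = x.1 - (r + 1) by ring] using this
  refine ⟨⟨c - b, hZ'⟩, Subtype.ext ?_⟩
  change M.pageMk r x ⟨c - b, _⟩ = M.pageMk r x ⟨c, _⟩
  rw [← sub_eq_zero, ← map_sub, Submodule.mkQ_apply, Submodule.Quotient.mk_eq_zero]
  refine Submodule.mem_sup_right ?_
  change (c - b) - c ∈ _
  rw [sub_sub_cancel_left]
  exact Submodule.neg_mem _ hb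

lemma ker_toPageHomology (r : ℤ) (x : ℤ × ℤ) :
    LinearMap.ker (M.toPageHomology r x) =
      (M.pageDenominator (r + 1) x).submoduleOf (M.almostCycles (r + 1) x) := by
  have hp : (ComplexShape.up' ((-r, r - 1) : ℤ × ℤ)).prev x = x - (-r, r - 1) :=
    (ComplexShape.up' ((-r, r - 1) : ℤ × ℤ)).prev_eq' (sub_add_cancel x _)
  have hrel : (ComplexShape.up' ((-r, r - 1) : ℤ × ℤ)).prev x + (-r, r - 1) = x := by
    rw [hp, sub_add_cancel]
  have e1 : x.1 + (r + 1 - 1) = (x - (-r, r - 1)).1 := by simp only [Prod.fst_sub]; ring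
  have e2 : x.2 - (r + 1 - 1) + 1 = (x - (-r, r - 1)).2 := by simp only [Prod.snd_sub]; ring
  ext ⟨c, hc⟩
  rw [LinearMap.mem_ker]
  change (Submodule.mkQ _) (M.toKer r x ⟨c, hc⟩) = 0 ↔ c ∈ M.pageDenominator (r + 1) x
  rw [Submodule.mkQ_apply, Submodule.Quotient.mk_eq_zero, LinearMap.mem_range]
  have key : ∀ w : M.almostCycles r ((ComplexShape.up' ((-r, r - 1) : ℤ × ℤ)).prev x),
      ((M.pageComplex r).sc x).moduleCatToCycles (M.pageMk r _ w) = M.toKer r x ⟨c, hc⟩ ↔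
        M.d w - c ∈ M.pageDenominator r x := by
    intro w
    rw [← Subtype.coe_inj]
    change ((M.pageComplex r).d _ x).hom _ = M.pageMk r x ⟨c, _⟩ ↔ _
    rw [M.pageComplex_d r hrel]
    change M.pageMk r _ (M.dAlmostCycles r hrel w) = _ ↔ _
    rw [← sub_eq_zero, ← map_sub, Submodule.mkQ_apply, Submodule.Quotient.mk_eq_zero]
    rfl
  constructor
  · rintro ⟨w, hw⟩
    obtain ⟨⟨w, hwZ⟩, rfl⟩ := Submodule.mkQ_surjective _ w
    rw [key] at hw
    rw [hp] at hwZ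
    obtain ⟨_, ⟨-, b, hb, rfl⟩, f, hf, hbf⟩ := Submodule.mem_sup.1 hw
    have hbf' : M.d b + f = M.d w - c := hbf
    refine Submodule.mem_sup.2 ⟨M.d (w - b), ⟨?_, w - b, ?_, rfl⟩, -f,
      Submodule.neg_mem _ hf, ?_⟩
    · have : M.d (w - b) = c + f := by
        rw [map_sub, sub_eq_iff_eq_add, add_assoc, add_comm f, hbf']; abel
      rw [this]
      refine Submodule.add_mem _ hc.1 ⟨M.fil_mono (by lia) hf.1, ?_⟩
      have := hf.2
      simpa only [show x.1 - 1 + (x.2 + 1) = x.1 + x.2 by ring] using this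
    · rw [e1, e2]
      refine Submodule.sub_mem _ hwZ.1 ⟨?_, ?_⟩
      · refine M.fil_mono ?_ hb.1
        simp only [Prod.fst_sub]; lia
      · have := hb.2
        simpa only [Prod.fst_sub, Prod.snd_sub, show x.1 - -r + (x.2 - (r - 1)) =
          x.1 + (r - 1) + (x.2 - (r - 1) + 1) by ring] using this
    · rw [map_sub, ← sub_eq_add_neg, sub_sub, hbf']; abel
  · intro h
    obtain ⟨_, ⟨hbF, b, hb, rfl⟩, f, hf, hbf⟩ := Submodule.mem_sup.1 h
    rw [e1, e2] at hb
    refine ⟨M.pageMk r _ ⟨b, ?_⟩, (key _).2 ?_⟩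
    · rw [hp]
      refine ⟨hb, ?_⟩
      have := hbF.1
      simpa using this
    · refine Submodule.mem_sup_right ?_
      change M.d b - c ∈ _
      rw [← hbf, sub_add_cancel_left]
      exact Submodule.neg_mem _ hf

/-- The isomorphism `E^{r+1} ≅ H(E^r)`, sending the class of `c ∈ Z^{r+1}` in `E^{r+1}` to the
homology class of the class of `c ∈ Z^r` in `E^r`. -/
def pageIso (r : ℤ) (x : ℤ × ℤ) :
    M.Page (r + 1) x ≃ₗ[k] ((M.pageComplex r).sc x).moduleCatLeftHomologyData.H :=
  (Submodule.quotEquivOfEq _ _ (M.ker_toPageHomology r x).symm).trans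
    ((M.toPageHomology r x).quotKerEquivOfSurjective (M.toPageHomology_surjective r x))

/-- The spectral sequence of a filtered differential graded module. -/
def spectralSequence :
    SpectralSequence (ModuleCat.{w} k)
      (fun r => ComplexShape.up' ((-r, r - 1) : ℤ × ℤ)) 0 where
  page r _ := M.pageComplex r
  iso r r' x hr _ := by
    subst hr
    exact ((M.pageComplex r).sc x).moduleCatHomologyIso ≪≫ (M.pageIso r x).symm.toModuleIso

end FilteredDGModule

/-! ### Comultiplications induced on homology -/

section Induced

variable {k : Type v} [Field k]

section Definition

variable {P : Type*} [AddCommMonoid P] [Module k P]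
  {Z : Type*} [AddCommMonoid Z] [Module k Z] {H : Type*} [AddCommMonoid H] [Module k H]

/-- The differential `D ⊗ 1 ± 1 ⊗ D` of `P ⊗ P`; the Koszul sign is carried by the operator `sgn`,
which is multiplication by `(-1)^n` on elements of degree `n`. -/
def tensorD (D sgn : P →ₗ[k] P) : P ⊗[k] P →ₗ[k] P ⊗[k] P :=
  TensorProduct.map D LinearMap.id + TensorProduct.map sgn D

/-- Let `H` be the homology of `(P, D)`, with `i : Z → P` the inclusion of the cycles and
`cls : Z → H` the class map, and let `Δ : P → P ⊗ P` be a chain map. This says that `ΔH` is the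
composite of the map `H → H(P ⊗ P)` induced by `Δ` with the inverse of the Künneth isomorphism
`H ⊗ H → H(P ⊗ P)`, `[y] ⊗ [y'] ↦ [y ⊗ y']`: for every cycle `z`, the cycle `Δ z` is homologous
to some `t ∈ Z ⊗ Z`, and `ΔH [z]` is the class of `t` in `H ⊗ H`. -/
def InducedOnHomology (D sgn : P →ₗ[k] P) (i : Z →ₗ[k] P) (cls : Z →ₗ[k] H)
    (Δ : P →ₗ[k] P ⊗[k] P) (ΔH : H →ₗ[k] H ⊗[k] H) : Prop :=
  ∀ z : Z, ∃ (t : Z ⊗[k] Z) (w : P ⊗[k] P),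
    Δ (i z) = TensorProduct.map i i t + tensorD D sgn w ∧ ΔH (cls z) = TensorProduct.map cls cls t

end Definition

variable {P : Type*} [AddCommGroup P] [Module k P]
  {Z : Type*} [AddCommGroup Z] [Module k Z] {H : Type*} [AddCommGroup H] [Module k H]

/-- The induced comultiplication exists and is unique (Künneth theorem over a field). -/
theorem existsUnique_inducedOnHomology (D sgn : P →ₗ[k] P) (i : Z →ₗ[k] P) (cls : Z →ₗ[k] H)
    (Δ : P →ₗ[k] P ⊗[k] P) (hDD : ∀ x, D (D x) = 0) (hsgn : ∀ x, sgn (sgn x) = x)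
    (hsD : ∀ x, D (sgn x) = -sgn (D x)) (hi : ∀ x, D x = 0 → ∃ z, i z = x)
    (hDi : ∀ z, D (i z) = 0) (hcls : Function.Surjective cls)
    (hker : ∀ z, cls z = 0 ↔ ∃ w, i z = D w)
    (hΔ : ∀ x, Δ (D x) = tensorD D sgn (Δ x)) :
    ∃! ΔH, InducedOnHomology D sgn i cls Δ ΔH := by
  -- a retraction `r` extending `cls`, a section `s` of `cls`, a generalized inverse `G` of `D`
  obtain ⟨r, hr⟩ : ∃ r : P →ₗ[k] H, ∀ z, r (i z) = cls z := by
    have hle : LinearMap.ker i ≤ LinearMap.ker cls := by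
      intro z hz
      rw [LinearMap.mem_ker] at hz ⊢
      exact (hker z).2 ⟨0, by rw [hz, map_zero]⟩
    obtain ⟨f, hf⟩ := LinearMap.exists_extend
      (((LinearMap.ker i).liftQ cls hle).comp i.quotKerEquivRange.symm.toLinearMap)
    refine ⟨f, fun z => ?_⟩
    have := congrArg (fun g => g ⟨i z, LinearMap.mem_range_self i z⟩) hf
    have e : i.quotKerEquivRange.symm ⟨i z, LinearMap.mem_range_self i z⟩ =
        (LinearMap.ker i).mkQ z := i.quotKerEquivRange_symm_apply_image z _
    simpa [e] using this
  obtain ⟨s, hs⟩ := cls.exists_rightInverse_of_surjective (LinearMap.range_eq_top.2 hcls)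
  have hs' : ∀ h, cls (s h) = h := fun h => congrArg (fun g => g h) hs
  have hrD : ∀ x, r (D x) = 0 := by
    intro x
    obtain ⟨z, hz⟩ := hi _ (hDD x)
    rw [← hz, hr, hker]
    exact ⟨x, hz⟩
  obtain ⟨G₀, hG₀⟩ : ∃ G : P →ₗ[k] P, ∀ x, D (G (D x)) = D x := by
    obtain ⟨g, hg⟩ := D.rangeRestrict.exists_rightInverse_of_surjective
      (LinearMap.range_eq_top.2 D.surjective_rangeRestrict)
    obtain ⟨f, hf⟩ := LinearMap.exists_extend g
    refine ⟨f, fun x => ?_⟩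
    have h1 : f (D x) = g (D.rangeRestrict x) := congrArg (fun g => g (D.rangeRestrict x)) hf
    have h2 := congrArg (fun g => (g (D.rangeRestrict x)).1) hg
    rw [h1]
    exact h2
  let e : P →ₗ[k] P := i ∘ₗ s ∘ₗ r
  have hDe : ∀ x, D (e x) = 0 := fun x => hDi _
  have heD : ∀ x, e (D x) = 0 := fun x => by simp [e, hrD]
  have hre : ∀ x, r (e x) = r x := fun x => by simp [e, hr, hs']
  let G : P →ₗ[k] P := G₀ - e ∘ₗ G₀
  have hG : ∀ x, D (G (D x)) = D x := fun x => by simp [G, hDe, hG₀]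
  have hrG : ∀ x, r (G x) = 0 := fun x => by simp [G, hre]
  let N : P →ₗ[k] P := LinearMap.id - e - G ∘ₗ D
  have hN : ∀ x, D (G (N x)) = N x := by
    intro x
    have h1 : D (N x) = 0 := by simp [N, hDe, hG]
    have h2 : r (N x) = 0 := by simp [N, hre, hrG]
    obtain ⟨z, hz⟩ := hi _ h1
    rw [← hz, hr, hker] at h2
    obtain ⟨w, hw⟩ := h2
    rw [← hz, hw, hG]
  let h : P →ₗ[k] P := G ∘ₗ N
  have hh : ∀ x, D (h x) + h (D x) = x - e x := by
    intro x
    have h1 : N (D x) = D x - G (D (D x)) := by simp [N, heD]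
    rw [hDD, map_zero, sub_zero] at h1
    change D (G (N x)) + G (N (D x)) = _
    rw [hN, h1]
    simp [N]
  have hcyc : ∀ y : P ⊗[k] P, tensorD D sgn y = 0 →
      y = TensorProduct.map e e y +
        tensorD D sgn (TensorProduct.map sgn h y + TensorProduct.map h e y) := by
    have key : (LinearMap.id : P ⊗[k] P →ₗ[k] P ⊗[k] P) = TensorProduct.map e e +
        tensorD D sgn ∘ₗ (TensorProduct.map sgn h + TensorProduct.map h e) +
        (TensorProduct.map sgn h + TensorProduct.map h e) ∘ₗ tensorD D sgn := by
      have hh' : ∀ x, x = D (h x) + h (D x) + e x := fun x => by rw [hh]; abel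
      ext a b
      simp only [tensorD, TensorProduct.AlgebraTensorModule.curry_apply,
        TensorProduct.curry_apply, LinearMap.coe_restrictScalars, LinearMap.id_apply,
        LinearMap.add_apply, LinearMap.comp_apply, TensorProduct.map_tmul, map_add, hsgn, hDe,
        heD, hsD, TensorProduct.tmul_zero, TensorProduct.neg_tmul, add_zero]
      nth_rewrite 1 [hh' b]
      nth_rewrite 1 [TensorProduct.tmul_add]
      have : a ⊗ₜ[k] e b = D (h a) ⊗ₜ e b + h (D a) ⊗ₜ e b + e a ⊗ₜ e b := by
        rw [← TensorProduct.add_tmul, ← TensorProduct.add_tmul, ← hh']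
      rw [this, TensorProduct.tmul_add]
      abel
    intro y hy
    have := congrArg (fun g => g y) key
    simpa [hy] using this
  have hrrD : ∀ w, TensorProduct.map r r (tensorD D sgn w) = 0 := by
    have : TensorProduct.map r r ∘ₗ tensorD D sgn = 0 := by
      ext a b
      simp [tensorD, hrD]
    exact fun w => congrArg (fun g => g w) this
  have hrri : ∀ t, TensorProduct.map r r (TensorProduct.map i i t) =
      TensorProduct.map cls cls t := by
    have : TensorProduct.map r r ∘ₗ TensorProduct.map i i = TensorProduct.map cls cls := by
      ext a b
      simp [hr]
    exact fun w => congrArg (fun g => g w) this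
  refine ⟨TensorProduct.map r r ∘ₗ Δ ∘ₗ i ∘ₗ s, fun z => ?_, fun Δ' hΔ' => ?_⟩
  · refine ⟨TensorProduct.map (s ∘ₗ r) (s ∘ₗ r) (Δ (i z)),
      TensorProduct.map sgn h (Δ (i z)) + TensorProduct.map h e (Δ (i z)), ?_, ?_⟩
    · have : TensorProduct.map i i (TensorProduct.map (s ∘ₗ r) (s ∘ₗ r) (Δ (i z))) =
          TensorProduct.map e e (Δ (i z)) := by
        rw [← LinearMap.comp_apply, ← TensorProduct.map_comp]
      rw [this]
      refine hcyc _ ?_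
      rw [← hΔ, hDi, map_zero]
    · obtain ⟨w, hw⟩ := (hker (z - s (cls z))).1 (by rw [map_sub, hs', sub_self])
      have h1 : TensorProduct.map r r (Δ (i (s (cls z)))) = TensorProduct.map r r (Δ (i z)) := by
        have : i z = i (s (cls z)) + D w := by rw [← hw, map_sub]; abel
        rw [this, map_add, map_add, hΔ, hrrD, add_zero]
      change TensorProduct.map r r (Δ (i (s (cls z)))) = _
      rw [h1]
      symm
      rw [← LinearMap.comp_apply, ← TensorProduct.map_comp]
      congr 2 <;> ext x <;> simp [hs']
  · ext h'
    obtain ⟨z, rfl⟩ := hcls h'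
    obtain ⟨t, w, h1, h2⟩ := hΔ' z
    obtain ⟨w', hw'⟩ := (hker (z - s (cls z))).1 (by rw [map_sub, hs', sub_self])
    have h3 : TensorProduct.map r r (Δ (i (s (cls z)))) = TensorProduct.map r r (Δ (i z)) := by
      have : i z = i (s (cls z)) + D w' := by rw [← hw', map_sub]; abel
      rw [this, map_add, map_add, hΔ, hrrD, add_zero]
    change _ = TensorProduct.map r r (Δ (i (s (cls z))))
    rw [h2, h3, h1, map_add, hrrD, add_zero, hrri]

end Induced

/-! ### Spectral sequences of coalgebras -/

section SpectralSequenceOfCoalgebras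

variable {k : Type v} [Field k]
  (S : SpectralSequence (ModuleCat.{w} k) (fun r => ComplexShape.up' ((-r, r - 1) : ℤ × ℤ)) 0)

/-- The `r`-th page of a spectral sequence, as one bigraded module. -/
abbrev TotalPage (r : ℕ) : Type w := ⨁ x : ℤ × ℤ, (S.page r).X x

/-- The cycles of the `r`-th page. -/
abbrev TotalPageCycles (r : ℕ) : Type w := ⨁ x : ℤ × ℤ, (S.page r).cycles x

/-- The inclusion of the summand of bidegree `x` in the `r`-th page. -/
abbrev pageIncl (r : ℕ) (x : ℤ × ℤ) : (S.page r).X x →ₗ[k] TotalPage S r :=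
  DirectSum.lof k (ℤ × ℤ) (fun x => (S.page r).X x) x

/-- The differential of the `r`-th page. -/
def totalPageD (r : ℕ) : TotalPage S r →ₗ[k] TotalPage S r :=
  DirectSum.toModule k _ _ fun x =>
    (pageIncl S r (x + (-(r : ℤ), (r : ℤ) - 1))).comp
      ((S.page r).d x (x + (-(r : ℤ), (r : ℤ) - 1))).hom

/-- Multiplication by `(-1)^{p+q}` in bidegree `(p, q)`. -/
def totalPageSgn (r : ℕ) : TotalPage S r →ₗ[k] TotalPage S r :=
  DirectSum.lmap fun x => ((Int.negOnePow (x.1 + x.2) : ℤ) : k) • LinearMap.id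

/-- The inclusion of the cycles in the `r`-th page. -/
def totalPageCyclesIncl (r : ℕ) : TotalPageCycles S r →ₗ[k] TotalPage S r :=
  DirectSum.lmap fun x => ((S.page r).iCycles x).hom

/-- The map from the cycles of the `r`-th page to the `(r + 1)`-st page, given by the
isomorphism `H(E^r) ≅ E^{r+1}` which is part of the spectral sequence. -/
def totalPageClass (r : ℕ) : TotalPageCycles S r →ₗ[k] TotalPage S (r + 1) :=
  DirectSum.lmap fun x => ((S.page r).homologyπ x ≫ (S.iso r ((r + 1 : ℕ) : ℤ) x).hom).hom

/-- The structure of a spectral sequence of coalgebras over `k` on a spectral sequence: every page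
is a bigraded coalgebra, the comultiplication and the counit are compatible with the
differentials (co-Leibniz rule), and the comultiplication and the counit of `E^{r+1}` are those
which are induced on `E^{r+1} ≅ H(E^r)`. -/
structure CoalgebraStructure where
  coalgebra (r : ℕ) : Coalgebra k (TotalPage S r)
  comul_mem (r : ℕ) (x : ℤ × ℤ) (c : (S.page r).X x) :
    (coalgebra r).comul (pageIncl S r x c) ∈
      ⨆ y : {y : (ℤ × ℤ) × (ℤ × ℤ) // y.1 + y.2 = x},
        LinearMap.range (TensorProduct.map (pageIncl S r y.1.1) (pageIncl S r y.1.2))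
  counit_eq_zero (r : ℕ) (x : ℤ × ℤ) (c : (S.page r).X x) (hx : x ≠ 0) :
    (coalgebra r).counit (pageIncl S r x c) = 0
  coLeibniz (r : ℕ) (c : TotalPage S r) :
    (coalgebra r).comul (totalPageD S r c) =
      tensorD (totalPageD S r) (totalPageSgn S r) ((coalgebra r).comul c)
  counit_d (r : ℕ) (c : TotalPage S r) : (coalgebra r).counit (totalPageD S r c) = 0
  comul_succ (r : ℕ) :
    InducedOnHomology (totalPageD S r) (totalPageSgn S r) (totalPageCyclesIncl S r)
      (totalPageClass S r) (coalgebra r).comul (coalgebra (r + 1)).comul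
  counit_succ (r : ℕ) (z : TotalPageCycles S r) :
    (coalgebra (r + 1)).counit (totalPageClass S r z) =
      (coalgebra r).counit (totalPageCyclesIncl S r z)

end SpectralSequenceOfCoalgebras

/-! ### Singular chains -/

/-- The singular `n`-simplices of `X`. -/
abbrev Sing (n : ℕ) (X : Type u) [TopologicalSpace X] : Type u :=
  C(stdSimplex ℝ (Fin (n + 1)), X)

/-- `α ∘ [f 0, …, f m]`: the composition of a singular simplex with the affine map
`Δ^m → Δ^n` which sends the vertex `i` to the vertex `f i`. -/
def Sing.pull {X : Type u} [TopologicalSpace X] {m n : ℕ} (α : Sing n X)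
    (f : Fin (m + 1) → Fin (n + 1)) : Sing m X :=
  α.comp ⟨stdSimplex.map f, stdSimplex.continuous_map f⟩

/-- The front face `α ∘ [0, …, i]`. -/
def Sing.front {X : Type u} [TopologicalSpace X] {n : ℕ} (α : Sing n X) (i : ℕ) (h : i ≤ n) :
    Sing i X :=
  α.pull fun a => ⟨a, by omega⟩

/-- The back face `α ∘ [i, …, n]`, where `n = i + j`. -/
def Sing.back {X : Type u} [TopologicalSpace X] {n : ℕ} (α : Sing n X) (i j : ℕ)
    (h : i + j = n) : Sing j X :=
  α.pull fun a => ⟨i + a, by omega⟩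

/-- The singular chains of `X` (in all degrees), with coefficients in `k`. -/
abbrev Chains (k : Type v) [Field k] (X : Type u) [TopologicalSpace X] : Type (max u v) :=
  (Σ n : ℕ, Sing n X) →₀ k

section Chains

variable (k : Type v) [Field k] (X : Type u) [TopologicalSpace X]

variable {X} in
/-- A singular simplex as a chain. -/
def simplexChain {n : ℕ} (α : Sing n X) : Chains k X := Finsupp.single ⟨n, α⟩ 1

/-- The boundary map `∂ α = ∑ i, (-1)^i α ∘ [0, …, i - 1, i + 1, …, n]`. -/
def boundary : Chains k X →ₗ[k] Chains k X :=
  Finsupp.linearCombination k fun s : (Σ n : ℕ, Sing n X) =>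
    match s with
    | ⟨0, _⟩ => 0
    | ⟨n + 1, α⟩ => ∑ i : Fin (n + 2), (-1 : k) ^ (i : ℕ) • simplexChain k (α.pull i.succAbove)

/-- Multiplication by `(-1)^n` in degree `n`. -/
def chainSgn : Chains k X →ₗ[k] Chains k X :=
  Finsupp.linearCombination k fun s : (Σ n : ℕ, Sing n X) => (-1 : k) ^ s.1 • simplexChain k s.2

/-- The Alexander--Whitney diagonal `α ↦ ∑ j, (α ∘ [0, …, j]) ⊗ (α ∘ [j, …, n])`. -/
def diagonal : Chains k X →ₗ[k] Chains k X ⊗[k] Chains k X :=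
  Finsupp.linearCombination k fun s : (Σ n : ℕ, Sing n X) =>
    ∑ j : Fin (s.1 + 1), simplexChain k (s.2.front j (by omega)) ⊗ₜ[k]
      simplexChain k (s.2.back j (s.1 - j) (by omega))

/-- The augmentation: the sum of the coefficients of the `0`-simplices. -/
def augmentation : Chains k X →ₗ[k] k :=
  Finsupp.linearCombination k fun s : (Σ n : ℕ, Sing n X) => if s.1 = 0 then 1 else 0

/-- The chains of degree `n`. -/
def chainsOfDegree (n : ℤ) : Submodule k (Chains k X) :=
  Finsupp.supported k k {s : (Σ n : ℕ, Sing n X) | (s.1 : ℤ) = n}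

/-- The map induced on chains by a continuous map. -/
def chainsMap {X Y : Type u} [TopologicalSpace X] [TopologicalSpace Y] (f : C(X, Y)) :
    Chains k X →ₗ[k] Chains k Y :=
  Finsupp.linearCombination k fun s : (Σ n : ℕ, Sing n X) => simplexChain k (f.comp s.2)

/-! Auxiliary lemmas: the boundary squares to zero, and the diagonal is a chain map. -/

section aux

variable {X} {N : ℕ} (α : Sing N X)

/-- Auxiliary: the `m`-simplex `α ∘ [g 0, …, g m]`. -/
def auxFace (m : ℕ) (g : ℕ → ℕ) : Chains k X :=
  simplexChain k (α.pull fun i : Fin (m + 1) => Fin.ofNat (N + 1) (g i))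

/-- Auxiliary: the coface map. -/
def auxSkip (i x : ℕ) : ℕ := if x < i then x else x + 1

variable {k}

lemma auxFace_congr {m : ℕ} {g g' : ℕ → ℕ} (h : ∀ x ≤ m, g x = g' x) :
    auxFace k α m g = auxFace k α m g' := by
  unfold auxFace
  congr 2
  ext i
  rw [h i (by omega)]

lemma simplexChain_eq_auxFace : simplexChain k α = auxFace k α N id := by
  unfold auxFace
  congr 1
  have : (fun i : Fin (N + 1) => Fin.ofNat (N + 1) (id (i : ℕ))) = id := by
    ext i; simp
  rw [this]
  ext x
  simp [Sing.pull]

lemma Sing.pull_pull {X : Type u} [TopologicalSpace X] {l m n : ℕ} (α : Sing n X)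
    (f : Fin (m + 1) → Fin (n + 1)) (g : Fin (l + 1) → Fin (m + 1)) :
    (α.pull f).pull g = α.pull (f ∘ g) := by
  ext x
  simp [Sing.pull, stdSimplex.map_comp_apply]

lemma boundary_simplexChain_zero (β : Sing 0 X) : boundary k X (simplexChain k β) = 0 := by
  simp [boundary, simplexChain]

lemma boundary_simplexChain_succ {n : ℕ} (β : Sing (n + 1) X) :
    boundary k X (simplexChain k β) =
      ∑ i : Fin (n + 2), (-1 : k) ^ (i : ℕ) • simplexChain k (β.pull i.succAbove) := by
  simp [boundary, simplexChain]

lemma boundary_auxFace_zero (g : ℕ → ℕ) : boundary k X (auxFace k α 0 g) = 0 :=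
  boundary_simplexChain_zero _

lemma boundary_auxFace_succ (m : ℕ) (g : ℕ → ℕ) : boundary k X (auxFace k α (m + 1) g) =
    ∑ i ∈ Finset.range (m + 2), (-1 : k) ^ i • auxFace k α m (g ∘ auxSkip i) := by
  rw [auxFace, boundary_simplexChain_succ, Finset.sum_range]
  refine Finset.sum_congr rfl fun i _ => ?_
  rw [Sing.pull_pull]
  unfold auxFace
  congr 3
  ext x
  simp only [Function.comp_apply, auxSkip, Fin.succAbove, Fin.lt_def, Fin.val_castSucc]
  split_ifs <;> simp

lemma diagonal_auxFace (m : ℕ) (g : ℕ → ℕ) : diagonal k X (auxFace k α m g) =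
    ∑ j ∈ Finset.range (m + 1), auxFace k α j g ⊗ₜ[k] auxFace k α (m - j) (fun x => g (j + x)) := by
  rw [Finset.sum_range]
  simp only [diagonal, auxFace, simplexChain, Finsupp.linearCombination_single, one_smul]
  refine Finset.sum_congr rfl fun j _ => ?_
  simp only [Sing.front, Sing.back, Sing.pull_pull]
  rfl

lemma boundary_boundary (c : Chains k X) : boundary k X (boundary k X c) = 0 := by
  suffices h : boundary k X ∘ₗ boundary k X = 0 from congrArg (fun f => f c) h
  refine Finsupp.lhom_ext' fun ⟨n, β⟩ => LinearMap.ext_ring ?_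
  change boundary k X (boundary k X (simplexChain k β)) = 0
  match n, β with
  | 0, β => rw [boundary_simplexChain_zero, map_zero]
  | 1, β =>
    rw [simplexChain_eq_auxFace, boundary_auxFace_succ, map_sum]
    exact Finset.sum_eq_zero fun i _ => by rw [map_smul, boundary_auxFace_zero, smul_zero]
  | n + 2, β =>
    rw [simplexChain_eq_auxFace, boundary_auxFace_succ, map_sum]
    simp only [map_smul, boundary_auxFace_succ, Finset.smul_sum, smul_smul]
    rw [← Finset.sum_product']
    refine Finset.sum_involution
      (fun p _ => if p.2 < p.1 then (p.2, p.1 - 1) else (p.2 + 1, p.1)) ?_ ?_ ?_ ?_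
    · rintro ⟨i, j⟩ h
      simp only
      split_ifs with hij
      · have e : auxFace k β n ((id ∘ auxSkip i) ∘ auxSkip j) =
            auxFace k β n ((id ∘ auxSkip j) ∘ auxSkip (i - 1)) := by
          refine auxFace_congr β fun x _ => ?_
          simp only [Function.comp_apply, auxSkip, id]
          split_ifs <;> omega
        obtain ⟨i, rfl⟩ : ∃ l, i = l + 1 := ⟨i - 1, by omega⟩
        rw [e, ← add_smul]
        simp only [Nat.add_sub_cancel]
        rw [show (-1 : k) ^ (i + 1) * (-1) ^ j + (-1) ^ j * (-1) ^ i = 0 by ring, zero_smul]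
      · have e : auxFace k β n ((id ∘ auxSkip i) ∘ auxSkip j) =
            auxFace k β n ((id ∘ auxSkip (j + 1)) ∘ auxSkip i) := by
          refine auxFace_congr β fun x _ => ?_
          simp only [Function.comp_apply, auxSkip, id]
          split_ifs <;> omega
        rw [e, ← add_smul,
          show (-1 : k) ^ i * (-1) ^ j + (-1) ^ (j + 1) * (-1) ^ i = 0 by ring, zero_smul]
    · rintro ⟨i, j⟩ h -
      simp only
      split_ifs with hij <;> simp <;> omega
    · rintro ⟨i, j⟩ h
      simp only [Finset.mem_product, Finset.mem_range] at h ⊢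
      split_ifs with hij <;> simp <;> omega
    · rintro ⟨i, j⟩ h
      simp only
      split_ifs <;> simp at * <;> omega

lemma chainSgn_simplexChain {n : ℕ} (β : Sing n X) :
    chainSgn k X (simplexChain k β) = (-1 : k) ^ n • simplexChain k β := by
  simp [chainSgn, simplexChain]

lemma chainSgn_auxFace (m : ℕ) (g : ℕ → ℕ) :
    chainSgn k X (auxFace k α m g) = (-1 : k) ^ m • auxFace k α m g :=
  chainSgn_simplexChain _

lemma chainSgn_chainSgn (c : Chains k X) : chainSgn k X (chainSgn k X c) = c := by
  suffices h : chainSgn k X ∘ₗ chainSgn k X = LinearMap.id from congrArg (fun f => f c) h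
  refine Finsupp.lhom_ext' fun ⟨n, β⟩ => LinearMap.ext_ring ?_
  change chainSgn k X (chainSgn k X (simplexChain k β)) = simplexChain k β
  rw [chainSgn_simplexChain, map_smul, chainSgn_simplexChain, smul_smul, ← pow_add,
    ← two_mul, pow_mul]
  simp

lemma boundary_chainSgn (c : Chains k X) :
    boundary k X (chainSgn k X c) = -chainSgn k X (boundary k X c) := by
  suffices h : boundary k X ∘ₗ chainSgn k X = -(chainSgn k X ∘ₗ boundary k X) from
    congrArg (fun f => f c) h
  refine Finsupp.lhom_ext' fun ⟨n, β⟩ => LinearMap.ext_ring ?_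
  change boundary k X (chainSgn k X (simplexChain k β)) =
    -(chainSgn k X (boundary k X (simplexChain k β)))
  rw [chainSgn_simplexChain, map_smul]
  match n, β with
  | 0, β => simp [boundary_simplexChain_zero]
  | n + 1, β =>
    rw [boundary_simplexChain_succ, map_sum, Finset.smul_sum, ← Finset.sum_neg_distrib]
    refine Finset.sum_congr rfl fun i _ => ?_
    rw [map_smul, chainSgn_simplexChain, smul_smul, smul_smul, ← neg_smul]
    congr 1
    ring

lemma diagonal_boundary (c : Chains k X) :
    diagonal k X (boundary k X c) =
      tensorD (boundary k X) (chainSgn k X) (diagonal k X c) := by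
  suffices h : diagonal k X ∘ₗ boundary k X =
      tensorD (boundary k X) (chainSgn k X) ∘ₗ diagonal k X from congrArg (fun f => f c) h
  refine Finsupp.lhom_ext' fun ⟨n, β⟩ => LinearMap.ext_ring ?_
  change diagonal k X (boundary k X (simplexChain k β)) =
    tensorD (boundary k X) (chainSgn k X) (diagonal k X (simplexChain k β))
  match n, β with
  | 0, β =>
    rw [simplexChain_eq_auxFace, boundary_auxFace_zero, map_zero, diagonal_auxFace]
    simp [tensorD, boundary_auxFace_zero]
  | n + 1, β =>
    rw [simplexChain_eq_auxFace, boundary_auxFace_succ, diagonal_auxFace]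
    simp only [map_sum, map_smul, diagonal_auxFace, tensorD, LinearMap.add_apply,
      TensorProduct.map_tmul, LinearMap.id_apply, chainSgn_auxFace, Finset.sum_add_distrib]
    rw [Finset.sum_range_succ' (fun j => boundary k X (auxFace k β j id) ⊗ₜ[k] _),
      Finset.sum_range_succ (fun j => ((-1 : k) ^ j • auxFace k β j id) ⊗ₜ[k] _)]
    simp only [boundary_auxFace_zero, TensorProduct.zero_tmul, add_zero, Nat.sub_self,
      TensorProduct.tmul_zero]
    simp only [Finset.smul_sum]
    rw [Finset.sum_comm, ← Finset.sum_add_distrib]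
    refine Finset.sum_congr rfl fun j hj => ?_
    have hj' : j < n + 1 := Finset.mem_range.1 hj
    obtain ⟨l, rfl⟩ : ∃ l, n = j + l := ⟨n - j, by omega⟩
    rw [show j + l + 1 - (j + 1) = l by omega, show j + l + 1 - j = l + 1 by omega,
      show j + l - j = l by omega, boundary_auxFace_succ, boundary_auxFace_succ,
      show j + l + 2 = (j + 1) + (l + 1) by omega, Finset.sum_range_add]
    have e1 : ∀ i ∈ Finset.range (j + 1),
        (-1 : k) ^ i • (auxFace k β j (id ∘ auxSkip i) ⊗ₜ[k]
          auxFace k β l (fun x => (id ∘ auxSkip i) (j + x))) =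
        (-1 : k) ^ i • (auxFace k β j (id ∘ auxSkip i) ⊗ₜ[k]
          auxFace k β l (fun x => id (j + 1 + x))) := by
      intro i hi
      have hi' : i < j + 1 := Finset.mem_range.1 hi
      congr 2
      refine auxFace_congr β fun x _ => ?_
      simp only [Function.comp_apply, auxSkip, id]
      split_ifs <;> omega
    have e2 : ∀ i ∈ Finset.range (l + 1),
        (-1 : k) ^ (j + 1 + i) • (auxFace k β j (id ∘ auxSkip (j + 1 + i)) ⊗ₜ[k]
          auxFace k β l (fun x => (id ∘ auxSkip (j + 1 + i)) (j + x))) =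
        (-1 : k) ^ (j + 1 + i) • (auxFace k β j id ⊗ₜ[k]
          auxFace k β l ((fun x => id (j + x)) ∘ auxSkip (i + 1))) := by
      intro i _
      congr 2
      · refine auxFace_congr β fun x _ => ?_
        simp only [Function.comp_apply, auxSkip, id]
        split_ifs <;> omega
      · refine auxFace_congr β fun x _ => ?_
        simp only [Function.comp_apply, auxSkip, id]
        split_ifs <;> omega
    have e3 : auxFace k β j (id ∘ auxSkip (j + 1)) = auxFace k β j id := by
      refine auxFace_congr β fun x _ => ?_
      simp only [Function.comp_apply, auxSkip, id]
      split_ifs <;> omega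
    have e4 : auxFace k β l ((fun x => id (j + x)) ∘ auxSkip 0) =
        auxFace k β l (fun x => id (j + 1 + x)) := by
      refine auxFace_congr β fun x _ => ?_
      simp only [Function.comp_apply, auxSkip, id]
      split_ifs <;> omega
    rw [Finset.sum_congr rfl e1, Finset.sum_congr rfl e2,
      Finset.sum_range_succ (fun i => (-1 : k) ^ i • auxFace k β j (id ∘ auxSkip i)) (j + 1),
      Finset.sum_range_succ' (fun i => (-1 : k) ^ i • auxFace k β l _) (l + 1), e3, e4,
      TensorProduct.add_tmul, TensorProduct.tmul_add, TensorProduct.sum_tmul,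
      TensorProduct.tmul_sum]
    simp only [TensorProduct.tmul_smul, TensorProduct.smul_tmul', smul_smul]
    have e5 : ∀ i, (-1 : k) ^ (i + 1) * (-1) ^ j = (-1) ^ (j + 1 + i) := fun i => by ring
    simp only [e5]
    rw [show (-1 : k) ^ 0 * (-1) ^ j = -(-1) ^ (j + 1) by ring]
    simp only [neg_smul, TensorProduct.neg_tmul]
    abel

end aux

end Chains

/-! ### Singular homology and its comultiplication -/

namespace DGModule

variable {k : Type v} [Field k] {C : Type w} [AddCommGroup C] [Module k C] (M : DGModule k C)

/-- The inclusion of the cycles, all degrees together. -/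
def totalCyclesIncl : (⨁ n : ℤ, M.cycles n) →ₗ[k] C := DirectSum.coeLinearMap M.cycles

/-- The class map from cycles to homology, all degrees together. -/
def totalClass : (⨁ n : ℤ, M.cycles n) →ₗ[k] M.TotalHomology :=
  DirectSum.lmap fun n => M.homologyClass n

/-- Auxiliary: the differential, on the direct sum of the graded pieces. -/
def auxD : (⨁ n : ℤ, M.gr n) →ₗ[k] ⨁ n : ℤ, M.gr n :=
  DirectSum.toModule k _ _ fun n =>
    (DirectSum.lof k ℤ (fun n => M.gr n) (n - 1)).comp (M.d.restrict (M.d_mem_gr n))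

lemma coe_auxD (y : ⨁ n : ℤ, M.gr n) :
    DirectSum.coeLinearMap M.gr (M.auxD y) = M.d (DirectSum.coeLinearMap M.gr y) := by
  suffices h : DirectSum.coeLinearMap M.gr ∘ₗ M.auxD = M.d ∘ₗ DirectSum.coeLinearMap M.gr from
    congrArg (fun f => f y) h
  ext n c
  simp [auxD, DirectSum.coeLinearMap]

lemma auxD_apply (y : ⨁ n : ℤ, M.gr n) (m n : ℤ) (h : m = n - 1) :
    ((M.auxD y) m : C) = M.d (y n) := by
  subst h
  suffices h : (M.gr (n - 1)).subtype ∘ₗ DirectSum.component k ℤ (fun n => M.gr n) (n - 1) ∘ₗ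
      M.auxD = M.d ∘ₗ (M.gr n).subtype ∘ₗ DirectSum.component k ℤ (fun n => M.gr n) n from
    congrArg (fun f => f y) h
  ext l c
  by_cases hl : l = n
  · subst hl
    simp [auxD, DirectSum.component.lof_self]
  · have hl' : l - 1 ≠ n - 1 := fun h => hl (by lia)
    simp [auxD, DirectSum.component.of, hl, hl']

lemma exists_eq (x : C) : ∃ y : ⨁ n : ℤ, M.gr n, DirectSum.coeLinearMap M.gr y = x :=
  M.isInternal.2 x

lemma exists_totalCyclesIncl_eq (x : C) (hx : M.d x = 0) : ∃ z, M.totalCyclesIncl z = x := by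
  obtain ⟨y, rfl⟩ := M.exists_eq x
  have h0 : M.auxD y = 0 := M.isInternal.1 (by
    change DirectSum.coeLinearMap M.gr (M.auxD y) = DirectSum.coeLinearMap M.gr 0
    rw [coe_auxD, hx, map_zero])
  have hy : ∀ n, (y n : C) ∈ M.cycles n := by
    intro n
    refine ⟨?_, (y n).2⟩
    have := M.auxD_apply y _ n rfl
    rw [h0] at this
    exact this.symm
  classical
  refine ⟨∑ n ∈ DFinsupp.support y, DirectSum.lof k ℤ (fun n => M.cycles n) n ⟨y n, hy n⟩, ?_⟩
  rw [map_sum]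
  conv_rhs => rw [← DirectSum.sum_support_of y, map_sum]
  refine Finset.sum_congr rfl fun n _ => ?_
  simp [totalCyclesIncl, DirectSum.coeLinearMap, DirectSum.toModule_lof,
    ← DirectSum.lof_eq_of k]

lemma d_totalCyclesIncl (z : ⨁ n : ℤ, M.cycles n) : M.d (M.totalCyclesIncl z) = 0 := by
  suffices h : M.d ∘ₗ M.totalCyclesIncl = 0 from congrArg (fun f => f z) h
  ext n c
  simpa [totalCyclesIncl, DirectSum.coeLinearMap] using c.2.1

lemma totalClass_surjective : Function.Surjective M.totalClass :=
  (DirectSum.lmap_surjective _).2 fun _ => Submodule.mkQ_surjective _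

lemma totalClass_eq_zero_iff (z : ⨁ n : ℤ, M.cycles n) :
    M.totalClass z = 0 ↔ ∃ w, M.totalCyclesIncl z = M.d w := by
  have h1 : M.totalClass z = 0 ↔ ∀ n, (z n : C) ∈ LinearMap.range M.d := by
    rw [DFinsupp.ext_iff]
    refine forall_congr' fun n => ?_
    change M.homologyClass n (z n) = 0 ↔ _
    rw [Submodule.mkQ_apply, Submodule.Quotient.mk_eq_zero]
    rfl
  rw [h1]
  constructor
  · intro h
    have : M.totalCyclesIncl z ∈ LinearMap.range M.d := by
      classical
      rw [← DirectSum.sum_support_of z, map_sum]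
      refine Submodule.sum_mem _ fun n _ => ?_
      simpa [totalCyclesIncl, DirectSum.coeLinearMap, DirectSum.toModule_lof,
        ← DirectSum.lof_eq_of k] using h n
    obtain ⟨w, hw⟩ := this
    exact ⟨w, hw.symm⟩
  · rintro ⟨w, hw⟩ n
    obtain ⟨y, rfl⟩ := M.exists_eq w
    let z' : ⨁ n : ℤ, M.gr n :=
      DirectSum.lmap (fun n => Submodule.inclusion (inf_le_right : M.cycles n ≤ M.gr n)) z
    have hz' : DirectSum.coeLinearMap M.gr z' = M.totalCyclesIncl z := by
      suffices h : DirectSum.coeLinearMap M.gr ∘ₗ DirectSum.lmap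
          (fun n => Submodule.inclusion (inf_le_right : M.cycles n ≤ M.gr n)) =
          M.totalCyclesIncl from congrArg (fun f => f z) h
      refine DirectSum.linearMap_ext _ fun n => LinearMap.ext fun c => ?_
      simp only [LinearMap.comp_apply, DirectSum.lmap_lof, DirectSum.coeLinearMap_lof]
      exact (DirectSum.coeLinearMap_lof M.cycles n c).symm
    have : M.auxD y = z' := M.isInternal.1 (by
      change DirectSum.coeLinearMap M.gr (M.auxD y) = DirectSum.coeLinearMap M.gr z'
      rw [coe_auxD, hz', hw])
    refine ⟨y (n + 1), ?_⟩
    rw [← M.auxD_apply y n (n + 1) (by lia), this]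
    rfl

end DGModule

section Homology

variable (k : Type v) [Field k] (X : Type u) [TopologicalSpace X]

lemma chainsOfDegree_isInternal : DirectSum.IsInternal (chainsOfDegree k X) := by
  rw [DirectSum.isInternal_submodule_iff_iSupIndep_and_iSup_eq_top]
  constructor
  · intro n
    have hle : ⨆ (m : ℤ) (_ : m ≠ n), chainsOfDegree k X m ≤
        Finsupp.supported k k {s : (Σ n : ℕ, Sing n X) | (s.1 : ℤ) ≠ n} :=
      iSup₂_le fun m hm => Finsupp.supported_mono fun s hs h => hm (hs.symm.trans h)
    refine Disjoint.mono_right hle (Finsupp.disjoint_supported_supported ?_)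
    exact Set.disjoint_left.2 fun s hs hs' => hs' hs
  · unfold chainsOfDegree
    rw [← Finsupp.supported_iUnion, eq_top_iff, ← Finsupp.supported_univ]
    refine Finsupp.supported_mono fun s _ => ?_
    simp

variable {X} in
lemma simplexChain_mem_supported {n : ℕ} (α : Sing n X) {T : Set (Σ n : ℕ, Sing n X)}
    (h : (⟨n, α⟩ : Σ n : ℕ, Sing n X) ∈ T) : simplexChain k α ∈ Finsupp.supported k k T :=
  Finsupp.single_mem_supported _ _ h

/-- To check that `f` maps chains supported in `T` to `W`, it suffices to look at simplices. -/
lemma map_mem_of_supported {V : Type*} [AddCommGroup V] [Module k V]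
    (f : Chains k X →ₗ[k] V) (T : Set (Σ n : ℕ, Sing n X)) (W : Submodule k V)
    (h : ∀ s ∈ T, f (simplexChain k s.2) ∈ W) :
    ∀ x ∈ Finsupp.supported k k T, f x ∈ W := by
  intro x hx
  rw [Finsupp.supported_eq_span_single] at hx
  induction hx using Submodule.span_induction with
  | mem x hx => obtain ⟨s, hs, rfl⟩ := hx; exact h s hs
  | zero => rw [map_zero]; exact W.zero_mem
  | add x y _ _ hx hy => rw [map_add]; exact W.add_mem hx hy
  | smul a x _ hx => rw [map_smul]; exact W.smul_mem a hx

lemma boundary_mem (T T' : Set (Σ n : ℕ, Sing n X))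
    (h : ∀ (n : ℕ) (α : Sing (n + 1) X), (⟨n + 1, α⟩ : Σ n : ℕ, Sing n X) ∈ T →
      ∀ i : Fin (n + 2), (⟨n, α.pull i.succAbove⟩ : Σ n : ℕ, Sing n X) ∈ T') :
    ∀ x ∈ Finsupp.supported k k T, boundary k X x ∈ Finsupp.supported k k T' := by
  refine map_mem_of_supported k X _ _ _ fun s hs => ?_
  match s, hs with
  | ⟨0, α⟩, _ => rw [boundary_simplexChain_zero]; exact Submodule.zero_mem _
  | ⟨n + 1, α⟩, hs =>
    rw [boundary_simplexChain_succ]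
    exact Submodule.sum_mem _ fun i _ => Submodule.smul_mem _ _
      (simplexChain_mem_supported k _ (h n α hs i))

/-- The singular chain complex `C_*(X; k)`. -/
def singularChains : DGModule k (Chains k X) where
  gr := chainsOfDegree k X
  isInternal := chainsOfDegree_isInternal k X
  d := boundary k X
  d_d := boundary_boundary
  d_mem_gr n := by
    refine boundary_mem k X _ _ fun m α hm i => ?_
    simp only [Set.mem_ofPred_eq] at hm ⊢
    lia

/-- The singular homology `H_n(X; k)`. -/
abbrev SingularHomology (n : ℤ) : Type (max u v) := (singularChains k X).Homology n

/-- The total singular homology `H_*(X; k) = ⨁ n, H_n(X; k)`. -/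
abbrev TotalSingularHomology : Type (max u v) := (singularChains k X).TotalHomology

theorem existsUnique_homologyComul : ∃! Δ : TotalSingularHomology k X →ₗ[k]
    TotalSingularHomology k X ⊗[k] TotalSingularHomology k X,
    InducedOnHomology (boundary k X) (chainSgn k X) (singularChains k X).totalCyclesIncl
      (singularChains k X).totalClass (diagonal k X) Δ :=
  existsUnique_inducedOnHomology (P := Chains k X) (H := TotalSingularHomology k X)
    (boundary k X) (chainSgn k X) (singularChains k X).totalCyclesIncl
    (singularChains k X).totalClass (diagonal k X) boundary_boundary chainSgn_chainSgn boundary_chainSgn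
    (singularChains k X).exists_totalCyclesIncl_eq (singularChains k X).d_totalCyclesIncl
    (singularChains k X).totalClass_surjective (singularChains k X).totalClass_eq_zero_iff
    diagonal_boundary

/-- The comultiplication of `H_*(X; k)`: the map induced by the Alexander--Whitney diagonal,
followed by the inverse of the Künneth isomorphism. -/
def homologyComul : TotalSingularHomology k X →ₗ[k]
    TotalSingularHomology k X ⊗[k] TotalSingularHomology k X :=
  (existsUnique_homologyComul k X).exists.choose

theorem homologyComul_spec :
    InducedOnHomology (boundary k X) (chainSgn k X) (singularChains k X).totalCyclesIncl
      (singularChains k X).totalClass (diagonal k X) (homologyComul k X) :=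
  (existsUnique_homologyComul k X).exists.choose_spec

lemma augmentation_boundary (c : Chains k X) : augmentation k X (boundary k X c) = 0 := by
  suffices h : augmentation k X ∘ₗ boundary k X = 0 from congrArg (fun f => f c) h
  refine Finsupp.lhom_ext' fun ⟨n, β⟩ => LinearMap.ext_ring ?_
  change augmentation k X (boundary k X (simplexChain k β)) = 0
  match n, β with
  | 0, β => rw [boundary_simplexChain_zero, map_zero]
  | 1, β =>
    rw [boundary_simplexChain_succ]
    simp [augmentation, simplexChain, Fin.sum_univ_two]
  | n + 2, β =>
    rw [boundary_simplexChain_succ]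
    simp [augmentation, simplexChain]

/-- The counit of `H_*(X; k)`, induced by the augmentation. -/
def homologyCounit : TotalSingularHomology k X →ₗ[k] k :=
  DirectSum.toModule k _ _ fun n =>
    Submodule.liftQ _ ((augmentation k X).comp ((singularChains k X).cycles n).subtype) <| by
      rintro ⟨_, _⟩ ⟨c, rfl⟩
      exact augmentation_boundary k X c

section map

variable {X} {Y : Type u} [TopologicalSpace Y] (f : C(X, Y))

lemma chainsMap_simplexChain {n : ℕ} (α : Sing n X) :
    chainsMap k f (simplexChain k α) = simplexChain k (f.comp α) := by
  simp [chainsMap, simplexChain]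

lemma chainsMap_boundary (c : Chains k X) :
    chainsMap k f (boundary k X c) = boundary k Y (chainsMap k f c) := by
  suffices h : chainsMap k f ∘ₗ boundary k X = boundary k Y ∘ₗ chainsMap k f from
    congrArg (fun g => g c) h
  refine Finsupp.lhom_ext' fun ⟨n, β⟩ => LinearMap.ext_ring ?_
  change chainsMap k f (boundary k X (simplexChain k β)) =
    boundary k Y (chainsMap k f (simplexChain k β))
  rw [chainsMap_simplexChain]
  match n, β with
  | 0, β => rw [boundary_simplexChain_zero, boundary_simplexChain_zero, map_zero]
  | n + 1, β =>
    rw [boundary_simplexChain_succ, boundary_simplexChain_succ, map_sum]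
    refine Finset.sum_congr rfl fun i _ => ?_
    rw [map_smul, chainsMap_simplexChain]
    rfl

lemma chainsMap_mem_cycles (n : ℤ) (c : Chains k X) (hc : c ∈ (singularChains k X).cycles n) :
    chainsMap k f c ∈ (singularChains k Y).cycles n := by
  refine ⟨?_, map_mem_of_supported k X _ _ (chainsOfDegree k Y n) (fun s hs => ?_) c hc.2⟩
  · have h : boundary k X c = 0 := hc.1
    change boundary k Y _ = 0
    rw [← chainsMap_boundary, h, map_zero]
  · rw [chainsMap_simplexChain]
    exact simplexChain_mem_supported k _ hs

/-- The map induced by a continuous map on singular homology. -/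
def homologyMap (n : ℤ) : SingularHomology k X n →ₗ[k] SingularHomology k Y n :=
  Submodule.mapQ _ _ ((chainsMap k f).restrict (chainsMap_mem_cycles k f n)) <| by
    rintro ⟨_, _⟩ ⟨c, rfl⟩
    exact ⟨chainsMap k f c, (chainsMap_boundary k f c).symm⟩

end map

end Homology

/-! ### The tensor product of the coalgebras `H_*(X; k)` and `H_*(Y; k)` -/

section TensorCoalgebra

variable (k : Type v) [Field k] (X Y : Type u) [TopologicalSpace X] [TopologicalSpace Y]

/-- The isomorphism `a ⊗ b ⊗ c ⊗ d ↦ (-1)^{|b||c|} a ⊗ c ⊗ b ⊗ d`. -/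
def koszulSwap :
    (TotalSingularHomology k X ⊗[k] TotalSingularHomology k X) ⊗[k]
      (TotalSingularHomology k Y ⊗[k] TotalSingularHomology k Y) →ₗ[k]
    (TotalSingularHomology k X ⊗[k] TotalSingularHomology k Y) ⊗[k]
      (TotalSingularHomology k X ⊗[k] TotalSingularHomology k Y) :=
  (TensorProduct.assoc k _ _ _).symm.toLinearMap ∘ₗ
    LinearMap.lTensor _ ((TensorProduct.assoc k _ _ _).toLinearMap ∘ₗ
      LinearMap.rTensor _ (TensorProduct.gradedComm k (fun n => SingularHomology k X n)
        (fun n => SingularHomology k Y n)).toLinearMap ∘ₗ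
      (TensorProduct.assoc k _ _ _).symm.toLinearMap) ∘ₗ
    (TensorProduct.assoc k _ _ _).toLinearMap

/-- The comultiplication of the tensor product of graded coalgebras `H_*(X; k) ⊗ H_*(Y; k)`. -/
def tensorHomologyComul :
    TotalSingularHomology k X ⊗[k] TotalSingularHomology k Y →ₗ[k]
    (TotalSingularHomology k X ⊗[k] TotalSingularHomology k Y) ⊗[k]
      (TotalSingularHomology k X ⊗[k] TotalSingularHomology k Y) :=
  koszulSwap k X Y ∘ₗ TensorProduct.map (homologyComul k X) (homologyComul k Y)

/-- The counit of the tensor product of graded coalgebras `H_*(X; k) ⊗ H_*(Y; k)`. -/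
def tensorHomologyCounit :
    TotalSingularHomology k X ⊗[k] TotalSingularHomology k Y →ₗ[k] k :=
  (TensorProduct.lid k k).toLinearMap ∘ₗ
    TensorProduct.map (homologyCounit k X) (homologyCounit k Y)

end TensorCoalgebra

/-! ### The Serre filtration and the Serre spectral sequence -/

/-- `V : Δ^n → B` factors as `V' ∘ s` with `s : [n] → [m]` a surjective monotone map
(a codegeneracy) and `V' : Δ^m → B`. -/
def Sing.FactorsThrough {B : Type u} [TopologicalSpace B] {n : ℕ} (V : Sing n B) (m : ℕ) : Prop :=
  ∃ s : Fin (n + 1) →o Fin (m + 1), Function.Surjective s ∧ ∃ V' : Sing m B, V = V'.pull s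

/-- A singular simplex is degenerate if it factors through a simplex of smaller dimension. -/
def Sing.IsDegenerate {B : Type u} [TopologicalSpace B] {n : ℕ} (V : Sing n B) : Prop :=
  ∃ m < n, V.FactorsThrough m

lemma Sing.FactorsThrough.pull {B : Type u} [TopologicalSpace B] {l n m : ℕ} {V : Sing n B}
    (h : V.FactorsThrough m) (f : Fin (l + 1) →o Fin (n + 1)) :
    ∃ m' ≤ m, (V.pull f).FactorsThrough m' := by
  obtain ⟨s, -, V', rfl⟩ := h
  let I : Finset (Fin (m + 1)) := Finset.univ.image (s ∘ f)
  have hI : ∀ i, s (f i) ∈ I := fun i => Finset.mem_image.2 ⟨i, Finset.mem_univ _, rfl⟩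
  have hpos : 0 < I.card := Finset.card_pos.2 ⟨_, hI 0⟩
  have hcard : I.card = I.card - 1 + 1 := by omega
  have hle : I.card ≤ m + 1 := by simpa using Finset.card_le_univ I
  let e := I.orderIsoOfFin hcard
  refine ⟨I.card - 1, by omega, ⟨fun i => e.symm ⟨s (f i), hI i⟩, fun i j hij => ?_⟩, ?_,
    V'.pull fun j => (e j : Fin (m + 1)), ?_⟩
  · exact e.symm.monotone (s.monotone (f.monotone hij))
  · intro j
    obtain ⟨i, -, hi⟩ := Finset.mem_image.1 (e j).2
    refine ⟨i, ?_⟩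
    change e.symm ⟨s (f i), hI i⟩ = j
    rw [OrderIso.symm_apply_eq]
    exact Subtype.ext hi
  · rw [Sing.pull_pull, Sing.pull_pull]
    congr 1
    funext i
    change s (f i) = (e (e.symm ⟨s (f i), hI i⟩) : Fin (m + 1))
    rw [OrderIso.apply_symm_apply]

section Serre

variable (k : Type v) [Field k] {E B : Type u} [TopologicalSpace E] [TopologicalSpace B]
  (π : C(E, B))

/-- The simplices of `E` which span `F^p`: those `α : Δ^n → E` for which `π ∘ α` factors through
a codegeneracy `Δ^n → Δ^m` with `m ≤ p`. -/
def serreSimplices (p : ℤ) : Set (Σ n : ℕ, Sing n E) :=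
  {s | ∃ m : ℕ, (m : ℤ) ≤ p ∧ Sing.FactorsThrough (π.comp s.2 : Sing s.1 B) m}

/-- The singular chain complex of `E` with the Serre filtration. -/
def serreFiltration : FilteredDGModule k (Chains k E) where
  toDGModule := singularChains k E
  fil p := Finsupp.supported k k (serreSimplices π p)
  fil_mono p q hpq := Finsupp.supported_mono fun _ ⟨m, hm, h⟩ => ⟨m, hm.trans hpq, h⟩
  d_mem_fil p := by
    refine boundary_mem k E _ _ fun n α ⟨m, hm, h⟩ i => ?_
    obtain ⟨m', hm', h'⟩ := h.pull (Fin.succAboveOrderEmb i).toOrderHom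
    exact ⟨m', by lia, h'⟩

/-- The homological Serre spectral sequence of `π`, with coefficients in `k`. -/
def serreSpectralSequence :
    SpectralSequence (ModuleCat.{max u v} k)
      (fun r => ComplexShape.up' ((-r, r - 1) : ℤ × ℤ)) 0 :=
  (serreFiltration k π).spectralSequence

/-- The class in `E^r_{p,q}`, as an element of the page `E^r`, of an almost cycle. -/
def serreClass (r : ℕ) (x : ℤ × ℤ) (c : Chains k E)
    (hc : c ∈ (serreFiltration k π).almostCycles r x) : TotalPage (serreSpectralSequence k π) r :=
  pageIncl (serreSpectralSequence k π) r x ((serreFiltration k π).pageMk r x ⟨c, hc⟩)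

/-- The comultiplication and the counit of `E^0_{p,q} = F^p_{p+q} / F^{p-1}_{p+q}` are induced by
the Alexander--Whitney diagonal and the augmentation of the singular chains of `E`: for a simplex
`α : Δ^n → E` in `F^p`, the comultiplication sends the class of `α` in `E^0_{p,n-p}` to the sum
over `j` of the classes of `α ∘ [0, …, j]` and `α ∘ [j, …, n]`, taken in filtration degrees
`a j` and `p - a j`. -/
def IsInducedByDiagonal (S : CoalgebraStructure (serreSpectralSequence k π)) : Prop :=
  (∀ (p : ℤ) (n : ℕ) (α : Sing n E)
    (hα : simplexChain k α ∈ (serreFiltration k π).almostCycles (0 : ℕ) (p, n - p)),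
    ∃ (a : Fin (n + 1) → ℤ)
      (hf : ∀ j : Fin (n + 1), simplexChain k (α.front j (by omega)) ∈
        (serreFiltration k π).almostCycles (0 : ℕ) (a j, j - a j))
      (hb : ∀ j : Fin (n + 1), simplexChain k (α.back j (n - j) (by omega)) ∈
        (serreFiltration k π).almostCycles (0 : ℕ) (p - a j, (n - p) - (j - a j))),
      (S.coalgebra 0).comul (serreClass k π 0 _ _ hα) =
        ∑ j, serreClass k π 0 _ _ (hf j) ⊗ₜ[k] serreClass k π 0 _ _ (hb j)) ∧
  ∀ (α : Sing 0 E)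
    (hα : simplexChain k α ∈ (serreFiltration k π).almostCycles (0 : ℕ) (0, 0)),
    (S.coalgebra 0).counit (serreClass k π 0 _ _ hα) = 1

/-! ### Serre fibrations and the identification of the second page -/

/-- `π` is a Serre fibration: it has the homotopy lifting property for all cubes `[0, 1]^n`
(equivalently, for all CW complexes). -/
def IsSerreFibration : Prop :=
  ∀ (n : ℕ) (f : C(Fin n → unitInterval, E)) (h : C((Fin n → unitInterval) × unitInterval, B)),
    (∀ x, h (x, 0) = π (f x)) →
    ∃ l : C((Fin n → unitInterval) × unitInterval, E),
      (∀ x, l (x, 0) = f x) ∧ ∀ y, π (l y) = h y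

/-- The fiber of `π` over `x`. -/
abbrev Fiber (x : B) : Type u := {e : E // π e = x}

/-- The inclusion of the fiber. -/
def fiberIncl (x : B) : C(Fiber π x, E) := ⟨Subtype.val, continuous_subtype_val⟩

/-- The pullback of `π` along a path in `B`. -/
abbrev PathPullback {x y : B} (γ : Path x y) : Type u :=
  {te : unitInterval × E // π te.2 = γ te.1}

/-- The inclusion of the fiber over the source in the pullback along a path. -/
def sourceIncl {x y : B} (γ : Path x y) : C(Fiber π x, PathPullback π γ) :=
  ⟨fun e => ⟨(0, e.1), by rw [e.2, γ.source]⟩, by fun_prop⟩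

/-- The inclusion of the fiber over the target in the pullback along a path. -/
def targetIncl {x y : B} (γ : Path x y) : C(Fiber π y, PathPullback π γ) :=
  ⟨fun e => ⟨(1, e.1), by rw [e.2, γ.target]⟩, by fun_prop⟩

/-- The family `τ x : H_*(F_x) ≅ H_*(F_b)` identifies the homology of the fibers of `π` with that
of the fiber over `b` by transport along paths: for every path `γ` from `x` to `b`, the class `u`
and its transport `τ x u` have the same image in the homology of the pullback of `π` along `γ`. -/
def IsFiberTransport (b : B)
    (τ : ∀ (x : B) (n : ℤ),
      SingularHomology k (Fiber π x) n ≃ₗ[k] SingularHomology k (Fiber π b) n) : Prop :=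
  ∀ (x : B) (γ : Path x b) (n : ℤ) (u : SingularHomology k (Fiber π x) n),
    homologyMap k (sourceIncl π γ) n u = homologyMap k (targetIncl π γ) n (τ x n u)

/-- The initial vertex of a singular simplex. -/
def Sing.initial {n : ℕ} (V : Sing n B) : B := V (stdSimplex.vertex 0)

/-- The group `C_p(B; Z_q(F))`: finite sums of pairs of a `p`-simplex `V` of `B` and a cycle of
degree `q` in the fiber over the initial vertex of `V`. -/
abbrev LocalCycles (p q : ℕ) : Type (max u v) :=
  ⨁ V : Sing p B, (singularChains k (Fiber π V.initial)).cycles q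

open Classical in
/-- The map `C_p(B; Z_q(F)) → C_q(E) ⊗ C_p(B)`, `(U, V) ↦ U ⊗ V`. -/
def localCyclesIncl (p q : ℕ) : LocalCycles k π p q →ₗ[k] Chains k E ⊗[k] Chains k B :=
  DirectSum.toModule k _ _ fun V =>
    ((TensorProduct.mk k (Chains k E) (Chains k B)).flip (simplexChain k V)).comp
      ((chainsMap k (fiberIncl π V.initial)).comp (Submodule.subtype _))

open Classical in
/-- The map `C_p(B; Z_q(F)) → C_p(B) ⊗ H_q(F_b)`, `(U, V) ↦ V ⊗ τ [U]`. -/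
def localCyclesClass (b : B) (τ : ∀ (x : B) (n : ℤ),
      SingularHomology k (Fiber π x) n ≃ₗ[k] SingularHomology k (Fiber π b) n) (p q : ℕ) :
    LocalCycles k π p q →ₗ[k] Chains k B ⊗[k] SingularHomology k (Fiber π b) q :=
  DirectSum.toModule k _ _ fun V =>
    (TensorProduct.mk k (Chains k B) _ (simplexChain k V)).comp
      ((τ V.initial q).toLinearMap.comp (DGModule.homologyClass _ _))

open Classical in
/-- The map `φ : C_{p+q}(E) → C_q(E) ⊗ C_p(B)`,
`α ↦ (α ∘ [0, …, q]) ⊗ (π ∘ α ∘ [q, …, p + q])`, with values in the normalized chains of `B`: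
the term is `0` if the simplex `π ∘ α ∘ [q, …, p + q]` is degenerate. -/
def frontBack (p q : ℕ) : Chains k E →ₗ[k] Chains k E ⊗[k] Chains k B :=
  Finsupp.linearCombination k fun s : (Σ n : ℕ, Sing n E) =>
    if h : q + p = s.1 then
      if Sing.IsDegenerate (π.comp (s.2.back q p h) : Sing p B) then 0
      else simplexChain k (s.2.front q (by omega)) ⊗ₜ[k]
        simplexChain k (π.comp (s.2.back q p h) : Sing p B)
    else 0

/-- The span of the degenerate simplices of `X`. -/
def degenerateChains (X : Type u) [TopologicalSpace X] : Submodule k (Chains k X) :=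
  Finsupp.supported k k {s : (Σ n : ℕ, Sing n X) | s.2.IsDegenerate}

/-- The element `h` of `H_p(X) ⊗ A = H_p(X; A)` is represented by the normalized chain `c` with
coefficients in `A`: up to degenerate chains, `c` is a cycle whose homology class is `h`. -/
def IsRepresentedBy (X : Type u) [TopologicalSpace X] {A : Type*} [AddCommGroup A] [Module k A]
    (p : ℤ) (h : SingularHomology k X p ⊗[k] A) (c : Chains k X ⊗[k] A) : Prop :=
  ∃ (t : (singularChains k X).cycles p ⊗[k] A) (e : degenerateChains k X ⊗[k] A),
    LinearMap.rTensor A ((singularChains k X).cycles p).subtype t =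
      c + LinearMap.rTensor A (degenerateChains k X).subtype e ∧
    LinearMap.rTensor A ((singularChains k X).homologyClass p) t = h

/-- The type of families of isomorphisms `E^2_{p,q} ≅ H_p(B; k) ⊗ H_q(F_b; k)`. -/
abbrev SecondPageIso (b : B) : Type (max u v) :=
  ∀ x : ℤ × ℤ, ((serreSpectralSequence k π).page (2 : ℕ)).X x ≃ₗ[k]
    SingularHomology k B x.1 ⊗[k] SingularHomology k (Fiber π b) x.2

/-- The family `Φ` is the standard identification of the second page of the Serre spectral
sequence. For `z ∈ Z^2_{p,q}`, the chain `φ z` lies in `C_p(B; Z_q(F))`, and `Φ [z]` is the class in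
`H_p(B; H_q(F_b)) = H_p(B) ⊗ H_q(F_b)` of `φ z` after the homology of all fibers has been
identified with that of `F_b`. The exchange of the factors
`C_q(F) ⊗ C_p(B) → C_p(B) ⊗ C_q(F)` contributes the Koszul sign `(-1)^{pq}`. -/
def IsStandardIdentification (b : B) (Φ : SecondPageIso k π b) : Prop :=
  ∃ τ, IsFiberTransport k π b τ ∧
    ∀ (p q : ℕ) (z : (serreFiltration k π).almostCycles (2 : ℕ) ((p : ℤ), (q : ℤ))),
      ∃ u : LocalCycles k π p q, localCyclesIncl k π p q u = frontBack k π p q z ∧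
        IsRepresentedBy k B p (Φ (p, q) ((serreFiltration k π).pageMk (2 : ℕ) _ z))
          ((-1 : k) ^ (p * q) • localCyclesClass k π b τ p q u)

/-- The isomorphism `E^2 ≅ H_*(B; k) ⊗ H_*(F_b; k)` given by isomorphisms
`E^2_{p,q} ≅ H_p(B; k) ⊗ H_q(F_b; k)`. -/
def secondPageEquiv (b : B) (Φ : SecondPageIso k π b) :
    TotalPage (serreSpectralSequence k π) 2 ≃ₗ[k]
      TotalSingularHomology k B ⊗[k] TotalSingularHomology k (Fiber π b) :=
  (DFinsupp.mapRange.linearEquiv Φ).trans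
    (TensorProduct.directSum k k (fun n => SingularHomology k B n)
      (fun n => SingularHomology k (Fiber π b) n)).symm

end Serre

end SerreCoalgebra

end

universe u v

open SerreCoalgebra

noncomputable section

namespace SerreCoalgebra

universe w

open Finset (Icc sum_eq_zero sum_eq_single mem_Icc sum_empty sum_congr mem_univ sum_add_distrib
  univ sum_sub_distrib mem_filter mem_erase range smul_sum mem_range Ico sum_neg_distrib
  sum_range_succ' range_zero sum_range_succ sum_comm)
open Finsupp (single supported linearCombination lapply lhom_ext' single_mem_supported
  supported_mono mapDomain lmapDomain mapDomain_single supported_univ linearCombination_single)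
open Function (Surjective Bijective surjInv_eq)
open LinearEquiv (coe_coe ofBijective)
open LinearMap (ker eqLocus ext_ring lTensor_tmul rTensor_tmul rTensor lTensor comp_id
  lTensor_comp lTensor_sub lTensor_id rTensor_comp lTensor_comp_apply)
open LinearMap renaming comp_apply → lcomp_apply, id → idₗ, sub_apply → lsub_apply, zero_apply →
  lzero_apply, congr_fun → lcongr_fun, add_apply → ladd_apply, ext → lin_ext, id_apply → idₗ_apply
open OrderHom (const comp_coe id_coe)
open SSet (horn)
open SimplexCategory (mkHom)
open Submodule (span_induction mem_bot mkQ_apply mem_sup_left mem_sup_right mkQ_surjective mem_sup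
  mkQ liftQ subtype mem_inf)
open TensorProduct (assoc induction_on)
open TensorProduct renaming map → tmap, map_comp → tmap_comp, map_id → tmap_id, ext' → text', rid
  → trid, comm → tcomm, lid → tlid
open stdSimplex (sum_eq_one map_comp_apply vertex map_vertex)

/-! ### Linear algebra over a field -/

section LinearAlgebra

variable {k : Type v} [Field k]

lemma exists_linear_extension {Z C P : Type*} [AddCommGroup Z] [Module k Z] [AddCommGroup C]
    [Module k C] [AddCommGroup P] [Module k P] (i : Z →ₗ[k] C) (f : Z →ₗ[k] P)
    (h : ∀ z, i z = 0 → f z = 0) : ∃ g : C →ₗ[k] P, ∀ z, g (i z) = f z := by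
  have hle : ker i ≤ ker f := fun z hz => h z hz
  obtain ⟨g, hg⟩ := LinearMap.exists_extend
    (((ker i).liftQ f hle).comp i.quotKerEquivRange.symm.toLinearMap)
  refine ⟨g, fun z => ?_⟩
  have := congrArg (fun g => g ⟨i z, LinearMap.mem_range_self i z⟩) hg
  have e : i.quotKerEquivRange.symm ⟨i z, LinearMap.mem_range_self i z⟩ =
      (ker i).mkQ z := i.quotKerEquivRange_symm_apply_image z _
  simpa [e] using this

lemma exists_extension_vanishing {C P : Type*} [AddCommGroup C]
    [Module k C] [AddCommGroup P] [Module k P] (Z F : Submodule k C) (f : Z →ₗ[k] P)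
    (h : ∀ z : Z, (z : C) ∈ F → f z = 0) :
    ∃ g : C →ₗ[k] P, (∀ z : Z, g z = f z) ∧ ∀ c ∈ F, g c = 0 := by
  obtain ⟨g, hg⟩ := exists_linear_extension (F.mkQ.comp Z.subtype) f fun z hz =>
    h z (by simpa using hz)
  refine ⟨g.comp F.mkQ, hg, fun c hc => ?_⟩
  have : F.mkQ c = 0 := by simpa using hc
  rw [lcomp_apply, this, map_zero]

lemma exists_generalized_inverse {C P : Type*} [AddCommGroup C]
    [Module k C] [AddCommGroup P] [Module k P] (f : C →ₗ[k] P) :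
    ∃ g : P →ₗ[k] C, ∀ x, f (g (f x)) = f x := by
  obtain ⟨s, hs⟩ := f.rangeRestrict.exists_rightInverse_of_surjective
    (LinearMap.range_eq_top.2 f.surjective_rangeRestrict)
  obtain ⟨g, hg⟩ := exists_linear_extension (LinearMap.range f).subtype s
    fun z hz => by rw [show z = 0 from Subtype.ext hz, map_zero]
  refine ⟨g, fun x => ?_⟩
  have h1 : g (f x) = s (f.rangeRestrict x) := hg (f.rangeRestrict x)
  have h2 := congrArg (fun g => (g (f.rangeRestrict x)).1) hs
  rw [h1]; exact h2

lemma map_mem_of_single {ι : Type*} {V : Type*} [AddCommMonoid V] [Module k V]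
    (f : (ι →₀ k) →ₗ[k] V) (T : Set ι) (W : Submodule k V)
    (h : ∀ i ∈ T, f (single i 1) ∈ W) :
    ∀ x ∈ supported k k T, f x ∈ W := by
  intro x hx; rw [Finsupp.supported_eq_span_single] at hx
  induction hx using span_induction with
  | mem x hx => obtain ⟨s, hs, rfl⟩ := hx; exact h s hs
  | zero => rw [map_zero]; exact W.zero_mem
  | add x y _ _ hx hy => rw [map_add]; exact W.add_mem hx hy
  | smul a x _ hx => rw [map_smul]; exact W.smul_mem a hx

lemma eq_on_of_single {ι : Type*} {V : Type*} [AddCommMonoid V] [Module k V]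
    (f g : (ι →₀ k) →ₗ[k] V) (T : Set ι)
    (h : ∀ i ∈ T, f (single i 1) = g (single i 1)) :
    ∀ x ∈ supported k k T, f x = g x := by
  exact fun x hx => map_mem_of_single idₗ T (eqLocus f g) h x hx

/-- The projection onto the span of the basis elements which satisfy `P`. -/
def basisProj {ι : Type*} (P : ι → Prop) [DecidablePred P] : (ι →₀ k) →ₗ[k] (ι →₀ k) :=
  linearCombination k fun i => if P i then single i 1 else 0

lemma basisProj_single {ι : Type*} (P : ι → Prop) [DecidablePred P] (i : ι) :
    basisProj (k := k) P (single i 1) = if P i then single i 1 else 0 := by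
  simp [basisProj]

lemma basisProj_apply {ι : Type*} (P : ι → Prop) [DecidablePred P] (x : ι →₀ k) (i : ι) :
    basisProj P x i = if P i then x i else 0 := by
  suffices h : lapply i ∘ₗ basisProj P =
      (if P i then (1 : k) else 0) • lapply (R := k) (M := k) i by
    have := congrArg (fun f => f x) h
    split_ifs with hi <;> simpa [hi] using this
  refine lhom_ext' fun j => ext_ring ?_
  simp only [lcomp_apply, Finsupp.lsingle_apply, basisProj_single, LinearMap.smul_apply]
  by_cases hij : j = i
  · subst hij; split_ifs <;> simp
  · split_ifs <;> simp [hij]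

lemma basisProj_mem {ι : Type*} (P : ι → Prop) [DecidablePred P] {T : Set ι} {x : ι →₀ k}
    (hx : x ∈ supported k k T) :
    basisProj P x ∈ supported k k {i | i ∈ T ∧ P i} := by
  refine map_mem_of_single _ T _ (fun i hi => ?_) x hx
  rw [basisProj_single]
  split_ifs with h
  · exact single_mem_supported _ _ ⟨hi, h⟩
  · exact zero_mem _

lemma sub_basisProj_mem {ι : Type*} (P : ι → Prop) [DecidablePred P] {T : Set ι} {x : ι →₀ k}
    (hx : x ∈ supported k k T) :
    x - basisProj P x ∈ supported k k {i | i ∈ T ∧ ¬ P i} := by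
  refine map_mem_of_single (idₗ - basisProj P) T _ (fun i hi => ?_) x hx
  rw [lsub_apply, basisProj_single]
  split_ifs with h
  · simp
  · simpa using single_mem_supported k 1 (show i ∈ {i | i ∈ T ∧ ¬ P i} from ⟨hi, h⟩)

lemma basisProj_eq_zero {ι : Type*} (P : ι → Prop) [DecidablePred P] {T : Set ι} {x : ι →₀ k}
    (hx : x ∈ supported k k T) (hT : ∀ i ∈ T, ¬ P i) : basisProj P x = 0 := by
  refine (eq_on_of_single (basisProj P) 0 T (fun i hi => ?_) x hx)
  rw [basisProj_single, if_neg (hT i hi)]; rfl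

lemma basisProj_eq_self {ι : Type*} (P : ι → Prop) [DecidablePred P] {T : Set ι} {x : ι →₀ k}
    (hx : x ∈ supported k k T) (hT : ∀ i ∈ T, P i) : basisProj P x = x := by
  refine (eq_on_of_single (basisProj P) idₗ T (fun i hi => ?_) x hx)
  rw [basisProj_single, if_pos (hT i hi)]; rfl

open Classical in
lemma mem_of_basisProj_mem {ι κ : Type*} (key : ι → κ) (x : ι →₀ k) (S : Submodule k (ι →₀ k))
    (h : ∀ v, basisProj (fun i => key i = v) x ∈ S) : x ∈ S := by
  have : x = ∑ v ∈ x.support.image key, basisProj (fun i => key i = v) x := by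
    ext i
    rw [Finsupp.finsetSum_apply]; simp only [basisProj_apply]; rw [Finset.sum_ite_eq]
    split_ifs with hi
    · rfl
    · by_contra h0
      exact hi (Finset.mem_image_of_mem _ (Finsupp.mem_support_iff.2 h0))
  rw [this]; exact sum_mem fun v _ => h v

end LinearAlgebra

/-! ### Graded families in a tensor square -/

section Tens

variable {k : Type v} [Field k] {C : Type w} [AddCommGroup C] [Module k C]

/-- The part of bidegree `x` of `C ⊗ C`, for a bigraded family of submodules of `C`. -/
def tens (A : ℤ × ℤ → Submodule k C) (x : ℤ × ℤ) : Submodule k (C ⊗[k] C) :=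
  Submodule.span k {t | ∃ a b c c', a + b = x ∧ c ∈ A a ∧ c' ∈ A b ∧ t = c ⊗ₜ c'}

lemma tmul_mem_tens {A : ℤ × ℤ → Submodule k C} {x a b : ℤ × ℤ} {c c' : C} (h : a + b = x)
    (hc : c ∈ A a) (hc' : c' ∈ A b) : c ⊗ₜ[k] c' ∈ tens A x :=
  Submodule.subset_span ⟨a, b, c, c', h, hc, hc', rfl⟩

lemma map_tens_mem {V : Type*} [AddCommGroup V] [Module k V] {A : ℤ × ℤ → Submodule k C}
    {x : ℤ × ℤ} (f : C ⊗[k] C →ₗ[k] V) (W : Submodule k V)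
    (h : ∀ a b c c', a + b = x → c ∈ A a → c' ∈ A b → f (c ⊗ₜ c') ∈ W) :
    ∀ t ∈ tens A x, f t ∈ W := by
  intro t ht
  induction ht using span_induction with
  | mem t ht => obtain ⟨a, b, c, c', hab, hc, hc', rfl⟩ := ht; exact h a b c c' hab hc hc'
  | zero => rw [map_zero]; exact W.zero_mem
  | add x y _ _ hx hy => rw [map_add]; exact W.add_mem hx hy
  | smul a x _ hx => rw [map_smul]; exact W.smul_mem a hx

lemma eq_on_tens {V : Type*} [AddCommGroup V] [Module k V] {A : ℤ × ℤ → Submodule k C}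
    {x : ℤ × ℤ} (f g : C ⊗[k] C →ₗ[k] V)
    (h : ∀ a b c c', a + b = x → c ∈ A a → c' ∈ A b → f (c ⊗ₜ c') = g (c ⊗ₜ c')) :
    ∀ t ∈ tens A x, f t = g t := by
  intro t ht
  have := map_tens_mem (A := A) (x := x) (f - g) ⊥ (fun a b c c' h1 h2 h3 => by
    simp [h a b c c' h1 h2 h3]) t ht
  rwa [mem_bot, lsub_apply, sub_eq_zero] at this

lemma map_mem_tens {A A' : ℤ × ℤ → Submodule k C} {f g : C →ₗ[k] C} {s t : ℤ × ℤ}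
    (hf : ∀ a, ∀ c ∈ A a, f c ∈ A' (a + s)) (hg : ∀ a, ∀ c ∈ A a, g c ∈ A' (a + t))
    {x y : ℤ × ℤ} (hy : x + s + t = y) :
    ∀ z ∈ tens A x, tmap f g z ∈ tens A' y := by
  refine map_tens_mem _ _ fun a b c c' h hc hc' => ?_
  rw [map_tmul]; exact tmul_mem_tens (by rw [← hy, ← h]; abel) (hf _ _ hc) (hg _ _ hc')

lemma tens_mono {A A' : ℤ × ℤ → Submodule k C} (h : ∀ a, A a ≤ A' a) (x : ℤ × ℤ) :
    tens A x ≤ tens A' x :=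
  Submodule.span_mono fun _ ⟨a, b, c, c', h1, h2, h3, h4⟩ => ⟨a, b, c, c', h1, h _ h2, h _ h3, h4⟩

end Tens

/-! ### Filtered differential graded modules with a basis of weighted elements -/

namespace FilteredDGModule

section Basic

variable {k : Type v} [Field k] {C : Type w} [AddCommGroup C] [Module k C]
  (M : FilteredDGModule k C)

lemma filGr_mono {x y : ℤ × ℤ} (h1 : x.1 ≤ y.1) (h2 : x.1 + x.2 = y.1 + y.2) :
    M.filGr x ≤ M.filGr y := by
  unfold filGr; rw [h2]; exact inf_le_inf_right _ (M.fil_mono h1)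

lemma almostCycles_le (r : ℤ) (x : ℤ × ℤ) : M.almostCycles r x ≤ M.filGr x := inf_le_left

lemma almostCycles_mono (r : ℤ) {x y : ℤ × ℤ} (h1 : x.1 ≤ y.1) (h2 : x.1 + x.2 = y.1 + y.2) :
    M.almostCycles r x ≤ M.almostCycles r y :=
  inf_le_inf (M.filGr_mono h1 h2) (Submodule.comap_mono (M.fil_mono (by lia)))

def incl (r : ℕ) (x : ℤ × ℤ) : M.Page r x →ₗ[k] TotalPage M.spectralSequence r :=
  pageIncl M.spectralSequence r x

def cls (r : ℕ) (x : ℤ × ℤ) : M.almostCycles r x →ₗ[k] TotalPage M.spectralSequence r :=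
  (M.incl r x).comp (M.pageMk r x)

lemma pageMk_eq_zero (r : ℤ) (x : ℤ × ℤ) (z : M.almostCycles r x)
    (hz : (z : C) ∈ M.pageDenominator r x) : M.pageMk r x z = 0 := by
  rw [mkQ_apply, Submodule.Quotient.mk_eq_zero]; exact hz

lemma pageMk_eq_zero_iff (r : ℤ) (x : ℤ × ℤ) (z : M.almostCycles r x) :
    M.pageMk r x z = 0 ↔ (z : C) ∈ M.pageDenominator r x := by
  rw [mkQ_apply, Submodule.Quotient.mk_eq_zero]; rfl

lemma cls_eq_zero (r : ℕ) (x : ℤ × ℤ) (z : M.almostCycles r x)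
    (hz : (z : C) ∈ M.pageDenominator r x) : M.cls r x z = 0 := by
  unfold cls; rw [lcomp_apply, M.pageMk_eq_zero r x z hz, map_zero]

lemma lower_le_pageDenominator (r : ℤ) (x : ℤ × ℤ) :
    M.filGr (x.1 - 1, x.2 + 1) ≤ M.pageDenominator r x := le_sup_right

lemma exists_pageExtension (r : ℤ) (x : ℤ × ℤ) : ∃ g : C →ₗ[k] M.Page r x,
    (∀ z : M.almostCycles r x, g z = M.pageMk r x z) ∧ ∀ c ∈ M.filGr (x.1 - 1, x.2 + 1), g c = 0 :=
  exists_extension_vanishing _ _ _ fun z hz =>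
    M.pageMk_eq_zero r x z (M.lower_le_pageDenominator r x hz)

/-- A linear extension to `C` of the class map from `Z^r_{p,q}` to `E^r_{p,q}`, vanishing on
`F^{p-1}_{p+q}`. -/
def pageExt (r : ℤ) (x : ℤ × ℤ) : C →ₗ[k] M.Page r x := (M.exists_pageExtension r x).choose

lemma pageExt_eq (r : ℤ) (x : ℤ × ℤ) (z : M.almostCycles r x) :
    M.pageExt r x z = M.pageMk r x z := (M.exists_pageExtension r x).choose_spec.1 z

lemma pageExt_eq_zero (r : ℤ) (x : ℤ × ℤ) {c : C} (hc : c ∈ M.filGr (x.1 - 1, x.2 + 1)) :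
    M.pageExt r x c = 0 := (M.exists_pageExtension r x).choose_spec.2 c hc

lemma totalPageD_cls (r : ℕ) {x y : ℤ × ℤ} (h : x + (-(r : ℤ), (r : ℤ) - 1) = y)
    (z : M.almostCycles r x) :
    totalPageD M.spectralSequence r (M.cls r x z) =
      M.cls r y ⟨M.d z, M.d_mem_almostCycles r h z.2⟩ := by
  subst h
  refine (toModule_lof k x _).trans ?_
  change M.incl r _ (((M.pageComplex r).d x _).hom (M.pageMk r x z)) = _; rw [M.pageComplex_d r rfl]
  rfl

end Basic

/-- The module has a basis, each element of which has a weight and a degree, such that the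
filtration is given by the weights and the grading by the degrees. -/
structure HasWeights {k : Type v} [Field k] {ι : Type u} (M : FilteredDGModule k (ι →₀ k))
    (wt deg : ι → ℤ) : Prop where
  fil_eq : ∀ p, M.fil p = supported k k {i | wt i ≤ p}
  gr_eq : ∀ n, M.gr n = supported k k {i | deg i = n}
  wt_nonneg : ∀ i, 0 ≤ wt i

section Weights

variable {k : Type v} [Field k] {ι : Type u} {M : FilteredDGModule k (ι →₀ k)}
  {wt deg : ι → ℤ} (hM : M.HasWeights wt deg)

include hM

lemma HasWeights.filGr_eq (x : ℤ × ℤ) :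
    M.filGr x = supported k k {i | wt i ≤ x.1 ∧ deg i = x.1 + x.2} := by
  unfold filGr; rw [hM.fil_eq, hM.gr_eq, ← Finsupp.supported_inter]; rfl

lemma HasWeights.fil_eq_bot {p : ℤ} (hp : p < 0) : M.fil p = ⊥ := by
  rw [hM.fil_eq, show {i | wt i ≤ p} = ∅ from
    Set.eq_empty_of_forall_notMem fun i hi => by have := hM.wt_nonneg i; simp at hi; lia,
    Finsupp.supported_empty]

omit hM in
abbrev wtProj (k : Type v) [Field k] (wt : ι → ℤ) (a : ℤ) : (ι →₀ k) →ₗ[k] (ι →₀ k) :=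
  basisProj fun i => wt i = a

omit hM in
variable (M wt deg) in
/-- The sum over all `i` of the class of the basis element `i` in bidegree
`(wt i, deg i - wt i)`. -/
def lead (r : ℕ) : (ι →₀ k) →ₗ[k] TotalPage M.spectralSequence r := linearCombination k fun i =>
    M.incl r (wt i, deg i - wt i) (M.pageExt r (wt i, deg i - wt i) (single i 1))

omit hM in
variable (M wt deg) in
def leadAt (r : ℕ) (a : ℤ) : (ι →₀ k) →ₗ[k] TotalPage M.spectralSequence r :=
  lead M wt deg r ∘ₗ wtProj k wt a

omit hM in
lemma lead_of_bideg (r : ℕ) (x : ℤ × ℤ) {c : ι →₀ k}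
    (hc : c ∈ supported k k {i | wt i = x.1 ∧ deg i = x.1 + x.2}) :
    lead M wt deg r c = M.incl r x (M.pageExt r x c) := by
  refine eq_on_of_single (lead M wt deg r) ((M.incl r x).comp (M.pageExt r x)) _
    (fun i hi => ?_) c hc
  obtain ⟨h1, h2⟩ := hi
  have : x = (wt i, deg i - wt i) := by ext <;> simp <;> lia
  subst this; simp [lead]

lemma HasWeights.wtProj_mem {x : ℤ × ℤ} {c : ι →₀ k} (hc : c ∈ M.filGr x) :
    wtProj k wt x.1 c ∈ supported k k {i | wt i = x.1 ∧ deg i = x.1 + x.2} := by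
  rw [hM.filGr_eq] at hc
  exact supported_mono (fun i (hi : (_ ∧ _) ∧ _) => And.intro hi.2 hi.1.2) (basisProj_mem _ hc)

lemma HasWeights.sub_wtProj_mem {x : ℤ × ℤ} {c : ι →₀ k} (hc : c ∈ M.filGr x) :
    c - wtProj k wt x.1 c ∈ M.filGr (x.1 - 1, x.2 + 1) := by
  rw [hM.filGr_eq] at hc ⊢
  refine supported_mono (fun i hi => ?_) (sub_basisProj_mem _ hc)
  obtain ⟨⟨h1, h2⟩, h3⟩ := hi
  constructor <;> simp <;> lia

lemma HasWeights.pageExt_wtProj (r : ℕ) {x : ℤ × ℤ} (z : M.almostCycles r x) :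
    M.pageExt r x (wtProj k wt x.1 z) = M.pageMk r x z := by
  have h := M.pageExt_eq_zero r x (hM.sub_wtProj_mem z.2.1)
  rw [map_sub, M.pageExt_eq, sub_eq_zero] at h; exact h.symm

lemma HasWeights.leadAt_cls (r : ℕ) {x : ℤ × ℤ} (z : M.almostCycles r x) :
    leadAt M wt deg r x.1 z = M.cls r x z := by
  unfold leadAt cls; rw [lcomp_apply, lead_of_bideg r x (hM.wtProj_mem z.2.1), hM.pageExt_wtProj]
  rfl

lemma HasWeights.leadAt_eq_zero (r : ℕ) {x : ℤ × ℤ} {a : ℤ} (ha : x.1 < a) {c : ι →₀ k}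
    (hc : c ∈ M.filGr x) : leadAt M wt deg r a c = 0 := by
  unfold leadAt; rw [hM.filGr_eq] at hc
  rw [lcomp_apply, basisProj_eq_zero _ hc (fun i hi => by have := hi.1; lia), map_zero]

omit hM in
variable (M wt deg) in
/-- The class in `E^r ⊗ E^r` of the part of weight `p` of an element of `C ⊗ C`. -/
def leadTensor (r : ℕ) (p : ℤ) : (ι →₀ k) ⊗[k] (ι →₀ k) →ₗ[k]
    TotalPage M.spectralSequence r ⊗[k] TotalPage M.spectralSequence r :=
  ∑ a ∈ Icc 0 p, tmap (leadAt M wt deg r a) (leadAt M wt deg r (p - a))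

lemma HasWeights.leadTensor_eq_zero (r : ℕ) {x : ℤ × ℤ} {p : ℤ} (hp : x.1 < p)
    {t : (ι →₀ k) ⊗[k] (ι →₀ k)} (ht : t ∈ tens M.filGr x) :
    leadTensor M wt deg r p t = 0 := by
  refine eq_on_tens (leadTensor M wt deg r p) 0 (fun a b c c' hab hc hc' => ?_) t ht
  simp only [leadTensor, LinearMap.sum_apply, map_tmul, lzero_apply]
  refine sum_eq_zero fun a' _ => ?_
  by_cases h : a.1 < a'
  · rw [hM.leadAt_eq_zero r h hc, zero_tmul]
  · rw [hM.leadAt_eq_zero r (x := b) (by rw [← hab, Prod.fst_add] at hp; lia) hc', tmul_zero]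

lemma HasWeights.leadTensor_tmul (r : ℕ) {a b : ℤ × ℤ} {p : ℤ} (hp : a.1 + b.1 = p)
    (z : M.almostCycles r a) (z' : M.almostCycles r b) :
    leadTensor M wt deg r p ((z : ι →₀ k) ⊗ₜ[k] (z' : ι →₀ k)) = M.cls r a z ⊗ₜ M.cls r b z' := by
  by_cases ha : a.1 < 0
  · have h0 : z = 0 := Subtype.ext (by
      have := z.2.1.1; rw [hM.fil_eq_bot ha] at this; simpa using this)
    simp [h0]
  by_cases hb : b.1 < 0
  · have h0 : z' = 0 := Subtype.ext (by
      have := z'.2.1.1; rw [hM.fil_eq_bot hb] at this; simpa using this)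
    simp [h0]
  simp only [leadTensor, LinearMap.sum_apply, map_tmul]; rw [sum_eq_single a.1]
  · rw [hM.leadAt_cls, show p - a.1 = b.1 by lia, hM.leadAt_cls]
  · intro a' _ ha'
    by_cases h : a.1 < a'
    · rw [hM.leadAt_eq_zero r h z.2.1, zero_tmul]
    · rw [hM.leadAt_eq_zero r (x := b) (by lia) z'.2.1, tmul_zero]
  · intro h; exact absurd (mem_Icc.2 ⟨by lia, by lia⟩) h

/-! ### Approximate contractions -/

omit hM in
/-- A chain map `e`, homotopic to the identity through a homotopy which raises the filtration
by at most `r - 1`, with values in almost cycles `Z^r`. -/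
structure IsApprox (M : FilteredDGModule k (ι →₀ k)) (r : ℤ) (e h : (ι →₀ k) →ₗ[k] (ι →₀ k)) :
    Prop where
  e_mem : ∀ x, ∀ c ∈ M.filGr x, e c ∈ M.almostCycles r x
  h_mem : ∀ x, ∀ c ∈ M.filGr x, h c ∈ M.filGr (x + (r - 1, 2 - r))
  homotopy : ∀ c, M.d (h c) + h (M.d c) = c - e c

end Weights

end FilteredDGModule

namespace FilteredDGModule

section Approx

variable {k : Type v} [Field k] {ι : Type u} {M : FilteredDGModule k (ι →₀ k)}
  {wt deg : ι → ℤ} 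

lemma HasWeights.single_mem (hM : M.HasWeights wt deg) (i : ι) :
    single i 1 ∈ M.filGr (wt i, deg i - wt i) := by
  rw [hM.filGr_eq]; exact single_mem_supported _ _ (by simp)

lemma HasWeights.ext_filGr (hM : M.HasWeights wt deg) {V : Type*} [AddCommGroup V] [Module k V]
    {f g : (ι →₀ k) →ₗ[k] V} (h : ∀ x, ∀ c ∈ M.filGr x, f c = g c) : f = g :=
  lhom_ext' fun i => ext_ring (h _ _ (hM.single_mem i))

section

variable {r : ℤ} {e h : (ι →₀ k) →ₗ[k] (ι →₀ k)} (he : IsApprox M r e h)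

include he

lemma IsApprox.d_e (c : ι →₀ k) : M.d (e c) = e (M.d c) := by
  have h1 := congrArg M.d (he.homotopy c)
  have h2 := he.homotopy (M.d c)
  rw [map_add, map_sub, M.d_d, zero_add] at h1; rw [M.d_d, map_zero, add_zero, h1] at h2
  simpa using h2

lemma IsApprox.sub_mem {x : ℤ × ℤ} {c : ι →₀ k} (hc : c ∈ M.almostCycles r x) :
    c - e c ∈ M.pageDenominator r x := by
  rw [← he.homotopy c]
  have hd := M.d_mem_almostCycles r rfl hc
  have h1 : h (M.d c) ∈ M.filGr (x.1 - 1, x.2 + 1) := by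
    refine M.filGr_mono ?_ ?_ (he.h_mem _ _ hd.1) <;> simp <;> omega
  refine add_mem (mem_sup_left ⟨?_, h c, ?_, rfl⟩) (mem_sup_right h1)
  · have : M.d (h c) = c - e c - h (M.d c) := by rw [← he.homotopy c]; abel
    rw [this]
    refine Submodule.sub_mem _ (Submodule.sub_mem _ hc.1 (he.e_mem x c hc.1).1) ?_
    exact M.filGr_mono (by simp) (by simp) h1
  · refine M.filGr_mono ?_ ?_ (he.h_mem _ _ hc.1) <;> simp <;> omega

end

lemma isApprox_zero : IsApprox M 0 idₗ 0 where
  e_mem x c hc := ⟨hc, by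
    rw [sub_zero]
    exact M.d_mem_fil _ _ hc.1⟩
  h_mem x c _ := zero_mem _
  homotopy c := by simp

lemma HasWeights.exists_lift_inverse (hM : M.HasWeights wt deg) (r : ℤ) :
    ∃ g : (ι →₀ k) →ₗ[k] (ι →₀ k), (∀ y, ∀ c ∈ M.filGr y, g c ∈ M.almostCycles r (y + (r, 1 - r))) ∧
      ∀ x, ∀ c ∈ M.almostCycles r x,
        M.d c - M.d (g (M.d c)) ∈ (M.filGr (x.1 - 1, x.2 + 1)).map M.d ⊔
          M.filGr (x.1 - r - 1, x.2 + r) := by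
  have hy : ∀ y : ℤ × ℤ, y + (r, 1 - r) + (-r, r - 1) = y := fun y => by ext <;> simp <;> omega
  choose G hG using fun y : ℤ × ℤ => exists_generalized_inverse (M.pageD r (hy y))
  choose s hs using fun y : ℤ × ℤ => (M.pageMk r y).exists_rightInverse_of_surjective
    (LinearMap.range_eq_top.2 (mkQ_surjective _))
  let gy : ∀ y : ℤ × ℤ, (ι →₀ k) →ₗ[k] (ι →₀ k) := fun y =>
    (M.almostCycles r (y + (r, 1 - r))).subtype ∘ₗ s _ ∘ₗ G y ∘ₗ M.pageExt r y
  let g : (ι →₀ k) →ₗ[k] (ι →₀ k) := linearCombination k fun i =>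
    gy (wt i, deg i - wt i) (single i 1)
  have hg1 : ∀ y, ∀ c ∈ M.filGr y, g c ∈ M.almostCycles r (y + (r, 1 - r)) := by
    intro y c hc; rw [hM.filGr_eq] at hc
    refine map_mem_of_single g _ _ (fun i hi => ?_) c hc
    obtain ⟨h1, h2⟩ := hi
    have : g (single i 1) = gy (wt i, deg i - wt i) (single i 1) := by simp [g]
    rw [this]
    refine M.almostCycles_mono r ?_ ?_ (Subtype.property _) <;> simp <;> omega
  refine ⟨g, hg1, fun x c hc => ?_⟩
  have hdc := M.d_mem_almostCycles r rfl hc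
  set y := x + (-r, r - 1) with hy'
  have hxy : y + (r, 1 - r) = x := by rw [hy']; ext <;> simp <;> omega
  have hw : g (wtProj k wt y.1 (M.d c)) = gy y (wtProj k wt y.1 (M.d c)) := by
    refine eq_on_of_single g (gy y) _ (fun i hi => ?_) _ (hM.wtProj_mem hdc.1)
    obtain ⟨h1, h2⟩ := hi
    have : y = (wt i, deg i - wt i) := by ext <;> simp <;> omega
    rw [this]; simp [g]
  have hext : M.pageExt r y (wtProj k wt y.1 (M.d c)) = M.pageMk r y ⟨M.d c, hdc⟩ := by
    have h := M.pageExt_eq_zero r y (hM.sub_wtProj_mem hdc.1)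
    rw [map_sub, sub_eq_zero] at h; exact h.symm.trans (M.pageExt_eq r y ⟨M.d c, hdc⟩)
  obtain ⟨u, hu⟩ : ∃ u : M.almostCycles r (y + (r, 1 - r)),
      u = s _ (G y (M.pageMk r y ⟨M.d c, hdc⟩)) := ⟨_, rfl⟩
  have hu1 : g (M.d c) - u ∈ M.filGr (x.1 - 1, x.2 + 1) := by
    have h1 : (u : ι →₀ k) = g (wtProj k wt y.1 (M.d c)) := by
      rw [hw, hu]; simp only [gy, lcomp_apply, hext]; rfl
    rw [h1, ← map_sub]
    refine M.filGr_mono ?_ ?_ (hg1 _ _ (hM.sub_wtProj_mem hdc.1)).1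
    · simp [hy']; omega
    · simp [hy']; omega
  have hu2 : M.d c - M.d u ∈ M.pageDenominator r y := by
    have hc' : c ∈ M.almostCycles r (y + (r, 1 - r)) := by rw [hxy]; exact hc
    have e1 : M.pageMk r y ⟨M.d c, hdc⟩ = M.pageD r (hy y) (M.pageMk r _ ⟨c, hc'⟩) := rfl
    have e2 : M.pageD r (hy y) (M.pageMk r _ u) = M.pageMk r y ⟨M.d c, hdc⟩ := by
      have : M.pageMk r _ u = G y (M.pageMk r y ⟨M.d c, hdc⟩) := by
        rw [hu]; exact lcongr_fun (hs _) _
      rw [this, e1, hG]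
    have e3 : M.pageD r (hy y) (M.pageMk r _ u) =
        M.pageMk r y ⟨M.d u, M.d_mem_almostCycles r (hy y) u.2⟩ := rfl
    rw [e3, eq_comm, ← sub_eq_zero, ← map_sub] at e2; exact (M.pageMk_eq_zero_iff r y _).1 e2
  obtain ⟨_, ⟨-, b, hb, rfl⟩, f, hf, hbf⟩ := mem_sup.1 hu2
  have : M.d c - M.d (g (M.d c)) = M.d (b - (g (M.d c) - u)) + f := by
    rw [map_sub, map_sub]
    have : M.d c = M.d b + f + M.d u := by rw [hbf]; abel
    nth_rewrite 1 [this]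
    abel
  rw [this]
  refine Submodule.add_mem_sup ⟨_, sub_mem ?_ hu1, rfl⟩ ?_
  · refine M.filGr_mono ?_ ?_ hb
    · simp [hy']; omega
    · simp [hy']; omega
  · refine M.filGr_mono ?_ ?_ hf <;> simp [hy'] <;> omega

theorem HasWeights.exists_isApprox (hM : M.HasWeights wt deg) (r : ℕ) :
    ∃ e h, IsApprox M (r : ℤ) e h := by
  induction r with
  | zero => exact ⟨_, _, isApprox_zero⟩
  | succ r ih =>
    obtain ⟨e, h, he⟩ := ih
    obtain ⟨g, hg1, hg2⟩ := hM.exists_lift_inverse (r : ℤ)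
    let e1 : (ι →₀ k) →ₗ[k] (ι →₀ k) := e - M.d ∘ₗ g ∘ₗ e - g ∘ₗ e ∘ₗ M.d
    have he1 : ∀ c, e1 c = e c - M.d (g (e c)) - g (M.d (e c)) := fun c => by simp [e1, he.d_e]
    have hmem : ∀ x, ∀ c ∈ M.filGr x, e1 c ∈ M.filGr x := by
      intro x c hc
      have hec := he.e_mem x c hc
      rw [he1]
      refine sub_mem (sub_mem hec.1 ?_) ?_
      · refine (M.d_mem_almostCycles (r : ℤ) ?_ (hg1 _ _ hec.1)).1
        ext <;> simp <;> omega
      · have := (hg1 _ _ (M.d_mem_almostCycles (r : ℤ) rfl hec).1).1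
        rwa [show x + (-(r : ℤ), (r : ℤ) - 1) + ((r : ℤ), 1 - (r : ℤ)) = x by ext <;> simp <;> omega] at this
    refine ⟨e ∘ₗ e1, h + e ∘ₗ (h + g ∘ₗ e), fun x c hc => ⟨(he.e_mem x _ (hmem x c hc)).1, ?_⟩,
      fun x c hc => ?_, fun c => ?_⟩
    · change M.d (e (e1 c)) ∈ M.fil (x.1 - ((r + 1 : ℕ) : ℤ))
      have h1 : M.d (e1 c) = M.d (e c) - M.d (g (M.d (e c))) := by rw [he1]; simp [M.d_d]
      obtain ⟨_, ⟨b, hb, rfl⟩, f, hf, hbf⟩ := mem_sup.1 (hg2 x _ (he.e_mem x c hc))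
      rw [he.d_e, h1, ← hbf, map_add, ← he.d_e]
      refine add_mem ?_ ?_
      · have := (he.e_mem _ b hb).2
        exact M.fil_mono (by push_cast; simp; omega) (this : M.d (e b) ∈ _)
      · exact M.fil_mono (by push_cast; simp; omega) (he.e_mem _ f hf).1.1
    · have hh : ∀ x, ∀ c ∈ M.filGr x, h c ∈ M.filGr (x + ((r : ℤ), 1 - (r : ℤ))) := by
        intro x c hc
        refine M.filGr_mono ?_ ?_ (he.h_mem _ _ hc) <;> simp <;> omega
      have e0 : x + (((r + 1 : ℕ) : ℤ) - 1, 2 - ((r + 1 : ℕ) : ℤ)) = x + ((r : ℤ), 1 - (r : ℤ)) := by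
        ext <;> simp <;> omega
      rw [e0]
      refine add_mem (hh _ _ hc) (he.e_mem _ _ (add_mem (hh _ _ hc) ?_)).1
      exact (hg1 _ _ (he.e_mem _ _ hc).1).1
    · have h1 := he.homotopy c
      have h2 : M.d (h c + g (e c)) + (h (M.d c) + g (e (M.d c))) = c - e1 c := by
        rw [he1, map_add, ← he.d_e, show M.d (h c) = (c - e c) - h (M.d c) by rw [← h1]; abel]
        abel
      have h3 := congrArg e h2
      simp only [ladd_apply, lcomp_apply]
      rw [map_add M.d, he.d_e, add_add_add_comm, h1, ← map_add e, h2, map_sub]; abel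

end Approx

/-! ### Linear maps out of the pages -/

section Pages

variable {k : Type v} [Field k] {C : Type w} [AddCommGroup C] [Module k C]
  (M : FilteredDGModule k C)

lemma cls_apply (r : ℕ) (x : ℤ × ℤ) (z : M.almostCycles r x) :
    M.cls r x z = M.incl r x (M.pageMk r x z) := rfl

/-- A linear map out of the total page, given by linear maps out of its bigraded pieces. -/
def ofPages (r : ℕ) {A : Type*} [AddCommMonoid A] [Module k A]
    (f : ∀ x, M.Page r x →ₗ[k] A) : TotalPage M.spectralSequence r →ₗ[k] A :=
  toModule k _ _ f

lemma ofPages_incl (r : ℕ) {A : Type*} [AddCommMonoid A] [Module k A]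
    (f : ∀ x, M.Page r x →ₗ[k] A) (x : ℤ × ℤ) (c : M.Page r x) :
    M.ofPages r f (M.incl r x c) = f x c :=
  toModule_lof k x c

lemma total_induction (r : ℕ) {P : TotalPage M.spectralSequence r → Prop}
    (h : ∀ x (z : M.almostCycles r x), P (M.cls r x z)) (h0 : P 0)
    (hadd : ∀ a b, P a → P b → P (a + b)) (c : TotalPage M.spectralSequence r) : P c := by
  refine DirectSum.induction_on c h0 (fun x c => ?_) hadd
  obtain ⟨z, hz⟩ := mkQ_surjective _ (show M.Page r x from c)
  have := h x z
  rwa [cls_apply, hz] at this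

lemma total_ext (r : ℕ) {A : Type*} [AddCommMonoid A] [Module k A]
    {f g : TotalPage M.spectralSequence r →ₗ[k] A}
    (h : ∀ x (z : M.almostCycles r x), f (M.cls r x z) = g (M.cls r x z)) : f = g := by
  ext1
  rename_i x
  refine lin_ext fun c => ?_
  obtain ⟨z, hz⟩ := mkQ_surjective _ (show M.Page r x from c)
  have := h x z
  rwa [cls_apply, hz] at this

lemma totalPageSgn_cls (r : ℕ) (x : ℤ × ℤ) (z : M.almostCycles r x) :
    totalPageSgn M.spectralSequence r (M.cls r x z) =
      ((Int.negOnePow (x.1 + x.2) : ℤ) : k) • M.cls r x z := by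
  unfold totalPageSgn
  refine (lmap_lof _ _ _).trans ?_
  exact map_smul (M.incl r x) _ (M.pageMk r x z)

end Pages

end FilteredDGModule

/-! ### Comultiplications induced on homology: further properties -/

section Induced

variable {k : Type v} [Field k] {P : Type*} [AddCommMonoid P] [Module k P]
  {Z : Type*} [AddCommMonoid Z] [Module k Z] {H : Type*} [AddCommMonoid H] [Module k H]
  {D sgn : P →ₗ[k] P} {i : Z →ₗ[k] P} {cls : Z →ₗ[k] H} {Δ : P →ₗ[k] P ⊗[k] P}
  {ΔH : H →ₗ[k] H ⊗[k] H}

lemma map_tensorD {A A' : Type*} [AddCommMonoid A] [Module k A] [AddCommMonoid A'] [Module k A']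
    {f : P →ₗ[k] A} {g : P →ₗ[k] A'} (hf : ∀ x, f (D x) = 0) (hg : ∀ x, g (D x) = 0)
    (w : P ⊗[k] P) : tmap f g (tensorD D sgn w) = 0 := by
  suffices h : tmap f g ∘ₗ tensorD D sgn = 0 from lcongr_fun h w
  ext a b
  simp [tensorD, hf, hg]

lemma InducedOnHomology.map_apply (h : InducedOnHomology D sgn i cls Δ ΔH)
    {A A' : Type*} [AddCommMonoid A] [Module k A] [AddCommMonoid A'] [Module k A']
    {f : P →ₗ[k] A} {g : P →ₗ[k] A'} (hf : ∀ x, f (D x) = 0) (hg : ∀ x, g (D x) = 0)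
    {fH : H →ₗ[k] A} {gH : H →ₗ[k] A'} (hfH : ∀ z, fH (cls z) = f (i z))
    (hgH : ∀ z, gH (cls z) = g (i z)) (z : Z) :
    tmap fH gH (ΔH (cls z)) = tmap f g (Δ (i z)) := by
  obtain ⟨t, w, h1, h2⟩ := h z
  rw [h1, h2, map_add, map_tensorD hf hg, add_zero, ← lcomp_apply, ← lcomp_apply,
    ← tmap_comp, ← tmap_comp]
  congr 2 <;> ext z
  exacts [hfH z, hgH z]

variable {ε : P →ₗ[k] k} {εH : H →ₗ[k] k} {r : P →ₗ[k] H}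

lemma InducedOnHomology.coassoc (h : InducedOnHomology D sgn i cls Δ ΔH)
    (hcls : Surjective cls) (hrD : ∀ x, r (D x) = 0) (hri : ∀ z, r (i z) = cls z)
    (hΔ : ∀ x, Δ (D x) = tensorD D sgn (Δ x))
    (hco : ∀ x, assoc k P P P (Δ.rTensor P (Δ x)) = Δ.lTensor P (Δ x)) (y : H) :
    assoc k H H H (ΔH.rTensor H (ΔH y)) = ΔH.lTensor H (ΔH y) := by
  obtain ⟨z, rfl⟩ := hcls y
  let δ : P →ₗ[k] H ⊗[k] H := tmap r r ∘ₗ Δ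
  have hδD : ∀ x, δ (D x) = 0 := fun x => by
    simp only [δ, lcomp_apply]; rw [hΔ, map_tensorD hrD hrD]
  have hδ : ∀ z, ΔH (cls z) = δ (i z) := fun z => by
    have := h.map_apply hrD hrD (fH := idₗ) (gH := idₗ)
      (fun z => (hri z).symm) (fun z => (hri z).symm) z
    rw [tmap_id] at this; exact this
  have h1 := h.map_apply (fH := ΔH) (gH := idₗ) hδD hrD hδ (fun z => (hri z).symm) z
  have h2 := h.map_apply (gH := ΔH) (fH := idₗ) hrD hδD (fun z => (hri z).symm) hδ z
  have e1 : tmap δ r = tmap (tmap r r) r ∘ₗ Δ.rTensor P := by ext a b; simp [δ]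
  have e2 : tmap r δ = tmap r (tmap r r) ∘ₗ Δ.lTensor P := by ext a b; simp [δ]
  have e3 : ∀ t, assoc k H H H (tmap (tmap r r) r t) = tmap r (tmap r r) (assoc k P P P t) := by
    intro t
    suffices h : (assoc k H H H).toLinearMap ∘ₗ (tmap (tmap r r) r) =
        tmap r (tmap r r) ∘ₗ (assoc k P P P).toLinearMap from
      lcongr_fun h t
    ext a b c; simp
  change assoc k H H H (tmap ΔH idₗ _) = tmap idₗ ΔH _
  rw [h1, h2, e1, e2, lcomp_apply, lcomp_apply, e3, hco]

lemma InducedOnHomology.rTensor_counit (h : InducedOnHomology D sgn i cls Δ ΔH)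
    (hcls : Surjective cls) (hrD : ∀ x, r (D x) = 0) (hri : ∀ z, r (i z) = cls z)
    (hεD : ∀ x, ε (D x) = 0) (hε : ∀ z, εH (cls z) = ε (i z))
    (hco : ∀ x, ε.rTensor P (Δ x) = 1 ⊗ₜ x) (y : H) :
    εH.rTensor H (ΔH y) = 1 ⊗ₜ y := by
  obtain ⟨z, rfl⟩ := hcls y
  refine (h.map_apply (fH := εH) (gH := idₗ) hεD hrD hε (fun z => (hri z).symm) z).trans ?_
  have : tmap ε r = r.lTensor k ∘ₗ ε.rTensor P := by ext a b; simp
  rw [this, lcomp_apply, hco, lTensor_tmul, hri]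

lemma InducedOnHomology.lTensor_counit (h : InducedOnHomology D sgn i cls Δ ΔH)
    (hcls : Surjective cls) (hrD : ∀ x, r (D x) = 0) (hri : ∀ z, r (i z) = cls z)
    (hεD : ∀ x, ε (D x) = 0) (hε : ∀ z, εH (cls z) = ε (i z))
    (hco : ∀ x, ε.lTensor P (Δ x) = x ⊗ₜ 1) (y : H) :
    εH.lTensor H (ΔH y) = y ⊗ₜ 1 := by
  obtain ⟨z, rfl⟩ := hcls y
  refine (h.map_apply (gH := εH) (fH := idₗ) hrD hεD (fun z => (hri z).symm) hε z).trans ?_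
  have : tmap r ε = r.rTensor k ∘ₗ ε.lTensor P := by ext a b; simp
  rw [this, lcomp_apply, hco, rTensor_tmul, hri]

end Induced

namespace FilteredDGModule

section Cycles

variable {k : Type v} [Field k] {C : Type w} [AddCommGroup C] [Module k C]
  (M : FilteredDGModule k C)

def toPageCycles (r : ℕ) (x : ℤ × ℤ) :
    M.almostCycles (r + 1 : ℤ) x →ₗ[k] (M.spectralSequence.page (r : ℤ)).cycles x :=
  (((M.pageComplex r).sc x).moduleCatCyclesIso.inv).hom.comp (M.toKer r x)

lemma iCycles_toPageCycles (r : ℕ) (x : ℤ × ℤ) (z : M.almostCycles (r + 1 : ℤ) x) :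
    ((M.spectralSequence.page (r : ℤ)).iCycles x).hom (M.toPageCycles r x z) =
      M.pageMk r x ⟨z, M.almostCycles_succ_le r x z.2⟩ := by
  have := congrArg (fun f => f.hom (M.toKer r x z))
    ((M.pageComplex r).sc x).moduleCatCyclesIso_inv_iCycles
  exact this

lemma class_toPageCycles (r : ℕ) (x : ℤ × ℤ) (z : M.almostCycles ((r + 1 : ℕ) : ℤ) x)
    (z' : M.almostCycles ((r : ℤ) + 1) x) (h : (z : C) = z') :
    ((M.spectralSequence.page (r : ℤ)).homologyπ x ≫
      (M.spectralSequence.iso r ((r + 1 : ℕ) : ℤ) x).hom).hom (M.toPageCycles r x z') =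
      M.pageMk ((r + 1 : ℕ) : ℤ) x z := by
  obtain rfl : z = z' := Subtype.ext h
  have h1 : ((M.pageComplex r).sc x).moduleCatCyclesIso.inv ≫ ((M.pageComplex r).sc x).homologyπ ≫
      ((M.pageComplex r).sc x).moduleCatHomologyIso.hom =
      ((M.pageComplex r).sc x).moduleCatLeftHomologyData.π := by
    rw [ShortComplex.π_moduleCatCyclesIso_hom, Iso.inv_hom_id_assoc]
  have h2 := congrArg (fun f => f.hom (M.toKer r x z)) h1
  change (M.pageIso r x).symm (((M.pageComplex r).sc x).moduleCatHomologyIso.hom.hom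
    (((M.pageComplex r).sc x).homologyπ.hom (M.toPageCycles r x z))) = _
  have h3 : ((M.pageComplex r).sc x).moduleCatHomologyIso.hom.hom
      (((M.pageComplex r).sc x).homologyπ.hom (M.toPageCycles r x z)) =
      M.pageIso r x (M.pageMk ((r : ℤ) + 1) x z) := h2
  rw [h3, LinearEquiv.symm_apply_apply]; rfl

lemma toKer_surjective (r : ℤ) (x : ℤ × ℤ) : Surjective (M.toKer r x) := by
  intro c
  obtain ⟨z, hz⟩ := M.toPageHomology_surjective r x (mkQ _ c)
  have hp : (ComplexShape.up' ((-r, r - 1) : ℤ × ℤ)).prev x = x - (-r, r - 1) :=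
    (ComplexShape.up' ((-r, r - 1) : ℤ × ℤ)).prev_eq' (sub_add_cancel x _)
  have hrel : (ComplexShape.up' ((-r, r - 1) : ℤ × ℤ)).prev x + (-r, r - 1) = x := by
    rw [hp, sub_add_cancel]
  change mkQ _ (M.toKer r x z) = mkQ _ c at hz
  rw [eq_comm, ← sub_eq_zero, ← map_sub, mkQ_apply, Submodule.Quotient.mk_eq_zero] at hz
  obtain ⟨w, hw⟩ := LinearMap.mem_range.1 hz
  obtain ⟨w, rfl⟩ := mkQ_surjective _ (show M.Page r _ from w)
  have hdw : M.d w ∈ M.almostCycles (r + 1) x :=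
    ⟨(M.d_mem_almostCycles r hrel w.2).1, by simp [M.d_d]⟩
  refine ⟨z + ⟨M.d w, hdw⟩, ?_⟩
  have h : M.toKer r x ⟨M.d w, hdw⟩ = c - M.toKer r x z := by
    refine Eq.trans (Subtype.ext ?_) hw
    change M.pageMk r x ⟨M.d w, _⟩ = ((M.pageComplex r).d _ x).hom _; rw [M.pageComplex_d r hrel]
    rfl
  rw [map_add, h]; exact add_sub_cancel _ _

lemma toPageCycles_surjective (r : ℕ) (x : ℤ × ℤ) : Surjective (M.toPageCycles r x) := by
  intro c
  obtain ⟨z, hz⟩ := M.toKer_surjective r x (((M.pageComplex r).sc x).moduleCatCyclesIso.hom.hom c)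
  refine ⟨z, ?_⟩
  change ((M.pageComplex r).sc x).moduleCatCyclesIso.inv.hom (M.toKer r x z) = c; rw [hz]
  exact congrArg (fun f => f.hom c) ((M.pageComplex r).sc x).moduleCatCyclesIso.hom_inv_id

/-- The element of the total module of cycles given by an element of `Z^{r+1}`. -/
def toCycles (r : ℕ) (x : ℤ × ℤ) :
    M.almostCycles ((r + 1 : ℕ) : ℤ) x →ₗ[k] TotalPageCycles M.spectralSequence r :=
  (lof k (ℤ × ℤ) (fun x => (M.spectralSequence.page (r : ℤ)).cycles x) x).comp (M.toPageCycles r x)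

lemma almostCycles_succ_le' (r : ℕ) (x : ℤ × ℤ) :
    M.almostCycles ((r + 1 : ℕ) : ℤ) x ≤ M.almostCycles r x := M.almostCycles_succ_le r x

lemma totalPageCyclesIncl_toCycles (r : ℕ) (x : ℤ × ℤ) (z : M.almostCycles ((r + 1 : ℕ) : ℤ) x) :
    totalPageCyclesIncl M.spectralSequence r (M.toCycles r x z) =
      M.cls r x ⟨z, M.almostCycles_succ_le' r x z.2⟩ := by
  refine (lmap_lof _ _ _).trans ?_
  exact congrArg (M.incl r x) (M.iCycles_toPageCycles r x z)

lemma totalPageClass_toCycles (r : ℕ) (x : ℤ × ℤ) (z : M.almostCycles ((r + 1 : ℕ) : ℤ) x) :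
    totalPageClass M.spectralSequence r (M.toCycles r x z) = M.cls (r + 1) x z := by
  refine (lmap_lof _ _ _).trans ?_
  exact congrArg (M.incl (r + 1) x) (M.class_toPageCycles r x z z rfl)

lemma cycles_induction (r : ℕ) {P : TotalPageCycles M.spectralSequence r → Prop}
    (h : ∀ x (z : M.almostCycles ((r + 1 : ℕ) : ℤ) x), P (M.toCycles r x z)) (h0 : P 0)
    (hadd : ∀ a b, P a → P b → P (a + b)) (c : TotalPageCycles M.spectralSequence r) : P c := by
  refine DirectSum.induction_on c h0 (fun x c => ?_) hadd
  obtain ⟨z, rfl⟩ := M.toPageCycles_surjective r x c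
  exact h x z

lemma totalPageClass_surjective (r : ℕ) : Surjective (totalPageClass M.spectralSequence r) := by
  intro c
  induction c using M.total_induction (r + 1) with
  | h x z => exact ⟨_, M.totalPageClass_toCycles r x z⟩
  | h0 => exact ⟨0, map_zero _⟩
  | hadd a b ha hb =>
    obtain ⟨a, rfl⟩ := ha
    obtain ⟨b, rfl⟩ := hb
    exact ⟨a + b, map_add _ _ _⟩

lemma exists_page_retraction (r : ℕ) :
    ∃ f : TotalPage M.spectralSequence r →ₗ[k] TotalPage M.spectralSequence (r + 1),
      (∀ c, f (totalPageD M.spectralSequence r c) = 0) ∧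
      ∀ z, f (totalPageCyclesIncl M.spectralSequence r z) =
        totalPageClass M.spectralSequence r z := by
  have key : ∀ x, ∃ f : M.Page r x →ₗ[k] M.Page ((r + 1 : ℕ) : ℤ) x,
      ∀ z : M.almostCycles ((r + 1 : ℕ) : ℤ) x,
        f (M.pageMk r x ⟨z, M.almostCycles_succ_le' r x z.2⟩) = M.pageMk ((r + 1 : ℕ) : ℤ) x z := by
    intro x
    refine exists_linear_extension
      ((M.pageMk r x).comp (Submodule.inclusion (M.almostCycles_succ_le' r x))) _ fun z hz => ?_
    rw [lcomp_apply, M.pageMk_eq_zero_iff] at hz; rw [M.pageMk_eq_zero_iff]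
    refine (sup_le_sup_right (inf_le_inf_left _ (Submodule.map_mono (M.filGr_mono ?_ ?_))) _ :
      M.pageDenominator r x ≤ M.pageDenominator ((r + 1 : ℕ) : ℤ) x) hz
    · simp
    · simp; omega
  choose f hf using key
  have hcls : ∀ x (z : M.almostCycles ((r + 1 : ℕ) : ℤ) x),
      M.ofPages r (fun x => (M.incl (r + 1) x).comp (f x))
        (M.cls r x ⟨z, M.almostCycles_succ_le' r x z.2⟩) = M.cls (r + 1) x z := fun x z => by
    rw [cls_apply, ofPages_incl, lcomp_apply, hf]; rfl
  refine ⟨M.ofPages r fun x => (M.incl (r + 1) x).comp (f x), fun c => ?_, fun z => ?_⟩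
  · induction c using M.total_induction r with
    | h x z =>
      rw [M.totalPageD_cls r rfl z]
      have hd := M.d_mem_almostCycles r rfl z.2
      have hd' : M.d z ∈ M.almostCycles ((r + 1 : ℕ) : ℤ) (x + (-(r : ℤ), (r : ℤ) - 1)) :=
        ⟨hd.1, by simp [M.d_d]⟩
      rw [hcls _ ⟨M.d z, hd'⟩]
      refine M.cls_eq_zero _ _ _ (mem_sup_left ⟨hd.1, z, ?_, rfl⟩)
      refine M.filGr_mono ?_ ?_ z.2.1
      · simp
      · simp; omega
    | h0 => simp
    | hadd a b ha hb => rw [map_add, map_add, ha, hb, add_zero]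
  · induction z using M.cycles_induction r with
    | h x z => rw [totalPageCyclesIncl_toCycles, hcls, totalPageClass_toCycles]
    | h0 => simp
    | hadd a b ha hb => rw [map_add, map_add, map_add, ha, hb]

end Cycles

end FilteredDGModule

namespace FilteredDGModule

/-- A filtered differential graded coalgebra with a basis of weighted elements. -/
structure IsWeightedCoalgebra {k : Type v} [Field k] {ι : Type u}
    (M : FilteredDGModule k (ι →₀ k)) (wt deg : ι → ℤ) (sgn : (ι →₀ k) →ₗ[k] (ι →₀ k))
    (Δ : (ι →₀ k) →ₗ[k] (ι →₀ k) ⊗[k] (ι →₀ k)) (ε : (ι →₀ k) →ₗ[k] k) : Prop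
    extends M.HasWeights wt deg where
  sgn_eq : ∀ n, ∀ c ∈ M.gr n, sgn c = ((Int.negOnePow n : ℤ) : k) • c
  comul_mem : ∀ x, ∀ c ∈ M.filGr x, Δ c ∈ tens M.filGr x
  comul_d : ∀ c, Δ (M.d c) = tensorD M.d sgn (Δ c)
  coassoc : ∀ c, assoc k _ _ _ (Δ.rTensor _ (Δ c)) = Δ.lTensor _ (Δ c)
  rTensor_counit : ∀ c, ε.rTensor _ (Δ c) = 1 ⊗ₜ c
  lTensor_counit : ∀ c, ε.lTensor _ (Δ c) = c ⊗ₜ 1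
  counit_d : ∀ c, ε (M.d c) = 0
  counit_eq_zero : ∀ n ≠ 0, ∀ c ∈ M.gr n, ε c = 0

section

variable {k : Type v} [Field k] {ι : Type u} {M : FilteredDGModule k (ι →₀ k)}
  {wt deg : ι → ℤ} {sgn : (ι →₀ k) →ₗ[k] (ι →₀ k)}
  {Δ : (ι →₀ k) →ₗ[k] (ι →₀ k) ⊗[k] (ι →₀ k)} {ε : (ι →₀ k) →ₗ[k] k}

namespace IsWeightedCoalgebra

variable (hM : IsWeightedCoalgebra M wt deg sgn Δ ε)

include hM

lemma sgn_mem {n : ℤ} {c : ι →₀ k} (hc : c ∈ M.gr n) (S : Submodule k (ι →₀ k)) (hS : c ∈ S) :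
    sgn c ∈ S := by
  rw [hM.sgn_eq n c hc]; exact S.smul_mem _ hS

lemma sgn_sgn (c : ι →₀ k) : sgn (sgn c) = c := by
  suffices h : sgn ∘ₗ sgn = idₗ from lcongr_fun h c
  refine hM.ext_filGr fun x c hc => ?_
  rw [lcomp_apply, hM.sgn_eq _ c hc.2, map_smul, hM.sgn_eq _ c hc.2, smul_smul,
    ← Int.cast_mul, ← Units.val_mul, Int.units_mul_self]
  simp

lemma apply_sgn_of_odd (f : (ι →₀ k) →ₗ[k] (ι →₀ k)) (s : ℤ) (hs : Odd s)
    (hf : ∀ n, ∀ c ∈ M.gr n, f c ∈ M.gr (n + s)) (c : ι →₀ k) : f (sgn c) = - sgn (f c) := by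
  suffices h : f ∘ₗ sgn = - (sgn ∘ₗ f) from lcongr_fun h c
  refine hM.ext_filGr fun x c hc => ?_
  rw [LinearMap.neg_apply, lcomp_apply, lcomp_apply, hM.sgn_eq _ c hc.2,
    hM.sgn_eq _ _ (hf _ c hc.2), map_smul, Int.negOnePow_add _ s, Int.negOnePow_odd s hs]
  simp

lemma apply_sgn (f : (ι →₀ k) →ₗ[k] (ι →₀ k))
    (hf : ∀ n, ∀ c ∈ M.gr n, f c ∈ M.gr n) (c : ι →₀ k) : f (sgn c) = sgn (f c) := by
  suffices h : f ∘ₗ sgn = sgn ∘ₗ f from lcongr_fun h c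
  refine hM.ext_filGr fun x c hc => ?_
  rw [lcomp_apply, lcomp_apply, hM.sgn_eq _ c hc.2, hM.sgn_eq _ _ (hf _ c hc.2), map_smul]

lemma mem_gr_of_filGr (f : (ι →₀ k) →ₗ[k] (ι →₀ k)) (s : ℤ × ℤ)
    (hf : ∀ x, ∀ c ∈ M.filGr x, f c ∈ M.filGr (x + s)) (n : ℤ) (c : ι →₀ k) (hc : c ∈ M.gr n) :
    f c ∈ M.gr (n + (s.1 + s.2)) := by
  rw [hM.gr_eq] at hc
  refine map_mem_of_single f _ _ (fun i hi => ?_) c hc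
  have := (hf _ _ (hM.single_mem i)).2
  have e : (((wt i, deg i - wt i) : ℤ × ℤ) + s).1 + (((wt i, deg i - wt i) : ℤ × ℤ) + s).2 =
      n + (s.1 + s.2) := by
    have : deg i = n := hi
    simp; omega
  rwa [e] at this

lemma tensorD_mem (r : ℤ) {x y : ℤ × ℤ} (hy : x + (-r, r - 1) = y) {t : (ι →₀ k) ⊗[k] (ι →₀ k)}
    (ht : t ∈ tens (M.almostCycles r) x) :
    tensorD M.d sgn t ∈ tens (M.almostCycles r) y := by
  refine add_mem ?_ ?_
  · exact map_mem_tens (s := (-r, r - 1)) (t := 0) (fun a c hc => M.d_mem_almostCycles r rfl hc)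
      (fun a c hc => by rw [add_zero]; exact hc) (by rw [add_zero, hy]) t ht
  · exact map_mem_tens (t := (-r, r - 1)) (s := 0)
      (fun a c hc => by rw [add_zero]; exact hM.sgn_mem hc.1.2 _ hc)
      (fun a c hc => M.d_mem_almostCycles r rfl hc) (by rw [add_zero, hy]) t ht

lemma leadTensor_tensorD (r : ℕ) {x : ℤ × ℤ} {t : (ι →₀ k) ⊗[k] (ι →₀ k)}
    (ht : t ∈ tens (M.almostCycles r) x) {p : ℤ} (hp : x.1 - r = p) :
    leadTensor M wt deg r p (tensorD M.d sgn t) =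
      tensorD (totalPageD M.spectralSequence r) (totalPageSgn M.spectralSequence r)
        (leadTensor M wt deg r x.1 t) := by
  refine eq_on_tens (leadTensor M wt deg r p ∘ₗ tensorD M.d sgn)
    (tensorD (totalPageD M.spectralSequence r) (totalPageSgn M.spectralSequence r) ∘ₗ
      leadTensor M wt deg r x.1) (fun a b c c' hab hc hc' => ?_) t ht
  have h1 := hM.leadTensor_tmul r (p := p) (a := a + (-(r : ℤ), (r : ℤ) - 1)) (b := b)
    (by rw [← hp, ← hab]; simp; omega) ⟨M.d c, M.d_mem_almostCycles r rfl hc⟩ ⟨c', hc'⟩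
  have h2 := hM.leadTensor_tmul r (p := p) (b := b + (-(r : ℤ), (r : ℤ) - 1)) (a := a)
    (by rw [← hp, ← hab]; simp; omega) ⟨c, hc⟩ ⟨M.d c', M.d_mem_almostCycles r rfl hc'⟩
  have h3 := hM.leadTensor_tmul r (p := x.1) (b := b) (a := a)
    (by rw [← hab]; simp) ⟨c, hc⟩ ⟨c', hc'⟩
  simp only [lcomp_apply]; simp only at h1 h2 h3; rw [h3]
  simp only [tensorD, ladd_apply, map_tmul, idₗ_apply, map_add,
    M.totalPageD_cls r rfl, totalPageSgn_cls, hM.sgn_eq _ c hc.1.2]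
  rw [h1, smul_tmul, tmul_smul, map_smul, h2, ← smul_tmul']

section Approx

variable {r : ℕ} {e h : (ι →₀ k) →ₗ[k] (ι →₀ k)} (he : IsApprox M (r : ℤ) e h)

include he

lemma e_sgn (c : ι →₀ k) : e (sgn c) = sgn (e c) := by
  refine hM.apply_sgn e (fun n c hc => ?_) c
  have := hM.mem_gr_of_filGr e 0 (fun x c hc => by rw [add_zero]; exact (he.e_mem x c hc).1) n c hc
  simpa using this

lemma h_sgn (c : ι →₀ k) : h (sgn c) = - sgn (h c) := by
  refine hM.apply_sgn_of_odd h 1 odd_one (fun n c hc => ?_) c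
  have := hM.mem_gr_of_filGr h ((r : ℤ) - 1, 2 - (r : ℤ)) he.h_mem n c hc
  rwa [show (r : ℤ) - 1 + (2 - (r : ℤ)) = 1 by ring] at this

omit hM in
lemma map_e_mem {x : ℤ × ℤ} {t : (ι →₀ k) ⊗[k] (ι →₀ k)} (ht : t ∈ tens M.filGr x) :
    tmap e e t ∈ tens (M.almostCycles r) x :=
  map_mem_tens (s := 0) (t := 0) (fun a c hc => by rw [add_zero]; exact he.e_mem a c hc)
    (fun a c hc => by rw [add_zero]; exact he.e_mem a c hc) (by simp) t ht

lemma map_e_tensorD (t : (ι →₀ k) ⊗[k] (ι →₀ k)) :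
    tmap e e (tensorD M.d sgn t) = tensorD M.d sgn (tmap e e t) := by
  suffices h : tmap e e ∘ₗ tensorD M.d sgn = tensorD M.d sgn ∘ₗ tmap e e from lcongr_fun h t
  refine text' fun a b => ?_
  simp [tensorD, he.d_e, hM.e_sgn he]

omit hM in
lemma cls_e {x : ℤ × ℤ} {c : ι →₀ k} (hc : c ∈ M.almostCycles r x) :
    M.cls r x ⟨e c, he.e_mem x c hc.1⟩ = M.cls r x ⟨c, hc⟩ := by
  rw [eq_comm, ← sub_eq_zero, ← map_sub]; exact M.cls_eq_zero _ _ _ (he.sub_mem hc)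

lemma leadTensor_map_e {x : ℤ × ℤ} {t : (ι →₀ k) ⊗[k] (ι →₀ k)}
    (ht : t ∈ tens (M.almostCycles r) x) :
    leadTensor M wt deg r x.1 (tmap e e t) = leadTensor M wt deg r x.1 t := by
  refine eq_on_tens (leadTensor M wt deg r x.1 ∘ₗ tmap e e) _ (fun a b c c' hab hc hc' => ?_) t ht
  have hp : a.1 + b.1 = x.1 := by rw [← hab]; rfl
  have h1 := hM.leadTensor_tmul r hp ⟨e c, he.e_mem a c hc.1⟩ ⟨e c', he.e_mem b c' hc'.1⟩
  have h2 := hM.leadTensor_tmul r hp ⟨c, hc⟩ ⟨c', hc'⟩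
  rw [cls_e he hc, cls_e he hc'] at h1; rw [lcomp_apply, map_tmul]; exact h1.trans h2.symm

lemma homotopy_map_e (t : (ι →₀ k) ⊗[k] (ι →₀ k)) : t = tmap e e t +
      tensorD M.d sgn (tmap sgn h t + tmap h e t) +
      (tmap sgn h (tensorD M.d sgn t) + tmap h e (tensorD M.d sgn t)) := by
  suffices H : (idₗ : (ι →₀ k) ⊗[k] (ι →₀ k) →ₗ[k] _) = tmap e e +
      tensorD M.d sgn ∘ₗ (tmap sgn h + tmap h e) +
      (tmap sgn h + tmap h e) ∘ₗ tensorD M.d sgn from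
    lcongr_fun H t
  have hh : ∀ c, c = M.d (h c) + h (M.d c) + e c := fun c => by rw [he.homotopy]; abel
  have hds : ∀ c, M.d (sgn c) = - sgn (M.d c) :=
    hM.apply_sgn_of_odd M.d (-1) (by decide) (fun n c hc => M.d_mem_gr n c hc)
  refine text' fun a b => ?_
  simp only [tensorD, idₗ_apply, ladd_apply, lcomp_apply, map_tmul, map_add, hM.sgn_sgn,
    hds, hM.h_sgn he, he.d_e, neg_tmul]
  nth_rewrite 1 [hh b]
  have : a ⊗ₜ[k] e b = M.d (h a) ⊗ₜ e b + h (M.d a) ⊗ₜ e b + e a ⊗ₜ e b := by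
    rw [← add_tmul, ← add_tmul, ← hh]
  rw [tmul_add, this, tmul_add]; abel

lemma map_h_mem {x y : ℤ × ℤ} (hy : x + ((r : ℤ) - 1, 2 - (r : ℤ)) = y)
    {t : (ι →₀ k) ⊗[k] (ι →₀ k)} (ht : t ∈ tens M.filGr x) :
    tmap sgn h t + tmap h e t ∈ tens M.filGr y := by
  refine add_mem ?_ ?_
  · exact map_mem_tens (s := 0) (t := ((r : ℤ) - 1, 2 - (r : ℤ)))
      (fun a c hc => by rw [add_zero]; exact hM.sgn_mem hc.2 _ hc) he.h_mem
      (by rw [add_zero, hy]) t ht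
  · exact map_mem_tens (t := 0) (s := ((r : ℤ) - 1, 2 - (r : ℤ))) he.h_mem
      (fun a c hc => by rw [add_zero]; exact (he.e_mem a c hc).1)
      (by rw [add_zero, hy]) t ht

lemma leadTensor_map_e_tensorD {x : ℤ × ℤ} {t : (ι →₀ k) ⊗[k] (ι →₀ k)}
    (ht : t ∈ tens M.filGr x) {p : ℤ} (hp : x.1 - r = p) :
    leadTensor M wt deg r p (tmap e e (tensorD M.d sgn t)) =
      tensorD (totalPageD M.spectralSequence r) (totalPageSgn M.spectralSequence r)
        (leadTensor M wt deg r x.1 (tmap e e t)) := by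
  rw [hM.map_e_tensorD he, hM.leadTensor_tensorD r (map_e_mem he ht) hp]

lemma leadTensor_map_e_eq_zero {x : ℤ × ℤ} {t : (ι →₀ k) ⊗[k] (ι →₀ k)}
    (ht : t ∈ tens M.filGr x) {p : ℤ} (hp : x.1 < p) :
    leadTensor M wt deg r p (tmap e e t) = 0 :=
  hM.leadTensor_eq_zero r hp (tens_mono (M.almostCycles_le r) x (map_e_mem he ht))

lemma leadTensor_map_e_tensorD_eq_zero {x : ℤ × ℤ} {t : (ι →₀ k) ⊗[k] (ι →₀ k)}
    (ht : t ∈ tens M.filGr x) {p : ℤ} (hp : x.1 - r < p) :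
    leadTensor M wt deg r p (tmap e e (tensorD M.d sgn t)) = 0 := by
  rw [hM.map_e_tensorD he]
  have := hM.tensorD_mem r rfl (map_e_mem he ht)
  exact hM.leadTensor_eq_zero r (by simp; omega) (tens_mono (M.almostCycles_le r) _ this)

end Approx

lemma exists_comul (r : ℕ) : ∃ (Δr : TotalPage M.spectralSequence r →ₗ[k]
    TotalPage M.spectralSequence r ⊗[k] TotalPage M.spectralSequence r) (e h : _),
    IsApprox M (r : ℤ) e h ∧ ∀ x (z : M.almostCycles r x),
      Δr (M.cls r x z) = leadTensor M wt deg r x.1 (tmap e e (Δ z)) := by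
  obtain ⟨e, h, he⟩ := hM.exists_isApprox r
  refine ⟨M.ofPages r fun x => liftQ _ (leadTensor M wt deg r x.1 ∘ₗ
    tmap e e ∘ₗ Δ ∘ₗ (M.almostCycles r x).subtype) ?_, e, h, he, fun x z => ?_⟩
  · rintro ⟨z, hz⟩ hzd
    obtain ⟨_, ⟨-, w, hw, rfl⟩, f, hf, hwf⟩ := mem_sup.1 (show z ∈ _ from hzd)
    change leadTensor M wt deg r x.1 (tmap e e (Δ z)) = 0
    rw [← hwf, map_add, hM.comul_d, map_add, map_add,
      hM.leadTensor_map_e_tensorD_eq_zero he (hM.comul_mem _ w hw) (by simp; omega),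
      hM.leadTensor_map_e_eq_zero he (hM.comul_mem _ f hf) (by simp), add_zero]
  · rw [cls_apply, ofPages_incl]; rfl

lemma exists_counit (r : ℕ) : ∃ εr : TotalPage M.spectralSequence r →ₗ[k] k,
    ∀ x (z : M.almostCycles r x), εr (M.cls r x z) = if x = 0 then ε z else 0 := by
  refine ⟨M.ofPages r fun x => liftQ _ (if x = 0 then
    ε ∘ₗ (M.almostCycles r x).subtype else 0) ?_, fun x z => ?_⟩
  · rintro ⟨z, hz⟩ hzd
    split_ifs with hx
    · subst hx
      obtain ⟨_, ⟨-, w, hw, rfl⟩, f, hf, hwf⟩ := mem_sup.1 (show z ∈ _ from hzd)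
      have hf0 : f = 0 := by
        have := hf.1
        rw [hM.fil_eq_bot (by simp)] at this; simpa using this
      change ε z = 0; rw [← hwf, hf0, add_zero, hM.counit_d]
    · rfl
  · rw [cls_apply, ofPages_incl]
    refine (Submodule.liftQ_apply _ _ _).trans ?_
    split_ifs <;> rfl

lemma leadTensor_mem (r : ℕ) {x : ℤ × ℤ} {t : (ι →₀ k) ⊗[k] (ι →₀ k)}
    (ht : t ∈ tens (M.almostCycles r) x) : leadTensor M wt deg r x.1 t ∈
      ⨆ y : {y : (ℤ × ℤ) × (ℤ × ℤ) // y.1 + y.2 = x},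
        LinearMap.range (tmap (pageIncl M.spectralSequence r y.1.1)
          (pageIncl M.spectralSequence r y.1.2)) := by
  refine map_tens_mem _ _ (fun a b c c' hab hc hc' => ?_) t ht
  have h1 := hM.leadTensor_tmul r (p := x.1) (by rw [← hab]; rfl) ⟨c, hc⟩ ⟨c', hc'⟩
  refine Submodule.mem_iSup_of_mem ⟨(a, b), hab⟩ ⟨M.pageMk r a ⟨c, hc⟩ ⊗ₜ M.pageMk r b ⟨c', hc'⟩, ?_⟩
  rw [h1]; rfl

lemma exists_cycles_leadTensor (r : ℕ) {x : ℤ × ℤ} {t : (ι →₀ k) ⊗[k] (ι →₀ k)}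
    (ht : t ∈ tens (M.almostCycles ((r + 1 : ℕ) : ℤ)) x) :
    ∃ u : TotalPageCycles M.spectralSequence r ⊗[k] TotalPageCycles M.spectralSequence r,
      tmap (totalPageCyclesIncl _ r) (totalPageCyclesIncl _ r) u = leadTensor M wt deg r x.1 t ∧
      tmap (totalPageClass _ r) (totalPageClass _ r) u = leadTensor M wt deg (r + 1) x.1 t := by
  induction ht using span_induction with
  | mem t ht =>
    obtain ⟨a, b, c, c', hab, hc, hc', rfl⟩ := ht
    have hp : a.1 + b.1 = x.1 := by rw [← hab]; rfl
    have h1 := hM.leadTensor_tmul r hp ⟨c, M.almostCycles_succ_le' r a hc⟩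
      ⟨c', M.almostCycles_succ_le' r b hc'⟩
    have h2 := hM.leadTensor_tmul (r + 1) hp ⟨c, hc⟩ ⟨c', hc'⟩
    refine ⟨M.toCycles r a ⟨c, hc⟩ ⊗ₜ M.toCycles r b ⟨c', hc'⟩, ?_, ?_⟩
    · rw [map_tmul, totalPageCyclesIncl_toCycles, totalPageCyclesIncl_toCycles]; exact h1.symm
    · rw [map_tmul, totalPageClass_toCycles, totalPageClass_toCycles]
      exact h2.symm
  | zero => exact ⟨0, by simp, by simp⟩
  | add t t' _ _ h h' =>
    obtain ⟨u, h1, h2⟩ := h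
    obtain ⟨u', h1', h2'⟩ := h'
    exact ⟨u + u', by rw [map_add, map_add, h1, h1'], by rw [map_add, map_add, h2, h2']⟩
  | smul a t _ h =>
    obtain ⟨u, h1, h2⟩ := h
    exact ⟨a • u, by rw [map_smul, map_smul, h1], by rw [map_smul, map_smul, h2]⟩

section Pages

variable {Δr : ∀ r : ℕ, TotalPage M.spectralSequence r →ₗ[k]
    TotalPage M.spectralSequence r ⊗[k] TotalPage M.spectralSequence r}
  {εr : ∀ r : ℕ, TotalPage M.spectralSequence r →ₗ[k] k}
  (hΔr : ∀ r : ℕ, ∃ e h, IsApprox M (r : ℤ) e h ∧ ∀ x (z : M.almostCycles r x),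
      Δr r (M.cls r x z) = leadTensor M wt deg r x.1 (tmap e e (Δ z)))
  (hεr : ∀ (r : ℕ) x (z : M.almostCycles r x), εr r (M.cls r x z) = if x = 0 then ε z else 0)

include hΔr

lemma comul_totalPageD (r : ℕ) (c : TotalPage M.spectralSequence r) :
    Δr r (totalPageD M.spectralSequence r c) = tensorD (totalPageD M.spectralSequence r)
      (totalPageSgn M.spectralSequence r) (Δr r c) := by
  obtain ⟨e, h, he, hr⟩ := hΔr r
  suffices H : Δr r ∘ₗ totalPageD M.spectralSequence r = tensorD (totalPageD M.spectralSequence r)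
      (totalPageSgn M.spectralSequence r) ∘ₗ Δr r from lcongr_fun H c
  refine M.total_ext r fun x z => ?_
  rw [lcomp_apply, lcomp_apply, M.totalPageD_cls r rfl, hr, hr, hM.comul_d,
    hM.leadTensor_map_e_tensorD he (hM.comul_mem _ _ z.2.1)]
  simp; omega

lemma inducedOnHomology_comul (r : ℕ) :
    InducedOnHomology (totalPageD M.spectralSequence r) (totalPageSgn M.spectralSequence r)
      (totalPageCyclesIncl M.spectralSequence r) (totalPageClass M.spectralSequence r)
      (Δr r) (Δr (r + 1)) := by
  obtain ⟨e, h, he, hr⟩ := hΔr r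
  obtain ⟨e', h', he', hr'⟩ := hΔr (r + 1)
  intro z
  induction z using M.cycles_induction r with
  | h x z =>
    have hΔz := hM.comul_mem x _ z.2.1
    have ht := map_e_mem he' hΔz
    have ht' := tens_mono (M.almostCycles_succ_le' r) x ht
    obtain ⟨u, hu1, hu2⟩ := hM.exists_cycles_leadTensor r ht
    rw [totalPageCyclesIncl_toCycles, totalPageClass_toCycles, hr, hr', ← hu2]
    have hH := hM.map_h_mem he' rfl hΔz
    refine ⟨u, leadTensor M wt deg r (x + (((r + 1 : ℕ) : ℤ) - 1, 2 - ((r + 1 : ℕ) : ℤ))).1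
      (tmap e e (tmap sgn h' (Δ z) + tmap h' e' (Δ z))),
      ?_, rfl⟩
    rw [hu1]
    nth_rewrite 1 [hM.homotopy_map_e he' (Δ z)]
    rw [map_add, map_add, map_add, map_add, hM.leadTensor_map_e he ht',
      hM.leadTensor_map_e_tensorD he hH (by simp), ← hM.comul_d]
    have hd := (M.d_mem_almostCycles ((r + 1 : ℕ) : ℤ) rfl z.2).1
    rw [hM.leadTensor_map_e_eq_zero he (hM.map_h_mem he' rfl (hM.comul_mem _ _ hd))
      (by simp; omega), add_zero]
  | h0 => exact ⟨0, 0, by simp, by simp⟩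
  | hadd a b ha hb =>
    obtain ⟨t, w, h1, h2⟩ := ha
    obtain ⟨t', w', h1', h2'⟩ := hb
    refine ⟨t + t', w + w', ?_, ?_⟩
    · rw [map_add, map_add, map_add, map_add, h1, h1']; abel
    · rw [map_add, map_add, map_add, h2, h2']

lemma comul_zero_cls (x : ℤ × ℤ) (z : M.almostCycles (0 : ℕ) x) :
    Δr 0 (M.cls 0 x z) = leadTensor M wt deg 0 x.1 (Δ z) := by
  obtain ⟨e, h, he, hr⟩ := hΔr 0
  rw [hr, hM.leadTensor_map_e he]
  refine tens_mono (fun a => ?_) x (hM.comul_mem x _ z.2.1)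
  intro c hc
  refine ⟨hc, ?_⟩
  change M.d c ∈ M.fil _; rw [Nat.cast_zero, sub_zero]; exact M.d_mem_fil _ _ hc.1

omit hΔr in
lemma tensor_tmul_zero {a y : ℤ × ℤ} {p : ℤ}
    (hp : a.1 + y.1 = p) (z : M.almostCycles (0 : ℕ) a) {t : (ι →₀ k) ⊗[k] (ι →₀ k)}
    (ht : t ∈ tens M.filGr y) :
    (∑ i ∈ Icc 0 p, tmap (leadAt M wt deg 0 i) (leadTensor M wt deg 0 (p - i)))
      ((z : ι →₀ k) ⊗ₜ t) = M.cls 0 a z ⊗ₜ leadTensor M wt deg 0 y.1 t := by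
  by_cases ha : a.1 < 0
  · have h0 : z = 0 := Subtype.ext (by
      have := z.2.1.1; rw [hM.fil_eq_bot ha] at this; simpa using this)
    simp [h0]
  simp only [LinearMap.sum_apply, map_tmul]; rw [sum_eq_single a.1]
  · rw [hM.leadAt_cls, show p - a.1 = y.1 by lia]
  · intro a' _ ha'
    by_cases h : a.1 < a'
    · rw [hM.leadAt_eq_zero 0 h z.2.1, zero_tmul]
    · rw [hM.leadTensor_eq_zero 0 (x := y) (by lia) ht, tmul_zero]
  · intro h
    have h0 : leadTensor M wt deg 0 (p - a.1) = 0 := by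
      rw [leadTensor, Finset.Icc_eq_empty (fun h' => h (mem_Icc.2 ⟨by lia, by lia⟩)), sum_empty]
    rw [h0, lzero_apply, tmul_zero]

omit hM hΔr in
lemma mem_almostCycles_zero {x : ℤ × ℤ} {c : ι →₀ k} (hc : c ∈ M.filGr x) :
    c ∈ M.almostCycles (0 : ℕ) x := by
  refine ⟨hc, ?_⟩
  change M.d c ∈ M.fil _; rw [Nat.cast_zero, sub_zero]; exact M.d_mem_fil _ _ hc.1

lemma comul_coassoc_zero (y : TotalPage M.spectralSequence 0) :
    assoc k _ _ _ ((Δr 0).rTensor _ (Δr 0 y)) = (Δr 0).lTensor _ (Δr 0 y) := by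
  have h0 := hM.comul_zero_cls hΔr
  let T : ℤ → (ι →₀ k) ⊗[k] ((ι →₀ k) ⊗[k] (ι →₀ k)) →ₗ[k] _ := fun p =>
    ∑ i ∈ Icc 0 p, tmap (leadAt M wt deg 0 i) (leadTensor M wt deg 0 (p - i))
  have hL : ∀ x, ∀ t ∈ tens M.filGr x,
      assoc k _ _ _ ((Δr 0).rTensor _ (leadTensor M wt deg 0 x.1 t)) =
        T x.1 (assoc k _ _ _ (Δ.rTensor _ t)) := by
    intro x
    refine eq_on_tens ((assoc k _ _ _).toLinearMap ∘ₗ (Δr 0).rTensor _ ∘ₗ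
      leadTensor M wt deg 0 x.1) (T x.1 ∘ₗ (assoc k _ _ _).toLinearMap ∘ₗ
        Δ.rTensor _) fun a b c c' hab hc hc' => ?_
    have hp : a.1 + b.1 = x.1 := by rw [← hab]; rfl
    have h1 := hM.leadTensor_tmul 0 hp ⟨c, mem_almostCycles_zero hc⟩ ⟨c', mem_almostCycles_zero hc'⟩
    simp only [lcomp_apply, coe_coe, rTensor_tmul]; simp only at h1; rw [h1, rTensor_tmul, h0]
    refine eq_on_tens ((assoc k _ _ _).toLinearMap ∘ₗ
      (TensorProduct.mk k _ _).flip (M.cls 0 b ⟨c', _⟩) ∘ₗ leadTensor M wt deg 0 a.1)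
      (T x.1 ∘ₗ (assoc k _ _ _).toLinearMap ∘ₗ (TensorProduct.mk k _ _).flip c')
      (fun a1 a2 d d' had hd hd' => ?_) _ (hM.comul_mem a c hc)
    have hp1 : a1.1 + a2.1 = a.1 := by rw [← had]; rfl
    have h2 := hM.leadTensor_tmul 0 hp1 ⟨d, mem_almostCycles_zero hd⟩
      ⟨d', mem_almostCycles_zero hd'⟩
    have h3 := tensor_tmul_zero hM (a := a1) (y := a2 + b) (p := x.1)
      (by rw [← hp, ← hp1]; simp; omega) ⟨d, mem_almostCycles_zero hd⟩
      (tmul_mem_tens rfl hd' hc')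
    have h4 := hM.leadTensor_tmul 0 (p := (a2 + b).1) rfl ⟨d', mem_almostCycles_zero hd'⟩
      ⟨c', mem_almostCycles_zero hc'⟩
    simp only at h2 h4
    simp only [lcomp_apply, coe_coe, LinearMap.flip_apply, mk_apply, assoc_tmul, h2]; rw [h4] at h3
    exact h3.symm
  have hR : ∀ x, ∀ t ∈ tens M.filGr x, (Δr 0).lTensor _ (leadTensor M wt deg 0 x.1 t) =
        T x.1 (Δ.lTensor _ t) := by
    intro x
    refine eq_on_tens ((Δr 0).lTensor _ ∘ₗ leadTensor M wt deg 0 x.1) (T x.1 ∘ₗ Δ.lTensor _)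
      fun a b c c' hab hc hc' => ?_
    have hp : a.1 + b.1 = x.1 := by rw [← hab]; rfl
    have h1 := hM.leadTensor_tmul 0 hp ⟨c, mem_almostCycles_zero hc⟩ ⟨c', mem_almostCycles_zero hc'⟩
    simp only [lcomp_apply, lTensor_tmul]; simp only at h1; rw [h1, lTensor_tmul, h0]
    exact (tensor_tmul_zero hM hp ⟨c, mem_almostCycles_zero hc⟩ (hM.comul_mem b c' hc')).symm
  suffices H : (assoc k _ _ _).toLinearMap ∘ₗ (Δr 0).rTensor _ ∘ₗ Δr 0 =
      (Δr 0).lTensor _ ∘ₗ Δr 0 from lcongr_fun H y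
  refine M.total_ext 0 fun x z => ?_
  simp only [lcomp_apply, coe_coe]
  have hz := hM.comul_mem x _ z.2.1
  rw [h0, hL _ _ hz, hR _ _ hz, hM.coassoc]

include hεr

lemma comul_rTensor_counit_zero (y : TotalPage M.spectralSequence 0) :
    (εr 0).rTensor _ (Δr 0 y) = 1 ⊗ₜ y := by
  have h0 := hM.comul_zero_cls hΔr
  have hL : ∀ x, ∀ t ∈ tens M.filGr x, (εr 0).rTensor _ (leadTensor M wt deg 0 x.1 t) =
      (leadAt M wt deg 0 x.1).lTensor k (ε.rTensor _ t) := by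
    intro x
    refine eq_on_tens ((εr 0).rTensor _ ∘ₗ leadTensor M wt deg 0 x.1)
      ((leadAt M wt deg 0 x.1).lTensor k ∘ₗ ε.rTensor _) fun a b c c' hab hc hc' => ?_
    have hp : a.1 + b.1 = x.1 := by rw [← hab]; rfl
    have h1 := hM.leadTensor_tmul 0 hp ⟨c, mem_almostCycles_zero hc⟩ ⟨c', mem_almostCycles_zero hc'⟩
    simp only [lcomp_apply, rTensor_tmul, lTensor_tmul]; simp only at h1; rw [h1, rTensor_tmul, hεr]
    split_ifs with ha
    · subst ha; rw [zero_add] at hab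
      subst hab; congr 1; exact (hM.leadAt_cls 0 ⟨c', mem_almostCycles_zero hc'⟩).symm
    · rw [zero_tmul]
      by_cases hd : a.1 + a.2 = 0
      · rcases lt_trichotomy a.1 0 with h | h | h
        · have hc0 := hc.1
          rw [hM.fil_eq_bot h] at hc0; rw [show c = 0 by simpa using hc0, map_zero, zero_tmul]
        · exact absurd (Prod.ext h (by simp; omega)) ha
        · rw [hM.leadAt_eq_zero 0 (by omega) hc', tmul_zero]
      · rw [hM.counit_eq_zero _ hd c hc.2, zero_tmul]
  suffices H : (εr 0).rTensor _ ∘ₗ Δr 0 = TensorProduct.mk k _ _ 1 from lcongr_fun H y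
  refine M.total_ext 0 fun x z => ?_
  rw [lcomp_apply, h0, hL _ _ (hM.comul_mem x _ z.2.1), hM.rTensor_counit,
    lTensor_tmul, hM.leadAt_cls]
  rfl

lemma comul_lTensor_counit_zero (y : TotalPage M.spectralSequence 0) :
    (εr 0).lTensor _ (Δr 0 y) = y ⊗ₜ 1 := by
  have h0 := hM.comul_zero_cls hΔr
  have hL : ∀ x, ∀ t ∈ tens M.filGr x, (εr 0).lTensor _ (leadTensor M wt deg 0 x.1 t) =
      (leadAt M wt deg 0 x.1).rTensor k (ε.lTensor _ t) := by
    intro x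
    refine eq_on_tens ((εr 0).lTensor _ ∘ₗ leadTensor M wt deg 0 x.1)
      ((leadAt M wt deg 0 x.1).rTensor k ∘ₗ ε.lTensor _) fun a b c c' hab hc hc' => ?_
    have hp : a.1 + b.1 = x.1 := by rw [← hab]; rfl
    have h1 := hM.leadTensor_tmul 0 hp ⟨c, mem_almostCycles_zero hc⟩ ⟨c', mem_almostCycles_zero hc'⟩
    simp only [lcomp_apply, rTensor_tmul, lTensor_tmul]; simp only at h1; rw [h1, lTensor_tmul, hεr]
    split_ifs with hb
    · subst hb; rw [add_zero] at hab
      subst hab; congr 1; exact (hM.leadAt_cls 0 ⟨c, mem_almostCycles_zero hc⟩).symm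
    · rw [tmul_zero]
      by_cases hd : b.1 + b.2 = 0
      · rcases lt_trichotomy b.1 0 with h | h | h
        · have hc0 := hc'.1
          rw [hM.fil_eq_bot h] at hc0; rw [show c' = 0 by simpa using hc0, map_zero, tmul_zero]
        · exact absurd (Prod.ext h (by simp; omega)) hb
        · rw [hM.leadAt_eq_zero 0 (by omega) hc, zero_tmul]
      · rw [hM.counit_eq_zero _ hd c' hc'.2, tmul_zero]
  suffices H : (εr 0).lTensor _ ∘ₗ Δr 0 = (TensorProduct.mk k _ _).flip 1 from
    lcongr_fun H y
  refine M.total_ext 0 fun x z => ?_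
  rw [lcomp_apply, h0, hL _ _ (hM.comul_mem x _ z.2.1), hM.lTensor_counit,
    rTensor_tmul, hM.leadAt_cls]
  rfl

omit hΔr in
lemma counit_totalPageD (r : ℕ) (c : TotalPage M.spectralSequence r) :
    εr r (totalPageD M.spectralSequence r c) = 0 := by
  suffices H : εr r ∘ₗ totalPageD M.spectralSequence r = 0 from lcongr_fun H c
  refine M.total_ext r fun x z => ?_
  rw [lcomp_apply, M.totalPageD_cls r rfl, hεr]; simp [hM.counit_d]

omit hΔr hM in
lemma counit_totalPageClass (r : ℕ) (z : TotalPageCycles M.spectralSequence r) :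
    εr (r + 1) (totalPageClass M.spectralSequence r z) =
      εr r (totalPageCyclesIncl M.spectralSequence r z) := by
  induction z using M.cycles_induction r with
  | h x z => rw [totalPageClass_toCycles, totalPageCyclesIncl_toCycles, hεr, hεr]
  | h0 => simp
  | hadd a b ha hb => rw [map_add, map_add, map_add, map_add, ha, hb]

lemma comul_laws (r : ℕ) :
    (∀ y, assoc k _ _ _ ((Δr r).rTensor _ (Δr r y)) = (Δr r).lTensor _ (Δr r y)) ∧
    (∀ y, (εr r).rTensor _ (Δr r y) = 1 ⊗ₜ y) ∧ ∀ y, (εr r).lTensor _ (Δr r y) = y ⊗ₜ 1 := by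
  induction r with
  | zero => exact ⟨hM.comul_coassoc_zero hΔr, hM.comul_rTensor_counit_zero hΔr hεr,
      hM.comul_lTensor_counit_zero hΔr hεr⟩
  | succ r ih =>
    obtain ⟨f, hf1, hf2⟩ := M.exists_page_retraction r
    have hi := hM.inducedOnHomology_comul hΔr r
    have hs := M.totalPageClass_surjective r
    exact ⟨hi.coassoc hs hf1 hf2 (hM.comul_totalPageD hΔr r) ih.1,
      hi.rTensor_counit hs hf1 hf2 (hM.counit_totalPageD hεr r)
        (counit_totalPageClass hεr r) ih.2.1,
      hi.lTensor_counit hs hf1 hf2 (hM.counit_totalPageD hεr r)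
        (counit_totalPageClass hεr r) ih.2.2⟩

end Pages

theorem exists_coalgebraStructure : ∃ S : CoalgebraStructure M.spectralSequence,
    (∀ x (z : M.almostCycles (0 : ℕ) x),
      (S.coalgebra 0).comul (M.cls 0 x z) = leadTensor M wt deg 0 x.1 (Δ z)) ∧
    ∀ (r : ℕ) x (z : M.almostCycles r x),
      (S.coalgebra r).counit (M.cls r x z) = if x = 0 then ε z else 0 := by
  choose Δr hΔr using hM.exists_comul
  choose εr hεr using hM.exists_counit
  refine ⟨{
    coalgebra r :=
      { comul := Δr r
        counit := εr r
        coassoc := lin_ext (hM.comul_laws hΔr hεr r).1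
        rTensor_counit_comp_comul := lin_ext (hM.comul_laws hΔr hεr r).2.1
        lTensor_counit_comp_comul := lin_ext (hM.comul_laws hΔr hεr r).2.2 }
    comul_mem r x c := ?_
    counit_eq_zero r x c hx := ?_
    coLeibniz := hM.comul_totalPageD hΔr
    counit_d := hM.counit_totalPageD hεr
    comul_succ := hM.inducedOnHomology_comul hΔr
    counit_succ := counit_totalPageClass hεr }, hM.comul_zero_cls hΔr, hεr⟩
  · obtain ⟨z, rfl⟩ := mkQ_surjective _ (show M.Page r x from c)
    obtain ⟨e, h, he, hr⟩ := hΔr r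
    have := hM.leadTensor_mem r (map_e_mem he (hM.comul_mem x _ z.2.1))
    rw [← hr] at this; exact this
  · obtain ⟨z, rfl⟩ := mkQ_surjective _ (show M.Page r x from c)
    exact (hεr r x z).trans (if_neg hx)

end IsWeightedCoalgebra

end

end FilteredDGModule

/-! ### The weight of a singular simplex -/

section Weight

variable {B : Type u} [TopologicalSpace B]

lemma Sing.pull_id {n : ℕ} (V : Sing n B) : V.pull id = V := by ext x; simp [Sing.pull]

lemma Sing.factorsThrough_self {n : ℕ} (V : Sing n B) : V.FactorsThrough n :=
  ⟨OrderHom.id, Function.surjective_id, V, V.pull_id.symm⟩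

def Sing.weight {n : ℕ} (V : Sing n B) : ℕ := sInf {m | V.FactorsThrough m}

lemma Sing.factorsThrough_weight {n : ℕ} (V : Sing n B) : V.FactorsThrough V.weight :=
  Nat.sInf_mem (s := {m | V.FactorsThrough m}) ⟨n, V.factorsThrough_self⟩

lemma Sing.FactorsThrough.weight_le {n m : ℕ} {V : Sing n B} (h : V.FactorsThrough m) :
    V.weight ≤ m := Nat.sInf_le h

lemma Sing.FactorsThrough.le {n m : ℕ} {V : Sing n B} (h : V.FactorsThrough m) : m ≤ n := by
  obtain ⟨s, hs, -⟩ := h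
  simpa using Fintype.card_le_of_surjective s hs

lemma Sing.isDegenerate_iff {n : ℕ} (V : Sing n B) : V.IsDegenerate ↔ V.weight < n :=
  ⟨fun ⟨_, hm, h⟩ => h.weight_le.trans_lt hm, fun h => ⟨_, h, V.factorsThrough_weight⟩⟩

lemma Sing.not_isDegenerate_iff {n : ℕ} (V : Sing n B) : ¬ V.IsDegenerate ↔ V.weight = n := by
  rw [V.isDegenerate_iff]
  have := V.factorsThrough_weight.le
  omega

lemma Sing.FactorsThrough.front {n m : ℕ} {V : Sing n B} {s : Fin (n + 1) →o Fin (m + 1)}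
    (hs : Surjective s) {V' : Sing m B} (h : V = V'.pull s) (j : ℕ) (hj : j ≤ n) :
    (V.front j hj).FactorsThrough (s ⟨j, by omega⟩) := by
  subst h
  refine ⟨⟨fun a => ⟨s ⟨a, by omega⟩, Nat.lt_succ_of_le ?_⟩, ?_⟩, ?_,
    V'.pull fun a => ⟨a, by omega⟩, ?_⟩
  · exact s.monotone (Fin.mk_le_mk.2 (by omega))
  · exact fun a b hab => s.monotone (by simpa using hab)
  · intro b
    obtain ⟨a, ha⟩ := hs ⟨b, by omega⟩
    by_cases haj : (a : ℕ) ≤ j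
    · exact ⟨⟨a, by omega⟩, Fin.ext (congrArg Fin.val ha :)⟩
    · have h1 : s ⟨j, by omega⟩ ≤ s a := s.monotone (Fin.le_def.2 (by simp; omega))
      rw [ha, Fin.le_def] at h1
      refine ⟨⟨j, by omega⟩, Fin.ext ?_⟩
      change (s ⟨j, _⟩ : ℕ) = b; simp only at h1
      have := b.2
      omega
  · simp only [Sing.front, Sing.pull_pull]; rfl

lemma Sing.FactorsThrough.back {n m : ℕ} {V : Sing n B} {s : Fin (n + 1) →o Fin (m + 1)}
    (hs : Surjective s) {V' : Sing m B} (h : V = V'.pull s) (i j : ℕ) (hj : i + j = n) :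
    (V.back i j hj).FactorsThrough (m - s ⟨i, by omega⟩) := by
  subst h
  have hle : ∀ a : Fin (j + 1), s ⟨i, by omega⟩ ≤ s ⟨i + a, by omega⟩ := fun a =>
    s.monotone (Fin.mk_le_mk.2 (by omega))
  refine ⟨⟨fun a => ⟨s ⟨i + a, by omega⟩ - s ⟨i, by omega⟩, by omega⟩, ?_⟩, ?_,
    V'.pull fun a => ⟨s ⟨i, by omega⟩ + a, by omega⟩, ?_⟩
  · intro a b hab
    have : s ⟨i + a, by omega⟩ ≤ s ⟨i + b, by omega⟩ := s.monotone (by simpa using hab)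
    have := Fin.le_def.1 this
    simp only [Fin.mk_le_mk]; omega
  · intro b
    obtain ⟨a, ha⟩ := hs ⟨s ⟨i, by omega⟩ + b, by omega⟩
    by_cases hai : i ≤ (a : ℕ)
    · refine ⟨⟨a - i, by omega⟩, Fin.ext ?_⟩
      have h1 : s ⟨i + (a - i), by omega⟩ = s a := congrArg s (Fin.ext (by simp; omega))
      change (s ⟨i + (a - i), _⟩ : ℕ) - s ⟨i, _⟩ = b; rw [h1, ha, Nat.add_sub_cancel_left]
    · have h1 : s a ≤ s ⟨i, by omega⟩ := s.monotone (Fin.le_def.2 (by simp; omega))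
      rw [ha, Fin.le_def] at h1
      refine ⟨⟨0, by omega⟩, Fin.ext ?_⟩
      change (s ⟨i + 0, _⟩ : ℕ) - s ⟨i, _⟩ = b; simp only [add_zero] at h1 ⊢; omega
  · simp only [Sing.back, Sing.pull_pull]; congr 1
    funext a
    refine Fin.ext ?_
    have h1 := Fin.le_def.1 (hle a)
    change (s ⟨i + a, _⟩ : ℕ) = s ⟨i, _⟩ + (s ⟨i + a, _⟩ - s ⟨i, _⟩); omega

lemma Sing.weight_front_add_weight_back {n : ℕ} (V : Sing n B) (i j : ℕ) (h : i + j = n) :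
    (V.front i (by omega)).weight + (V.back i j h).weight ≤ V.weight := by
  obtain ⟨s, hs, V', hV⟩ := V.factorsThrough_weight
  have h1 := (Sing.FactorsThrough.front hs hV i (by omega)).weight_le
  have h2 := (Sing.FactorsThrough.back hs hV i j h).weight_le
  have := (s ⟨i, by omega⟩).2
  omega

lemma Sing.weight_pull_le {l n : ℕ} (V : Sing n B) (f : Fin (l + 1) →o Fin (n + 1)) :
    (V.pull f).weight ≤ V.weight := by
  obtain ⟨m', hm', h⟩ := V.factorsThrough_weight.pull f
  exact h.weight_le.trans hm'

end Weight

/-! ### The coalgebra of singular chains -/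

section Coalgebra

variable (k : Type v) [Field k] {X : Type u} [TopologicalSpace X]

lemma augmentation_auxFace {N : ℕ} (α : Sing N X) (m : ℕ) (g : ℕ → ℕ) :
    augmentation k X (auxFace k α m g) = if m = 0 then 1 else 0 := by
  simp [augmentation, auxFace, simplexChain]

lemma chains_ext {V : Type*} [AddCommMonoid V] [Module k V] {f g : Chains k X →ₗ[k] V}
    (h : ∀ (n : ℕ) (α : Sing n X), f (simplexChain k α) = g (simplexChain k α)) : f = g :=
  lhom_ext' fun s => ext_ring (h s.1 s.2)

lemma diagonal_coassoc (c : Chains k X) :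
    assoc k _ _ _ ((diagonal k X).rTensor _ (diagonal k X c)) =
      (diagonal k X).lTensor _ (diagonal k X c) := by
  suffices H : (assoc k (Chains k X) (Chains k X) (Chains k X)).toLinearMap ∘ₗ (diagonal k X).rTensor _ ∘ₗ
    diagonal k X = (diagonal k X).lTensor _ ∘ₗ diagonal k X from lcongr_fun H c
  refine chains_ext k (V := Chains k X ⊗[k] (Chains k X ⊗[k] Chains k X)) fun n α => ?_
  simp only [lcomp_apply, coe_coe, simplexChain_eq_auxFace, diagonal_auxFace,
    map_sum, rTensor_tmul, lTensor_tmul, sum_tmul,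
    tmul_sum, assoc_tmul]
  rw [Finset.sum_sigma', Finset.sum_sigma']
  refine Finset.sum_bij' (fun a _ => ⟨a.2, a.1 - a.2⟩) (fun a _ => ⟨a.1 + a.2, a.1⟩) ?_ ?_ ?_ ?_ ?_
  · rintro ⟨a, b⟩ h; simp at h ⊢; omega
  · rintro ⟨a, b⟩ h; simp at h ⊢; omega
  · rintro ⟨a, b⟩ h; simp at h ⊢; omega
  · rintro ⟨a, b⟩ h; simp
  · rintro ⟨a, b⟩ h; simp at h
    obtain ⟨c, rfl⟩ : ∃ c, a = b + c := ⟨a - b, by omega⟩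
    simp only [Nat.add_sub_cancel_left]; congr 2; rw [show n - b - c = n - (b + c) by omega]
    exact auxFace_congr α fun x _ => by simp [add_assoc]

lemma diagonal_rTensor_augmentation (c : Chains k X) :
    (augmentation k X).rTensor _ (diagonal k X c) = 1 ⊗ₜ c := by
  suffices H : (augmentation k X).rTensor _ ∘ₗ diagonal k X = TensorProduct.mk k _ _ 1 from
    lcongr_fun H c
  refine chains_ext k fun n α => ?_
  simp only [lcomp_apply, simplexChain_eq_auxFace, diagonal_auxFace, map_sum,
    rTensor_tmul, augmentation_auxFace]
  rw [sum_eq_single 0]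
  · simp; rfl
  · intro b _ hb; rw [if_neg hb, zero_tmul]
  · simp

lemma diagonal_lTensor_augmentation (c : Chains k X) :
    (augmentation k X).lTensor _ (diagonal k X c) = c ⊗ₜ 1 := by
  suffices H : (augmentation k X).lTensor _ ∘ₗ diagonal k X = (TensorProduct.mk k (Chains k X) k).flip 1 from
    lcongr_fun H c
  refine chains_ext k (V := Chains k X ⊗[k] k) fun n α => ?_
  simp only [lcomp_apply, simplexChain_eq_auxFace, diagonal_auxFace, map_sum,
    lTensor_tmul, augmentation_auxFace]
  rw [sum_eq_single n]
  · simp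
  · intro b hb hbn; rw [if_neg (by simp at hb; omega), tmul_zero]
  · simp

lemma chainSgn_of_mem (n : ℤ) (c : Chains k X) (hc : c ∈ chainsOfDegree k X n) :
    chainSgn k X c = ((Int.negOnePow n : ℤ) : k) • c := by
  refine eq_on_of_single (chainSgn k X) (((Int.negOnePow n : ℤ) : k) • idₗ) _ (fun s hs => ?_) c hc
  obtain rfl : (s.1 : ℤ) = n := hs
  refine (chainSgn_simplexChain s.2).trans ?_
  simp [Int.negOnePow_def, simplexChain]

lemma augmentation_of_mem (n : ℤ) (hn : n ≠ 0) (c : Chains k X) (hc : c ∈ chainsOfDegree k X n) :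
    augmentation k X c = 0 := by
  refine eq_on_of_single (augmentation k X) 0 _ (fun s hs => ?_) c hc
  obtain rfl : (s.1 : ℤ) = n := hs
  have : s.1 ≠ 0 := by simpa using hn
  simp [augmentation, this]

end Coalgebra

section SerreWeights

variable (k : Type v) [Field k] {E B : Type u} [TopologicalSpace E] [TopologicalSpace B]
  (π : C(E, B))

/-- The weight in the Serre filtration of a singular simplex of the total space. -/
def serreWeight (s : Σ n : ℕ, Sing n E) : ℤ := Sing.weight (π.comp s.2 : Sing s.1 B)

lemma mem_serreSimplices_iff (p : ℤ) (s : Σ n : ℕ, Sing n E) :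
    s ∈ serreSimplices π p ↔ serreWeight π s ≤ p := by
  constructor
  · rintro ⟨m, hm, h⟩
    have := h.weight_le
    unfold serreWeight; omega
  · exact fun h => ⟨_, h, Sing.factorsThrough_weight _⟩

lemma serre_hasWeights : (serreFiltration k π).HasWeights (serreWeight π) fun s => s.1 where
  fil_eq p := by
    change supported k k (serreSimplices π p) = _; congr 1
    ext s
    exact mem_serreSimplices_iff π p s
  gr_eq n := rfl
  wt_nonneg s := Int.natCast_nonneg _

lemma front_mem_filGr {n : ℕ} (α : Sing n E) (i j : ℕ) (h : i + j = n) :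
    simplexChain k (α.front i (by omega)) ∈ (serreFiltration k π).filGr
      (serreWeight π ⟨i, α.front i (by omega)⟩, i - serreWeight π ⟨i, α.front i (by omega)⟩) :=
  (serre_hasWeights k π).single_mem ⟨i, α.front i (by omega)⟩

lemma back_mem_filGr {p : ℤ} {n : ℕ} (α : Sing n E) (hα : serreWeight π ⟨n, α⟩ ≤ p) (i j : ℕ)
    (h : i + j = n) : simplexChain k (α.back i j h) ∈ (serreFiltration k π).filGr
      (p - serreWeight π ⟨i, α.front i (by omega)⟩,
        (n - p) - (i - serreWeight π ⟨i, α.front i (by omega)⟩)) := by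
  have h1 := (serre_hasWeights k π).single_mem ⟨j, α.back i j h⟩
  have h2 : (serreWeight π ⟨i, α.front i (by omega)⟩ + serreWeight π ⟨j, α.back i j h⟩ : ℤ) ≤ p :=
    le_trans (Int.ofNat_le.2 <| Sing.weight_front_add_weight_back (π.comp α : Sing n B) i j h) hα
  refine (serreFiltration k π).filGr_mono ?_ ?_ h1
  · simp; omega
  · simp; omega

lemma serre_isWeightedCoalgebra : (serreFiltration k π).IsWeightedCoalgebra
    (serreWeight π) (fun s => s.1) (chainSgn k E) (diagonal k E) (augmentation k E) where
  toHasWeights := serre_hasWeights k π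
  sgn_eq := chainSgn_of_mem k
  comul_mem x c hc := by
    rw [(serre_hasWeights k π).filGr_eq] at hc
    refine map_mem_of_single (V := Chains k E ⊗[k] Chains k E) (diagonal k E) _ _ (fun s hs => ?_) c hc
    obtain ⟨h1, h2⟩ := hs
    rw [show diagonal k E (single s 1) = ∑ j : Fin (s.1 + 1),
      simplexChain k (s.2.front j (by omega)) ⊗ₜ[k]
      simplexChain k (s.2.back j (s.1 - j) (by omega)) by simp [diagonal]]
    refine sum_mem fun j _ => tmul_mem_tens ?_ (front_mem_filGr k π s.2 j (s.1 - j) (by omega))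
      (back_mem_filGr k π s.2 h1 j (s.1 - j) (by omega))
    ext <;> simp <;> omega
  comul_d := diagonal_boundary
  coassoc := diagonal_coassoc k
  rTensor_counit := diagonal_rTensor_augmentation k
  lTensor_counit := diagonal_lTensor_augmentation k
  counit_d := augmentation_boundary k E
  counit_eq_zero := augmentation_of_mem k

lemma isInducedByDiagonal_of_comul (S : CoalgebraStructure (serreSpectralSequence k π))
    (h1 : ∀ x (z : (serreFiltration k π).almostCycles (0 : ℕ) x),
      (S.coalgebra 0).comul ((serreFiltration k π).cls 0 x z) =
        FilteredDGModule.leadTensor (serreFiltration k π) (serreWeight π) (fun s => s.1) 0 x.1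
          (diagonal k E z))
    (h2 : ∀ (r : ℕ) x (z : (serreFiltration k π).almostCycles r x),
      (S.coalgebra r).counit ((serreFiltration k π).cls r x z) =
        if x = 0 then augmentation k E z else 0) :
    IsInducedByDiagonal k π S := by
  have hM := serre_isWeightedCoalgebra k π
  refine ⟨fun p n α hα => ?_, fun α hα => ?_⟩
  · have hp : serreWeight π ⟨n, α⟩ ≤ p := by
      have := hα.1
      rw [hM.filGr_eq] at this
      exact ((Finsupp.mem_supported _ _).1 this (by simp [simplexChain])).1
    have hf : ∀ j : Fin (n + 1), simplexChain k (α.front j (by omega)) ∈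
        (serreFiltration k π).almostCycles (0 : ℕ) (serreWeight π ⟨j, α.front j (by omega)⟩,
          j - serreWeight π ⟨j, α.front j (by omega)⟩) := fun j =>
      FilteredDGModule.IsWeightedCoalgebra.mem_almostCycles_zero (front_mem_filGr k π α j (n - j) (by omega))
    have hb : ∀ j : Fin (n + 1), simplexChain k (α.back j (n - j) (by omega)) ∈
        (serreFiltration k π).almostCycles (0 : ℕ) (p - serreWeight π ⟨j, α.front j (by omega)⟩,
          (n - p) - (j - serreWeight π ⟨j, α.front j (by omega)⟩)) := fun j =>
      FilteredDGModule.IsWeightedCoalgebra.mem_almostCycles_zero (back_mem_filGr k π α hp j (n - j) (by omega))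
    refine ⟨_, hf, hb, (h1 _ ⟨_, hα⟩).trans ?_⟩
    have : diagonal k E (simplexChain k α) = ∑ j : Fin (n + 1),
      simplexChain k (α.front j (by omega)) ⊗ₜ[k]
      simplexChain k (α.back j (n - j) (by omega)) := by simp [diagonal, simplexChain]
    simp only [this, map_sum]
    refine sum_congr rfl fun j _ => ?_
    exact hM.leadTensor_tmul 0 (by simp) ⟨_, hf j⟩ ⟨_, hb j⟩
  · refine (h2 0 _ ⟨_, hα⟩).trans ?_
    rw [if_pos Prod.mk_zero_zero]; simp [augmentation, simplexChain]

end SerreWeights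

/-! ### Homotopy lifting for simplices -/

section Lifting

variable {E B : Type u} [TopologicalSpace E] [TopologicalSpace B] {π : C(E, B)}

def simplexToCube (n : ℕ) : C(stdSimplex ℝ (Fin (n + 1)), Fin (n + 1) → unitInterval) where
  toFun t i := ⟨t i, t.2.1 i, by
    rw [← t.2.2]
    exact Finset.single_le_sum (f := t.1) (fun i _ => t.2.1 i) (mem_univ i)⟩
  continuous_toFun := by
    refine continuous_pi fun i => Continuous.subtype_mk ?_ _
    exact (continuous_apply i).comp continuous_subtype_val

def cubeSum {n : ℕ} (z : Fin (n + 1) → unitInterval) : ℝ := max 1 (∑ i, (z i : ℝ))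

def cubeToSimplex (n : ℕ) : C(Fin (n + 1) → unitInterval, stdSimplex ℝ (Fin (n + 1))) where
  toFun z := ⟨fun i => ((z i : ℝ) + if i = 0 then cubeSum z - ∑ i, (z i : ℝ) else 0) / cubeSum z, by
    have h1 : (0 : ℝ) < cubeSum z := lt_of_lt_of_le one_pos (le_max_left _ _)
    have h2 : ∑ i, (z i : ℝ) ≤ cubeSum z := le_max_right _ _
    constructor
    · intro i
      refine div_nonneg (add_nonneg (z i).2.1 ?_) h1.le
      split_ifs
      · linarith
      · exact le_rfl
    · rw [← Finset.sum_div, sum_add_distrib, Finset.sum_ite_eq' univ]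
      simp [h1.ne']⟩
  continuous_toFun := by
    refine Continuous.subtype_mk (continuous_pi fun i => ?_) _
    have hz : ∀ i, Continuous fun z : Fin (n + 1) → unitInterval => (z i : ℝ) := fun i =>
      continuous_subtype_val.comp (continuous_apply i)
    have hs : Continuous fun z : Fin (n + 1) → unitInterval => ∑ i, (z i : ℝ) :=
      continuous_finsetSum _ fun i _ => hz i
    have hc : Continuous (cubeSum (n := n)) := continuous_const.max hs
    refine Continuous.div ?_ hc fun z => (lt_of_lt_of_le one_pos (le_max_left _ _)).ne'
    refine (hz i).add ?_
    split_ifs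
    · exact hc.sub hs
    · exact continuous_const

lemma cubeToSimplex_simplexToCube {n : ℕ} (t : stdSimplex ℝ (Fin (n + 1))) :
    cubeToSimplex n (simplexToCube n t) = t := by
  have h : ∑ i, ((simplexToCube n t i : unitInterval) : ℝ) = 1 := t.2.2
  refine Subtype.ext (funext fun i => ?_)
  change ((simplexToCube n t i : ℝ) + if i = 0 then cubeSum (simplexToCube n t) -
    ∑ i, ((simplexToCube n t i : unitInterval) : ℝ) else 0) / cubeSum (simplexToCube n t) = t i
  rw [cubeSum, h]; simp; rfl

lemma IsSerreFibration.lift_simplex (hπ : IsSerreFibration π) {n : ℕ}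
    (f : C(stdSimplex ℝ (Fin (n + 1)), E)) (h : C(stdSimplex ℝ (Fin (n + 1)) × unitInterval, B))
    (hf : ∀ x, h (x, 0) = π (f x)) :
    ∃ l : C(stdSimplex ℝ (Fin (n + 1)) × unitInterval, E),
      (∀ x, l (x, 0) = f x) ∧ ∀ y, π (l y) = h y := by
  obtain ⟨l, hl1, hl2⟩ := hπ (n + 1) (f.comp (cubeToSimplex n))
    (h.comp ((cubeToSimplex n).prodMap (ContinuousMap.id _))) fun x => hf _
  refine ⟨l.comp ((simplexToCube n).prodMap (ContinuousMap.id _)), fun x => ?_, fun y => ?_⟩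
  · change l (simplexToCube n x, 0) = _
    rw [hl1, ContinuousMap.comp_apply, cubeToSimplex_simplexToCube]
  · change π (l (simplexToCube n y.1, y.2)) = _; rw [hl2]
    change h (cubeToSimplex n (simplexToCube n y.1), y.2) = _; rw [cubeToSimplex_simplexToCube]

def minCoord {n : ℕ} (k : Fin (n + 2)) (t : stdSimplex ℝ (Fin (n + 2))) : ℝ :=
  univ.inf' Finset.univ_nonempty fun j : Fin (n + 1) => t (k.succAbove j)

lemma continuous_coord {n : ℕ} (j : Fin (n + 1)) :
    Continuous fun t : stdSimplex ℝ (Fin (n + 1)) => t j :=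
  (continuous_apply j).comp continuous_subtype_val

lemma continuous_minCoord {n : ℕ} (k : Fin (n + 2)) : Continuous (minCoord k) :=
  Continuous.finset_inf'_apply _ fun j _ => continuous_coord _

lemma minCoord_le {n : ℕ} (k : Fin (n + 2)) (t : stdSimplex ℝ (Fin (n + 2))) {j : Fin (n + 2)}
    (hj : j ≠ k) : minCoord k t ≤ t j := by
  obtain ⟨i, rfl⟩ := Fin.exists_succAbove_eq hj
  exact Finset.inf'_le _ (mem_univ i)

lemma exists_minCoord_eq {n : ℕ} (k : Fin (n + 2)) (t : stdSimplex ℝ (Fin (n + 2))) :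
    ∃ j ≠ k, minCoord k t = t j := by
  obtain ⟨i, -, hi⟩ := Finset.exists_mem_eq_inf' Finset.univ_nonempty
    fun j : Fin (n + 1) => t (k.succAbove j)
  exact ⟨_, Fin.succAbove_ne k i, hi⟩

lemma minCoord_nonneg {n : ℕ} (k : Fin (n + 2)) (t : stdSimplex ℝ (Fin (n + 2))) :
    0 ≤ minCoord k t := by
  obtain ⟨j, -, h⟩ := exists_minCoord_eq k t
  rw [h]; exact t.2.1 j

lemma minCoord_le_one {n : ℕ} (k : Fin (n + 2)) (t : stdSimplex ℝ (Fin (n + 2))) :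
    minCoord k t ≤ 1 := by
  obtain ⟨j, -, h⟩ := exists_minCoord_eq k t
  rw [h, ← t.2.2]; exact Finset.single_le_sum (f := t.1) (fun i _ => t.2.1 i) (mem_univ j)

def hornSet {n : ℕ} (k : Fin (n + 2)) : Set (stdSimplex ℝ (Fin (n + 2))) := {t | ∃ j ≠ k, t j = 0}

lemma minCoord_eq_zero_iff {n : ℕ} {k : Fin (n + 2)} {t : stdSimplex ℝ (Fin (n + 2))} :
    minCoord k t = 0 ↔ t ∈ hornSet k := by
  constructor
  · intro h
    obtain ⟨j, hj, h'⟩ := exists_minCoord_eq k t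
    exact ⟨j, hj, h'.symm.trans h⟩
  · rintro ⟨j, hj, h⟩; exact le_antisymm (h ▸ minCoord_le k t hj) (minCoord_nonneg k t)

def shiftCoord {n : ℕ} (k : Fin (n + 2)) (t : stdSimplex ℝ (Fin (n + 2))) (a : ℝ)
    (h1 : a ≤ minCoord k t) (h2 : 0 ≤ t k + (n + 1) * a) : stdSimplex ℝ (Fin (n + 2)) :=
  ⟨fun j => if j = k then t k + (n + 1) * a else t j - a, by
    intro j
    dsimp only
    split_ifs with hj
    · exact h2
    · have := minCoord_le k t hj
      linarith, by
    rw [Fin.sum_univ_succAbove _ k]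
    simp only [if_true, Fin.succAbove_ne, if_false, sum_sub_distrib]
    have : t k + ∑ i, t (k.succAbove i) = 1 := by
      rw [← Fin.sum_univ_succAbove (fun i => t i) k]; exact t.2.2
    simp
    linarith⟩

def hornProj {n : ℕ} (k : Fin (n + 2)) (t : stdSimplex ℝ (Fin (n + 2))) :
    stdSimplex ℝ (Fin (n + 2)) :=
  shiftCoord k t (minCoord k t) le_rfl
    (add_nonneg (t.2.1 k) (mul_nonneg (by positivity) (minCoord_nonneg k t)))

lemma continuous_hornProj {n : ℕ} (k : Fin (n + 2)) : Continuous (hornProj k) := by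
  refine Continuous.subtype_mk (continuous_pi fun j => ?_) _
  split_ifs
  · exact (continuous_coord k).add (continuous_const.mul (continuous_minCoord k))
  · exact (continuous_coord j).sub (continuous_minCoord k)

lemma hornProj_apply_self {n : ℕ} (k : Fin (n + 2)) (t : stdSimplex ℝ (Fin (n + 2))) :
    hornProj k t k = t k + (n + 1) * minCoord k t := if_pos rfl

lemma hornProj_apply_ne {n : ℕ} {k j : Fin (n + 2)} (hj : j ≠ k) (t : stdSimplex ℝ (Fin (n + 2))) :
    hornProj k t j = t j - minCoord k t := if_neg hj

lemma hornProj_mem {n : ℕ} (k : Fin (n + 2)) (t : stdSimplex ℝ (Fin (n + 2))) :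
    hornProj k t ∈ hornSet k := by
  obtain ⟨j, hj, h⟩ := exists_minCoord_eq k t
  exact ⟨j, hj, by rw [hornProj_apply_ne hj, h, sub_self]⟩

lemma minCoord_hornProj {n : ℕ} (k : Fin (n + 2)) (t : stdSimplex ℝ (Fin (n + 2))) :
    minCoord k (hornProj k t) = 0 := minCoord_eq_zero_iff.2 (hornProj_mem k t)

lemma hornProj_eq_self {n : ℕ} {k : Fin (n + 2)} {t : stdSimplex ℝ (Fin (n + 2))}
    (ht : t ∈ hornSet k) : hornProj k t = t := by
  have h0 := minCoord_eq_zero_iff.2 ht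
  refine Subtype.ext (funext fun j => ?_)
  change hornProj k t j = t j
  by_cases hj : j = k
  · subst hj; rw [hornProj_apply_self, h0]; simp
  · rw [hornProj_apply_ne hj, h0, sub_zero]

def hornRetract {n : ℕ} (k : Fin (n + 2)) :
    C(stdSimplex ℝ (Fin (n + 2)) × unitInterval, stdSimplex ℝ (Fin (n + 2))) where
  toFun y := shiftCoord k (hornProj k y.1) (- min (y.2 : ℝ) (hornProj k y.1 k / (n + 1))) (by
      rw [minCoord_hornProj]
      have : 0 ≤ hornProj k y.1 k / (n + 1) := div_nonneg ((hornProj k y.1).2.1 k) (by positivity)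
      have := le_min y.2.2.1 this
      linarith) (by
      have h1 : (0 : ℝ) < n + 1 := by positivity
      have h2 := min_le_right (y.2 : ℝ) (hornProj k y.1 k / (n + 1))
      rw [le_div_iff₀ h1] at h2
      linarith)
  continuous_toFun := by
    refine Continuous.subtype_mk (continuous_pi fun j => ?_) _
    have h1 := (continuous_coord k).comp (continuous_hornProj k)
    have h2 := (continuous_coord j).comp (continuous_hornProj k)
    simp only [Function.comp_def] at h1 h2
    split_ifs <;> fun_prop

lemma hornRetract_zero {n : ℕ} (k : Fin (n + 2)) (t : stdSimplex ℝ (Fin (n + 2))) :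
    hornRetract k (t, 0) = hornProj k t := by
  have h : min (((0 : unitInterval) : ℝ)) (hornProj k t k / (n + 1)) = 0 :=
    min_eq_left (div_nonneg ((hornProj k t).2.1 k) (by positivity))
  refine Subtype.ext (funext fun j => ?_)
  change (if j = k then hornProj k t k + (n + 1) * (- min ((0 : unitInterval) : ℝ) _) else
    hornProj k t j - (- min ((0 : unitInterval) : ℝ) _)) = hornProj k t j
  rw [h]
  split_ifs with hj
  · subst hj; simp
  · simp

lemma hornRetract_minCoord {n : ℕ} (k : Fin (n + 2)) (t : stdSimplex ℝ (Fin (n + 2))) :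
    hornRetract k (t, ⟨minCoord k t, minCoord_nonneg k t, minCoord_le_one k t⟩) = t := by
  have h : min (minCoord k t) (hornProj k t k / (n + 1)) = minCoord k t := by
    refine min_eq_left ?_
    rw [le_div_iff₀ (by positivity), hornProj_apply_self]
    have : 0 ≤ t k := t.2.1 k
    linarith
  refine Subtype.ext (funext fun j => ?_)
  change (if j = k then hornProj k t k + (n + 1) * (- min (minCoord k t) _) else
    hornProj k t j - (- min (minCoord k t) _)) = t j
  rw [h]
  split_ifs with hj
  · subst hj; rw [hornProj_apply_self]; ring
  · rw [hornProj_apply_ne hj]; ring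

lemma IsSerreFibration.lift_horn (hπ : IsSerreFibration π) {n : ℕ} (k : Fin (n + 2))
    (σ : Sing (n + 1) B) (F : stdSimplex ℝ (Fin (n + 2)) → E) (hF : ContinuousOn F (hornSet k))
    (hσ : ∀ t ∈ hornSet k, π (F t) = σ t) :
    ∃ l : Sing (n + 1) E, π.comp l = σ ∧ ∀ t ∈ hornSet k, l t = F t := by
  obtain ⟨l, hl1, hl2⟩ := hπ.lift_simplex
    ⟨fun t => F (hornProj k t), hF.comp_continuous (continuous_hornProj k) (hornProj_mem k)⟩
    (σ.comp (hornRetract k)) fun t => by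
      rw [ContinuousMap.comp_apply, hornRetract_zero]; exact (hσ _ (hornProj_mem k t)).symm
  refine ⟨l.comp ⟨fun t => (t, ⟨minCoord k t, minCoord_nonneg k t, minCoord_le_one k t⟩), ?_⟩,
    ?_, fun t ht => ?_⟩
  · exact continuous_id.prodMk ((continuous_minCoord k).subtype_mk _)
  · ext t
    refine (hl2 _).trans ?_
    exact congrArg σ (hornRetract_minCoord k t)
  · have h0 : (⟨minCoord k t, minCoord_nonneg k t, minCoord_le_one k t⟩ : unitInterval) = 0 :=
      Subtype.ext (minCoord_eq_zero_iff.2 ht)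
    change l (t, ⟨minCoord k t, _⟩) = _; rw [h0, hl1]; change F (hornProj k t) = _
    rw [hornProj_eq_self ht]

end Lifting

section

open Simplicial MonoidalCategory Opposite

/-! ### Singular simplicial sets and Kan fibrations -/

section SingularSimplicialSet

def SS (X : Type u) [TopologicalSpace X] : SSet.{u} where
  obj n := Sing n.unop.len X
  map f := ↾fun α => Sing.pull α f.unop.toOrderHom
  map_id n := by
    ext α x
    exact DFunLike.congr_fun (Sing.pull_id α) x
  map_comp f g := by
    ext α x
    exact (DFunLike.congr_fun (Sing.pull_pull α f.unop.toOrderHom g.unop.toOrderHom) x).symm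

def SS.map {X Y : Type u} [TopologicalSpace X] [TopologicalSpace Y] (f : C(X, Y)) :
    SS X ⟶ SS Y where
  app n := ↾fun α : Sing n.unop.len X => (f.comp α : Sing n.unop.len Y)
  naturality := by intros; rfl

def spull {X : SSet.{u}} {m n : ℕ} (x : X _⦋n⦌) (f : Fin (m + 1) →o Fin (n + 1)) : X _⦋m⦌ :=
  X.map (mkHom f).op x

lemma spull_spull {X : SSet.{u}} {l m n : ℕ} (x : X _⦋n⦌) (f : Fin (m + 1) →o Fin (n + 1))
    (g : Fin (l + 1) →o Fin (m + 1)) : spull (spull x f) g = spull x (f.comp g) :=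
  (ConcreteCategory.congr_hom (X.map_comp (mkHom f).op (mkHom g).op) x).symm

lemma spull_id {X : SSet.{u}} {n : ℕ} (x : X _⦋n⦌) : spull x OrderHom.id = x :=
  ConcreteCategory.congr_hom (X.map_id (op ⦋n⦌)) x

lemma app_spull {X Y : SSet.{u}} (F : X ⟶ Y) {m n : ℕ} (x : X _⦋n⦌)
    (f : Fin (m + 1) →o Fin (n + 1)) : F.app _ (spull x f) = spull (F.app _ x) f :=
  ConcreteCategory.congr_hom (F.naturality (mkHom f).op) x

def retractOnto {n : ℕ} (S : Finset (Fin (n + 1))) (hS : S.Nonempty) :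
    Fin (n + 1) →o Fin (n + 1) where
  toFun x := if h : (S.filter (· ≤ x)).Nonempty then (S.filter (· ≤ x)).max' h else S.min' hS
  monotone' := by
    intro x y hxy
    dsimp only
    split_ifs with h1 h2 h2
    · exact Finset.max'_subset h1 (Finset.monotone_filter_right _ fun _ _ h => h.trans hxy)
    · exact absurd (h1.mono (Finset.monotone_filter_right _ fun _ _ h => h.trans hxy)) h2
    · exact Finset.min'_le _ _ (mem_filter.1 (Finset.max'_mem _ h2)).1
    · exact le_rfl

lemma retractOnto_mem {n : ℕ} (S : Finset (Fin (n + 1))) (hS : S.Nonempty) (x : Fin (n + 1)) :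
    retractOnto S hS x ∈ S := by
  change (if h : _ then _ else _) ∈ S
  split_ifs with h
  · exact (mem_filter.1 (Finset.max'_mem _ h)).1
  · exact Finset.min'_mem _ _

lemma retractOnto_eq_self {n : ℕ} {S : Finset (Fin (n + 1))} (hS : S.Nonempty) {x : Fin (n + 1)}
    (hx : x ∈ S) : retractOnto S hS x = x := by
  have h : (S.filter (· ≤ x)).Nonempty := ⟨x, mem_filter.2 ⟨hx, le_rfl⟩⟩
  refine (dif_pos h).trans (le_antisymm ?_ ?_)
  · exact (mem_filter.1 (Finset.max'_mem _ h)).2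
  · exact Finset.le_max' (S.filter (· ≤ x)) x (mem_filter.2 ⟨hx, le_rfl⟩)

lemma stdSimplex_map_apply {m n : ℕ} (t : stdSimplex ℝ (Fin (m + 1)))
    (f : Fin (m + 1) → Fin (n + 1)) (j : Fin (n + 1)) :
    stdSimplex.map f t j = ∑ i with f i = j, t i := by
  rw [stdSimplex.map_coe, FunOnFinite.linearMap_apply_apply]

lemma stdSimplex_map_eq_self {n : ℕ} (t : stdSimplex ℝ (Fin (n + 1)))
    (f : Fin (n + 1) → Fin (n + 1)) (hf : ∀ i, t i ≠ 0 → f i = i) : stdSimplex.map f t = t := by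
  refine Subtype.ext (funext fun j => ?_)
  change (stdSimplex.map f t) j = t j; rw [stdSimplex_map_apply, Finset.sum_filter]
  rw [sum_eq_single j]
  · split_ifs with h
    · rfl
    · exact (not_not.1 (mt (hf j) h)).symm
  · intro i _ hij
    split_ifs with h
    · by_contra h0
      exact hij ((hf i h0).symm.trans h)
    · rfl
  · simp

lemma stdSimplex_map_apply_eq_zero {m n : ℕ} (t : stdSimplex ℝ (Fin (m + 1)))
    (f : Fin (m + 1) → Fin (n + 1)) {j : Fin (n + 1)} (hj : ∀ i, f i ≠ j) :
    stdSimplex.map f t j = 0 := by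
  rw [stdSimplex_map_apply, Finset.filter_false_of_mem fun i _ => hj i, sum_empty]

def hornMk {n m : ℕ} {k : Fin (n + 2)} (f : Fin (m + 1) →o Fin (n + 2))
    (h : ∃ j ≠ k, ∀ i, f i ≠ j) : (Λ[n + 1, k] : SSet.{u}) _⦋m⦌ :=
  ⟨SSet.stdSimplex.objMk f, (SSet.mem_horn_iff_notMem_range _ _).2 <| by
    obtain ⟨j, hj, h⟩ := h
    exact ⟨j, hj, fun ⟨i, hi⟩ => h i hi⟩⟩

section Horn

variable {X : Type u} [TopologicalSpace X] {n : ℕ} {k : Fin (n + 2)} (g : (Λ[n + 1, k] : SSet.{u}) ⟶ SS X)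

/-- The value of a map from a horn to a singular simplicial set on a simplex of the horn. -/
def hornValue {m : ℕ} (f : Fin (m + 1) →o Fin (n + 2)) (h : ∃ j ≠ k, ∀ i, f i ≠ j) : Sing m X :=
  g.app (op ⦋m⦌) (hornMk f h)

lemma hornValue_congr {m : ℕ} {f f' : Fin (m + 1) →o Fin (n + 2)} (hf : f = f') (h h') :
    hornValue g f h = hornValue g f' h' := by
  subst hf; rfl

lemma hornValue_comp {m l : ℕ} (f : Fin (m + 1) →o Fin (n + 2)) (h : ∃ j ≠ k, ∀ i, f i ≠ j)
    (f' : Fin (l + 1) →o Fin (m + 1)) (h') :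
    hornValue g (f.comp f') h' = (hornValue g f h).pull f' :=
  app_spull g (hornMk f h) f'

def carrier {n : ℕ} (t : stdSimplex ℝ (Fin (n + 1))) : Finset (Fin (n + 1)) :=
  univ.filter fun i => t i ≠ 0

lemma carrier_nonempty {n : ℕ} (t : stdSimplex ℝ (Fin (n + 1))) : (carrier t).Nonempty := by
  by_contra h
  have h0 : ∑ i, t i = 0 := sum_eq_zero fun i _ => by
    by_contra hi
    exact h ⟨i, mem_filter.2 ⟨mem_univ i, hi⟩⟩
  exact one_ne_zero ((sum_eq_one t).symm.trans h0)

lemma retractOnto_carrier_ne {t : stdSimplex ℝ (Fin (n + 2))} (ht : t ∈ hornSet k) :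
    ∃ j ≠ k, ∀ i, retractOnto (carrier t) (carrier_nonempty t) i ≠ j := by
  obtain ⟨j, hj, h⟩ := ht
  refine ⟨j, hj, fun i hi => ?_⟩
  have := retractOnto_mem (carrier t) (carrier_nonempty t) i
  rw [hi] at this; exact (mem_filter.1 this).2 h

open Classical in
/-- The function on the union of faces which corresponds to a map from a horn. -/
def hornFun (t : stdSimplex ℝ (Fin (n + 2))) : X := if ht : t ∈ hornSet k then
    hornValue g (retractOnto (carrier t) (carrier_nonempty t)) (retractOnto_carrier_ne ht) t
  else hornValue g (const _ k) (⟨k.succAbove 0, Fin.succAbove_ne _ _,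
    fun _ => (Fin.succAbove_ne _ _).symm⟩) t

lemma hornFun_map {m : ℕ} (f : Fin (m + 1) →o Fin (n + 2)) (h : ∃ j ≠ k, ∀ i, f i ≠ j)
    (t : stdSimplex ℝ (Fin (m + 1))) : hornFun g (stdSimplex.map f t) = hornValue g f h t := by
  obtain ⟨j, hj, hf⟩ := id h
  have ht : stdSimplex.map f t ∈ hornSet k := ⟨j, hj, stdSimplex_map_apply_eq_zero t f hf⟩
  rw [hornFun, dif_pos ht]
  have hj' : (univ.erase j).Nonempty := ⟨k, mem_erase.2 ⟨hj.symm, mem_univ k⟩⟩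
  have hr : ∀ i, retractOnto _ hj' i ≠ j := fun i => (mem_erase.1 (retractOnto_mem _ hj' i)).1
  have e1 : f = (retractOnto _ hj').comp f := OrderHom.ext _ _ (funext fun i =>
    (retractOnto_eq_self hj' (mem_erase.2 ⟨hf i, mem_univ _⟩)).symm)
  have e2 : retractOnto (carrier (stdSimplex.map f t)) (carrier_nonempty _) =
      (retractOnto _ hj').comp (retractOnto (carrier (stdSimplex.map f t)) (carrier_nonempty _)) := by
    refine OrderHom.ext _ _ (funext fun i => (retractOnto_eq_self hj' (mem_erase.2 ⟨?_, mem_univ _⟩)).symm)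
    intro hi
    have := retractOnto_mem (carrier (stdSimplex.map f t)) (carrier_nonempty _) i
    rw [hi] at this; exact (mem_filter.1 this).2 (stdSimplex_map_apply_eq_zero t f hf)
  have A : ∀ (l : ℕ) (f' : Fin (l + 1) →o Fin (n + 2)) (h') (s : stdSimplex ℝ (Fin (l + 1))),
      f' = (retractOnto _ hj').comp f' →
      hornValue g f' h' s = hornValue g (retractOnto _ hj') ⟨j, hj, hr⟩ (stdSimplex.map f' s) := by
    intro l f' h' s hf'
    exact DFunLike.congr_fun ((hornValue_congr g hf' _ (hf' ▸ h')).trans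
      (hornValue_comp g (retractOnto _ hj') ⟨j, hj, hr⟩ f' (hf' ▸ h'))) s
  rw [A _ _ _ _ e1, A _ _ _ _ e2]; congr 1
  exact stdSimplex_map_eq_self _ _ fun i hi => retractOnto_eq_self _ (mem_filter.2 ⟨mem_univ i, hi⟩)

lemma continuousOn_hornFun : ContinuousOn (hornFun g) (hornSet k) := by
  have e : hornSet k = ⋃ j : {j : Fin (n + 2) // j ≠ k},
      ({t | t j.1 = 0} : Set (stdSimplex ℝ (Fin (n + 2)))) := by
    ext t
    simp [hornSet]
  rw [e]
  refine (locallyFinite_of_finite _).continuousOn_iUnion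
    (fun j => isClosed_eq (continuous_coord j.1) continuous_const) fun ⟨j, hj⟩ => ?_
  have hj' : (univ.erase j).Nonempty := ⟨k, mem_erase.2 ⟨hj.symm, mem_univ k⟩⟩
  have hr : ∀ i, retractOnto _ hj' i ≠ j := fun i => (mem_erase.1 (retractOnto_mem _ hj' i)).1
  refine ((hornValue g (retractOnto _ hj') ⟨j, hj, hr⟩).continuous.continuousOn).congr fun t ht => ?_
  rw [← hornFun_map g]; congr 1
  refine (stdSimplex_map_eq_self _ _ fun i hi => retractOnto_eq_self _
    (mem_erase.2 ⟨?_, mem_univ i⟩)).symm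
  rintro rfl; exact hi ht

end Horn

open SSet.modelCategoryQuillen HomotopicalAlgebra

lemma IsSerreFibration.fibration {E B : Type u} [TopologicalSpace E] [TopologicalSpace B]
    {π : C(E, B)} (hπ : IsSerreFibration π) : Fibration (SS.map π) := by
  rw [fibration_iff]; intro A A' i hi; simp only [J, MorphismProperty.iSup_iff] at hi
  obtain ⟨n, ⟨k⟩⟩ := hi
  constructor
  intro g b sq
  obtain ⟨σ, rfl⟩ := SSet.yonedaEquiv.symm.surjective b
  have hw : ∀ {m : ℕ} (f : Fin (m + 1) →o Fin (n + 2)) (h : ∃ j ≠ k, ∀ i, f i ≠ j),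
      π.comp (hornValue g f h) = Sing.pull (n := n + 1) σ f := by
    intro m f h; exact ConcreteCategory.congr_hom (NatTrans.congr_app sq.w (op ⦋m⦌)) (hornMk f h)
  obtain ⟨l, hl1, hl2⟩ := hπ.lift_horn k σ (hornFun g) (continuousOn_hornFun g) (by
    intro t ht; rw [hornFun, dif_pos ht]
    refine (DFunLike.congr_fun (hw _ (retractOnto_carrier_ne ht)) t).trans ?_
    have e : stdSimplex.map (retractOnto (carrier t) (carrier_nonempty t)) t = t :=
      stdSimplex_map_eq_self _ _ fun i hi => retractOnto_eq_self _ (mem_filter.2 ⟨mem_univ i, hi⟩)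
    exact congrArg (DFunLike.coe (F := Sing (n + 1) B) σ) e)
  constructor
  constructor
  refine ⟨SSet.yonedaEquiv.symm l, ?_, ?_⟩
  · refine NatTrans.ext (funext fun ⟨m⟩ => ?_)
    induction m using SimplexCategory.rec with | _ m => ?_
    ext ⟨x, hx⟩
    obtain ⟨f, rfl⟩ := SSet.stdSimplex.objMk_bijective.2 x
    obtain ⟨j, hj, h⟩ := (SSet.mem_horn_iff_notMem_range _ _).1 hx
    have h' : ∃ j ≠ k, ∀ i, f i ≠ j := ⟨j, hj, fun i hi => h ⟨i, hi⟩⟩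
    change Sing.pull l f = hornValue g f h'
    ext t
    rw [← hornFun_map]; exact hl2 _ ⟨j, hj, stdSimplex_map_apply_eq_zero t f fun i hi => h ⟨i, hi⟩⟩
  · refine (SSet.yonedaEquiv_symm_comp _ _).trans ?_
    exact congrArg _ hl1

lemma IsSerreFibration.exists_homotopy_lift {E B : Type u} [TopologicalSpace E]
    [TopologicalSpace B] {π : C(E, B)} (hπ : IsSerreFibration π) {X : SSet.{u}} (f : X ⟶ SS E)
    (H : X ⊗ Δ[1] ⟶ SS B) (hH : SSet.ι₀ ≫ H = f ≫ SS.map π) :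
    ∃ P : X ⊗ Δ[1] ⟶ SS E, SSet.ι₀ ≫ P = f ∧ P ≫ SS.map π = H := by
  have := hπ.fibration
  have hA : SSet.anodyneExtensions (X ◁ (horn.{u} 1 0).ι) :=
    (SSet.anodyneExtensions.horn_ι 0).whiskerLeft X
  have hlp := hA (SS.map π) this.mem
  have sq : CommSq (CartesianMonoidalCategory.fst X _ ≫ f) (X ◁ (horn.{u} 1 0).ι) (SS.map π) H := by
    constructor
    rw [Category.assoc, ← hH]
    refine NatTrans.ext (funext fun ⟨m⟩ => ?_)
    induction m using SimplexCategory.rec with | _ m => ?_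
    ext ⟨x, s, hs⟩
    refine congrArg (H.app (op ⦋m⦌)) (?_ : SSet.ι₀.app _ x = (x, s))
    refine Prod.ext rfl ?_
    obtain ⟨g, rfl⟩ := SSet.stdSimplex.objMk_bijective.2 s
    obtain ⟨j, hj, h⟩ := (SSet.mem_horn_iff_notMem_range _ _).1 hs
    refine congrArg SSet.stdSimplex.objMk (?_ : const _ 0 = g)
    ext i
    have h1 : g i ≠ j := fun h' => h ⟨i, h'⟩
    have h2 : ∀ a b : Fin 2, b ≠ 0 → a ≠ b → ((0 : Fin 2) : ℕ) = a := by decide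
    exact h2 _ _ hj h1
  have hl := hlp.sq_hasLift sq
  refine ⟨hl.exists_lift.some.l, ?_, hl.exists_lift.some.fac_right⟩
  refine NatTrans.ext (funext fun ⟨m⟩ => ?_)
  induction m using SimplexCategory.rec with | _ m => ?_
  have h0 : (SSet.stdSimplex.objMk (const _ 0) : (Δ[1] : SSet.{u}) _⦋m⦌) ∈
      (horn.{u} 1 0).obj (op ⦋m⦌) :=
    (SSet.mem_horn_iff_notMem_range _ _).2 ⟨(1 : Fin 2), one_ne_zero, fun ⟨i, hi⟩ =>
      zero_ne_one (α := Fin 2) hi⟩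
  ext : 1
  refine DFunLike.ext _ _ fun x => ?_
  have hx := ConcreteCategory.congr_hom (NatTrans.congr_app hl.exists_lift.some.fac_left (op ⦋m⦌))
    ((x, ⟨_, h0⟩) : X _⦋m⦌ × (horn.{u} 1 0 : SSet.{u}) _⦋m⦌)
  exact hx

end SingularSimplicialSet

/-! ### Chains of simplicial sets and the prism operator -/

section SimplicialChains

/-- The monotone map `{0, …, m} → {0, …, N}` given by a monotone map of natural numbers. -/
def clampHom (m N : ℕ) (g : ℕ →o ℕ) : Fin (m + 1) →o Fin (N + 1) where
  toFun a := ⟨min (g a) N, by omega⟩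
  monotone' a b h := by
    have := g.monotone (show (a : ℕ) ≤ b from h)
    exact Fin.mk_le_mk.2 (by omega)

def skipHom (i : ℕ) : ℕ →o ℕ where
  toFun := auxSkip i
  monotone' a b h := by
    simp only [auxSkip]
    split_ifs <;> omega

def squashHom (j : ℕ) : ℕ →o ℕ where
  toFun x := if x ≤ j then x else x - 1
  monotone' a b h := by
    dsimp only
    split_ifs <;> omega

lemma skipHom_apply (i x : ℕ) : skipHom i x = if x < i then x else x + 1 := rfl

lemma squashHom_apply (j x : ℕ) : squashHom j x = if x ≤ j then x else x - 1 := rfl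

lemma clampHom_congr {m N : ℕ} {g g' : ℕ →o ℕ} (h : ∀ x ≤ m, min (g x) N = min (g' x) N) :
    clampHom m N g = clampHom m N g' := by
  ext a
  exact h a (by omega)

lemma clampHom_id (N : ℕ) : clampHom N N OrderHom.id = OrderHom.id := by
  ext a
  change min (a : ℕ) N = a; omega

lemma clampHom_comp {l m N : ℕ} (g g' : ℕ →o ℕ) (h : ∀ x ≤ l, g' x ≤ m) :
    (clampHom m N g).comp (clampHom l m g') = clampHom l N (g.comp g') := by
  ext a
  change min (g (min (g' a) m)) N = min (g (g' a)) N; rw [min_eq_left (h a (by omega))]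

variable (k : Type v) [Field k] (X : SSet.{u})

abbrev SChains : Type (max u v) := (Σ n : ℕ, X _⦋n⦌) →₀ k

variable {X}

def schain {n : ℕ} (x : X _⦋n⦌) : SChains k X := single ⟨n, x⟩ 1

def sface {N : ℕ} (x : X _⦋N⦌) (m : ℕ) (g : ℕ →o ℕ) : SChains k X :=
  schain k (spull x (clampHom m N g))

variable (X) in
def sboundary : SChains k X →ₗ[k] SChains k X := linearCombination k fun s : (Σ n : ℕ, X _⦋n⦌) =>
    match s with
    | ⟨0, _⟩ => 0
    | ⟨n + 1, x⟩ => ∑ i ∈ range (n + 2), (-1 : k) ^ i • sface k x n (skipHom i)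

variable {k}

lemma sface_congr {N m : ℕ} (x : X _⦋N⦌) {g g' : ℕ →o ℕ}
    (h : ∀ a ≤ m, min (g a) N = min (g' a) N) : sface k x m g = sface k x m g' := by
  rw [sface, clampHom_congr h, sface]

lemma sface_spull {l m N : ℕ} (x : X _⦋N⦌) (g g' : ℕ →o ℕ) (h : ∀ a ≤ l, g' a ≤ m) :
    sface k (spull x (clampHom m N g)) l g' = sface k x l (g.comp g') := by
  rw [sface, spull_spull, clampHom_comp _ _ h, sface]

lemma sboundary_schain_zero (x : X _⦋0⦌) : sboundary k X (schain k x) = 0 := by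
  simp [sboundary, schain]

lemma sboundary_schain_succ {n : ℕ} (x : X _⦋n + 1⦌) : sboundary k X (schain k x) =
    ∑ i ∈ range (n + 2), (-1 : k) ^ i • sface k x n (skipHom i) := by
  simp [sboundary, schain]

lemma sboundary_sface_succ {N : ℕ} (x : X _⦋N⦌) (m : ℕ) (g : ℕ →o ℕ) :
    sboundary k X (sface k x (m + 1) g) =
      ∑ i ∈ range (m + 2), (-1 : k) ^ i • sface k x m (g.comp (skipHom i)) := by
  rw [sface, sboundary_schain_succ]
  refine sum_congr rfl fun i _ => ?_
  rw [sface_spull]; intro a ha; rw [skipHom_apply]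
  split_ifs <;> omega

lemma schains_ext {V : Type*} [AddCommMonoid V] [Module k V] {f g : SChains k X →ₗ[k] V}
    (h : ∀ n (x : X _⦋n⦌), f (schain k x) = g (schain k x)) : f = g :=
  lhom_ext' fun ⟨n, x⟩ => ext_ring (h n x)

lemma sboundary_sboundary (c : SChains k X) : sboundary k X (sboundary k X c) = 0 := by
  suffices h : sboundary k X ∘ₗ sboundary k X = 0 from congrArg (fun f => f c) h
  refine schains_ext fun n x => ?_
  change sboundary k X (sboundary k X (schain k x)) = 0
  match n, x with
  | 0, x => rw [sboundary_schain_zero, map_zero]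
  | 1, x =>
    rw [sboundary_schain_succ, map_sum]
    exact sum_eq_zero fun i _ => by rw [map_smul, sface, sboundary_schain_zero, smul_zero]
  | n + 2, x =>
    rw [sboundary_schain_succ, map_sum]
    simp only [map_smul, sboundary_sface_succ, smul_sum, smul_smul]; rw [← Finset.sum_product']
    refine Finset.sum_involution
      (fun p _ => if p.2 < p.1 then (p.2, p.1 - 1) else (p.2 + 1, p.1)) ?_ ?_ ?_ ?_
    · rintro ⟨i, j⟩ h; simp only
      split_ifs with hij
      · have e : sface k x n ((skipHom i).comp (skipHom j)) =
            sface k x n ((skipHom j).comp (skipHom (i - 1))) := by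
          refine sface_congr x fun a _ => ?_
          simp only [comp_coe, Function.comp_apply, skipHom_apply]
          split_ifs <;> omega
        obtain ⟨i, rfl⟩ : ∃ l, i = l + 1 := ⟨i - 1, by omega⟩
        rw [e, ← add_smul]; simp only [Nat.add_sub_cancel]
        rw [show (-1 : k) ^ (i + 1) * (-1) ^ j + (-1) ^ j * (-1) ^ i = 0 by ring, zero_smul]
      · have e : sface k x n ((skipHom i).comp (skipHom j)) =
            sface k x n ((skipHom (j + 1)).comp (skipHom i)) := by
          refine sface_congr x fun a _ => ?_
          simp only [comp_coe, Function.comp_apply, skipHom_apply]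
          split_ifs <;> omega
        rw [e, ← add_smul,
          show (-1 : k) ^ i * (-1) ^ j + (-1) ^ (j + 1) * (-1) ^ i = 0 by ring, zero_smul]
    · rintro ⟨i, j⟩ h -; simp only
      split_ifs with hij <;> simp <;> omega
    · rintro ⟨i, j⟩ h; simp only [Finset.mem_product, mem_range] at h ⊢
      split_ifs with hij <;> simp <;> omega
    · rintro ⟨i, j⟩ h; simp only
      split_ifs <;> simp at * <;> omega

/-- The singular simplex which corresponds to a simplex under a map to a singular simplicial set. -/
def singApp {Y : Type u} [TopologicalSpace Y] (P : X ⟶ SS Y) {n : ℕ} (x : X _⦋n⦌) : Sing n Y :=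
  P.app (op ⦋n⦌) x

lemma singApp_spull {Y : Type u} [TopologicalSpace Y] (P : X ⟶ SS Y) {m n : ℕ} (x : X _⦋n⦌)
    (f : Fin (m + 1) →o Fin (n + 1)) : singApp P (spull x f) = (singApp P x).pull f :=
  app_spull P x f

def ofSing {Y : Type u} [TopologicalSpace Y] {n : ℕ} (α : Sing n Y) : (SS Y) _⦋n⦌ := α

def realize {Y : Type u} [TopologicalSpace Y] (P : X ⟶ SS Y) : SChains k X →ₗ[k] Chains k Y :=
  linearCombination k fun s : (Σ n : ℕ, X _⦋n⦌) => simplexChain k (singApp P s.2)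

lemma realize_schain {Y : Type u} [TopologicalSpace Y] (P : X ⟶ SS Y) {n : ℕ} (x : X _⦋n⦌) :
    realize P (schain k x) = simplexChain k (singApp P x) := by
  simp [realize, schain]

lemma realize_sface {Y : Type u} [TopologicalSpace Y] (P : X ⟶ SS Y) {N : ℕ} (x : X _⦋N⦌) (m : ℕ)
    (g : ℕ →o ℕ) : realize P (sface k x m g) =
      simplexChain k ((singApp P x).pull (clampHom m N g)) := by
  rw [sface, realize_schain, singApp_spull]

lemma boundary_realize {Y : Type u} [TopologicalSpace Y] (P : X ⟶ SS Y) (c : SChains k X) :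
    boundary k Y (realize P c) = realize P (sboundary k X c) := by
  suffices h : boundary k Y ∘ₗ realize P = realize P ∘ₗ sboundary k X from
    congrArg (fun f => f c) h
  refine schains_ext fun n x => ?_
  change boundary k Y (realize P (schain k x)) = realize P (sboundary k X (schain k x))
  rw [realize_schain]
  match n, x with
  | 0, x => rw [sboundary_schain_zero, map_zero, boundary_simplexChain_zero]
  | n + 1, x =>
    rw [sboundary_schain_succ, map_sum, boundary_simplexChain_succ, Finset.sum_range]
    refine sum_congr rfl fun i _ => ?_
    rw [map_smul, realize_sface]; congr 3
    ext a
    change _ = min (auxSkip i a) (n + 1)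
    simp only [auxSkip, Fin.succAbove, Fin.lt_def, Fin.val_castSucc]
    split_ifs <;> simp <;> omega

def toSChains (Y : Type u) [TopologicalSpace Y] : Chains k Y →ₗ[k] SChains k (SS Y) :=
  linearCombination k fun s : (Σ n : ℕ, Sing n Y) => schain k (ofSing s.2)

lemma toSChains_simplexChain {Y : Type u} [TopologicalSpace Y] {n : ℕ} (α : Sing n Y) :
    toSChains Y (simplexChain k α) = schain k (ofSing α) := by
  simp [toSChains, simplexChain]

lemma sboundary_toSChains {Y : Type u} [TopologicalSpace Y] (c : Chains k Y) :
    sboundary k (SS Y) (toSChains Y c) = toSChains Y (boundary k Y c) := by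
  have h1 : ∀ c, realize (𝟙 (SS Y)) (toSChains (k := k) Y c) = c := by
    suffices h : realize (𝟙 (SS Y)) ∘ₗ toSChains (k := k) Y = idₗ from
      fun c => congrArg (fun f => f c) h
    refine chains_ext k fun n α => ?_
    change realize _ (toSChains Y (simplexChain k α)) = simplexChain k α
    rw [toSChains_simplexChain, realize_schain]; rfl
  have h2 : ∀ c, toSChains (k := k) Y (realize (𝟙 (SS Y)) c) = c := by
    suffices h : toSChains (k := k) Y ∘ₗ realize (𝟙 (SS Y)) = idₗ from
      fun c => congrArg (fun f => f c) h
    refine schains_ext fun n α => ?_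
    change toSChains Y (realize _ (schain k α)) = schain k α
    rw [realize_schain, toSChains_simplexChain]; rfl
  rw [← h2 (sboundary k (SS Y) _), ← boundary_realize, h1]

end SimplicialChains

section Prism

lemma prism_sum {A : Type*} [AddCommGroup A] (m : ℕ) (a b : ℕ → ℕ → A) (c : ℕ → A)
    (h1 : ∀ i j, i ≤ j → j < m → b i (j + 1) = -a i j)
    (h2 : ∀ i j, j < i → i ≤ m → b (i + 1) j = -a i j)
    (h3 : ∀ j ≤ m, b j j = c j) (h4 : ∀ j ≤ m, b (j + 1) j = -c (j + 1)) :
    ∑ j ∈ range (m + 1), ∑ i ∈ range (m + 2), b i j +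
      ∑ j ∈ range m, ∑ i ∈ range (m + 1), a i j = c 0 - c (m + 1) := by
  have key : ∀ j ∈ range (m + 1), ∑ i ∈ range (m + 2), b i j =
      ∑ i ∈ range j, b i j + (c j - c (j + 1)) - ∑ i ∈ Ico (j + 1) (m + 1), a i j := by
    intro j hj; rw [mem_range] at hj
    rw [← Finset.sum_range_add_sum_Ico _ (show j ≤ m + 2 by omega),
      Finset.sum_eq_sum_Ico_succ_bot (by omega), Finset.sum_eq_sum_Ico_succ_bot (by omega),
      h3 j (by omega), h4 j (by omega), ← Finset.sum_Ico_add' (fun i => b i j) (j + 1) (m + 1) 1,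
      sub_eq_add_neg _ (∑ i ∈ _, _), ← sum_neg_distrib]
    rw [sum_congr rfl fun i hi => h2 i j (by rw [Finset.mem_Ico] at hi; omega)
      (by rw [Finset.mem_Ico] at hi; omega)]
    abel
  rw [sum_congr rfl key, sum_sub_distrib, sum_add_distrib,
    sum_range_succ', Finset.sum_range_sub', range_zero, sum_empty, add_zero,
    sum_range_succ (fun j => ∑ i ∈ Ico (j + 1) (m + 1), a i j), Finset.Ico_self,
    sum_empty, add_zero]
  have e : ∑ j ∈ range m, ∑ i ∈ range (m + 1), a i j =
      -(∑ j ∈ range m, ∑ i ∈ range (j + 1), b i (j + 1)) +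
        ∑ j ∈ range m, ∑ i ∈ Ico (j + 1) (m + 1), a i j := by
    rw [← sum_neg_distrib, ← sum_add_distrib]
    refine sum_congr rfl fun j hj => ?_
    rw [mem_range] at hj
    rw [← Finset.sum_range_add_sum_Ico _ (show j + 1 ≤ m + 1 by omega), ← sum_neg_distrib]; congr 1
    refine sum_congr rfl fun i hi => ?_
    rw [mem_range] at hi; rw [h1 i j (by omega) hj, neg_neg]
  rw [e]; abel

def threshold (m t : ℕ) : (Δ[1] : SSet.{u}) _⦋m⦌ :=
  SSet.stdSimplex.objMk ⟨fun a => if t ≤ a then 1 else 0, fun a b h => by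
    have h' : (a : ℕ) ≤ b := h
    dsimp only
    split_ifs
    · exact le_rfl
    · omega
    · exact Fin.zero_le _
    · exact le_rfl⟩

variable {k : Type v} [Field k] {X : SSet.{u}}

def Cylinder (X : SSet.{u}) : SSet.{u} := X ⊗ Δ[1]

def cylMk {n : ℕ} (x : X _⦋n⦌) (θ : (Δ[1] : SSet.{u}) _⦋n⦌) : (Cylinder X) _⦋n⦌ := (x, θ)

lemma spull_cylMk {m n : ℕ} (x : X _⦋n⦌) (θ : (Δ[1] : SSet.{u}) _⦋n⦌)
    (f : Fin (m + 1) →o Fin (n + 1)) :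
    spull (cylMk x θ) f = cylMk (spull x f) (spull θ f) := rfl

def prismFace (k : Type v) [Field k] {N : ℕ} (x : X _⦋N⦌) (m : ℕ) (g : ℕ →o ℕ) (t : ℕ) :
    SChains k (Cylinder X) :=
  schain k (cylMk (spull x (clampHom m N g)) (threshold m t))

lemma threshold_congr {m t t' : ℕ} (h : ∀ a ≤ m, t ≤ a ↔ t' ≤ a) :
    threshold.{u} m t = threshold m t' := by
  refine congrArg SSet.stdSimplex.objMk (OrderHom.ext _ _ (funext fun a => ?_))
  exact if_congr (h a (Nat.lt_succ_iff.1 a.2)) rfl rfl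

lemma spull_threshold (m n t t' : ℕ) (f : Fin (m + 1) →o Fin (n + 1))
    (h : ∀ a, t ≤ (f a : ℕ) ↔ t' ≤ (a : ℕ)) : spull (threshold.{u} n t) f = threshold m t' := by
  refine congrArg SSet.stdSimplex.objMk (OrderHom.ext _ _ (funext fun a => ?_))
  exact if_congr (h a) rfl rfl

lemma prismFace_congr {N m t t' : ℕ} (x : X _⦋N⦌) {g g' : ℕ →o ℕ}
    (h : ∀ a ≤ m, min (g a) N = min (g' a) N) (ht : ∀ a ≤ m, t ≤ a ↔ t' ≤ a) :
    prismFace k x m g t = prismFace k x m g' t' := by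
  rw [prismFace, clampHom_congr h, threshold_congr ht, prismFace]

lemma sboundary_prismFace_succ {N : ℕ} (x : X _⦋N⦌) (m : ℕ) (g : ℕ →o ℕ) (t : ℕ) :
    sboundary k (Cylinder X) (prismFace k x (m + 1) g t) = ∑ i ∈ range (m + 2), (-1 : k) ^ i •
        prismFace k x m (g.comp (skipHom i)) (if i < t then t - 1 else t) := by
  rw [prismFace, sboundary_schain_succ]
  refine sum_congr rfl fun i _ => ?_
  congr 1
  rw [prismFace, ← clampHom_comp g (skipHom i) (m := m + 1) (fun a ha => by
    rw [skipHom_apply]; split_ifs <;> omega), ← spull_spull,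
    ← spull_threshold m (m + 1) t _ (clampHom m (m + 1) (skipHom i)), ← spull_cylMk]
  · rfl
  · intro a; change t ≤ min (skipHom i a) (m + 1) ↔ _; rw [skipHom_apply]
    have := a.2
    split_ifs <;> omega

def prism (k : Type v) [Field k] (X : SSet.{u}) : SChains k X →ₗ[k] SChains k (Cylinder X) :=
  linearCombination k fun s : (Σ n : ℕ, X _⦋n⦌) =>
    ∑ j ∈ range (s.1 + 1), (-1 : k) ^ j • prismFace k s.2 (s.1 + 1) (squashHom j) (j + 1)

lemma prism_schain {n : ℕ} (x : X _⦋n⦌) : prism k X (schain k x) =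
    ∑ j ∈ range (n + 1), (-1 : k) ^ j • prismFace k x (n + 1) (squashHom j) (j + 1) := by
  simp [prism, schain]

lemma prism_sface {N : ℕ} (x : X _⦋N⦌) (m : ℕ) (g : ℕ →o ℕ) : prism k X (sface k x m g) =
    ∑ j ∈ range (m + 1), (-1 : k) ^ j • prismFace k x (m + 1) (g.comp (squashHom j)) (j + 1) := by
  rw [sface, prism_schain]
  refine sum_congr rfl fun j hj => ?_
  rw [mem_range] at hj; rw [prismFace, spull_spull, clampHom_comp, prismFace]; intro a ha
  rw [squashHom_apply]
  split_ifs <;> omega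

lemma sboundary_prism {n : ℕ} (x : X _⦋n⦌) :
    sboundary k (Cylinder X) (prism k X (schain k x)) + prism k X (sboundary k X (schain k x)) =
      schain k (cylMk x (threshold n 0)) - schain k (cylMk x (threshold n (n + 1))) := by
  have e : ∀ t, schain k (cylMk x (threshold n t)) = prismFace k x n OrderHom.id t := fun t => by
    rw [prismFace, clampHom_id, spull_id]
  rw [e, e, prism_schain, map_sum]
  simp only [map_smul, sboundary_prismFace_succ, smul_sum, smul_smul]
  refine Eq.trans ?_ (prism_sum n (fun i j => ((-1 : k) ^ i * (-1) ^ j) •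
      prismFace k x n ((skipHom i).comp (squashHom j)) (j + 1))
    (fun i j => ((-1 : k) ^ j * (-1) ^ i) •
      prismFace k x n ((squashHom j).comp (skipHom i)) (if i < j + 1 then j + 1 - 1 else j + 1))
    (fun t => prismFace k x n OrderHom.id t) ?_ ?_ ?_ ?_)
  · congr 1
    match n, x with
    | 0, x => rw [sboundary_schain_zero, map_zero, range_zero, sum_empty]
    | n + 1, x =>
      rw [sboundary_schain_succ, map_sum, sum_comm]
      refine sum_congr rfl fun i _ => ?_
      rw [map_smul, prism_sface, smul_sum]; simp only [smul_smul]
  · intro i j hij hj; rw [← neg_smul, if_pos (by omega)]; congr 1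
    · ring
    · refine prismFace_congr x (fun a _ => ?_) (fun a _ => by omega)
      simp only [comp_coe, Function.comp_apply, skipHom_apply, squashHom_apply]
      split_ifs <;> omega
  · intro i j hij hi; rw [← neg_smul, if_neg (by omega)]; congr 1
    · ring
    · refine prismFace_congr x (fun a _ => ?_) (fun a _ => Iff.rfl)
      simp only [comp_coe, Function.comp_apply, skipHom_apply, squashHom_apply]
      split_ifs <;> omega
  · intro j hj; rw [← pow_add, Even.neg_one_pow ⟨j, rfl⟩, one_smul, if_pos (by omega)]
    refine prismFace_congr x (fun a _ => ?_) (fun a _ => by omega)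
    simp only [comp_coe, Function.comp_apply, skipHom_apply, squashHom_apply, id_coe, id]
    split_ifs <;> omega
  · intro j hj; rw [← pow_add, Odd.neg_one_pow ⟨j, by ring⟩, neg_one_smul, if_neg (by omega)]
    congr 1
    refine prismFace_congr x (fun a _ => ?_) (fun a _ => Iff.rfl)
    simp only [comp_coe, Function.comp_apply, skipHom_apply, squashHom_apply, id_coe, id]
    split_ifs <;> omega

end Prism

/-! ### Singular homology -/

section HomologyBasics

variable {k : Type v} [Field k] {X Y Z : Type u} [TopologicalSpace X] [TopologicalSpace Y]
  [TopologicalSpace Z]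

lemma homologyClass_eq_zero_iff {n : ℤ} (z : (singularChains k X).cycles n) :
    (singularChains k X).homologyClass n z = 0 ↔ ∃ w, boundary k X w = z := by
  rw [mkQ_apply, Submodule.Quotient.mk_eq_zero]; rfl

lemma homologyClass_eq_iff {n : ℤ} (z z' : (singularChains k X).cycles n) :
    (singularChains k X).homologyClass n z = (singularChains k X).homologyClass n z' ↔
      ∃ w, boundary k X w = (z : Chains k X) - z' := by
  rw [← sub_eq_zero, ← map_sub, homologyClass_eq_zero_iff]; rfl

lemma homologyClass_surjective (n : ℤ) :
    Surjective ((singularChains k X).homologyClass n) := mkQ_surjective _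

lemma homologyMap_homologyClass (f : C(X, Y)) {n : ℤ} (z : (singularChains k X).cycles n) :
    homologyMap k f n ((singularChains k X).homologyClass n z) =
      (singularChains k Y).homologyClass n ⟨chainsMap k f z, chainsMap_mem_cycles k f n z z.2⟩ :=
  rfl

lemma chainsMap_comp (g : C(Y, Z)) (f : C(X, Y)) (c : Chains k X) :
    chainsMap k (g.comp f) c = chainsMap k g (chainsMap k f c) := by
  suffices h : chainsMap k (g.comp f) = chainsMap k g ∘ₗ chainsMap k f from
    lcongr_fun h c
  refine chains_ext k fun n α => ?_
  change chainsMap k _ (simplexChain k α) = chainsMap k g (chainsMap k f (simplexChain k α))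
  rw [chainsMap_simplexChain, chainsMap_simplexChain, chainsMap_simplexChain]; rfl

lemma chainsMap_id (c : Chains k X) : chainsMap k (ContinuousMap.id X) c = c := by
  suffices h : chainsMap k (ContinuousMap.id X) = idₗ from lcongr_fun h c
  refine chains_ext k fun n α => ?_
  change chainsMap k _ (simplexChain k α) = simplexChain k α; rw [chainsMap_simplexChain]; rfl

lemma homologyMap_comp (g : C(Y, Z)) (f : C(X, Y)) (n : ℤ) (u : SingularHomology k X n) :
    homologyMap k (g.comp f) n u = homologyMap k g n (homologyMap k f n u) := by
  obtain ⟨z, rfl⟩ := homologyClass_surjective n u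
  rw [homologyMap_homologyClass, homologyMap_homologyClass, homologyMap_homologyClass]; congr 1
  exact Subtype.ext (chainsMap_comp g f _)

lemma homologyMap_id (n : ℤ) (u : SingularHomology k X n) :
    homologyMap k (ContinuousMap.id X) n u = u := by
  obtain ⟨z, rfl⟩ := homologyClass_surjective n u
  rw [homologyMap_homologyClass]; congr 1; exact Subtype.ext (chainsMap_id _)

lemma chainsMap_eq_mapDomain (f : C(X, Y)) (c : Chains k X) : chainsMap k f c =
    mapDomain (fun s : (Σ n : ℕ, Sing n X) => (⟨s.1, f.comp s.2⟩ : Σ n : ℕ, Sing n Y)) c := by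
  suffices h : chainsMap k f = lmapDomain k k
      (fun s : (Σ n : ℕ, Sing n X) => (⟨s.1, f.comp s.2⟩ : Σ n : ℕ, Sing n Y)) from
    lcongr_fun h c
  refine chains_ext k fun n α => ?_
  change chainsMap k _ (simplexChain k α) = mapDomain _ (single _ _)
  rw [chainsMap_simplexChain, mapDomain_single]; rfl

lemma sigmaComp_injective {f : C(X, Y)} (hf : Function.Injective f) : Function.Injective
    (fun s : (Σ n : ℕ, Sing n X) => (⟨s.1, f.comp s.2⟩ : Σ n : ℕ, Sing n Y)) := by
  rintro ⟨m, α⟩ ⟨n, β⟩ h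
  obtain ⟨rfl, h⟩ := Sigma.mk.inj_iff.1 h
  have h' := eq_of_heq h
  congr 1
  ext t
  exact hf (DFunLike.congr_fun h' t)

lemma chainsMap_injective {f : C(X, Y)} (hf : Function.Injective f) :
    Function.Injective (chainsMap k f) := by
  intro c c' h; rw [chainsMap_eq_mapDomain, chainsMap_eq_mapDomain] at h
  exact Finsupp.mapDomain_injective (sigmaComp_injective hf) h

lemma mem_chainsOfDegree_of_chainsMap {f : C(X, Y)} (hf : Function.Injective f) {n : ℤ}
    {c : Chains k X} (h : chainsMap k f c ∈ chainsOfDegree k Y n) : c ∈ chainsOfDegree k X n := by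
  intro s hs
  refine h (a := ⟨s.1, f.comp s.2⟩) ?_
  rw [Finset.mem_coe, Finsupp.mem_support_iff, chainsMap_eq_mapDomain]
  rw [Finsupp.mapDomain_apply (sigmaComp_injective hf)]; exact Finsupp.mem_support_iff.1 hs

lemma homologyMap_bijective_of_deformation {f : C(X, Y)} (hf : Function.Injective f)
    (P h : Chains k Y →ₗ[k] Chains k Y)
    (hP : ∀ c, boundary k Y (h c) + h (boundary k Y c) = P c - c)
    (hPdeg : ∀ n, ∀ c ∈ chainsOfDegree k Y n, P c ∈ chainsOfDegree k Y n)
    (hPf : ∀ c, P c ∈ LinearMap.range (chainsMap k f))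
    (hh : ∀ c, h (chainsMap k f c) ∈ LinearMap.range (chainsMap k f)) (n : ℤ) :
    Bijective (homologyMap k f n) := by
  constructor
  · rw [injective_iff_map_eq_zero]; intro u hu
    obtain ⟨z, rfl⟩ := homologyClass_surjective n u
    rw [homologyMap_homologyClass, homologyClass_eq_zero_iff] at hu
    obtain ⟨w, hw⟩ := hu
    obtain ⟨y, hy⟩ := hPf w
    obtain ⟨y', hy'⟩ := hh z
    have hz : boundary k X z = 0 := z.2.1
    refine (homologyClass_eq_zero_iff z).2 ⟨y - y', chainsMap_injective hf ?_⟩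
    have e1 := congrArg (boundary k Y) (hP w)
    rw [map_add, boundary_boundary, zero_add, hw, map_sub, hw] at e1
    rw [chainsMap_boundary, map_sub, hy, hy', map_sub]
    have e1' : boundary k Y (P w) = boundary k Y (h (chainsMap k f z)) + chainsMap k f z := by
      rw [e1]; exact (sub_add_cancel _ _).symm
    rw [e1', add_sub_cancel_left]
  · intro u
    obtain ⟨z, rfl⟩ := homologyClass_surjective n u
    have hz : boundary k Y z = 0 := z.2.1
    obtain ⟨y, hy⟩ := hPf z
    have hPz := hP z
    rw [hz, map_zero, add_zero] at hPz
    have hyc : y ∈ (singularChains k X).cycles n := by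
      refine ⟨chainsMap_injective hf (?_ : chainsMap k f (boundary k X y) = chainsMap k f 0),
        mem_chainsOfDegree_of_chainsMap hf (hy ▸ hPdeg n z z.2.2)⟩
      rw [chainsMap_boundary, hy, map_zero, ← sub_add_cancel (P z) (z : Chains k Y), ← hPz,
        map_add, boundary_boundary, hz, add_zero]
    refine ⟨(singularChains k X).homologyClass n ⟨y, hyc⟩, ?_⟩
    rw [homologyMap_homologyClass, homologyClass_eq_iff]
    exact ⟨h z, by rw [hPz]; exact congrArg (· - (z : Chains k Y)) hy.symm⟩

lemma basisProj_boundary [∀ n : ℤ, DecidablePred fun s : (Σ n : ℕ, Sing n X) => (s.1 : ℤ) = n]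
    (n : ℤ) (c : Chains k X) :
    basisProj (fun s : (Σ n : ℕ, Sing n X) => (s.1 : ℤ) = n) (boundary k X c) =
      boundary k X (basisProj (fun s : (Σ n : ℕ, Sing n X) => (s.1 : ℤ) = n + 1) c) := by
  suffices h : basisProj (fun s : (Σ n : ℕ, Sing n X) => (s.1 : ℤ) = n) ∘ₗ boundary k X =
      boundary k X ∘ₗ basisProj (fun s : (Σ n : ℕ, Sing n X) => (s.1 : ℤ) = n + 1) from
    lcongr_fun h c
  refine chains_ext k fun m α => ?_
  have hmem : boundary k X (simplexChain k α) ∈ chainsOfDegree k X ((m : ℤ) - 1) :=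
    (singularChains k X).d_mem_gr m _ (simplexChain_mem_supported k α rfl)
  change basisProj _ (boundary k X (simplexChain k α)) = boundary k X (basisProj _ (single _ _))
  rw [basisProj_single]
  split_ifs with h
  · refine basisProj_eq_self _ hmem fun s hs => ?_
    have : (s.1 : ℤ) = m - 1 := hs
    have : (m : ℤ) = n + 1 := h
    omega
  · rw [map_zero]
    refine basisProj_eq_zero _ hmem fun s hs => ?_
    have : (s.1 : ℤ) = m - 1 := hs
    have : ¬ (m : ℤ) = n + 1 := h
    omega

lemma exists_homologyRetr (n : ℤ) : ∃ R : Chains k X →ₗ[k] SingularHomology k X n,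
      (∀ z : (singularChains k X).cycles n, R z = (singularChains k X).homologyClass n z) ∧
      (∀ w, R (boundary k X w) = 0) ∧ ∀ m ≠ n, ∀ c ∈ chainsOfDegree k X m, R c = 0 := by
  classical
  obtain ⟨R, hR1, hR2⟩ := exists_extension_vanishing ((singularChains k X).cycles n)
    (LinearMap.range (boundary k X) ⊔ supported k k ({s | (s.1 : ℤ) ≠ n} : Set (Σ n : ℕ, Sing n X)))
    ((singularChains k X).homologyClass n) (by
      intro z hz
      obtain ⟨_, ⟨w, rfl⟩, o, ho, hzo⟩ := mem_sup.1 hz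
      have hz' := basisProj_eq_self (fun s : (Σ n : ℕ, Sing n X) => (s.1 : ℤ) = n) z.2.2
        fun s hs => hs
      rw [← hzo, map_add, basisProj_boundary, basisProj_eq_zero _ ho fun s hs => hs,
        add_zero] at hz'
      rw [homologyClass_eq_zero_iff, ← hzo, ← hz']
      exact ⟨_, rfl⟩)
  refine ⟨R, hR1, fun w => hR2 _ (mem_sup_left ⟨w, rfl⟩), fun m hm c hc => hR2 _ ?_⟩
  refine mem_sup_right (supported_mono (fun s hs => ?_) hc)
  have : (s.1 : ℤ) = m := hs
  exact fun h => hm (this.symm.trans h)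

end HomologyBasics

/-! ### Pullbacks of Serre fibrations to contractible spaces -/

section Transport

variable {E B : Type u} [TopologicalSpace E] [TopologicalSpace B] (π : C(E, B))

abbrev BasePullback {A : Type} [TopologicalSpace A] (f : C(A, B)) : Type u :=
  {ae : A × E // π ae.2 = f ae.1}

def pullbackIncl {A : Type} [TopologicalSpace A] (f : C(A, B)) (a : A) {x : B} (h : f a = x) :
    C(Fiber π x, BasePullback π f) :=
  ⟨fun e => ⟨(a, e.1), by rw [e.2, h]⟩, by fun_prop⟩

/-- The point of the interval to which a simplex of `Δ[1]` sends a point. -/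
def intervalCoord {m : ℕ} (θ : (Δ[1] : SSet.{u}) _⦋m⦌) :
    C(stdSimplex ℝ (Fin (m + 1)), unitInterval) where
  toFun t := simplexToCube 1 (stdSimplex.map (SSet.stdSimplex.asOrderHom θ) t) 1
  continuous_toFun := (continuous_apply _).comp
    ((simplexToCube 1).continuous.comp (stdSimplex.continuous_map _))

lemma intervalCoord_spull {m n : ℕ} (θ : (Δ[1] : SSet.{u}) _⦋n⦌) (f : Fin (m + 1) →o Fin (n + 1))
    (t : stdSimplex ℝ (Fin (m + 1))) :
    intervalCoord (spull θ f) t = intervalCoord θ (stdSimplex.map f t) := by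
  refine congrArg (fun s => simplexToCube 1 s 1) ?_
  exact (map_comp_apply f (SSet.stdSimplex.asOrderHom θ) t).symm

lemma intervalCoord_eq_zero {m : ℕ} (θ : (Δ[1] : SSet.{u}) _⦋m⦌)
    (hθ : ∀ i, SSet.stdSimplex.asOrderHom θ i = 0) (t : stdSimplex ℝ (Fin (m + 1))) :
    intervalCoord θ t = 0 :=
  Subtype.ext (stdSimplex_map_apply_eq_zero t _ fun i => by rw [hθ i]; exact zero_ne_one)

lemma intervalCoord_eq_one {m : ℕ} (θ : (Δ[1] : SSet.{u}) _⦋m⦌)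
    (hθ : ∀ i, SSet.stdSimplex.asOrderHom θ i = 1) (t : stdSimplex ℝ (Fin (m + 1))) :
    intervalCoord θ t = 1 := by
  refine Subtype.ext ?_
  have h0 : stdSimplex.map (SSet.stdSimplex.asOrderHom θ) t 0 = 0 :=
    stdSimplex_map_apply_eq_zero t _ fun i => by rw [hθ i]; exact one_ne_zero
  have h1 := sum_eq_one (stdSimplex.map (SSet.stdSimplex.asOrderHom θ) t)
  rw [Fin.sum_univ_two, h0, zero_add] at h1; exact h1

def homToSS {X : SSet.{u}} {Y : Type u} [TopologicalSpace Y] (F : ∀ m : ℕ, X _⦋m⦌ → Sing m Y)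
    (hF : ∀ (m n : ℕ) (f : Fin (m + 1) →o Fin (n + 1)) (x : X _⦋n⦌), F m (spull x f) = (F n x).pull f) :
    X ⟶ SS Y where
  app m := ↾fun x : X.obj m => (F m.unop.len x : Sing m.unop.len Y)
  naturality m n g := by
    refine ConcreteCategory.ext (DFunLike.ext _ _ fun x => ?_)
    exact hF n.unop.len m.unop.len g.unop.toOrderHom x

lemma homToSS_ext {X : SSet.{u}} {Y : Type u} [TopologicalSpace Y] {f g : X ⟶ SS Y}
    (h : ∀ (n : ℕ) (x : X _⦋n⦌), singApp f x = singApp g x) : f = g := by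
  refine NatTrans.ext (funext fun m => ?_)
  refine ConcreteCategory.ext (DFunLike.ext _ _ fun x => ?_)
  exact h m.unop.len x

def toSing {Y : Type u} [TopologicalSpace Y] {n : ℕ} (x : (SS Y) _⦋n⦌) : Sing n Y := x

def cylFst {X : SSet.{u}} {n : ℕ} (x : (Cylinder X) _⦋n⦌) : X _⦋n⦌ := x.1

def cylSnd {X : SSet.{u}} {n : ℕ} (x : (Cylinder X) _⦋n⦌) : (Δ[1] : SSet.{u}) _⦋n⦌ := x.2

lemma cylSnd_cylMk {X : SSet.{u}} {n : ℕ} (x : X _⦋n⦌) (θ : (Δ[1] : SSet.{u}) _⦋n⦌) :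
    cylSnd (cylMk x θ) = θ := rfl

lemma cylSnd_spull {X : SSet.{u}} {m n : ℕ} (x : (Cylinder X) _⦋n⦌)
    (f : Fin (m + 1) →o Fin (n + 1)) : cylSnd (spull x f) = spull (cylSnd x) f := rfl

lemma asOrderHom_threshold_zero (m : ℕ) (i : Fin (m + 1)) :
    SSet.stdSimplex.asOrderHom (threshold.{u} m 0) i = 1 := by
  change (if 0 ≤ (i : ℕ) then (1 : Fin 2) else 0) = 1; exact if_pos (Nat.zero_le _)

lemma asOrderHom_threshold_last (m : ℕ) (i : Fin (m + 1)) :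
    SSet.stdSimplex.asOrderHom (threshold.{u} m (m + 1)) i = 0 := if_neg (not_le.2 i.2)

lemma IsSerreFibration.exists_lift_cylinder {π : C(E, B)} (hπ : IsSerreFibration π) {X : SSet.{u}}
    (f : X ⟶ SS E) (H : Cylinder X ⟶ SS B)
    (hH : ∀ (n : ℕ) (x : X _⦋n⦌), singApp H (cylMk x (threshold n (n + 1))) = π.comp (singApp f x)) :
    ∃ P : Cylinder X ⟶ SS E,
      (∀ (n : ℕ) (x : X _⦋n⦌), singApp P (cylMk x (threshold n (n + 1))) = singApp f x) ∧
      ∀ (n : ℕ) (x : (Cylinder X) _⦋n⦌), π.comp (singApp P x) = singApp H x := by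
  have h0 : ∀ (n : ℕ) (x : X _⦋n⦌), (SSet.ι₀.app (op ⦋n⦌) x : (Cylinder X) _⦋n⦌) =
      cylMk x (threshold n (n + 1)) := by
    intro n x
    refine Prod.ext rfl (congrArg SSet.stdSimplex.objMk (OrderHom.ext _ _ (funext fun a => ?_)))
    exact (asOrderHom_threshold_last.{u} n a).symm
  obtain ⟨P, h1, h2⟩ := hπ.exists_homotopy_lift f H (homToSS_ext fun n x =>
    (congrArg (singApp H) (h0 n x)).trans (hH n x))
  refine ⟨P, fun n x => ?_, fun n x => ?_⟩
  · rw [← h0]; exact congrArg (fun F => singApp F x) h1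
  · exact congrArg (fun F => singApp F x) h2

/-- If `A` can be contracted to the point `a`, relative to this point, then the inclusion of the
fiber over `f a` in the pullback of a Serre fibration along `f` induces an isomorphism in
homology. -/
lemma IsSerreFibration.homologyMap_pullbackIncl_bijective {π : C(E, B)} (hπ : IsSerreFibration π)
    (k : Type v) [Field k] {A : Type} [TopologicalSpace A] (f : C(A, B)) (a : A)
    (c : C(A × unitInterval, A)) (hc0 : ∀ y, c (y, 0) = y) (hc1 : ∀ y, c (y, 1) = a)
    (hca : ∀ t, c (a, t) = a) {x : B} (hx : f a = x) (n : ℤ) :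
    Bijective (homologyMap k (pullbackIncl π f a hx) n) := by
  let pA : C(BasePullback π f, A) := ContinuousMap.fst.comp ⟨Subtype.val, continuous_subtype_val⟩
  let pE : C(BasePullback π f, E) := ContinuousMap.snd.comp ⟨Subtype.val, continuous_subtype_val⟩
  obtain ⟨P, hP0, hP⟩ := hπ.exists_lift_cylinder (SS.map pE)
    (homToSS (X := Cylinder (SS (BasePullback π f))) (fun m x => (f.comp c).comp
      ((pA.comp (toSing (cylFst x))).prodMk (intervalCoord (cylSnd x)))) (by
        intro m n g x
        ext t
        change f (c (pA _, intervalCoord (cylSnd (spull x g)) t)) = _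
        rw [cylSnd_spull, intervalCoord_spull]
        rfl)) (by
        intro m x
        ext t
        change f (c (pA (toSing x t), intervalCoord (threshold m (m + 1)) t)) = π (pE (toSing x t))
        rw [intervalCoord_eq_zero, hc0]
        · exact (toSing x t).2.symm
        · exact asOrderHom_threshold_last.{u} m)
  have hP' : ∀ (m : ℕ) (x : (Cylinder (SS (BasePullback π f))) _⦋m⦌) (t),
      π (singApp P x t) = f (c (pA (toSing (cylFst x) t), intervalCoord (cylSnd x) t)) :=
    fun m x t => DFunLike.congr_fun (hP m x) t
  let Q : Cylinder (SS (BasePullback π f)) ⟶ SS (BasePullback π f) :=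
    homToSS (fun m x => ⟨fun t => ⟨(c (pA (toSing (cylFst x) t), intervalCoord (cylSnd x) t),
      singApp P x t), hP' m x t⟩, by fun_prop⟩) (by
        intro m n g x
        refine ContinuousMap.ext fun t => Subtype.ext (Prod.ext ?_ ?_)
        · change c (pA _, intervalCoord (cylSnd (spull x g)) t) = _
          rw [cylSnd_spull, intervalCoord_spull]; rfl
        · change singApp P (spull x g) t = _; rw [singApp_spull]
          rfl)
  have hQ : ∀ (m : ℕ) (x : (Cylinder (SS (BasePullback π f))) _⦋m⦌) (t),
      (singApp Q x t).1 = (c (pA (toSing (cylFst x) t), intervalCoord (cylSnd x) t),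
        singApp P x t) := fun m x t => rfl
  have hQ0 : ∀ (m : ℕ) (α : Sing m (BasePullback π f)),
      singApp Q (cylMk (ofSing α) (threshold m (m + 1))) = α := by
    intro m α
    refine ContinuousMap.ext fun t => Subtype.ext (Prod.ext ?_ ?_)
    · rw [hQ, cylSnd_cylMk, intervalCoord_eq_zero _ (asOrderHom_threshold_last.{u} m), hc0]; rfl
    · rw [hQ, hP0]; rfl
  have hinj : Function.Injective (pullbackIncl π f a hx) := fun e e' h =>
    Subtype.ext (congrArg (fun y => y.1.2) h)
  have hmem : ∀ (m : ℕ) (α : Sing m (BasePullback π f)), (∀ t, (α t).1.1 = a) →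
      simplexChain k α ∈ LinearMap.range (chainsMap k (pullbackIncl π f a hx)) := by
    intro m α hα
    have hα' : ∀ t, π (pE (α t)) = x := fun t => by
      have := (α t).2
      rw [hα t, hx] at this; exact this
    refine ⟨simplexChain k (⟨fun t => ⟨pE (α t), hα' t⟩,
      Continuous.subtype_mk (pE.comp α).continuous _⟩ : Sing m (Fiber π x)), ?_⟩
    · rw [chainsMap_simplexChain]; congr 1
      exact ContinuousMap.ext fun t => Subtype.ext (Prod.ext (hα t).symm rfl)
  let h : Chains k (BasePullback π f) →ₗ[k] Chains k (BasePullback π f) :=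
    realize Q ∘ₗ prism k _ ∘ₗ toSChains _
  have hh : ∀ (m : ℕ) (α : Sing m (BasePullback π f)), h (simplexChain k α) =
      ∑ j ∈ range (m + 1), (-1 : k) ^ j • simplexChain k (singApp Q (cylMk
        (spull (ofSing α) (clampHom (m + 1) m (squashHom j))) (threshold (m + 1) (j + 1)))) := by
    intro m α
    simp only [h, lcomp_apply, toSChains_simplexChain, prism_schain, map_sum, map_smul,
      prismFace, realize_schain]
  let P' : Chains k (BasePullback π f) →ₗ[k] Chains k (BasePullback π f) :=
    linearCombination k fun s : (Σ n : ℕ, Sing n (BasePullback π f)) =>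
      simplexChain k (singApp Q (cylMk (ofSing s.2) (threshold s.1 0)))
  have hP1 : ∀ (m : ℕ) (α : Sing m (BasePullback π f)), P' (simplexChain k α) =
      simplexChain k (singApp Q (cylMk (ofSing α) (threshold m 0))) := by
    intro m α; simp [P', simplexChain]
  refine homologyMap_bijective_of_deformation hinj P' h (fun y => ?_)
    (fun m => map_mem_of_supported k _ _ _ _ fun s hs => ?_) (fun y => ?_) (fun y => ?_) n
  · suffices e : boundary k _ ∘ₗ h + h ∘ₗ boundary k _ = P' - idₗ from
      lcongr_fun e y
    refine chains_ext k fun m α => ?_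
    change boundary k _ (realize Q (prism k _ (toSChains _ (simplexChain k α)))) +
      realize Q (prism k _ (toSChains _ (boundary k _ (simplexChain k α)))) =
      P' (simplexChain k α) - simplexChain k α
    rw [← sboundary_toSChains, boundary_realize, ← map_add, toSChains_simplexChain,
      sboundary_prism, map_sub, realize_schain, realize_schain, hQ0, hP1]
  · rw [hP1]; exact simplexChain_mem_supported k _ hs
  · refine map_mem_of_single P' Set.univ _ (fun s _ => ?_) y (by simp [supported_univ])
    have := hP1 s.1 s.2
    rw [simplexChain] at this; rw [this]
    refine hmem _ _ fun t => ?_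
    rw [hQ, cylSnd_cylMk, intervalCoord_eq_one _ (asOrderHom_threshold_zero.{u} s.1), hc1]
  · refine map_mem_of_single (h ∘ₗ chainsMap k (pullbackIncl π f a hx)) Set.univ _ (fun s _ => ?_)
      y (by simp [supported_univ])
    change h (chainsMap k _ (simplexChain k s.2)) ∈ _; rw [chainsMap_simplexChain, hh]
    refine sum_mem fun j _ => Submodule.smul_mem _ _ (hmem _ _ fun t => ?_)
    rw [hQ]; exact hca _

end Transport

end

variable {E B : Type u} [TopologicalSpace E] [TopologicalSpace B] {π : C(E, B)}
  {hπ : IsSerreFibration π} {k : Type v} [Field k] {b : B} {X : Type u} [TopologicalSpace X]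

local notation "𝗦" => serreFiltration k π
local notation "𝗛" => SingularHomology k
local notation "𝗧" => TotalSingularHomology k

/-! ### Transport of the homology of the fibers -/

section FiberTransport

def intervalContraction (a : unitInterval) : C(unitInterval × unitInterval, unitInterval) where
  toFun y := ⟨(1 - y.2) * y.1 + y.2 * a, by
    have h1 := y.1.2
    have h2 := y.2.2
    have h3 := a.2
    constructor
    · have := mul_nonneg (sub_nonneg.2 h2.2) h1.1
      have := mul_nonneg h2.1 h3.1
      linarith
    · have := mul_le_mul_of_nonneg_left h1.2 (sub_nonneg.2 h2.2)
      have := mul_le_mul_of_nonneg_left h3.2 h2.1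
      linarith⟩
  continuous_toFun := by fun_prop

lemma intervalContraction_zero (a y : unitInterval) : intervalContraction a (y, 0) = y :=
  Subtype.ext (by simp [intervalContraction])

lemma intervalContraction_one (a y : unitInterval) : intervalContraction a (y, 1) = a :=
  Subtype.ext (by simp [intervalContraction])

lemma intervalContraction_self (a t : unitInterval) : intervalContraction a (a, t) = a :=
  Subtype.ext (by simp only [intervalContraction, ContinuousMap.coe_mk]; ring)

variable (hπ) (k)

include hπ in
lemma IsSerreFibration.homologyMap_interval_bijective (f : C(unitInterval, B)) (a : unitInterval)
    {x : B} (hx : f a = x) (n : ℤ) :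
    Bijective (homologyMap k (pullbackIncl π f a hx) n) :=
  hπ.homologyMap_pullbackIncl_bijective k f a (intervalContraction a)
    (intervalContraction_zero a) (intervalContraction_one a) (intervalContraction_self a) hx n

include hπ in
lemma IsSerreFibration.homologyMap_square_bijective (f : C(unitInterval × unitInterval, B))
    (a : unitInterval × unitInterval) {x : B} (hx : f a = x) (n : ℤ) :
    Bijective (homologyMap k (pullbackIncl π f a hx) n) :=
  hπ.homologyMap_pullbackIncl_bijective k f a
    ⟨fun y => (intervalContraction a.1 (y.1.1, y.2), intervalContraction a.2 (y.1.2, y.2)),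
      by fun_prop⟩
    (fun y => Prod.ext (intervalContraction_zero _ _) (intervalContraction_zero _ _))
    (fun y => Prod.ext (intervalContraction_one _ _) (intervalContraction_one _ _))
    (fun t => Prod.ext (intervalContraction_self _ _) (intervalContraction_self _ _)) hx n

include hπ in
lemma IsSerreFibration.homologyMap_sourceIncl_bijective {x y : B} (γ : Path x y) (n : ℤ) :
    Bijective (homologyMap k (sourceIncl π γ) n) :=
  hπ.homologyMap_interval_bijective k γ.toContinuousMap 0 γ.source n

include hπ in
lemma IsSerreFibration.homologyMap_targetIncl_bijective {x y : B} (γ : Path x y) (n : ℤ) :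
    Bijective (homologyMap k (targetIncl π γ) n) :=
  hπ.homologyMap_interval_bijective k γ.toContinuousMap 1 γ.target n

def pathTransport {x y : B} (γ : Path x y) (n : ℤ) : 𝗛 (Fiber π x) n ≃ₗ[k] 𝗛 (Fiber π y) n :=
  (ofBijective _ (hπ.homologyMap_sourceIncl_bijective k γ n)).trans
    (ofBijective _ (hπ.homologyMap_targetIncl_bijective k γ n)).symm

lemma pathTransport_spec {x y : B} (γ : Path x y) (n : ℤ) (u : 𝗛 (Fiber π x) n) :
    homologyMap k (sourceIncl π γ) n u =
      homologyMap k (targetIncl π γ) n (pathTransport hπ k γ n u) :=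
  ((ofBijective _ (hπ.homologyMap_targetIncl_bijective k γ n)).apply_symm_apply
    (homologyMap k (sourceIncl π γ) n u)).symm

lemma pathTransport_eq {x y : B} (γ : Path x y) (n : ℤ) {u : 𝗛 (Fiber π x) n} {v : 𝗛 (Fiber π y) n}
    (h : homologyMap k (sourceIncl π γ) n u = homologyMap k (targetIncl π γ) n v) :
    pathTransport hπ k γ n u = v :=
  (hπ.homologyMap_targetIncl_bijective k γ n).1 ((pathTransport_spec hπ k γ n u).symm.trans h)

lemma pullbackIncl_pathTransport {A : Type} [TopologicalSpace A] (f : C(A, B)) {a a' : A}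
    (δ : Path a a') {x y : B} (hx : f a = x) (hy : f a' = y) (γ : Path x y)
    (hγ : ∀ t, γ t = f (δ t)) (n : ℤ) (u : 𝗛 (Fiber π x) n) :
    homologyMap k (pullbackIncl π f a hx) n u =
      homologyMap k (pullbackIncl π f a' hy) n (pathTransport hπ k γ n u) := by
  let Φ : C(PathPullback π γ, BasePullback π f) :=
    ⟨fun te => ⟨(δ te.1.1, te.1.2), by rw [te.2, hγ]⟩, by fun_prop⟩
  have h1 : pullbackIncl π f a hx = Φ.comp (sourceIncl π γ) :=
    ContinuousMap.ext fun e => Subtype.ext (Prod.ext δ.source.symm rfl)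
  have h2 : pullbackIncl π f a' hy = Φ.comp (targetIncl π γ) :=
    ContinuousMap.ext fun e => Subtype.ext (Prod.ext δ.target.symm rfl)
  rw [h1, h2, homologyMap_comp, homologyMap_comp, pathTransport_spec hπ]

lemma pathTransport_refl (x : B) (n : ℤ) (u : 𝗛 (Fiber π x) n) :
    pathTransport hπ k (Path.refl x) n u = u := by
  let r : C(PathPullback π (Path.refl x), Fiber π x) := ⟨fun te => ⟨te.1.2, te.2⟩, by fun_prop⟩
  have h1 : r.comp (sourceIncl π (Path.refl x)) = ContinuousMap.id _ := rfl
  have h2 : r.comp (targetIncl π (Path.refl x)) = ContinuousMap.id _ := rfl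
  have h := congrArg (homologyMap k r n) (pathTransport_spec hπ k (Path.refl x) n u)
  rw [← homologyMap_comp, ← homologyMap_comp, h1, h2, homologyMap_id, homologyMap_id] at h
  exact h.symm

lemma pathTransport_trans {x y z : B} (γ : Path x y) (σ : Path y z) (σ' : Path x z)
    (h : σ'.Homotopic (γ.trans σ)) (n : ℤ) (u : 𝗛 (Fiber π x) n) :
    pathTransport hπ k σ n (pathTransport hπ k γ n u) = pathTransport hπ k σ' n u := by
  obtain ⟨G⟩ := h
  let f : C(unitInterval × unitInterval, B) := G.toContinuousMap
  have h00 : f (0, 0) = x := G.source 0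
  have h10 : f (1, 0) = x := G.source 1
  have h01 : f (0, 1) = z := G.target 0
  have h11 : f (1, 1) = z := G.target 1
  have e1 := pullbackIncl_pathTransport hπ k f (a := (0, 0)) (a' := (0, 1))
    ⟨⟨fun t => (0, t), by fun_prop⟩, rfl, rfl⟩ h00 h01 σ'
    (fun t => (G.apply_zero t).symm) n u
  have e2 := pullbackIncl_pathTransport hπ k f (a := (0, 0)) (a' := (1, 0))
    ⟨⟨fun t => (t, 0), by fun_prop⟩, rfl, rfl⟩ h00 h10 (Path.refl x)
    (fun t => (G.source t).symm) n u
  have e3 := pullbackIncl_pathTransport hπ k f (a := (0, 1)) (a' := (1, 1))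
    ⟨⟨fun t => (t, 1), by fun_prop⟩, rfl, rfl⟩ h01 h11 (Path.refl z)
    (fun t => (G.target t).symm) n (pathTransport hπ k σ' n u)
  let half : unitInterval := ⟨1 / 2, by norm_num, by norm_num⟩
  have hh : f (1, half) = y := by
    refine (G.apply_one half).trans ?_
    rw [Path.coe_toContinuousMap, Path.trans_apply, dif_pos le_rfl]
    refine (congrArg γ (Subtype.ext ?_)).trans γ.target
    norm_num [half]
  have e4 := pullbackIncl_pathTransport hπ k f (a := (1, 0)) (a' := (1, half))
    ⟨⟨fun t => (1, ⟨t / 2, by have := t.2.1; positivity, by have := t.2.2; linarith⟩),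
      by fun_prop⟩, Prod.ext rfl (Subtype.ext (by simp)), Prod.ext rfl (Subtype.ext (by simp [half]))⟩
    h10 hh γ (fun t => by
      refine Eq.symm ((G.apply_one _).trans ?_)
      rw [Path.coe_toContinuousMap, Path.trans_apply, dif_pos (by
        have := t.2.2; change (t : ℝ) / 2 ≤ 1 / 2; linarith)]
      refine congrArg γ (Subtype.ext ?_)
      change 2 * ((t : ℝ) / 2) = t
      ring) n u
  have e5 := pullbackIncl_pathTransport hπ k f (a := (1, half)) (a' := (1, 1))
    ⟨⟨fun t => (1, ⟨(1 + t) / 2, by have := t.2.1; positivity, by have := t.2.2; linarith⟩),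
      by fun_prop⟩, Prod.ext rfl (Subtype.ext (by simp [half])),
      Prod.ext rfl (Subtype.ext (by simp))⟩
    hh h11 σ (fun t => by
      refine Eq.symm ((G.apply_one _).trans ?_)
      rw [Path.coe_toContinuousMap, Path.trans_apply]
      split_ifs with h
      · have h0 : (t : ℝ) ≤ 0 := by
          have h' : (1 + (t : ℝ)) / 2 ≤ 1 / 2 := h
          linarith
        have ht : t = 0 := Subtype.ext (le_antisymm h0 t.2.1)
        subst ht; rw [σ.source]
        refine (congrArg γ (Subtype.ext ?_)).trans γ.target
        change 2 * ((1 + (0 : ℝ)) / 2) = 1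
        norm_num
      · refine congrArg σ (Subtype.ext ?_)
        change 2 * ((1 + (t : ℝ)) / 2) - 1 = t
        ring) n (pathTransport hπ k γ n u)
  rw [pathTransport_refl] at e2 e3
  exact (hπ.homologyMap_square_bijective k f (1, 1) h11 n).1
    (e5.symm.trans (e4.symm.trans (e2.symm.trans (e1.trans e3))))

variable [SimplyConnectedSpace B] (b)

/-- The identification of the homology of the fibers with that of the fiber over `b`. -/
def fiberTransport (x : B) (n : ℤ) : 𝗛 (Fiber π x) n ≃ₗ[k] 𝗛 (Fiber π b) n :=
  pathTransport hπ k (PathConnectedSpace.somePath x b) n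

lemma fiberTransport_pathTransport {x y : B} (γ : Path x y) (n : ℤ) (u : 𝗛 (Fiber π x) n) :
    fiberTransport hπ k b y n (pathTransport hπ k γ n u) = fiberTransport hπ k b x n u :=
  pathTransport_trans hπ k γ _ _ (SimplyConnectedSpace.paths_homotopic _ _) n u

lemma fiberTransport_eq_of_path {x y : B} (γ : Path x y) (n : ℤ)
    {u : 𝗛 (Fiber π x) n} {v : 𝗛 (Fiber π y) n}
    (h : homologyMap k (sourceIncl π γ) n u = homologyMap k (targetIncl π γ) n v) :
    fiberTransport hπ k b x n u = fiberTransport hπ k b y n v := by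
  rw [← pathTransport_eq hπ k γ n h, fiberTransport_pathTransport]

lemma isFiberTransport_fiberTransport : IsFiberTransport k π b (fiberTransport hπ k b) := by
  intro x γ n u
  have h : ∀ v, fiberTransport hπ k b b n v = v := fun v => by
    refine (fiberTransport hπ k b b n).injective ?_
    exact fiberTransport_pathTransport hπ k b _ n v
  rw [← fiberTransport_pathTransport hπ k b γ, h]; exact pathTransport_spec hπ k γ n u

end FiberTransport

section

open Simplicial MonoidalCategory Opposite

/-! ### Degenerate chains -/

section Degenerate

def singModule (k : Type v) [Field k] (X : Type u) [TopologicalSpace X] :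
    SimplicialObject (ModuleCat.{max u v} k) where
  obj n := ModuleCat.of k (Sing n.unop.len X →₀ k)
  map f := ModuleCat.ofHom (lmapDomain k k fun α => α.pull f.unop.toOrderHom)
  map_id n := by
    refine ModuleCat.hom_ext (lhom_ext' fun α => ext_ring ?_)
    change mapDomain _ (single α 1) = single α 1; rw [mapDomain_single]
    exact congrArg (fun β => single β 1) α.pull_id
  map_comp f g := by
    refine ModuleCat.hom_ext (lhom_ext' fun α => ext_ring ?_)
    change mapDomain _ (single α 1) = mapDomain _ (mapDomain _ (single α 1))
    rw [mapDomain_single, mapDomain_single, mapDomain_single]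
    exact congrArg (fun β => single β 1) (α.pull_pull f.unop.toOrderHom g.unop.toOrderHom).symm

def singIncl (n : ℕ) : (singModule k X) _⦋n⦌ →ₗ[k] Chains k X :=
  lmapDomain k k fun α : Sing n X => (⟨n, α⟩ : Σ n : ℕ, Sing n X)

def singMk (k : Type v) [Field k] {n : ℕ} (α : Sing n X) : (singModule k X) _⦋n⦌ :=
  (single α 1 : Sing n X →₀ k)

lemma singIncl_singMk {n : ℕ} (α : Sing n X) : singIncl n (singMk k α) = simplexChain k α :=
  mapDomain_single

lemma δ_singMk {n : ℕ} (i : Fin (n + 2)) (α : Sing (n + 1) X) :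
    ((singModule k X).δ i).hom (singMk k α) = singMk k (α.pull i.succAbove) :=
  mapDomain_single

lemma σ_singMk {n : ℕ} (i : Fin (n + 1)) (α : Sing n X) :
    ((singModule k X).σ i).hom (singMk k α) = singMk k (α.pull i.predAbove) :=
  mapDomain_single

lemma boundary_singIncl (n : ℕ) (c : (singModule k X) _⦋n + 1⦌) :
    boundary k X (singIncl (n + 1) c) = singIncl n
      (((AlgebraicTopology.AlternatingFaceMapComplex.obj (singModule k X)).d (n + 1) n).hom c) := by
  rw [AlgebraicTopology.AlternatingFaceMapComplex.obj_d_eq]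
  suffices h : boundary k X ∘ₗ singIncl (n + 1) =
      singIncl n ∘ₗ (∑ i : Fin (n + 2), (-1 : ℤ) ^ (i : ℕ) • (singModule k X).δ i).hom from
    lcongr_fun h c
  refine lhom_ext' fun α => ext_ring ?_
  change boundary k X (singIncl (n + 1) (singMk k α)) = singIncl n
    ((∑ i : Fin (n + 2), (-1 : ℤ) ^ (i : ℕ) • (singModule k X).δ i).hom (singMk k α))
  rw [singIncl_singMk, ModuleCat.hom_sum, LinearMap.sum_apply, map_sum]
  refine (boundary_simplexChain_succ _).trans (sum_congr rfl fun i _ => ?_)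
  rw [ModuleCat.hom_zsmul, LinearMap.smul_apply, δ_singMk, map_zsmul, singIncl_singMk,
    ← Int.cast_smul_eq_zsmul k]
  simp

lemma Sing.FactorsThrough.exists_pull_predAbove {n m : ℕ} {V : Sing (n + 1) X} (hm : m < n + 1)
    (h : V.FactorsThrough m) : ∃ (i : Fin (n + 1)) (W : Sing n X), V = W.pull i.predAbove := by
  obtain ⟨s, -, V', rfl⟩ := h
  obtain ⟨i, hi⟩ : ∃ i : Fin (n + 1), s i.castSucc = s i.succ := by
    by_contra! hne
    have hs : StrictMono s := Fin.strictMono_iff_lt_succ.2 fun i =>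
      lt_of_le_of_ne (s.monotone (Fin.castSucc_le_succ i)) (hne i)
    have := Fintype.card_le_of_injective s hs.injective
    simp at this; omega
  refine ⟨i, (V'.pull s).pull i.succ.succAbove, ?_⟩
  rw [Sing.pull_pull, Sing.pull_pull]; congr 1
  funext a
  simp only [Function.comp_apply]
  by_cases h : a = i.succ
  · subst h; rw [Fin.predAbove_succ_self, ← hi]; congr 1
    ext
    simp [Fin.succAbove, Fin.lt_def]
  · congr 1
    ext
    have : (a : ℕ) ≠ i + 1 := fun h' => h (Fin.ext h')
    simp only [Fin.succAbove, Fin.predAbove, Fin.lt_def, Fin.val_castSucc, Fin.val_succ]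
    split_ifs with h1 h2 h2 <;> simp_all <;> omega

open AlgebraicTopology AlgebraicTopology.DoldKan in
/-- The projection of the chains of degree `n` onto the normalized subcomplex. -/
def pInfty (k : Type v) [Field k] (X : Type u) [TopologicalSpace X] (n : ℕ) :
    (singModule k X) _⦋n⦌ →ₗ[k] (singModule k X) _⦋n⦌ :=
  ((PInfty : AlternatingFaceMapComplex.obj (singModule k X) ⟶ _).f n).hom

lemma boundary_singIncl_zero (c : (singModule k X) _⦋0⦌) : boundary k X (singIncl 0 c) = 0 := by
  suffices h : boundary k X ∘ₗ singIncl 0 = 0 from lcongr_fun h c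
  refine lhom_ext' fun α => ext_ring ?_
  change boundary k X (singIncl 0 (singMk k α)) = 0; rw [singIncl_singMk]
  exact boundary_simplexChain_zero α

lemma singIncl_mem (n : ℕ) (c : (singModule k X) _⦋n⦌) : singIncl n c ∈ chainsOfDegree k X n := by
  refine map_mem_of_single (singIncl (k := k) (X := X) n) Set.univ _ (fun α _ => ?_) c
    (by rw [supported_univ]; trivial)
  change singIncl n (singMk k α) ∈ _; rw [singIncl_singMk]; exact simplexChain_mem_supported k α rfl

lemma singIncl_σ_mem (n : ℕ) (i : Fin (n + 1)) (c : (singModule k X) _⦋n⦌) :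
    singIncl (n + 1) (((singModule k X).σ i).hom c) ∈ degenerateChains k X := by
  refine map_mem_of_single (singIncl (k := k) (X := X) (n + 1) ∘ₗ ((singModule k X).σ i).hom)
    Set.univ _ (fun α _ => ?_) c (by rw [supported_univ]; trivial)
  change singIncl (n + 1) (((singModule k X).σ i).hom (singMk k α)) ∈ _
  rw [σ_singMk, singIncl_singMk]
  refine simplexChain_mem_supported k _ ⟨n, n.lt_succ_self, ⟨i.predAbove, ?_⟩, ?_, α, rfl⟩
  · exact Fin.predAbove_right_monotone i
  · exact Fin.predAbove_surjective i

variable (k X) in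
/-- The projection of the singular chains onto the normalized subcomplex, which is isomorphic to
the quotient by the degenerate chains. -/
def normalize : Chains k X →ₗ[k] Chains k X := linearCombination k fun s : (Σ n : ℕ, Sing n X) =>
    singIncl s.1 (pInfty k X s.1 (singMk k s.2))

lemma normalize_singIncl (n : ℕ) (c : (singModule k X) _⦋n⦌) :
    normalize k X (singIncl n c) = singIncl n (pInfty k X n c) := by
  suffices h : normalize k X ∘ₗ singIncl n = singIncl n ∘ₗ pInfty k X n from
    lcongr_fun h c
  refine lhom_ext' fun α => ext_ring ?_
  change normalize k X (singIncl n (singMk k α)) = _; rw [singIncl_singMk]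
  exact (linearCombination_single k _ _).trans (one_smul _ _)

lemma normalize_simplexChain {n : ℕ} (α : Sing n X) :
    normalize k X (simplexChain k α) = singIncl n (pInfty k X n (singMk k α)) := by
  rw [← singIncl_singMk, normalize_singIncl]

lemma boundary_normalize (c : Chains k X) :
    boundary k X (normalize k X c) = normalize k X (boundary k X c) := by
  suffices h : boundary k X ∘ₗ normalize k X = normalize k X ∘ₗ boundary k X from
    lcongr_fun h c
  refine chains_ext k fun n α => ?_
  change boundary k X (normalize k X (simplexChain k α)) =
    normalize k X (boundary k X (simplexChain k α))
  rw [normalize_simplexChain]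
  match n, α with
  | 0, α => rw [boundary_singIncl_zero, boundary_simplexChain_zero, map_zero]
  | n + 1, α =>
    rw [boundary_singIncl, ← singIncl_singMk, boundary_singIncl, normalize_singIncl]
    exact congrArg (fun f => singIncl n (f.hom (singMk k α))) ((AlgebraicTopology.DoldKan.PInfty :
        AlgebraicTopology.AlternatingFaceMapComplex.obj (singModule k X) ⟶ _).comm (n + 1) n)

lemma normalize_mem {n : ℤ} {c : Chains k X} (hc : c ∈ chainsOfDegree k X n) :
    normalize k X c ∈ chainsOfDegree k X n := by
  refine map_mem_of_single (normalize k X) _ _ (fun ⟨m, α⟩ hm => ?_) c hc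
  obtain rfl : (m : ℤ) = n := hm
  change normalize k X (simplexChain k α) ∈ _; rw [normalize_simplexChain]; exact singIncl_mem m _

lemma normalize_eq_zero {e : Chains k X} (he : e ∈ degenerateChains k X) : normalize k X e = 0 := by
  refine eq_on_of_single (normalize k X) 0 _ (fun ⟨n, α⟩ hα => ?_) e he
  obtain ⟨l, hl, h⟩ := hα
  change normalize k X (simplexChain k α) = 0
  match n, α, hl, h with
  | n + 1, α, hl, h =>
    obtain ⟨i, W, rfl⟩ := h.exists_pull_predAbove hl
    rw [normalize_simplexChain, ← σ_singMk]
    refine Eq.trans (congrArg (singIncl (n + 1)) ?_) (map_zero _)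
    exact congrArg (fun f => f.hom (singMk k W))
      (AlgebraicTopology.DoldKan.σ_comp_PInfty (singModule k X) i)

lemma sub_normalize_mem (c : Chains k X) : c - normalize k X c ∈ degenerateChains k X := by
  refine map_mem_of_single (idₗ - normalize k X) Set.univ _ (fun ⟨n, α⟩ _ => ?_) c
    (by rw [supported_univ]; trivial)
  change simplexChain k α - normalize k X (simplexChain k α) ∈ _
  rw [normalize_simplexChain, ← singIncl_singMk, ← map_sub]
  have h := congrArg (fun f => f.hom (singMk k α))
    (AlgebraicTopology.DoldKan.PInfty_f_add_QInfty_f (X := singModule k X) n)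
  have h' : singMk k α - pInfty k X n (singMk k α) = ((AlgebraicTopology.DoldKan.QInfty :
        AlgebraicTopology.AlternatingFaceMapComplex.obj (singModule k X) ⟶ _).f n).hom
          (singMk k α) :=
    sub_eq_of_eq_add' h.symm
  rw [h']
  match n, α with
  | 0, α =>
    rw [AlgebraicTopology.DoldKan.QInfty_f_0]
    refine (congrArg (· ∈ degenerateChains k X) (map_zero (singIncl (k := k) (X := X) 0))).mpr ?_
    exact zero_mem _
  | n + 1, α =>
    rw [AlgebraicTopology.DoldKan.QInfty_f, AlgebraicTopology.DoldKan.decomposition_Q,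
      ModuleCat.hom_sum, LinearMap.sum_apply, map_sum]
    exact sum_mem fun i _ => singIncl_σ_mem n _ _

lemma boundary_mem_degenerateChains {e : Chains k X} (he : e ∈ degenerateChains k X) :
    boundary k X e ∈ degenerateChains k X := by
  have := sub_normalize_mem (boundary k X e)
  rwa [← boundary_normalize, normalize_eq_zero he, map_zero, sub_zero] at this

variable (k X) in
def normalizeHomotopy : Chains k X →ₗ[k] Chains k X :=
  linearCombination k fun s : (Σ n : ℕ, Sing n X) =>
    singIncl (s.1 + 1) (((AlgebraicTopology.DoldKan.homotopyPInftyToId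
      (singModule k X)).hom s.1 (s.1 + 1)).hom (singMk k s.2))

lemma normalizeHomotopy_singIncl (n : ℕ) (c : (singModule k X) _⦋n⦌) :
    normalizeHomotopy k X (singIncl n c) =
      singIncl (n + 1) (((AlgebraicTopology.DoldKan.homotopyPInftyToId
        (singModule k X)).hom n (n + 1)).hom c) := by
  suffices h : normalizeHomotopy k X ∘ₗ singIncl n = singIncl (n + 1) ∘ₗ
      ((AlgebraicTopology.DoldKan.homotopyPInftyToId (singModule k X)).hom n (n + 1)).hom from
    lcongr_fun h c
  refine lhom_ext' fun α => ext_ring ?_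
  change normalizeHomotopy k X (singIncl n (singMk k α)) = _; rw [singIncl_singMk]
  exact (linearCombination_single k _ _).trans (one_smul _ _)

lemma normalize_eq (c : Chains k X) : normalize k X c =
    normalizeHomotopy k X (boundary k X c) + boundary k X (normalizeHomotopy k X c) + c := by
  suffices h : normalize k X = normalizeHomotopy k X ∘ₗ boundary k X +
      boundary k X ∘ₗ normalizeHomotopy k X + idₗ from lcongr_fun h c
  refine chains_ext k fun n α => ?_
  change normalize k X (simplexChain k α) =
    normalizeHomotopy k X (boundary k X (simplexChain k α)) +
      boundary k X (normalizeHomotopy k X (simplexChain k α)) + simplexChain k α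
  have h := (AlgebraicTopology.DoldKan.homotopyPInftyToId (singModule k X)).comm n
  rw [normalize_simplexChain, ← singIncl_singMk, normalizeHomotopy_singIncl, boundary_singIncl]
  match n, α, h with
  | 0, α, h =>
    rw [boundary_singIncl_zero, map_zero, zero_add, ← map_add]
    rw [Homotopy.dNext_zero_chainComplex, Homotopy.prevD_chainComplex, zero_add] at h
    exact congrArg (fun f => singIncl 0 (f.hom (singMk k α))) h
  | n + 1, α, h =>
    rw [boundary_singIncl, normalizeHomotopy_singIncl, ← map_add, ← map_add]
    rw [Homotopy.dNext_succ_chainComplex, Homotopy.prevD_chainComplex] at h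
    exact congrArg (fun f => singIncl (n + 1) (f.hom (singMk k α))) h

variable (k X) in
/-- A linear extension of the class map to all chains, vanishing on boundaries, on degenerate chains
and on chains of other degrees. -/
def homologyRetr (n : ℤ) : Chains k X →ₗ[k] 𝗛 X n := (exists_homologyRetr n).choose ∘ₗ normalize k X

lemma homologyRetr_cycle {n : ℤ} (z : (singularChains k X).cycles n) :
    homologyRetr k X n z = (singularChains k X).homologyClass n z := by
  have h : boundary k X z = 0 := z.2.1
  change (exists_homologyRetr n).choose (normalize k X z) = _
  rw [normalize_eq, h, map_zero, zero_add, map_add,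
    (exists_homologyRetr (k := k) (X := X) n).choose_spec.2.1, zero_add]
  exact (exists_homologyRetr n).choose_spec.1 z

lemma homologyRetr_boundary (n : ℤ) (c : Chains k X) : homologyRetr k X n (boundary k X c) = 0 := by
  change (exists_homologyRetr n).choose (normalize k X (boundary k X c)) = _
  rw [← boundary_normalize]; exact (exists_homologyRetr n).choose_spec.2.1 _

lemma homologyRetr_degenerate (n : ℤ) {e : Chains k X} (he : e ∈ degenerateChains k X) :
    homologyRetr k X n e = 0 := by
  change (exists_homologyRetr n).choose (normalize k X e) = _; rw [normalize_eq_zero he, map_zero]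

lemma homologyRetr_of_ne {m n : ℤ} (h : m ≠ n) {c : Chains k X}
    (hc : c ∈ chainsOfDegree k X m) : homologyRetr k X n c = 0 :=
  (exists_homologyRetr n).choose_spec.2.2 m h _ (normalize_mem hc)

lemma normalize_mem_cycles {n : ℤ} {c : Chains k X} (hc : c ∈ chainsOfDegree k X n)
    (hd : boundary k X c ∈ degenerateChains k X) :
    normalize k X c ∈ (singularChains k X).cycles n :=
  ⟨(boundary_normalize c).trans (normalize_eq_zero hd), normalize_mem hc⟩

lemma homologyClass_normalize {n : ℤ} {c : Chains k X} (hc : c ∈ chainsOfDegree k X n)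
    (hd : boundary k X c ∈ degenerateChains k X) :
    (singularChains k X).homologyClass n ⟨normalize k X c, normalize_mem_cycles hc hd⟩ =
      homologyRetr k X n c := by
  have h := homologyRetr_degenerate n (sub_normalize_mem c)
  rw [map_sub, sub_eq_zero] at h; rw [← homologyRetr_cycle, h]

lemma exists_sub_boundary_mem_degenerateChains {n : ℤ} {c : Chains k X}
    (hc : c ∈ chainsOfDegree k X n) (hd : boundary k X c ∈ degenerateChains k X)
    (h : homologyRetr k X n c = 0) :
    ∃ s ∈ chainsOfDegree k X (n + 1), c - boundary k X s ∈ degenerateChains k X := by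
  classical
  rw [← homologyClass_normalize hc hd, homologyClass_eq_zero_iff] at h
  obtain ⟨s, hs⟩ := h
  have hs : boundary k X s = normalize k X c := hs
  refine ⟨basisProj (fun t : (Σ n : ℕ, Sing n X) => (t.1 : ℤ) = n + 1) s,
    supported_mono (fun t ht => ht.2) (basisProj_mem _ (T := Set.univ)
      (by rw [supported_univ]; trivial)), ?_⟩
  rw [← basisProj_boundary, hs, basisProj_eq_self
    (fun t : (Σ n : ℕ, Sing n X) => (t.1 : ℤ) = n) (normalize_mem hc) fun t ht => ht]
  exact sub_normalize_mem c

end Degenerate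

end

/-! ### The coalgebra structure of homology -/

section HomologyCoalgebra

variable (k) (X)

def totalRetr : Chains k X →ₗ[k] TotalSingularHomology k X :=
  linearCombination k fun s : (Σ n : ℕ, Sing n X) =>
    lof k ℤ (fun n => 𝗛 X n) s.1 (homologyRetr k X s.1 (simplexChain k s.2))

variable {k X}

lemma totalRetr_of_mem {n : ℤ} {c : Chains k X} (hc : c ∈ chainsOfDegree k X n) :
    totalRetr k X c = lof k ℤ (fun n => 𝗛 X n) n (homologyRetr k X n c) := by
  refine eq_on_of_single (totalRetr k X) ((lof k ℤ
    (fun n => 𝗛 X n) n).comp (homologyRetr k X n)) _ (fun s hs => ?_) c hc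
  obtain rfl : (s.1 : ℤ) = n := hs
  exact (linearCombination_single k _ _).trans (one_smul _ _)

lemma totalRetr_simplexChain {n : ℕ} (α : Sing n X) :
    totalRetr k X (simplexChain k α) = lof k ℤ (fun n => 𝗛 X n) n
      (homologyRetr k X n (simplexChain k α)) :=
  totalRetr_of_mem (simplexChain_mem_supported k α rfl)

lemma totalRetr_boundary (c : Chains k X) : totalRetr k X (boundary k X c) = 0 := by
  suffices h : totalRetr k X ∘ₗ boundary k X = 0 from lcongr_fun h c
  refine chains_ext k fun n α => ?_
  change totalRetr k X (boundary k X (simplexChain k α)) = 0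
  have hmem : boundary k X (simplexChain k α) ∈ chainsOfDegree k X (n - 1) :=
    (singularChains k X).d_mem_gr n _ (simplexChain_mem_supported k α rfl)
  rw [totalRetr_of_mem hmem, homologyRetr_boundary, map_zero]

lemma totalRetr_degenerate {c : Chains k X} (hc : c ∈ degenerateChains k X) :
    totalRetr k X c = 0 := by
  refine eq_on_of_single (totalRetr k X) 0 _ (fun s hs => ?_) c hc
  refine (totalRetr_simplexChain s.2).trans ?_
  rw [homologyRetr_degenerate _ (simplexChain_mem_supported k _ hs), map_zero]; rfl

lemma totalRetr_simplexChain_of_isDegenerate {n : ℕ} {α : Sing n X} (h : α.IsDegenerate) :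
    totalRetr k X (simplexChain k α) = 0 :=
  totalRetr_degenerate (simplexChain_mem_supported k _ h)

lemma totalRetr_cycle {n : ℤ} (z : (singularChains k X).cycles n) :
    totalRetr k X z = lof k ℤ (fun n => 𝗛 X n) n ((singularChains k X).homologyClass n z) := by
  rw [totalRetr_of_mem z.2.2, homologyRetr_cycle]

lemma totalRetr_totalCyclesIncl (z : ⨁ n : ℤ, (singularChains k X).cycles n) :
    totalRetr k X ((singularChains k X).totalCyclesIncl z) = (singularChains k X).totalClass z := by
  suffices h : totalRetr k X ∘ₗ (singularChains k X).totalCyclesIncl =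
      (singularChains k X).totalClass from lcongr_fun h z
  refine linearMap_ext k fun n => lin_ext fun z => ?_
  simp only [lcomp_apply, DGModule.totalCyclesIncl, DGModule.totalClass, coeLinearMap_lof, lmap_lof]
  exact totalRetr_cycle z

lemma totalRetr_normalize (c : Chains k X) : totalRetr k X (normalize k X c) = totalRetr k X c := by
  have h := totalRetr_degenerate (sub_normalize_mem c)
  rw [map_sub, sub_eq_zero] at h; exact h.symm

lemma map_totalRetr_diagonal_degenerate {c : Chains k X} (hc : c ∈ degenerateChains k X) :
    tmap (totalRetr k X) (totalRetr k X) (diagonal k X c) = 0 := by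
  refine eq_on_of_single (tmap (totalRetr k X) (totalRetr k X) ∘ₗ
    diagonal k X) 0 _ (fun s hs => ?_) c hc
  have hdiag : diagonal k X (single s 1) = ∑ j : Fin (s.1 + 1),
      simplexChain k (s.2.front j (by omega)) ⊗ₜ[k]
        simplexChain k (s.2.back j (s.1 - j) (by omega)) :=
    (linearCombination_single k _ _).trans (one_smul _ _)
  rw [lcomp_apply, hdiag, map_sum]
  refine sum_eq_zero fun j _ => ?_
  have h := Sing.weight_front_add_weight_back s.2 j (s.1 - j) (by omega)
  have hs' : s.2.weight < s.1 := (Sing.isDegenerate_iff _).1 hs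
  rw [map_tmul]
  by_cases h1 : (s.2.front j (by omega)).IsDegenerate
  · rw [totalRetr_simplexChain_of_isDegenerate h1, zero_tmul]
  · have h2 : (s.2.back j (s.1 - j) (by omega)).IsDegenerate := by
      rw [Sing.not_isDegenerate_iff] at h1; rw [Sing.isDegenerate_iff]; omega
    rw [totalRetr_simplexChain_of_isDegenerate h2, tmul_zero]

lemma homologyComul_totalRetr {c : Chains k X} (hc : boundary k X c ∈ degenerateChains k X) :
    homologyComul k X (totalRetr k X c) =
      tmap (totalRetr k X) (totalRetr k X) (diagonal k X c) := by
  obtain ⟨z, hz⟩ := (singularChains k X).exists_totalCyclesIncl_eq (normalize k X c)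
    ((boundary_normalize c).trans (normalize_eq_zero hc))
  have h := (homologyComul_spec k X).map_apply (f := totalRetr k X)
    (g := totalRetr k X) (fH := idₗ) (gH := idₗ)
    totalRetr_boundary totalRetr_boundary
    (fun z => (totalRetr_totalCyclesIncl z).symm)
    (fun z => (totalRetr_totalCyclesIncl z).symm) z
  have h2 := map_totalRetr_diagonal_degenerate (sub_normalize_mem c)
  rw [tmap_id, idₗ_apply, hz] at h
  nth_rw 2 [← sub_add_cancel c (normalize k X c)]
  rw [map_add, map_add, h2, zero_add, ← h, ← totalRetr_normalize, ← hz, totalRetr_totalCyclesIncl]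

lemma homologyCounit_totalRetr (c : Chains k X) :
    homologyCounit k X (totalRetr k X c) = augmentation k X c := by
  suffices h : homologyCounit k X ∘ₗ totalRetr k X = augmentation k X from
    lcongr_fun h c
  refine chains_ext k fun n α => ?_
  change homologyCounit k X (totalRetr k X (simplexChain k α)) = _
  have hlof : ∀ (m : ℤ) (z : (singularChains k X).cycles m),
      homologyCounit k X (lof k ℤ (fun n => 𝗛 X n) m
        ((singularChains k X).homologyClass m z)) = augmentation k X z := fun m z =>
    toModule_lof k m _
  match n, α with
  | 0, α =>
    have hz : simplexChain k α ∈ (singularChains k X).cycles (0 : ℕ) :=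
      ⟨boundary_simplexChain_zero α, simplexChain_mem_supported k α rfl⟩
    exact (congrArg _ (totalRetr_cycle ⟨_, hz⟩)).trans (hlof _ ⟨_, hz⟩)
  | n + 1, α =>
    obtain ⟨z, hz⟩ := homologyClass_surjective _
      (homologyRetr k X ((n + 1 : ℕ) : ℤ) (simplexChain k α))
    have hne : ((n + 1 : ℕ) : ℤ) ≠ 0 := by omega
    rw [totalRetr_simplexChain, ← hz, hlof, augmentation_of_mem k _ hne _ z.2.2,
      augmentation_of_mem k _ hne _ (simplexChain_mem_supported k α rfl)]

lemma totalRetr_surjective : Surjective (totalRetr k X ∘ₗ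
    (singularChains k X).totalCyclesIncl) := fun y => by
  obtain ⟨z, rfl⟩ := (singularChains k X).totalClass_surjective y
  exact ⟨z, totalRetr_totalCyclesIncl z⟩

lemma exists_cycle_totalRetr (y : TotalSingularHomology k X) :
    ∃ c, boundary k X c = 0 ∧ totalRetr k X c = y := by
  obtain ⟨z, rfl⟩ := totalRetr_surjective y
  exact ⟨_, (singularChains k X).d_totalCyclesIncl z, rfl⟩

variable {Y : Type u} [TopologicalSpace Y]

def totalHomologyMap (k : Type v) [Field k] (f : C(X, Y)) :
    TotalSingularHomology k X →ₗ[k] TotalSingularHomology k Y :=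
  lmap fun n => homologyMap k f n

lemma totalHomologyMap_totalRetr (f : C(X, Y)) {c : Chains k X} (hc : boundary k X c = 0) :
    totalHomologyMap k f (totalRetr k X c) = totalRetr k Y (chainsMap k f c) := by
  obtain ⟨z, rfl⟩ := (singularChains k X).exists_totalCyclesIncl_eq c hc
  suffices h : totalHomologyMap k f ∘ₗ totalRetr k X ∘ₗ (singularChains k X).totalCyclesIncl =
      totalRetr k Y ∘ₗ chainsMap k f ∘ₗ (singularChains k X).totalCyclesIncl from
    lcongr_fun h z
  refine linearMap_ext k fun n => lin_ext fun z => ?_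
  simp only [lcomp_apply, DGModule.totalCyclesIncl, coeLinearMap_lof]; rw [totalRetr_cycle]
  refine (lmap_lof _ _ _).trans ?_
  exact (totalRetr_cycle ⟨_, chainsMap_mem_cycles k f n z z.2⟩).symm

lemma diagonal_chainsMap (f : C(X, Y)) (c : Chains k X) : diagonal k Y (chainsMap k f c) =
    tmap (chainsMap k f) (chainsMap k f) (diagonal k X c) := by
  suffices h : diagonal k Y ∘ₗ chainsMap k f =
      tmap (chainsMap k f) (chainsMap k f) ∘ₗ diagonal k X from
    lcongr_fun h c
  refine chains_ext k fun n α => ?_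
  have hdiag : ∀ {Z : Type u} [TopologicalSpace Z] (β : Sing n Z),
      diagonal k Z (simplexChain k β) = ∑ j : Fin (n + 1),
      simplexChain k (β.front j (by omega)) ⊗ₜ[k] simplexChain k (β.back j (n - j) (by omega)) :=
    fun β => (linearCombination_single k _ _).trans (one_smul _ _)
  rw [lcomp_apply, lcomp_apply, chainsMap_simplexChain, hdiag, hdiag, map_sum]
  refine sum_congr rfl fun j _ => ?_
  rw [map_tmul, chainsMap_simplexChain, chainsMap_simplexChain]; rfl

lemma augmentation_chainsMap (f : C(X, Y)) (c : Chains k X) :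
    augmentation k Y (chainsMap k f c) = augmentation k X c := by
  suffices h : augmentation k Y ∘ₗ chainsMap k f = augmentation k X from lcongr_fun h c
  refine chains_ext k fun n α => ?_
  rw [lcomp_apply, chainsMap_simplexChain]; simp [augmentation, simplexChain]

lemma homologyComul_totalHomologyMap (f : C(X, Y)) (y : TotalSingularHomology k X) :
    homologyComul k Y (totalHomologyMap k f y) =
      tmap (totalHomologyMap k f) (totalHomologyMap k f) (homologyComul k X y) := by
  obtain ⟨z, rfl⟩ := (singularChains k X).totalClass_surjective y
  have hz := (singularChains k X).d_totalCyclesIncl z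
  have h0 : ∀ x, (totalRetr k Y ∘ₗ chainsMap k f) (boundary k X x) = 0 := fun x => by
    rw [lcomp_apply, chainsMap_boundary, totalRetr_boundary]
  have h1 : ∀ z, totalHomologyMap k f ((singularChains k X).totalClass z) =
      (totalRetr k Y ∘ₗ chainsMap k f) ((singularChains k X).totalCyclesIncl z) := fun z => by
    rw [← totalRetr_totalCyclesIncl, totalHomologyMap_totalRetr f
      ((singularChains k X).d_totalCyclesIncl z)]; rfl
  have h := (homologyComul_spec k X).map_apply h0 h0 h1 h1 z
  rw [h, ← totalRetr_totalCyclesIncl, totalHomologyMap_totalRetr f hz, homologyComul_totalRetr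
    (by rw [← chainsMap_boundary]; erw [hz]; rw [map_zero]; exact zero_mem _),
    diagonal_chainsMap, ← lcomp_apply, ← tmap_comp]

lemma homologyCounit_totalHomologyMap (f : C(X, Y)) (y : TotalSingularHomology k X) :
    homologyCounit k Y (totalHomologyMap k f y) = homologyCounit k X y := by
  obtain ⟨c, hc, rfl⟩ := exists_cycle_totalRetr y
  rw [totalHomologyMap_totalRetr f hc, homologyCounit_totalRetr,
    homologyCounit_totalRetr, augmentation_chainsMap]

lemma totalHomologyMap_injective (f : C(X, Y)) (hf : ∀ n, Function.Injective (homologyMap k f n)) :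
    Function.Injective (totalHomologyMap k f) :=
  DFinsupp.mapRange_injective _ (fun n => map_zero (homologyMap k f n)) |>.2 hf

end HomologyCoalgebra

/-! ### Transport of the homology of the fibers to a fixed fiber -/

section FiberRetr

variable [SimplyConnectedSpace B] (hπ) (k) (b)

def totalFiberTransport (x : B) :
    TotalSingularHomology k (Fiber π x) →ₗ[k] TotalSingularHomology k (Fiber π b) :=
  lmap fun n => (fiberTransport hπ k b x n).toLinearMap

lemma totalHomologyMap_totalFiberTransport {x : B} (γ : Path x b)
    (y : TotalSingularHomology k (Fiber π x)) :
    totalHomologyMap k (targetIncl π γ) (totalFiberTransport hπ k b x y) =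
      totalHomologyMap k (sourceIncl π γ) y := by
  suffices h : totalHomologyMap k (targetIncl π γ) ∘ₗ totalFiberTransport hπ k b x =
      totalHomologyMap k (sourceIncl π γ) from lcongr_fun h y
  refine linearMap_ext k fun n => lin_ext fun u => ?_
  simp only [lcomp_apply, totalHomologyMap, totalFiberTransport, lmap_lof]
  exact congrArg _ (isFiberTransport_fiberTransport hπ k b x γ n u).symm

lemma homologyComul_totalFiberTransport (x : B) (y : TotalSingularHomology k (Fiber π x)) :
    homologyComul k (Fiber π b) (totalFiberTransport hπ k b x y) =
      tmap (totalFiberTransport hπ k b x) (totalFiberTransport hπ k b x)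
        (homologyComul k (Fiber π x) y) := by
  let γ : Path x b := PathConnectedSpace.somePath x b
  have hinj := totalHomologyMap_injective (targetIncl π γ)
    fun n => (hπ.homologyMap_targetIncl_bijective k γ n).1
  apply map_injective_of_flat_flat _ _ hinj hinj
  rw [← homologyComul_totalHomologyMap, totalHomologyMap_totalFiberTransport,
    homologyComul_totalHomologyMap]
  refine Eq.trans ?_ (lcomp_apply _ _ _)
  rw [← tmap_comp]
  congr 2 <;> exact lin_ext fun y => (totalHomologyMap_totalFiberTransport hπ k b γ y).symm

lemma homologyCounit_totalFiberTransport (x : B) (y : TotalSingularHomology k (Fiber π x)) :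
    homologyCounit k (Fiber π b) (totalFiberTransport hπ k b x y) =
      homologyCounit k (Fiber π x) y := by
  let γ : Path x b := PathConnectedSpace.somePath x b
  rw [← homologyCounit_totalHomologyMap (targetIncl π γ), totalHomologyMap_totalFiberTransport,
    homologyCounit_totalHomologyMap]

/-- A singular simplex with constant projection `x`, as a simplex of the fiber over `x`. -/
def Sing.toFiber {x : B} {n : ℕ} (α : Sing n E) (h : ∀ t, π (α t) = x) : Sing n (Fiber π x) :=
  ⟨fun t => ⟨α t, h t⟩, by fun_prop⟩

open Classical in
/-- The map on chains which sends a simplex contained in a fiber to its class, transported to the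
fixed fiber, and all other simplices to zero. -/
def fiberRetr : Chains k E →ₗ[k] TotalSingularHomology k (Fiber π b) :=
  linearCombination k fun s : (Σ n : ℕ, Sing n E) =>
    if h : ∀ t, π (s.2 t) = π (s.2 (vertex 0)) then
      totalFiberTransport hπ k b _ (totalRetr k _ (simplexChain k (s.2.toFiber h))) else 0

lemma fiberRetr_fiberIncl {x : B} (c : Chains k (Fiber π x)) :
    fiberRetr hπ k b (chainsMap k (fiberIncl π x) c) =
      totalFiberTransport hπ k b x (totalRetr k _ c) := by
  suffices h : fiberRetr hπ k b ∘ₗ chainsMap k (fiberIncl π x) =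
      totalFiberTransport hπ k b x ∘ₗ totalRetr k _ from lcongr_fun h c
  refine chains_ext k fun n α => ?_
  rw [lcomp_apply, lcomp_apply, chainsMap_simplexChain]
  refine ((linearCombination_single k _ _).trans (one_smul _ _)).trans ?_
  have hα : ∀ t, π ((fiberIncl π x).comp α t) = x := fun t => (α t).2
  rw [dif_pos fun t => (hα t).trans (hα _).symm]
  have key : ∀ (x' : B) (e : x' = x) (h : ∀ t, π ((fiberIncl π x).comp α t) = x'),
      totalFiberTransport hπ k b x' (totalRetr k _ (simplexChain k
        (Sing.toFiber (π := π) ((fiberIncl π x).comp α) h))) =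
      totalFiberTransport hπ k b x (totalRetr k _ (simplexChain k α)) := by
    rintro _ rfl h; rfl
  exact key _ (hα _) _

omit [SimplyConnectedSpace B] in
lemma Sing.factorsThrough_zero_iff {n : ℕ} {V : Sing n B} :
    V.FactorsThrough 0 ↔ ∀ t, V t = V (vertex 0) := by
  constructor
  · rintro ⟨s, -, V', rfl⟩ t
    refine congrArg V' (Subsingleton.elim (α := stdSimplex ℝ (Fin 1)) _ _)
  · intro h
    refine ⟨⟨fun _ => 0, fun _ _ _ => le_rfl⟩, fun i => ⟨0, Subsingleton.elim (α := Fin 1) _ _⟩,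
      ContinuousMap.const _ (V (vertex 0)), ContinuousMap.ext h⟩

omit [SimplyConnectedSpace B] in
lemma serreWeight_eq_zero_iff (s : Σ n : ℕ, Sing n E) : serreWeight π s = 0 ↔
    ∀ t, π (s.2 t) = π (s.2 (vertex 0)) := by
  refine Iff.trans ?_ (Sing.factorsThrough_zero_iff (V := (π.comp s.2 : Sing s.1 B)))
  unfold serreWeight
  constructor
  · intro h
    have := Sing.factorsThrough_weight (π.comp s.2 : Sing s.1 B)
    rwa [Int.natCast_eq_zero.1 h] at this
  · intro h; exact Int.natCast_eq_zero.2 (Nat.le_zero.1 h.weight_le)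

lemma fiberRetr_eq_zero {c : Chains k E} (hc : c ∈ supported k k {s | serreWeight π s ≠ 0}) :
    fiberRetr hπ k b c = 0 := by
  refine eq_on_of_single (fiberRetr hπ k b) 0 _ (fun s hs => ?_) c hc
  refine ((linearCombination_single k _ _).trans (one_smul _ _)).trans ?_
  rw [dif_neg fun h => hs ((serreWeight_eq_zero_iff s).2 h)]; rfl

omit [SimplyConnectedSpace B] in
lemma mem_of_fiber {V : Type*} [AddCommMonoid V] [Module k V] (f : Chains k E →ₗ[k] V)
    (W : Submodule k V) (h : ∀ x (c : Chains k (Fiber π x)), f (chainsMap k (fiberIncl π x) c) ∈ W) :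
    ∀ c ∈ 𝗦.fil 0, f c ∈ W := by
  refine map_mem_of_single f _ W fun s hs => ?_
  have h0 : serreWeight π s = 0 :=
    le_antisymm ((mem_serreSimplices_iff π 0 s).1 hs) (Int.natCast_nonneg _)
  have := h _ (simplexChain k (s.2.toFiber ((serreWeight_eq_zero_iff s).1 h0)))
  rwa [chainsMap_simplexChain] at this

lemma fiberRetr_boundary {c : Chains k E} (hc : c ∈ 𝗦.fil 0) :
    fiberRetr hπ k b (boundary k E c) = 0 := by
  refine mem_of_fiber k (fiberRetr hπ k b ∘ₗ boundary k E) ⊥ (fun x c => ?_) c hc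
  rw [mem_bot, lcomp_apply, ← chainsMap_boundary, fiberRetr_fiberIncl, totalRetr_boundary, map_zero]

lemma homologyCounit_fiberRetr {c : Chains k E} (hc : c ∈ 𝗦.fil 0) :
    homologyCounit k _ (fiberRetr hπ k b c) = augmentation k E c := by
  rw [← sub_eq_zero]
  refine mem_of_fiber k (homologyCounit k _ ∘ₗ fiberRetr hπ k b - augmentation k E) ⊥
    (fun x c => ?_) c hc
  rw [mem_bot, lsub_apply, lcomp_apply, fiberRetr_fiberIncl,
    homologyCounit_totalFiberTransport, homologyCounit_totalRetr, augmentation_chainsMap,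
    sub_self]

end FiberRetr

section

open Simplicial MonoidalCategory Opposite

/-! ### The simplices over a simplex of the base -/

section SimplicialMaps

variable {X Y : SSet.{u}}

def sapp (Q : X ⟶ Y) {n : ℕ} (x : X _⦋n⦌) : Y _⦋n⦌ := Q.app (op ⦋n⦌) x

lemma sapp_spull (Q : X ⟶ Y) {m n : ℕ} (x : X _⦋n⦌) (f : Fin (m + 1) →o Fin (n + 1)) :
    sapp Q (spull x f) = spull (sapp Q x) f := app_spull Q x f

def smap (Q : X ⟶ Y) : SChains k X →ₗ[k] SChains k Y :=
  linearCombination k fun s : (Σ n : ℕ, X _⦋n⦌) => schain k (sapp Q s.2)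

lemma smap_schain (Q : X ⟶ Y) {n : ℕ} (x : X _⦋n⦌) : smap Q (schain k x) = schain k (sapp Q x) := by
  simp [smap, schain]

lemma sboundary_smap (Q : X ⟶ Y) (c : SChains k X) :
    sboundary k Y (smap Q c) = smap Q (sboundary k X c) := by
  suffices h : sboundary k Y ∘ₗ smap Q = smap Q ∘ₗ sboundary k X from lcongr_fun h c
  refine schains_ext fun n x => ?_
  change sboundary k Y (smap Q (schain k x)) = smap Q (sboundary k X (schain k x)); rw [smap_schain]
  match n, x with
  | 0, x => rw [sboundary_schain_zero, sboundary_schain_zero, map_zero]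
  | n + 1, x =>
    rw [sboundary_schain_succ, sboundary_schain_succ, map_sum]
    refine sum_congr rfl fun i _ => ?_
    rw [map_smul, sface, sface, smap_schain, sapp_spull]

lemma schain_mem {n : ℕ} (x : X _⦋n⦌) {T : Set (Σ n : ℕ, X _⦋n⦌)} (h : ⟨n, x⟩ ∈ T) :
    schain k x ∈ supported k k T := single_mem_supported _ _ h

lemma sboundary_mem {T T' : Set (Σ n : ℕ, X _⦋n⦌)}
    (h : ∀ (n : ℕ) (x : X _⦋n + 1⦌), ⟨n + 1, x⟩ ∈ T → ∀ f : Fin (n + 1) →o Fin (n + 2),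
      (⟨n, spull x f⟩ : Σ n : ℕ, X _⦋n⦌) ∈ T') :
    ∀ c ∈ supported k k T, sboundary k X c ∈ supported k k T' := by
  refine map_mem_of_single _ _ _ fun ⟨n, x⟩ hx => ?_
  change sboundary k X (schain k x) ∈ _
  match n, x, hx with
  | 0, x, _ => rw [sboundary_schain_zero]; exact zero_mem _
  | n + 1, x, hx =>
    rw [sboundary_schain_succ]
    exact sum_mem fun i _ => Submodule.smul_mem _ _ (schain_mem _ (h n x hx _))

lemma smap_prism_mem (Q : Cylinder X ⟶ Y) {T : Set (Σ n : ℕ, X _⦋n⦌)} {T' : Set (Σ n : ℕ, Y _⦋n⦌)}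
    (h : ∀ (n : ℕ) (x : X _⦋n⦌), ⟨n, x⟩ ∈ T → ∀ (f : Fin (n + 2) →o Fin (n + 1))
      (θ : (Δ[1] : SSet.{u}) _⦋n + 1⦌),
      (⟨n + 1, sapp Q (cylMk (spull x f) θ)⟩ : Σ n : ℕ, Y _⦋n⦌) ∈ T') :
    ∀ c ∈ supported k k T, smap Q (prism k X c) ∈ supported k k T' := by
  refine map_mem_of_single (smap Q ∘ₗ prism k X) _ _ fun ⟨n, x⟩ hx => ?_
  change smap Q (prism k X (schain k x)) ∈ _; rw [prism_schain, map_sum]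
  refine sum_mem fun i _ => ?_
  rw [map_smul, prismFace, smap_schain]; exact Submodule.smul_mem _ _ (schain_mem _ (h n x hx _ _))

lemma exists_sub_sboundary_mem (Q : Cylinder X ⟶ X)
    (hQ : ∀ (n : ℕ) (x : X _⦋n⦌), sapp Q (cylMk x (threshold n (n + 1))) = x)
    (L A : Set (Σ n : ℕ, X _⦋n⦌))
    (hL : ∀ (n : ℕ) (x : X _⦋n⦌), ⟨n, x⟩ ∈ L → ∀ (f : Fin (n + 2) →o Fin (n + 1))
      (θ : (Δ[1] : SSet.{u}) _⦋n + 1⦌),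
      (⟨n + 1, sapp Q (cylMk (spull x f) θ)⟩ : Σ n : ℕ, X _⦋n⦌) ∈ L)
    (hA : ∀ (n : ℕ) (x : X _⦋n⦌), ⟨n, x⟩ ∈ A → ∀ (f : Fin (n + 2) →o Fin (n + 1))
      (θ : (Δ[1] : SSet.{u}) _⦋n + 1⦌),
      (⟨n + 1, sapp Q (cylMk (spull x f) θ)⟩ : Σ n : ℕ, X _⦋n⦌) ∈ A)
    (hLA : ∀ (n : ℕ) (x : X _⦋n⦌), ⟨n, x⟩ ∈ L →
      (⟨n, sapp Q (cylMk x (threshold n 0))⟩ : Σ n : ℕ, X _⦋n⦌) ∈ A)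
    (m : ℕ) {c : SChains k X} (hc : c ∈ supported k k L)
    (hm : c ∈ supported k k ({s | s.1 = m} : Set (Σ n : ℕ, X _⦋n⦌)))
    (hd : sboundary k X c ∈ supported k k A) :
    ∃ w ∈ supported k k L, w ∈ supported k k ({s | s.1 = m + 1} : Set (Σ n : ℕ, X _⦋n⦌)) ∧
      c - sboundary k X w ∈ supported k k A := by
  let φ : SChains k X →ₗ[k] SChains k X := linearCombination k fun s : (Σ n : ℕ, X _⦋n⦌) =>
      schain k (sapp Q (cylMk s.2 (threshold s.1 0)))
  have hφ : ∀ c, sboundary k X (smap Q (prism k X c)) + smap Q (prism k X (sboundary k X c)) =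
      φ c - c := by
    intro c
    suffices e : sboundary k X ∘ₗ smap Q ∘ₗ prism k X + smap Q ∘ₗ prism k X ∘ₗ sboundary k X =
        φ - idₗ from lcongr_fun e c
    refine schains_ext fun n x => ?_
    have hφx : φ (schain k x) = schain k (sapp Q (cylMk x (threshold n 0))) := by simp [φ, schain]
    change sboundary k X (smap Q (prism k X (schain k x))) +
      smap Q (prism k X (sboundary k X (schain k x))) = φ (schain k x) - schain k x
    rw [sboundary_smap, ← map_add, sboundary_prism, map_sub, smap_schain, smap_schain, hQ, hφx]
  refine ⟨-smap Q (prism k X c), neg_mem (smap_prism_mem Q hL c hc),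
    neg_mem (smap_prism_mem Q (fun n x hx f θ => ?_) c hm), ?_⟩
  · have hx : n = m := hx
    exact congrArg (· + 1) hx
  · have e : c - sboundary k X (-smap Q (prism k X c)) =
        φ c - smap Q (prism k X (sboundary k X c)) := by
      rw [map_neg, sub_neg_eq_add, ← eq_sub_iff_add_eq.1 (hφ c)]; abel
    rw [e]
    refine sub_mem (map_mem_of_single φ L _ (fun ⟨n, x⟩ hx => ?_) c hc) (smap_prism_mem Q hA _ hd)
    have hφx : φ (schain k x) = schain k (sapp Q (cylMk x (threshold n 0))) := by simp [φ, schain]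
    exact (congrArg (· ∈ _) hφx).mpr (schain_mem _ (hLA n x hx))

end SimplicialMaps

section SimplexPull

variable (π) {p : ℕ} (V : Sing p B)

/-- The simplicial set of the simplices `α` of `E` with a monotone map `s` such that
`π ∘ α = V ∘ s`. -/
def SimplexPull : SSet.{u} where
  obj n := {x : (Fin (n.unop.len + 1) →o Fin (p + 1)) × Sing n.unop.len E //
    π.comp x.2 = Sing.pull V x.1}
  map {m _} f := ↾fun x => ⟨(x.1.1.comp f.unop.toOrderHom, x.1.2.pull f.unop.toOrderHom),
    (congrArg (fun W : Sing m.unop.len B => Sing.pull W f.unop.toOrderHom) x.2).trans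
      (Sing.pull_pull V x.1.1 f.unop.toOrderHom)⟩
  map_id n := by
    refine ConcreteCategory.ext (DFunLike.ext _ _ fun x => Subtype.ext (Prod.ext rfl ?_))
    exact Sing.pull_id _
  map_comp f g := by
    refine ConcreteCategory.ext (DFunLike.ext _ _ fun x => Subtype.ext (Prod.ext rfl ?_))
    exact (Sing.pull_pull x.1.2 f.unop.toOrderHom g.unop.toOrderHom).symm

variable {π V}

local notation "𝗣" => SimplexPull π V

def spMk {n : ℕ} (s : Fin (n + 1) →o Fin (p + 1)) (α : Sing n E) (h : π.comp α = V.pull s) :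
    𝗣 _⦋n⦌ := ⟨(s, α), h⟩

def spFst {n : ℕ} (x : 𝗣 _⦋n⦌) : Fin (n + 1) →o Fin (p + 1) := x.1.1

def spSnd {n : ℕ} (x : 𝗣 _⦋n⦌) : Sing n E := x.1.2

lemma comp_spSnd {n : ℕ} (x : 𝗣 _⦋n⦌) : (π.comp (spSnd x) : Sing n B) = V.pull (spFst x) := x.2

lemma sp_ext {n : ℕ} {x y : 𝗣 _⦋n⦌} (h1 : spFst x = spFst y)
    (h2 : spSnd x = spSnd y) : x = y := Subtype.ext (Prod.ext h1 h2)

lemma spSnd_spull {m n : ℕ} (x : 𝗣 _⦋n⦌) (f : Fin (m + 1) →o Fin (n + 1)) :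
    spSnd (spull x f) = (spSnd x).pull f := rfl

variable (π V) in
def spHom : 𝗣 ⟶ SS E := homToSS (fun _ x => spSnd x) fun _ _ _ _ => rfl

lemma singApp_spHom {n : ℕ} (x : 𝗣 _⦋n⦌) : singApp (spHom π V) x = spSnd x := rfl

/-- The position of a simplex of the cylinder, moved by `c` at the end `1`. -/
def moveHom (c : Fin (p + 1) →o Fin (p + 1)) (hc : ∀ i, i ≤ c i) {n : ℕ}
    (x : (Cylinder 𝗣) _⦋n⦌) : Fin (n + 1) →o Fin (p + 1) where
  toFun a := if SSet.stdSimplex.asOrderHom (cylSnd x) a = 0 then spFst (cylFst x) a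
    else c (spFst (cylFst x) a)
  monotone' a a' h := by
    have h1 := (spFst (cylFst x)).monotone h
    have h2 := (SSet.stdSimplex.asOrderHom (cylSnd x)).monotone h
    dsimp only
    split_ifs with h3 h4 h4
    · exact h1
    · exact h1.trans (hc _)
    · rw [h4] at h2; exact absurd (Fin.le_zero_iff.1 h2) h3
    · exact c.monotone h1

lemma moveHom_apply (c : Fin (p + 1) →o Fin (p + 1)) (hc : ∀ i, i ≤ c i) {n : ℕ}
    (x : (Cylinder 𝗣) _⦋n⦌) (a : Fin (n + 1)) : moveHom c hc x a =
      if SSet.stdSimplex.asOrderHom (cylSnd x) a = 0 then spFst (cylFst x) a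
      else c (spFst (cylFst x) a) := rfl

lemma IsSerreFibration.exists_move (hπ : IsSerreFibration π) (c : Fin (p + 1) →o Fin (p + 1))
    (hc : ∀ i, i ≤ c i) :
    ∃ Q : Cylinder 𝗣 ⟶ 𝗣, (∀ (n : ℕ) (x : 𝗣 _⦋n⦌), sapp Q (cylMk x (threshold n (n + 1))) = x) ∧
      ∀ (n : ℕ) (x : (Cylinder 𝗣) _⦋n⦌), spFst (sapp Q x) = moveHom c hc x := by
  have h0 : ∀ (n : ℕ) (x : 𝗣 _⦋n⦌),
      moveHom c hc (cylMk x (threshold n (n + 1))) = spFst x := fun n x =>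
    OrderHom.ext _ _ (funext fun a => if_pos (asOrderHom_threshold_last.{u} n a))
  obtain ⟨P, hP0, hP⟩ := hπ.exists_lift_cylinder (spHom π V)
    (homToSS (X := Cylinder 𝗣) (fun m x => V.pull (moveHom c hc x))
      (fun m n g x => (Sing.pull_pull V (moveHom c hc x) g).symm)) (by
        intro n x
        exact (congrArg (fun s : Fin (n + 1) →o Fin (p + 1) => V.pull s) (h0 n x)).trans
          (comp_spSnd x).symm)
  let Q : Cylinder 𝗣 ⟶ 𝗣 :=
    { app := fun m => ↾fun x : (Cylinder 𝗣).obj m =>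
        (spMk (n := m.unop.len) (moveHom (n := m.unop.len) c hc x) (singApp (n := m.unop.len) P x)
          (hP m.unop.len x) : 𝗣 _⦋m.unop.len⦌)
      naturality := fun m n g => by
        refine ConcreteCategory.ext (DFunLike.ext _ _ fun x => ?_)
        refine sp_ext (n := n.unop.len) rfl ?_
        exact singApp_spull (n := m.unop.len) P x g.unop.toOrderHom }
  exact ⟨Q, fun n x => sp_ext (h0 n x) (hP0 n x), fun n x => rfl⟩

variable (π V) in
def lowSimplices (j : ℕ) : Set (Σ n : ℕ, 𝗣 _⦋n⦌) := {x | ∀ a, (spFst x.2 a : ℕ) ≤ j}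

variable (π V) in
/-- The simplices whose position is in `{0, …, j}` and misses one of the numbers smaller than
`t`. -/
def missSimplices (j t : ℕ) : Set (Σ n : ℕ, 𝗣 _⦋n⦌) :=
  {x | (∀ a, (spFst x.2 a : ℕ) ≤ j) ∧ ∃ i < t, ∀ a, (spFst x.2 a : ℕ) ≠ i}

lemma IsSerreFibration.exists_sub_sboundary_mem (hπ : IsSerreFibration π) (k : Type v) [Field k]
    {j : ℕ} (hj : j < p) {m : ℕ} {c : SChains k 𝗣}
    (hc : c ∈ supported k k (lowSimplices π V (j + 1)))
    (hm : c ∈ supported k k ({s | s.1 = m} : Set (Σ n : ℕ, 𝗣 _⦋n⦌)))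
    (hd : sboundary k _ c ∈ supported k k (missSimplices π V (j + 1) (j + 1))) :
    ∃ w ∈ supported k k (lowSimplices π V (j + 1)), w ∈ supported k k
        ({s | s.1 = m + 1} : Set (Σ n : ℕ, 𝗣 _⦋n⦌)) ∧
      c - sboundary k _ w ∈ supported k k (missSimplices π V (j + 1) (j + 1)) := by
  let e : Fin (p + 1) →o Fin (p + 1) :=
    { toFun := fun i => if (i : ℕ) = j then ⟨j + 1, by omega⟩ else i
      monotone' := fun a a' h => by
        have h' : (a : ℕ) ≤ a' := h
        dsimp only; rw [Fin.le_def]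
        split_ifs
        · exact le_rfl
        · change j + 1 ≤ (a' : ℕ); omega
        · change (a : ℕ) ≤ j + 1; omega
        · exact h' }
  have he : ∀ i, (e i : ℕ) = if (i : ℕ) = j then j + 1 else i := fun i => by
    change ((if (i : ℕ) = j then _ else i : Fin (p + 1)) : ℕ) = _
    split_ifs <;> rfl
  have hle : ∀ i, i ≤ e i := fun i => by
    rw [Fin.le_def, he]
    split_ifs <;> omega
  obtain ⟨Q, hQ1, hQ2⟩ := hπ.exists_move (V := V) e hle
  have hval : ∀ (n : ℕ) (x : (Cylinder 𝗣) _⦋n⦌) (a), (spFst (sapp Q x) a : ℕ) = spFst (cylFst x) a ∨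
      (spFst (sapp Q x) a : ℕ) = e (spFst (cylFst x) a) := fun n x a => by
    rw [hQ2, moveHom_apply]
    split_ifs
    · exact Or.inl rfl
    · exact Or.inr rfl
  refine SerreCoalgebra.exists_sub_sboundary_mem Q hQ1 (lowSimplices π V (j + 1))
    (missSimplices π V (j + 1) (j + 1)) (fun n x hx f θ a => ?_)
    (fun n x ⟨hx, i, hi, hxi⟩ f θ => ⟨fun a => ?_, i, hi, fun a => ?_⟩)
    (fun n x hx => ⟨fun a => ?_, j, j.lt_succ_self, fun a => ?_⟩) m hc hm hd
  · have h1 : (spFst x (f a) : ℕ) ≤ j + 1 := hx (f a)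
    rcases hval _ (cylMk (spull x f) θ) a with h | h
    · exact h.le.trans h1
    · rw [he] at h
      refine h.le.trans ?_
      split_ifs
      · exact le_rfl
      · exact h1
  · have h1 : (spFst x (f a) : ℕ) ≤ j + 1 := hx (f a)
    rcases hval _ (cylMk (spull x f) θ) a with h | h
    · exact h.le.trans h1
    · rw [he] at h
      refine h.le.trans ?_
      split_ifs
      · exact le_rfl
      · exact h1
  · have h1 : (spFst x (f a) : ℕ) ≠ i := hxi (f a)
    rcases hval _ (cylMk (spull x f) θ) a with h | h
    · exact fun h' => h1 (h.symm.trans h')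
    · rw [he] at h
      refine fun h' => h1 ?_
      rw [h'] at h
      split_ifs at h
      · omega
      · exact h.symm
  · have h1 : (spFst x a : ℕ) ≤ j + 1 := hx a
    rcases hval _ (cylMk x (threshold n 0)) a with h | h
    · exact h.le.trans h1
    · rw [he] at h
      refine h.le.trans ?_
      split_ifs
      · exact le_rfl
      · exact h1
  · have h : (spFst (sapp Q (cylMk x (threshold n 0))) a : ℕ) = e (spFst x a) := by
      rw [hQ2, moveHom_apply, cylSnd_cylMk, if_neg]
      · rfl
      exact fun h => one_ne_zero ((asOrderHom_threshold_zero.{u} n a).symm.trans h)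
    change (spFst (sapp Q (cylMk x (threshold n 0))) a : ℕ) ≠ j; rw [h, he]
    split_ifs with h
    · omega
    · exact h

end SimplexPull

/-! ### The homology of the simplices over a simplex of the base -/

section PositionMap

variable {p : ℕ} {V : Sing p B} {A : Type*} [AddCommGroup A] [Module k A]

local notation "𝗣" => SimplexPull π V

open Classical in
/-- The map which sends a simplex of dimension `q + j` and of position `0, …, 0, 1, …, j` to the
value of `g` on its front face of dimension `q`. -/
def positionMap (g : Chains k E →ₗ[k] A) (j q : ℕ) : SChains k 𝗣 →ₗ[k] A :=
  linearCombination k fun x : (Σ n : ℕ, 𝗣 _⦋n⦌) =>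
    if x.1 = q + j ∧ ∀ a, (spFst x.2 a : ℕ) = a - q then
      g (simplexChain k ((spSnd x.2).pull (clampHom q x.1 OrderHom.id))) else 0

open Classical in
lemma positionMap_schain (g : Chains k E →ₗ[k] A) (j q : ℕ) {n : ℕ}
    (x : 𝗣 _⦋n⦌) : positionMap g j q (schain k x) = if n = q + j ∧ ∀ a, (spFst x a : ℕ) = a - q then
        g (simplexChain k ((spSnd x).pull (clampHom q n OrderHom.id))) else 0 :=
  (linearCombination_single k _ _).trans (one_smul _ _)

open Classical in
lemma positionMap_sface (g : Chains k E →ₗ[k] A) (j q : ℕ) {n : ℕ}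
    (x : 𝗣 _⦋n⦌) (i : ℕ) : positionMap g j q (sface k x (q + j) (skipHom i)) =
      if ∀ a ≤ q + j, (spFst x (clampHom (q + j) n (skipHom i) (Fin.ofNat _ a)) : ℕ) = a - q then
        g (simplexChain k ((spSnd x).pull (clampHom q n (skipHom i)))) else 0 := by
  rw [sface, positionMap_schain, spSnd_spull, Sing.pull_pull]
  refine if_congr ?_ ?_ rfl
  · simp only [true_and]
    constructor
    · intro h a ha
      refine (h (Fin.ofNat _ a)).trans ?_
      rw [Fin.val_ofNat, Nat.mod_eq_of_lt (by omega)]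
    · intro h a
      have := h a (by omega)
      rwa [Fin.ofNat_eq_cast, Fin.cast_val_eq_self] at this
  · congr 3
    have := clampHom_comp (l := q) (m := q + j) (N := n) (skipHom i) OrderHom.id
      (fun a ha => by change a ≤ q + j; omega)
    exact congrArg (fun f : Fin (q + 1) →o Fin (n + 1) => (f : Fin (q + 1) → Fin (n + 1))) this

lemma Sing.pull_const_factorsThrough {n m : ℕ} (W : Sing m B) (f : Fin (n + 1) → Fin (m + 1))
    (hf : ∀ a, f a = f 0) : (W.pull f).FactorsThrough 0 := by
  refine ⟨⟨fun _ => 0, fun _ _ _ => le_rfl⟩, fun i => ⟨0, Subsingleton.elim (α := Fin 1) _ _⟩,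
    W.pull fun _ => f 0, ?_⟩
  rw [Sing.pull_pull]; exact congrArg W.pull (funext hf)

lemma positionMap_sboundary_schain {g : Chains k E →ₗ[k] A}
    (hg : ∀ c ∈ 𝗦.fil 0, g (boundary k E c) = 0) (j q : ℕ) {n : ℕ}
    (x : 𝗣 _⦋n⦌) (hx : ∀ a, (spFst x a : ℕ) ≤ j + 1) :
    positionMap g j q (sboundary k _ (schain k x)) =
      (-1 : k) ^ (q + j + 1) • positionMap g (j + 1) q (schain k x) := by
  classical
  match n, x, hx with
  | 0, x, hx =>
    rw [sboundary_schain_zero, map_zero, positionMap_schain, if_neg (by omega), smul_zero]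
  | n + 1, x, hx =>
    by_cases hn : n = q + j
    swap
    · rw [positionMap_schain, if_neg (by omega), smul_zero, sboundary_schain_succ, map_sum]
      refine sum_eq_zero fun i _ => ?_
      rw [map_smul, sface, positionMap_schain, if_neg (by omega), smul_zero]
    subst hn; rw [sboundary_schain_succ, map_sum]; simp only [map_smul, positionMap_sface]
    let s : ℕ → ℕ := fun a => spFst x (Fin.ofNat _ a)
    have hs : ∀ a b, a ≤ b → b ≤ q + j + 1 → s a ≤ s b := fun a b hab hb => by
      refine (spFst x).monotone (Fin.le_def.2 ?_)
      rw [Fin.val_ofNat, Fin.val_ofNat, Nat.mod_eq_of_lt (by omega), Nat.mod_eq_of_lt (by omega)]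
      exact hab
    have hs1 : ∀ a, s a ≤ j + 1 := fun a => hx _
    have hclamp : ∀ i, (∀ a ≤ q + j, (spFst x (clampHom (q + j) (q + j + 1) (skipHom i)
        (Fin.ofNat _ a)) : ℕ) = a - q) ↔
        ∀ a ≤ q + j, s (if a < i then a else a + 1) = a - q := fun i => by
      refine forall₂_congr fun a ha => ?_
      rw [show clampHom (q + j) (q + j + 1) (skipHom i) (Fin.ofNat _ a) =
        Fin.ofNat (q + j + 2) (if a < i then a else a + 1) from Fin.ext ?_]
      change min (skipHom i _) _ = _
      rw [skipHom_apply, Fin.val_ofNat, Fin.val_ofNat, Nat.mod_eq_of_lt (by omega)]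
      split_ifs
      · rw [Nat.mod_eq_of_lt (by omega)]; omega
      · rw [Nat.mod_eq_of_lt (by omega)]; omega
    simp only [hclamp]
    have hfront : ∀ i, q < i → clampHom q (q + j + 1) (skipHom i) =
        clampHom q (q + j + 1) OrderHom.id := fun i hi => clampHom_congr fun a ha => by
      rw [skipHom_apply, if_pos (by omega)]; rfl
    rw [positionMap_schain]
    have hpos : (q + j + 1 = q + (j + 1) ∧ ∀ a, (spFst x a : ℕ) = a - q) ↔
        ∀ a ≤ q + j + 1, s a = a - q := by
      constructor
      · intro h a ha
        have := h.2 (Fin.ofNat _ a)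
        rwa [Fin.val_ofNat, Nat.mod_eq_of_lt (by omega)] at this
      · refine fun h => ⟨by omega, fun a => ?_⟩
        have := h a (by omega)
        simpa only [s, Fin.ofNat_eq_cast, Fin.cast_val_eq_self] using this
    simp only [hpos]
    by_cases hA : ∀ a ≤ q + j + 1, s a = a - q
    · rw [if_pos hA, Finset.sum_eq_single_of_mem (q + j + 1) (mem_range.2 (by omega))]
      · rw [if_pos, hfront _ (by omega)]; intro a ha; rw [if_pos (by omega), hA a (by omega)]
      · intro i hi hne; rw [mem_range] at hi; rw [if_neg, smul_zero]
        intro h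
        have := h (q + j) le_rfl
        rw [if_neg (by omega), hA _ le_rfl] at this; omega
    rw [if_neg hA, smul_zero]
    by_cases hB : ∃ i ≤ q + j + 1, ∀ a ≤ q + j, s (if a < i then a else a + 1) = a - q
    swap
    · refine sum_eq_zero fun i hi => ?_
      rw [mem_range] at hi; rw [if_neg fun h => hB ⟨i, by omega, h⟩, smul_zero]
    obtain ⟨i₀, hi₀, hP⟩ := hB
    obtain ⟨e, he, hse⟩ : ∃ e ≤ q + j, ∀ a ≤ q + j + 1,
        s a = if a ≤ e then a - q else a - 1 - q := by
      have h1 : ∀ a < i₀, s a = a - q := fun a ha => by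
        have := hP a (by omega)
        rwa [if_pos ha] at this
      have h2 : ∀ a, i₀ < a → a ≤ q + j + 1 → s a = a - 1 - q := fun a ha ha' => by
        have := hP (a - 1) (by omega)
        rwa [if_neg (by omega), Nat.sub_add_cancel (by omega)] at this
      by_cases h3 : s i₀ = i₀ - q
      · have hlt : i₀ ≤ q + j := by
          by_contra hlt
          refine hA fun a ha => ?_
          by_cases ha' : a < i₀
          · exact h1 a ha'
          · rw [show a = i₀ by omega, h3]
        refine ⟨i₀, hlt, fun a ha => ?_⟩
        split_ifs with h4
        · rcases Nat.lt_or_eq_of_le h4 with h5 | rfl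
          · exact h1 a h5
          · exact h3
        · exact h2 a (by omega) ha
      · have h4 : s i₀ = i₀ - 1 - q := by
          have lower : i₀ - 1 - q ≤ s i₀ := by
            by_cases h0 : i₀ = 0
            · omega
            · rw [← Nat.sub_right_comm, Nat.sub_right_comm, ← h1 (i₀ - 1) (by omega)]
              exact hs _ _ (by omega) hi₀
          have upper : s i₀ ≤ i₀ - q := by
            by_cases h5 : i₀ = q + j + 1
            · have := hs1 i₀
              omega
            · have := hs i₀ (i₀ + 1) (by omega) (by omega)
              rw [h2 (i₀ + 1) (by omega) (by omega)] at this; omega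
          omega
        refine ⟨i₀ - 1, by omega, fun a ha => ?_⟩
        split_ifs with h5
        · by_cases h6 : a < i₀
          · exact h1 a h6
          · rw [show a = i₀ by omega, h4]; omega
        · by_cases h6 : a = i₀
          · rw [h6, h4]
          · exact h2 a (by omega) ha
    by_cases heq : e ≤ q
    · have hs0 : ∀ a ≤ q + j + 1, s a = a - 1 - q := fun a ha => by
        rw [hse a ha]
        split_ifs <;> omega
      have hterm : ∀ i ∈ range (q + j + 2), (-1 : k) ^ i •
          (if ∀ a ≤ q + j, s (if a < i then a else a + 1) = a - q then
            g (simplexChain k ((spSnd x).pull (clampHom q (q + j + 1) (skipHom i)))) else 0) =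
          if i ∈ range (q + 2) then (-1 : k) ^ i •
            g (simplexChain k ((spSnd x).pull (clampHom q (q + j + 1) (skipHom i)))) else 0 := by
        intro i hi; rw [mem_range] at hi
        by_cases hiq : i < q + 2
        · rw [if_pos, if_pos (mem_range.2 hiq)]; intro a ha; rw [hs0 _ (by split_ifs <;> omega)]
          split_ifs <;> omega
        · rw [if_neg, if_neg (by rw [mem_range]; exact hiq), smul_zero]
          intro h
          have := h (q + 1) (by omega)
          rw [if_pos (by omega), hs0 _ (by omega)] at this; omega
      rw [sum_congr rfl hterm, Finset.sum_ite_mem, Finset.inter_eq_right.2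
        (Finset.range_subset_range.2 (by omega))]
      have hb : boundary k E (realize (spHom π V) (sface k x (q + 1) OrderHom.id)) =
          ∑ i ∈ range (q + 2), (-1 : k) ^ i •
            simplexChain k ((spSnd x).pull (clampHom q (q + j + 1) (skipHom i))) := by
        rw [boundary_realize, sboundary_sface_succ, map_sum]
        refine sum_congr rfl fun i _ => ?_
        rw [map_smul, realize_sface]; rfl
      rw [← hg (realize (spHom π V) (sface k x (q + 1) OrderHom.id)) ?_, hb, map_sum]
      · exact sum_congr rfl fun i _ => (map_smul _ _ _).symm
      · rw [realize_sface, singApp_spHom]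
        refine simplexChain_mem_supported k _ ⟨0, le_rfl, ?_⟩
        have h1 : (π.comp ((spSnd x).pull (clampHom (q + 1) (q + j + 1) OrderHom.id)) :
            Sing (q + 1) B) =
            V.pull (spFst x ∘ clampHom (q + 1) (q + j + 1) OrderHom.id) :=
          (congrArg (fun W : Sing _ B => Sing.pull W (clampHom (q + 1) (q + j + 1) OrderHom.id))
            (comp_spSnd x)).trans (Sing.pull_pull _ _ _)
        change Sing.FactorsThrough (π.comp ((spSnd x).pull
          (clampHom (q + 1) (q + j + 1) OrderHom.id)) : Sing (q + 1) B) 0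
        rw [h1]
        refine Sing.pull_const_factorsThrough V _ fun a => Fin.ext ?_
        have h0 : ∀ a : Fin (q + 2),
            (spFst x (clampHom (q + 1) (q + j + 1) OrderHom.id a) : ℕ) = 0 := fun a => by
          have h2 : clampHom (q + 1) (q + j + 1) OrderHom.id a = Fin.ofNat _ (a : ℕ) := Fin.ext (by
              change min (a : ℕ) _ = _; rw [Fin.val_ofNat, Nat.mod_eq_of_lt (by omega)]
              omega)
          rw [h2]; change s a = 0; rw [hs0 _ (by omega)]
          omega
        exact (h0 a).trans (h0 0).symm
    · have hterm : ∀ i ∈ range (q + j + 2), (-1 : k) ^ i •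
          (if ∀ a ≤ q + j, s (if a < i then a else a + 1) = a - q then
            g (simplexChain k ((spSnd x).pull (clampHom q (q + j + 1) (skipHom i)))) else 0) =
          if i ∈ ({e, e + 1} : Finset ℕ) then (-1 : k) ^ i •
            g (simplexChain k ((spSnd x).pull (clampHom q (q + j + 1) OrderHom.id))) else 0 := by
        intro i hi; rw [mem_range] at hi
        by_cases hie : i = e ∨ i = e + 1
        · rw [if_pos, if_pos (by simpa using hie), hfront i (by omega)]; intro a ha
          rw [hse _ (by split_ifs <;> omega)]
          split_ifs <;> omega
        · rw [if_neg, if_neg (by simpa using hie), smul_zero]; intro h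
          by_cases hlt : i < e
          · have := h (e - 1) (by omega)
            rw [if_neg (by omega), hse _ (by omega), if_pos (by omega)] at this; omega
          · have := h (e + 1) (by omega)
            rw [if_pos (by omega), hse _ (by omega), if_neg (by omega)] at this; omega
      rw [sum_congr rfl hterm, Finset.sum_ite_mem, Finset.inter_eq_right.2, Finset.sum_pair
        (by omega), ← add_smul, pow_succ, mul_neg_one, add_neg_cancel, zero_smul]
      intro i hi; rw [Finset.mem_insert, Finset.mem_singleton] at hi; rw [mem_range]
      omega

lemma positionMap_sboundary {g : Chains k E →ₗ[k] A}
    (hg : ∀ c ∈ 𝗦.fil 0, g (boundary k E c) = 0) (j q : ℕ)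
    {c : SChains k 𝗣}
    (hc : c ∈ supported k k (lowSimplices π V (j + 1))) :
    positionMap g j q (sboundary k _ c) = (-1 : k) ^ (q + j + 1) • positionMap g (j + 1) q c :=
  eq_on_of_single (positionMap g j q ∘ₗ sboundary k _)
    ((-1 : k) ^ (q + j + 1) • positionMap g (j + 1) q) _
    (fun s hs => positionMap_sboundary_schain hg j q s.2 hs) c hc

lemma positionMap_eq_zero (g : Chains k E →ₗ[k] A) (j q : ℕ) {c : SChains k 𝗣}
    (hc : c ∈ supported k k ({x | ∃ i ≤ j, ∀ a, (spFst x.2 a : ℕ) ≠ i} : Set (Σ n : ℕ, 𝗣 _⦋n⦌))) :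
    positionMap g j q c = 0 := by
  classical
  refine eq_on_of_single (positionMap g j q) 0 _ (fun ⟨n, x⟩ ⟨i, hi, hx⟩ => ?_) c hc
  refine (positionMap_schain g j q x).trans (if_neg fun ⟨hn, h⟩ => ?_)
  refine hx (Fin.ofNat _ (q + i)) ((h _).trans ?_)
  rw [Fin.val_ofNat, Nat.mod_eq_of_lt (by omega)]; omega

end PositionMap

section FiberRetrAt

variable [SimplyConnectedSpace B] (hπ) (k) (b)

def fiberRetrAt (q : ℤ) : Chains k E →ₗ[k] 𝗛 (Fiber π b) q :=
  component k ℤ (fun n => 𝗛 (Fiber π b) n) q ∘ₗ fiberRetr hπ k b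

lemma fiberRetrAt_fiberIncl (q : ℤ) {x : B} (c : Chains k (Fiber π x)) :
    fiberRetrAt hπ k b q (chainsMap k (fiberIncl π x) c) =
      fiberTransport hπ k b x q (homologyRetr k _ q c) := by
  suffices h : fiberRetrAt hπ k b q ∘ₗ chainsMap k (fiberIncl π x) =
      (fiberTransport hπ k b x q).toLinearMap ∘ₗ homologyRetr k _ q from
    lcongr_fun h c
  refine chains_ext k fun n α => ?_
  change component k ℤ (fun n => 𝗛 (Fiber π b) n) q
    (fiberRetr hπ k b (chainsMap k (fiberIncl π x) (simplexChain k α))) = _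
  rw [fiberRetr_fiberIncl, totalRetr_simplexChain, totalFiberTransport]
  refine (congrArg _ (lmap_lof _ _ _)).trans ?_
  by_cases h : (n : ℤ) = q
  · subst h; exact component.lof_self k _ _
  · refine (component.of k _ _ _).trans ?_
    rw [dif_neg h]; change 0 = fiberTransport hπ k b x q (homologyRetr k _ q (simplexChain k α))
    rw [homologyRetr_of_ne h (simplexChain_mem_supported k α rfl), map_zero]

lemma fiberRetrAt_boundary (q : ℤ) {c : Chains k E} (hc : c ∈ 𝗦.fil 0) :
    fiberRetrAt hπ k b q (boundary k E c) = 0 := by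
  rw [fiberRetrAt, lcomp_apply, fiberRetr_boundary hπ k b hc, map_zero]

lemma fiberRetrAt_eq_zero (q : ℤ) {c : Chains k E}
    (hc : c ∈ supported k k {s | serreWeight π s ≠ 0}) :
    fiberRetrAt hπ k b q c = 0 := by
  rw [fiberRetrAt, lcomp_apply, fiberRetr_eq_zero hπ k b hc, map_zero]

end FiberRetrAt

section PositionHomology

variable {p : ℕ} {V : Sing p B}

local notation "𝗣" => SimplexPull π V

lemma stdSimplex_map_const {n m : ℕ} (c : Fin (m + 1)) (t : stdSimplex ℝ (Fin (n + 1))) :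
    stdSimplex.map (fun _ => c) t = vertex c := by
  have h := map_comp_apply (fun _ : Fin (n + 1) => (0 : Fin 1)) (fun _ => c) t
  refine h.symm.trans ((congrArg _ (Subsingleton.elim (α := stdSimplex ℝ (Fin 1)) _
    (vertex 0))).trans (map_vertex _ _))

variable (π V) in
/-- The fiber over the initial vertex, as a simplicial subset of the simplices over `V`. -/
def initialFiber : SS (Fiber π V.initial) ⟶ 𝗣 where
  app n := ↾fun α : Sing n.unop.len (Fiber π V.initial) =>
    (spMk (n := n.unop.len) ⟨fun _ => 0, fun _ _ _ => le_rfl⟩ ((fiberIncl π V.initial).comp α)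
      (ContinuousMap.ext fun t => (α t).2.trans (congrArg V (stdSimplex_map_const 0 t).symm)) :
        𝗣 _⦋n.unop.len⦌)
  naturality _ _ _ := rfl

lemma spFst_initialFiber {n : ℕ} (α : Sing n (Fiber π V.initial)) (a : Fin (n + 1)) :
    spFst (sapp (initialFiber π V) (ofSing α)) a = 0 := rfl

variable (π V k) in
def initialFiberChains : Chains k (Fiber π V.initial) →ₗ[k] SChains k 𝗣 :=
  smap (initialFiber π V) ∘ₗ toSChains _

lemma initialFiberChains_simplexChain {n : ℕ} (α : Sing n (Fiber π V.initial)) :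
    initialFiberChains π k V (simplexChain k α) =
      schain k (sapp (initialFiber π V) (ofSing α)) := by
  rw [initialFiberChains, lcomp_apply, toSChains_simplexChain, smap_schain]

lemma sboundary_initialFiberChains (c : Chains k (Fiber π V.initial)) :
    sboundary k _ (initialFiberChains π k V c) = initialFiberChains π k V (boundary k _ c) := by
  rw [initialFiberChains, lcomp_apply, sboundary_smap, sboundary_toSChains]; rfl

lemma realize_initialFiberChains (c : Chains k (Fiber π V.initial)) :
    realize (spHom π V) (initialFiberChains π k V c) = chainsMap k (fiberIncl π V.initial) c := by
  suffices h : realize (spHom π V) ∘ₗ initialFiberChains π k V =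
      chainsMap k (fiberIncl π V.initial) from lcongr_fun h c
  refine chains_ext k fun n α => ?_
  rw [lcomp_apply, initialFiberChains_simplexChain, realize_schain, chainsMap_simplexChain]; rfl

lemma initialFiberChains_mem_low (j : ℕ) (c : Chains k (Fiber π V.initial)) :
    initialFiberChains π k V c ∈ supported k k (lowSimplices π V j) := by
  refine map_mem_of_single (initialFiberChains π k V) Set.univ _ (fun s _ => ?_) c
    (by rw [supported_univ]; trivial)
  refine (congrArg (· ∈ _) (initialFiberChains_simplexChain s.2)).mpr (schain_mem _ fun a => ?_)
  exact Nat.zero_le _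

lemma initialFiberChains_mem_degree {q : ℕ} {c : Chains k (Fiber π V.initial)}
    (hc : c ∈ chainsOfDegree k _ q) : initialFiberChains π k V c ∈ supported k k
      ({s | s.1 = q} : Set (Σ n : ℕ, 𝗣 _⦋n⦌)) := by
  refine map_mem_of_single (initialFiberChains π k V) _ _ (fun s hs => ?_) c hc
  exact (congrArg (· ∈ _) (initialFiberChains_simplexChain s.2)).mpr
    (schain_mem _ (Int.ofNat_inj.1 hs))

lemma exists_initialFiberChains_eq {q : ℕ} {c : SChains k 𝗣}
    (hc : c ∈ supported k k (lowSimplices π V 0))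
    (hq : c ∈ supported k k ({s | s.1 = q} : Set (Σ n : ℕ, 𝗣 _⦋n⦌))) :
    ∃ y ∈ chainsOfDegree k (Fiber π V.initial) q, initialFiberChains π k V y = c := by
  refine map_mem_of_single (idₗ (R := k) (M := SChains k 𝗣)) {x | x ∈ lowSimplices π V 0 ∧ x.1 = q}
    ((chainsOfDegree k (Fiber π V.initial) q).map (initialFiberChains π k V))
    (fun ⟨n, x⟩ ⟨hx, hn⟩ => ?_) c (fun x hx => ⟨hc hx, hq hx⟩)
  have h0 : ∀ a, spFst x a = 0 := fun a => Fin.ext (Nat.le_zero.1 (hx a))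
  have hfib : ∀ t, π (spSnd x t) = V.initial := fun t => by
    refine (DFunLike.congr_fun (comp_spSnd x) t).trans (congrArg V ?_)
    change stdSimplex.map (spFst x) t = _
    rw [show (spFst x : Fin (n + 1) → Fin (p + 1)) = fun _ => 0 from funext h0,
      stdSimplex_map_const]
  refine ⟨simplexChain k (Sing.toFiber (spSnd x) hfib),
    simplexChain_mem_supported k _ (congrArg Nat.cast hn), ?_⟩
  rw [initialFiberChains_simplexChain]
  exact congrArg (schain k) (sp_ext (OrderHom.ext _ _ (funext fun a => (h0 a).symm)) rfl)

lemma positionMap_initialFiberChains {A : Type*} [AddCommGroup A] [Module k A]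
    (g : Chains k E →ₗ[k] A) {q : ℕ} {c : Chains k (Fiber π V.initial)}
    (hc : c ∈ chainsOfDegree k _ q) :
    positionMap g 0 q (initialFiberChains π k V c) = g (chainsMap k (fiberIncl π V.initial) c) := by
  classical
  refine eq_on_of_single (positionMap g 0 q ∘ₗ initialFiberChains π k V)
    (g ∘ₗ chainsMap k (fiberIncl π V.initial)) _ (fun ⟨n, α⟩ hα => ?_) c hc
  obtain rfl : n = q := Int.ofNat_inj.1 hα
  change positionMap g 0 n (initialFiberChains π k V (simplexChain k α)) =
    g (chainsMap k (fiberIncl π V.initial) (simplexChain k α))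
  have hpos : n = n + 0 ∧ ∀ a, (spFst (sapp (initialFiber π V) (ofSing α)) a : ℕ) = a - n := by
    refine ⟨rfl, fun a => ?_⟩
    rw [spFst_initialFiber]; change 0 = _; omega
  rw [initialFiberChains_simplexChain, positionMap_schain, if_pos hpos, chainsMap_simplexChain,
    clampHom_id]
  exact congrArg (fun α => g (simplexChain k α)) (Sing.pull_id _)

lemma supported_miss_zero_one : supported k k (missSimplices π V 0 1) = ⊥ := by
  rw [show missSimplices π V 0 1 = ∅ from ?_, Finsupp.supported_empty]
  refine Set.eq_empty_of_forall_notMem fun x ⟨h, i, hi, h'⟩ => h' 0 ?_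
  have := h 0
  omega

lemma sboundary_mem_miss {j t : ℕ} {c : SChains k 𝗣}
    (hc : c ∈ supported k k (missSimplices π V j t)) :
    sboundary k _ c ∈ supported k k (missSimplices π V j t) :=
  sboundary_mem (T := missSimplices π V j t) (T' := missSimplices π V j t)
    (fun _ _ ⟨h, i, hi, h'⟩ f => ⟨fun a => h (f a), i, hi, fun a => h' (f a)⟩) c hc

lemma sboundary_mem_low {j : ℕ} {c : SChains k 𝗣} (hc : c ∈ supported k k (lowSimplices π V j)) :
    sboundary k _ c ∈ supported k k (lowSimplices π V j) :=
  sboundary_mem (T := lowSimplices π V j) (T' := lowSimplices π V j) (fun _ _ h f a => h (f a)) c hc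

lemma sboundary_mem_degree {X : SSet.{u}} {m : ℕ} {c : SChains k X}
    (hc : c ∈ supported k k ({s | s.1 = m + 1} : Set (Σ n : ℕ, X _⦋n⦌))) :
    sboundary k _ c ∈ supported k k ({s | s.1 = m} : Set (Σ n : ℕ, X _⦋n⦌)) := by
  refine sboundary_mem (T' := {s | s.1 = m}) (fun n _ h f => ?_) c hc
  have h : n + 1 = m + 1 := h
  exact Nat.succ_injective h

lemma miss_le_miss {j j' t t' : ℕ} (hj : j ≤ j') (ht : t ≤ t') :
    supported k k (missSimplices π V j t) ≤ supported k k (missSimplices π V j' t') :=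
  supported_mono (s := missSimplices π V j t) fun _ ⟨h, i, hi, h'⟩ =>
    ⟨fun a => (h a).trans hj, i, hi.trans_le ht, h'⟩

lemma low_le_low {j j' : ℕ} (hj : j ≤ j') : supported k k (lowSimplices π V j) ≤
      supported k k (lowSimplices π V j') :=
  supported_mono fun _ h a => (h a).trans hj

lemma low_le_miss (j : ℕ) : supported k k (lowSimplices π V j) ≤
      supported k k (missSimplices π V (j + 1) (j + 2)) :=
  supported_mono fun _ h =>
    ⟨fun a => (h a).trans j.le_succ, j + 1, by omega, fun a => by have := h a; omega⟩

lemma positionMap_miss {A : Type*} [AddCommGroup A] [Module k A] (g : Chains k E →ₗ[k] A)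
    (j q : ℕ) {i : ℕ} {c : SChains k 𝗣}
    (hc : c ∈ supported k k (missSimplices π V i (j + 1))) : positionMap g j q c = 0 :=
  positionMap_eq_zero g j q (supported_mono (s := missSimplices π V i (j + 1))
      (t := {x | ∃ i ≤ j, ∀ a, (spFst x.2 a : ℕ) ≠ i})
      (fun _ ⟨_, i, hi, h'⟩ => ⟨i, Nat.lt_succ_iff.1 hi, h'⟩) hc)

variable [SimplyConnectedSpace B]

lemma exists_positionMap_eq (hπ : IsSerreFibration π) (b : B) (q : ℕ) {j : ℕ} (hj : j ≤ p)
    (h : 𝗛 (Fiber π b) q) :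
    ∃ z ∈ supported k k (lowSimplices π V j), z ∈ supported k k
        ({s | s.1 = q + j} : Set (Σ n : ℕ, 𝗣 _⦋n⦌)) ∧
      sboundary k _ z ∈ supported k k (missSimplices π V j (j + 1)) ∧
      positionMap (fiberRetrAt hπ k b q) j q z = h := by
  induction j generalizing h with
  | zero =>
    obtain ⟨c, hc⟩ := homologyClass_surjective (k := k) q
      ((fiberTransport hπ k b V.initial q).symm h)
    refine ⟨initialFiberChains π k V c, initialFiberChains_mem_low 0 _,
      initialFiberChains_mem_degree c.2.2, ?_, ?_⟩
    · have hc0 : boundary k (Fiber π V.initial) c = 0 := c.2.1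
      rw [sboundary_initialFiberChains, hc0, map_zero]; exact zero_mem _
    · rw [positionMap_initialFiberChains _ c.2.2, fiberRetrAt_fiberIncl,
        homologyRetr_cycle, hc, LinearEquiv.apply_symm_apply]
  | succ j ih =>
    obtain ⟨u, hu, hud, hdu, hu'⟩ := ih (by omega) ((-1 : k) ^ (q + j + 1) • h)
    obtain ⟨w, hw, hwd, hdw⟩ := hπ.exists_sub_sboundary_mem k (by omega)
      (low_le_low j.le_succ hu) hud (miss_le_miss j.le_succ le_rfl hdu)
    refine ⟨w, hw, hwd, ?_, ?_⟩
    · rw [← sub_sub_cancel u (sboundary k _ w)]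
      exact sub_mem (low_le_miss j hu) (miss_le_miss le_rfl (by omega) hdw)
    · have h1 := positionMap_sboundary (g := fiberRetrAt hπ k b q)
        (fun c hc => fiberRetrAt_boundary hπ k b q hc) j q hw
      rw [← sub_sub_cancel u (sboundary k _ w), map_sub, positionMap_miss _ j q hdw, hu',
        sub_zero] at h1
      have h2 := congrArg (fun y => (-1 : k) ^ (q + j + 1) • y) h1
      simp only [smul_smul, ← mul_pow, neg_one_mul, neg_neg, one_pow, one_smul] at h2; exact h2.symm

lemma exists_sub_sboundary_mem_miss (hπ : IsSerreFibration π) (b : B) (q : ℕ) {j : ℕ} (hj : j ≤ p)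
    {z : SChains k 𝗣}
    (hz : z ∈ supported k k (lowSimplices π V j))
    (hzd : z ∈ supported k k ({s | s.1 = q + j} : Set (Σ n : ℕ, 𝗣 _⦋n⦌)))
    (hdz : sboundary k _ z ∈ supported k k (missSimplices π V j (j + 1)))
    (h : positionMap (fiberRetrAt hπ k b q) j q z = 0) :
    ∃ w ∈ supported k k (lowSimplices π V j), w ∈ supported k k
        ({s | s.1 = q + j + 1} : Set (Σ n : ℕ, 𝗣 _⦋n⦌)) ∧
      z - sboundary k _ w ∈ supported k k (missSimplices π V j (j + 1)) := by
  classical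
  induction j generalizing z with
  | zero =>
    obtain ⟨y, hy, rfl⟩ := exists_initialFiberChains_eq (q := q) hz hzd
    rw [supported_miss_zero_one, mem_bot, sboundary_initialFiberChains] at hdz
    have hdy : boundary k _ y = 0 := by
      refine chainsMap_injective (k := k) (f := fiberIncl π V.initial) Subtype.val_injective ?_
      rw [← realize_initialFiberChains, hdz, map_zero, map_zero]
    rw [positionMap_initialFiberChains _ hy, fiberRetrAt_fiberIncl,
      LinearEquiv.map_eq_zero_iff] at h
    have h' := (homologyRetr_cycle (⟨y, hdy, hy⟩ : (singularChains k _).cycles q)).symm.trans h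
    obtain ⟨w, hw⟩ := (homologyClass_eq_zero_iff _).1 h'
    have hw : boundary k _ w = y := hw
    refine ⟨initialFiberChains π k V (basisProj (fun s => (s.1 : ℤ) = q + 1) w),
      initialFiberChains_mem_low 0 _, initialFiberChains_mem_degree
        (supported_mono (fun s hs => hs.2) (basisProj_mem _ (T := Set.univ)
          (by rw [supported_univ]; trivial))), ?_⟩
    rw [sboundary_initialFiberChains, ← basisProj_boundary, hw,
      basisProj_eq_self (fun s : (Σ n : ℕ, Sing n _) => (s.1 : ℤ) = q) hy fun s hs => hs, sub_self]
    exact zero_mem _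
  | succ j ih =>
    set u := basisProj (fun x => x ∈ lowSimplices π V j) (sboundary k _ z) with hu
    have hulow : u ∈ supported k k (lowSimplices π V j) :=
      supported_mono (fun x hx => hx.2) (basisProj_mem _ hdz)
    have hudeg := supported_mono (R := k) (M := k) (fun x hx => hx.1)
      (basisProj_mem (fun x => x ∈ lowSimplices π V j) (sboundary_mem_degree hzd))
    have hlam : sboundary k _ z - u ∈ supported k k (missSimplices π V (j + 1) (j + 1)) := by
      refine supported_mono (fun x hx => ?_) (sub_basisProj_mem _ hdz)
      obtain ⟨⟨hx1, i, hi, hi'⟩, hx2⟩ := hx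
      refine ⟨hx1, i, lt_of_le_of_ne (Nat.lt_succ_iff.1 hi) fun h => hx2 fun a => ?_, hi'⟩
      have h1 := hx1 a
      have h2 := hi' a
      omega
    have hdu : sboundary k _ u ∈ supported k k (missSimplices π V j (j + 1)) := by
      have h1 := sboundary_mem_miss hlam
      rw [map_sub, sboundary_sboundary, zero_sub, Submodule.neg_mem_iff] at h1; intro x hx
      obtain ⟨-, h3⟩ := h1 hx
      exact ⟨sboundary_mem_low hulow hx, h3⟩
    have hpos : positionMap (fiberRetrAt hπ k b q) j q u = 0 := by
      have h1 := positionMap_sboundary (g := fiberRetrAt hπ k b q)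
        (fun c hc => fiberRetrAt_boundary hπ k b q hc) j q hz
      rw [h, smul_zero, ← sub_add_cancel (sboundary k _ z) u, map_add,
        positionMap_miss _ j q hlam, zero_add] at h1
      exact h1
    obtain ⟨y, hy, hyd, hyu⟩ := ih (by omega) hulow hudeg hdu hpos
    obtain ⟨w, hw, hwd, hzw⟩ := hπ.exists_sub_sboundary_mem k (c := z - y) (m := q + (j + 1))
      (by omega) (sub_mem hz (low_le_low j.le_succ hy))
      (sub_mem hzd hyd) (by
        rw [map_sub, show sboundary k _ z - sboundary k _ y =
          (sboundary k _ z - u) + (u - sboundary k _ y) by abel]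
        exact add_mem hlam (miss_le_miss j.le_succ le_rfl hyu))
    refine ⟨w, hw, hwd, ?_⟩
    rw [show z - sboundary k _ w = y + (z - y - sboundary k _ w) by abel]
    exact add_mem (low_le_miss j hy) (miss_le_miss le_rfl (by omega) hzw)

end PositionHomology

/-! ### The first page -/

section NondegenerateSimplices

lemma Sing.weight_pull_lt {n p : ℕ} (V : Sing p B) (f : Fin (n + 1) →o Fin (p + 1))
    (hf : ¬ Surjective f) : (V.pull f).weight < p := by
  obtain ⟨i, hi⟩ := not_forall.1 hf
  match p, V, f, i with
  | 0, V, f, i => exact absurd ⟨0, Subsingleton.elim (α := Fin 1) _ _⟩ hi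
  | p + 1, V, f, i =>
    choose g hg using fun a => Fin.exists_succAbove_eq (x := f a) (y := i) fun h => hi ⟨a, h⟩
    have hmono : Monotone g := fun a a' h => by
      rw [← (Fin.strictMono_succAbove i).le_iff_le, hg, hg]; exact f.monotone h
    have e : V.pull f = (V.pull i.succAbove).pull (⟨g, hmono⟩ : Fin (n + 1) →o Fin (p + 1)) := by
      rw [Sing.pull_pull]; exact congrArg V.pull (funext fun a => (hg a).symm)
    rw [e, Nat.lt_succ_iff]
    exact (Sing.weight_pull_le _ _).trans (Sing.factorsThrough_self _).weight_le

lemma monotone_surjective_eq_id {n : ℕ} (f : Fin (n + 1) →o Fin (n + 1))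
    (hf : Surjective f) : (f : Fin (n + 1) → Fin (n + 1)) = id :=
  (f.monotone.strictMono_of_injective (Finite.injective_iff_surjective.2 hf)).eq_id

lemma Sing.eq_id_of_not_isDegenerate {p : ℕ} {V : Sing p B} (f : Fin (p + 1) →o Fin (p + 1))
    (h : ¬ (V.pull f).IsDegenerate) : (f : Fin (p + 1) → Fin (p + 1)) = id := by
  refine monotone_surjective_eq_id f (not_not.1 fun hf => h ?_)
  rw [Sing.isDegenerate_iff]; exact V.weight_pull_lt f hf

lemma Sing.pull_inj {n p : ℕ} {V V' : Sing p B} (hV : ¬ V.IsDegenerate)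
    {s s' : Fin (n + 1) →o Fin (p + 1)} (hs : Surjective s)
    (h : V.pull s = V'.pull s') : V = V' ∧ s = s' := by
  have key : ∀ a, ∃ e : Fin (p + 1) → Fin (n + 1), e (s a) = a ∧ V = V' ∧ s' ∘ e = id := by
    intro a
    let e : Fin (p + 1) → Fin (n + 1) := Function.update (Function.surjInv hs) (s a) a
    have hse : ∀ i, s (e i) = i := fun i => by
      by_cases hi : i = s a
      · rw [hi]; exact congrArg s (Function.update_self _ _ _)
      · exact (congrArg s (Function.update_of_ne hi _ _)).trans (surjInv_eq hs i)
    have hmono : Monotone e := fun i j hij => by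
      by_contra hlt
      have := s.monotone (le_of_not_ge hlt)
      rw [hse, hse] at this; exact hlt (le_of_eq (congrArg e (le_antisymm hij this)))
    have h1 : V = V'.pull (s'.comp ⟨e, hmono⟩) := by
      have h2 := congrArg (fun W : Sing n B => W.pull e) h
      rw [show V.pull s = V.pull s from rfl] at h2; simp only [Sing.pull_pull] at h2
      rw [show (s : Fin (n + 1) → Fin (p + 1)) ∘ e = id from funext hse] at h2
      exact (Sing.pull_id V).symm.trans h2
    have h3 := Sing.eq_id_of_not_isDegenerate (V := V') (s'.comp ⟨e, hmono⟩) (h1 ▸ hV)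
    refine ⟨e, Function.update_self _ _ _, h1.trans ?_, h3⟩
    rw [h3]; exact Sing.pull_id V'
  refine ⟨(key 0).choose_spec.2.1, OrderHom.ext _ _ (funext fun a => ?_)⟩
  obtain ⟨e, h1, -, h2⟩ := key a
  exact (congrFun h2 (s a)).symm.trans (congrArg s' h1)

end NondegenerateSimplices

section FirstPage

variable {p : ℕ} {V : Sing p B}

local notation "𝗣" => SimplexPull π V

/-- The projection of `α` is a degeneracy of the nondegenerate simplex `V`. -/
def IsOver (π : C(E, B)) (V : Sing p B) (α : Σ n : ℕ, Sing n E) : Prop :=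
  ¬ V.IsDegenerate ∧ ∃ s : Fin (α.1 + 1) →o Fin (p + 1), Surjective s ∧
    (π.comp α.2 : Sing α.1 B) = V.pull s

lemma IsOver.unique {V V' : Sing p B} {α : Σ n : ℕ, Sing n E} (h : IsOver π V α)
    (h' : IsOver π V' α) : V = V' := by
  obtain ⟨hV, s, hs, e⟩ := h
  obtain ⟨-, s', -, e'⟩ := h'
  exact (Sing.pull_inj hV hs (e.symm.trans e')).1

lemma exists_isOver {α : Σ n : ℕ, Sing n E} (h : serreWeight π α = p) :
    ∃ V : Sing p B, IsOver π V α := by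
  have h' : Sing.weight (π.comp α.2 : Sing α.1 B) = p := Int.ofNat_inj.1 h
  have hf := Sing.factorsThrough_weight (π.comp α.2 : Sing α.1 B)
  rw [h'] at hf
  obtain ⟨s, hs, V, e⟩ := hf
  refine ⟨V, fun hV => ?_, s, hs, e⟩
  rw [Sing.isDegenerate_iff] at hV
  have := Sing.weight_pull_le V s
  rw [e] at h'; omega

lemma serreWeight_spSnd_le {n : ℕ} (x : 𝗣 _⦋n⦌) : serreWeight π ⟨n, spSnd x⟩ ≤ p := by
  have h1 := Sing.weight_pull_le V (spFst x)
  rw [← comp_spSnd x] at h1; exact Int.ofNat_le.2 (h1.trans V.factorsThrough_self.weight_le)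

lemma serreWeight_spSnd_lt {n : ℕ} (x : 𝗣 _⦋n⦌)
    (h : ¬ Surjective (spFst x)) : serreWeight π ⟨n, spSnd x⟩ < p := by
  have h1 := Sing.weight_pull_lt V (spFst x) h
  rw [← comp_spSnd x] at h1; exact Int.ofNat_lt.2 h1

lemma IsOver.serreWeight_eq {α : Σ n : ℕ, Sing n E} (h : IsOver π V α) : serreWeight π α = p := by
  obtain ⟨hV, s, hs, e⟩ := h
  refine le_antisymm (serreWeight_spSnd_le (spMk s α.2 e)) (not_lt.1 fun hlt => ?_)
  have hlt' : Sing.weight (π.comp α.2 : Sing α.1 B) < p := Int.ofNat_lt.1 hlt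
  obtain ⟨s', hs', V', e'⟩ := Sing.factorsThrough_weight (π.comp α.2 : Sing α.1 B)
  obtain ⟨e1, he1⟩ : ∃ e1 : Fin (p + 1) →o Fin (α.1 + 1), ∀ i, s (e1 i) = i := by
    refine ⟨⟨Function.surjInv hs, fun i j hij => ?_⟩, surjInv_eq hs⟩
    by_contra hlt
    have := s.monotone (le_of_not_ge hlt)
    rw [surjInv_eq hs, surjInv_eq hs] at this
    exact hlt (le_of_eq (congrArg _ (le_antisymm hij this)))
  have h1 : V = V'.pull (s'.comp e1) := by
    have h2 := congrArg (fun W : Sing α.1 B => W.pull e1) (e.symm.trans e')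
    simp only [Sing.pull_pull] at h2
    rw [show (s : Fin (α.1 + 1) → Fin (p + 1)) ∘ e1 = id from funext he1] at h2
    exact (Sing.pull_id V).symm.trans h2
  rw [Sing.not_isDegenerate_iff, h1] at hV
  have := Sing.weight_pull_le V' (s'.comp e1)
  have := V'.factorsThrough_self.weight_le
  omega

open Classical in
def partOver (π : C(E, B)) (V : Sing p B) (k : Type v) [Field k] :
    Chains k E →ₗ[k] SChains k (SimplexPull π V) :=
  linearCombination k fun α : (Σ n : ℕ, Sing n E) =>
    if h : IsOver π V α then schain k (spMk h.2.choose α.2 h.2.choose_spec.2) else 0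

lemma partOver_of_isOver {n : ℕ} (x : 𝗣 _⦋n⦌) (hV : ¬ V.IsDegenerate) (hx : Surjective (spFst x)) :
    partOver π V k (simplexChain k (spSnd x)) = schain k x := by
  refine ((linearCombination_single k _ _).trans (one_smul _ _)).trans ?_
  have h : IsOver π V ⟨n, spSnd x⟩ := ⟨hV, spFst x, hx, comp_spSnd x⟩
  rw [dif_pos h]
  refine congrArg (schain k) (sp_ext ?_ rfl)
  exact (Sing.pull_inj hV hx ((comp_spSnd x).symm.trans h.2.choose_spec.2)).2.symm

lemma partOver_of_not_isOver {α : Σ n : ℕ, Sing n E} (h : ¬ IsOver π V α) :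
    partOver π V k (simplexChain k α.2) = 0 :=
  ((linearCombination_single k _ _).trans (one_smul _ _)).trans (dif_neg h)

lemma exists_of_isOver {n : ℕ} {α : Sing n E} (h : IsOver π V ⟨n, α⟩) :
    ∃ x : 𝗣 _⦋n⦌, spSnd x = α ∧ Surjective (spFst x) := by
  obtain ⟨-, s, hs, e⟩ := h
  exact ⟨spMk s α e, rfl, hs⟩

lemma mem_miss_of_not_surjective {n : ℕ} {x : 𝗣 _⦋n⦌}
    (h : ¬ Surjective (spFst x)) : ⟨n, x⟩ ∈ missSimplices π V p (p + 1) := by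
  obtain ⟨i, hi⟩ := not_forall.1 h
  exact ⟨fun a => Nat.lt_succ_iff.1 (spFst x a).2, i, i.2, fun a h' => hi ⟨a, Fin.ext h'⟩⟩

lemma mem_low (V : Sing p B) (c : SChains k (SimplexPull π V)) :
    c ∈ supported k k (lowSimplices π V p) :=
  fun x _ a => Nat.lt_succ_iff.1 (spFst x.2 a).2

lemma realize_mem_fil (c : SChains k 𝗣) : realize (spHom π V) c ∈ 𝗦.fil p := by
  refine map_mem_of_single (realize (spHom π V)) Set.univ _ (fun ⟨n, x⟩ _ => ?_) c
    (by rw [supported_univ]; trivial)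
  refine (congrArg (· ∈ _) (realize_schain (k := k) (spHom π V) x)).mpr ?_
  exact simplexChain_mem_supported k _ ((mem_serreSimplices_iff π p _).2 (serreWeight_spSnd_le x))

lemma realize_mem_degree {m : ℕ} {c : SChains k 𝗣}
    (hc : c ∈ supported k k ({s | s.1 = m} : Set (Σ n : ℕ, 𝗣 _⦋n⦌))) :
    realize (spHom π V) c ∈ chainsOfDegree k E m := by
  refine map_mem_of_single (realize (spHom π V)) _ _ (fun ⟨n, x⟩ hn => ?_) c hc
  refine (congrArg (· ∈ _) (realize_schain (k := k) (spHom π V) x)).mpr ?_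
  exact simplexChain_mem_supported k _ (congrArg Nat.cast hn)

lemma realize_mem_fil_of_miss {c : SChains k 𝗣}
    (hc : c ∈ supported k k (missSimplices π V p (p + 1))) :
    realize (spHom π V) c ∈ 𝗦.fil (p - 1) := by
  refine map_mem_of_single (realize (spHom π V)) _ _ (fun ⟨n, x⟩ ⟨_, i, hi, hx⟩ => ?_) c hc
  refine (congrArg (· ∈ _) (realize_schain (k := k) (spHom π V) x)).mpr ?_
  refine simplexChain_mem_supported k _ ((mem_serreSimplices_iff π _ _).2 ?_)
  have := serreWeight_spSnd_lt x fun h => by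
    obtain ⟨a, ha⟩ := h ⟨i, hi⟩
    exact hx a (congrArg Fin.val ha)
  rw [singApp_spHom]; omega

lemma sboundary_partOver_sub_mem (V : Sing p B) {c : Chains k E} (hc : c ∈ 𝗦.fil p) :
    sboundary k _ (partOver π V k c) - partOver π V k (boundary k E c) ∈
      supported k k (missSimplices π V p (p + 1)) := by
  classical
  refine map_mem_of_single (sboundary k _ ∘ₗ partOver π V k - partOver π V k ∘ₗ boundary k E)
    (serreSimplices π p) _ (fun ⟨n, α⟩ hα => ?_) c hc
  change sboundary k _ (partOver π V k (simplexChain k α)) -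
    partOver π V k (boundary k E (simplexChain k α)) ∈ _
  by_cases h : IsOver π V ⟨n, α⟩
  · obtain ⟨x, rfl, hx⟩ := exists_of_isOver h
    rw [partOver_of_isOver x h.1 hx, ← singApp_spHom x, ← realize_schain, boundary_realize]
    match n, x with
    | 0, x => rw [sboundary_schain_zero, map_zero, map_zero, sub_zero]; exact zero_mem _
    | n + 1, x =>
      rw [sboundary_schain_succ, map_sum, map_sum, ← sum_sub_distrib]
      refine sum_mem fun i _ => ?_
      rw [map_smul, map_smul, ← smul_sub]
      refine Submodule.smul_mem _ _ ?_
      rw [sface, realize_schain, singApp_spHom]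
      by_cases hs : Surjective (spFst (spull x (clampHom n (n + 1) (skipHom i))))
      · rw [partOver_of_isOver _ h.1 hs, sub_self]; exact zero_mem _
      · rw [partOver_of_not_isOver (α := ⟨n, spSnd (spull x (clampHom n (n + 1) (skipHom i)))⟩)
          fun h' => (serreWeight_spSnd_lt _ hs).ne h'.serreWeight_eq, sub_zero]
        exact schain_mem _ (mem_miss_of_not_surjective hs)
  · rw [partOver_of_not_isOver (α := ⟨n, α⟩) h, map_zero, zero_sub, Submodule.neg_mem_iff]
    suffices h0 : partOver π V k (boundary k E (simplexChain k α)) = 0 by rw [h0]; exact zero_mem _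
    match n, α, h, hα with
    | 0, α, h, _ => rw [boundary_simplexChain_zero, map_zero]
    | n + 1, α, h, hα =>
      rw [boundary_simplexChain_succ, map_sum]
      refine sum_eq_zero fun i _ => ?_
      rw [map_smul, partOver_of_not_isOver (α := ⟨n, α.pull i.succAbove⟩), smul_zero]; intro h'
      have h1 := h'.serreWeight_eq
      have h2 : serreWeight π ⟨n, α.pull i.succAbove⟩ ≤ serreWeight π ⟨n + 1, α⟩ :=
        Int.ofNat_le.2 (Sing.weight_pull_le (π.comp α : Sing (n + 1) B)
          (Fin.succAboveOrderEmb i).toOrderHom)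
      have h3 := (mem_serreSimplices_iff π p _).1 hα
      obtain ⟨V', hV'⟩ := exists_isOver (p := p) (π := π) (α := ⟨n + 1, α⟩) (by omega)
      obtain ⟨x, rfl, hx⟩ := exists_of_isOver hV'
      refine h ?_
      have hs : Surjective (spFst (spull x (Fin.succAboveOrderEmb i).toOrderHom)) := by
        by_contra hs
        exact (serreWeight_spSnd_lt _ hs).ne h1
      have : IsOver π V' ⟨n, (spSnd x).pull i.succAbove⟩ :=
        ⟨hV'.1, _, hs, comp_spSnd (spull x (Fin.succAboveOrderEmb i).toOrderHom)⟩
      rwa [h'.unique this]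

end FirstPage

section FrontBack

open Classical in
lemma frontBack_simplexChain (p q : ℕ) {n : ℕ} (α : Sing n E) :
    frontBack k π p q (simplexChain k α) = if h : q + p = n then
        if Sing.IsDegenerate (π.comp (α.back q p h) : Sing p B) then 0
        else simplexChain k (α.front q (by omega)) ⊗ₜ[k]
          simplexChain k (π.comp (α.back q p h) : Sing p B)
      else 0 :=
  (linearCombination_single k _ _).trans (one_smul _ _)

lemma frontBack_eq_zero {p q : ℕ} {c : Chains k E}
    (hc : c ∈ 𝗦.fil (p - 1)) : frontBack k π p q c = 0 := by
  classical
  refine eq_on_of_single (frontBack k π p q) 0 (serreSimplices π (p - 1)) (fun ⟨n, α⟩ hα => ?_) c hc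
  refine (frontBack_simplexChain p q α).trans ?_
  split_ifs with h hd
  · rfl
  · exfalso
    rw [Sing.not_isDegenerate_iff] at hd
    have h1 : Sing.weight (π.comp α : Sing n B) ≤ (p : ℤ) - 1 := (mem_serreSimplices_iff π _ _).1 hα
    have h2 := Sing.weight_front_add_weight_back (π.comp α : Sing n B) q p h
    have h3 : Sing.weight (Sing.back (π.comp α : Sing n B) q p h) = p := hd
    omega
  · rfl

variable {p : ℕ} {V : Sing p B} {A : Type*} [AddCommGroup A] [Module k A] (g : Chains k E →ₗ[k] A)
  (q : ℕ)

local notation "𝗣" => SimplexPull π V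

lemma rTensor_frontBack_spSnd (hV : ¬ V.IsDegenerate) {n : ℕ} (x : 𝗣 _⦋n⦌) :
    rTensor _ g (frontBack k π p q (simplexChain k (spSnd x))) =
      positionMap g p q (schain k x) ⊗ₜ[k] simplexChain k V := by
  classical
  rw [frontBack_simplexChain, positionMap_schain]
  by_cases hn : q + p = n
  · subst hn
    have hback : (π.comp ((spSnd x).back q p rfl) : Sing p B) =
        V.pull ((spFst x).comp ⟨fun a : Fin (p + 1) => ⟨q + a, by omega⟩, fun a b h =>
          Fin.mk_le_mk.2 (by have : (a : ℕ) ≤ b := h; omega)⟩) := by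
      have h := congrArg (fun W : Sing (q + p) B => W.back q p rfl) (comp_spSnd x)
      refine Eq.trans (b := Sing.back (π.comp (spSnd x) : Sing (q + p) B) q p rfl) rfl (h.trans ?_)
      exact Sing.pull_pull _ _ _
    by_cases hpos : ∀ a, (spFst x a : ℕ) = a - q
    · have hid : (π.comp ((spSnd x).back q p rfl) : Sing p B) = V := by
        rw [hback]
        refine (congrArg V.pull (funext fun a => Fin.ext ?_)).trans (Sing.pull_id V)
        refine (hpos _).trans ?_
        exact Nat.add_sub_cancel_left _ _
      rw [dif_pos rfl, hid, if_neg hV, if_pos ⟨rfl, hpos⟩, rTensor_tmul]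
      refine congrArg (fun α => g (simplexChain k α) ⊗ₜ[k] simplexChain k V) ?_
      refine congrArg (spSnd x).pull (funext fun a => Fin.ext ?_)
      change (a : ℕ) = min (a : ℕ) (q + p); omega
    · have hneg : ¬ (q + p = q + p ∧ ∀ a, (spFst x a : ℕ) = a - q) := fun h => hpos h.2
      rw [if_neg hneg, dif_pos rfl, zero_tmul]
      split_ifs with hd
      · rw [map_zero]
      · exfalso
        rw [hback] at hd
        have hid := Sing.eq_id_of_not_isDegenerate _ hd
        have hid' : ∀ a : Fin (p + 1), (spFst x ⟨q + a, by omega⟩ : ℕ) = a := fun a =>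
          congrArg Fin.val (congrFun hid a)
        refine hpos fun a => ?_
        by_cases ha : (a : ℕ) ≤ q
        · have h0 := hid' 0
          have := (spFst x).monotone (show a ≤ ⟨q + (0 : Fin (p + 1)), by omega⟩ from ha)
          have : (spFst x a : ℕ) ≤ (spFst x ⟨q + (0 : Fin (p + 1)), by omega⟩ : ℕ) := this
          rw [h0] at this; simp only [Fin.val_zero] at this; omega
        · have h1 := hid' ⟨a - q, by omega⟩
          have e : (⟨q + (a - q), by omega⟩ : Fin (q + p + 1)) = a :=
            Fin.ext (show q + ((a : ℕ) - q) = a by omega)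
          exact (congrArg (fun a => (spFst x a : ℕ)) e).symm.trans h1
  · rw [dif_neg hn, if_neg fun h => hn h.1.symm, map_zero, zero_tmul]

lemma rTensor_frontBack_realize (hV : ¬ V.IsDegenerate) (c : SChains k 𝗣) :
    rTensor _ g (frontBack k π p q (realize (spHom π V) c)) =
      positionMap g p q c ⊗ₜ[k] simplexChain k V := by
  suffices h : rTensor _ g ∘ₗ frontBack k π p q ∘ₗ realize (spHom π V) =
      (TensorProduct.mk k A (Chains k B)).flip (simplexChain k V) ∘ₗ positionMap g p q from
    congrArg (fun f => f c) h
  refine schains_ext fun n x => ?_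
  change rTensor _ g (frontBack k π p q (realize (spHom π V) (schain k x))) = _
  rw [realize_schain, singApp_spHom]; exact rTensor_frontBack_spSnd g q hV x

def coefficient (V : Sing p B) : A ⊗[k] Chains k B →ₗ[k] A :=
  (trid k A).toLinearMap ∘ₗ lTensor A (lapply ⟨p, V⟩)

lemma coefficient_tmul (V V' : Sing p B) [Decidable (V' = V)] (a : A) :
    coefficient V (a ⊗ₜ[k] simplexChain k V') = if V' = V then a else 0 := by
  classical
  refine (rid_tmul _ _).trans ?_
  change (single _ (1 : k) _) • a = _; rw [Finsupp.single_apply]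
  by_cases h : V' = V
  · rw [if_pos (by rw [h]), if_pos h, one_smul]
  · rw [if_neg (show ¬ (⟨p, V'⟩ : Σ n : ℕ, Sing n B) = ⟨p, V⟩ from
      fun h' => h (eq_of_heq (Sigma.mk.inj h').2)), if_neg h, zero_smul]

lemma positionMap_partOver (hV : ¬ V.IsDegenerate) {z : Chains k E} (hz : z ∈ 𝗦.fil p) :
    positionMap g p q (partOver π V k z) = coefficient V (rTensor _ g (frontBack k π p q z)) := by
  classical
  refine eq_on_of_single (positionMap g p q ∘ₗ partOver π V k)
    (coefficient V ∘ₗ rTensor _ g ∘ₗ frontBack k π p q) (serreSimplices π p)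
    (fun ⟨n, α⟩ hα => ?_) z hz
  change positionMap g p q (partOver π V k (simplexChain k α)) =
    coefficient V (rTensor _ g (frontBack k π p q (simplexChain k α)))
  have hw := (mem_serreSimplices_iff π p _).1 hα
  by_cases hlt : serreWeight π ⟨n, α⟩ < p
  · rw [frontBack_eq_zero (simplexChain_mem_supported k _
        ((mem_serreSimplices_iff π _ ⟨n, α⟩).2 (by omega))),
      partOver_of_not_isOver (α := ⟨n, α⟩) fun h => hlt.ne h.serreWeight_eq, map_zero, map_zero,
      map_zero]
  · obtain ⟨V', hV'⟩ := exists_isOver (p := p) (π := π) (α := ⟨n, α⟩) (by omega)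
    obtain ⟨x, rfl, hx⟩ := exists_of_isOver hV'
    rw [rTensor_frontBack_spSnd g q hV'.1, coefficient_tmul]
    split_ifs with h
    · subst h; rw [partOver_of_isOver x hV hx]
    · rw [partOver_of_not_isOver (α := ⟨n, spSnd x⟩) fun h' => h (hV'.unique h'), map_zero]

end FrontBack

section FirstPageHomology

variable {p : ℕ}

lemma partOver_eq_zero (V : Sing p B) {c : Chains k E}
    (hc : c ∈ 𝗦.fil (p - 1)) : partOver π V k c = 0 := by
  refine eq_on_of_single (partOver π V k) 0 (serreSimplices π (p - 1)) (fun α hα => ?_) c hc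
  refine partOver_of_not_isOver fun h => ?_
  have h1 := (mem_serreSimplices_iff π _ _).1 hα
  have h2 := h.serreWeight_eq
  omega

lemma partOver_mem_degree (V : Sing p B) {m : ℕ} {c : Chains k E} (hc : c ∈ chainsOfDegree k E m) :
    partOver π V k c ∈ supported k k ({s | s.1 = m} : Set (Σ n : ℕ, (SimplexPull π V) _⦋n⦌)) := by
  refine map_mem_of_single (partOver π V k) _ _ (fun ⟨n, α⟩ hα => ?_) c hc
  change partOver π V k (simplexChain k α) ∈ _
  by_cases h : IsOver π V ⟨n, α⟩
  · obtain ⟨x, rfl, hx⟩ := exists_of_isOver h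
    rw [partOver_of_isOver x h.1 hx]; exact schain_mem _ (Int.ofNat_inj.1 hα)
  · rw [partOver_of_not_isOver (α := ⟨n, α⟩) h]; exact zero_mem _

open Classical in
lemma realize_partOver (V : Sing p B) (c : Chains k E) :
    realize (spHom π V) (partOver π V k c) = basisProj (IsOver π V) c := by
  suffices h : realize (spHom π V) ∘ₗ partOver π V k = basisProj (IsOver π V) from
    congrArg (fun f => f c) h
  refine chains_ext k fun n α => ?_
  refine Eq.trans ?_ (basisProj_single _ _).symm
  change realize (spHom π V) (partOver π V k (simplexChain k α)) = _
  by_cases h : IsOver π V ⟨n, α⟩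
  · rw [if_pos h]
    obtain ⟨x, rfl, hx⟩ := exists_of_isOver h
    rw [partOver_of_isOver x h.1 hx, realize_schain]; rfl
  · rw [if_neg h, partOver_of_not_isOver (α := ⟨n, α⟩) h, map_zero]

lemma mem_of_realize_partOver_mem {z : Chains k E} (hz : z ∈ 𝗦.fil p)
    {S : Submodule k (Chains k E)} (hS : 𝗦.fil (p - 1) ≤ S)
    (h : ∀ V : Sing p B, ¬ V.IsDegenerate → realize (spHom π V) (partOver π V k z) ∈ S) :
    z ∈ S := by
  classical
  refine mem_of_basisProj_mem (fun α => if h : ∃ V : Sing p B, IsOver π V α then some h.choose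
    else none) z S fun o => ?_
  match o with
  | none =>
    refine hS (supported_mono (fun α hα => ?_) 
      (@basisProj_mem k _ _ _ (fun _ => Classical.propDecidable _) _ _ hz))
    have h1 : serreWeight π α ≤ p := (mem_serreSimplices_iff π _ _).1 hα.1
    refine (mem_serreSimplices_iff π _ _).2 (not_lt.1 fun hlt => ?_)
    have h2 : ∃ V : Sing p B, IsOver π V α := exists_isOver (by omega)
    have h3 := hα.2
    rw [dif_pos h2] at h3
    exact Option.some_ne_none _ h3
  | some V =>
    have e : ∀ α, ((if h : ∃ V : Sing p B, IsOver π V α then some h.choose else none) = some V) =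
        IsOver π V α := fun α => propext ⟨fun h1 => by
      split_ifs at h1 with h2
      exact Option.some.inj h1 ▸ h2.choose_spec, fun h1 => by
      rw [dif_pos ⟨V, h1⟩]
      exact congrArg some ((Exists.intro V h1 : ∃ V, IsOver π V α).choose_spec.unique h1)⟩
    simp only [e]
    by_cases hV : V.IsDegenerate
    · rw [basisProj_eq_zero _ (T := Set.univ) (by rw [supported_univ]; trivial)
        fun α _ hα => hα.1 hV]
      exact S.zero_mem
    · have := h V hV
      rw [realize_partOver] at this
      convert this

variable [SimplyConnectedSpace B] (hπ) (b) (q : ℕ)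

variable (k) in
/-- The front face is replaced by its class in the homology of the fiber. -/
def frontBackClass (p : ℕ) : Chains k E →ₗ[k] 𝗛 (Fiber π b) q ⊗[k] Chains k B :=
  rTensor _ (fiberRetrAt hπ k b q) ∘ₗ frontBack k π p q

open Classical in
def ndProj (k : Type v) [Field k] (B : Type u) [TopologicalSpace B] (p : ℕ) :
    Chains k B →ₗ[k] Chains k B :=
  basisProj fun s : (Σ n : ℕ, Sing n B) => s.1 = p ∧ ¬ s.2.IsDegenerate

lemma exists_frontBackClass_eq (t : 𝗛 (Fiber π b) q ⊗[k] Chains k B) :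
    ∃ z ∈ 𝗦.almostCycles 1 ((p : ℤ), (q : ℤ)),
      frontBackClass hπ k b q p z = lTensor _ (ndProj k B p) t := by
  classical
  suffices h : lTensor _ (ndProj k B p) t ∈
      (𝗦.almostCycles 1 ((p : ℤ), (q : ℤ))).map (frontBackClass hπ k b q p) from h
  induction t using induction_on with
  | zero => rw [map_zero]; exact zero_mem _
  | add t t' ht ht' => rw [map_add]; exact add_mem ht ht'
  | tmul h c =>
    refine map_mem_of_single (lTensor _ (ndProj k B p) ∘ₗ
      TensorProduct.mk k _ _ h) Set.univ _ (fun ⟨n, V⟩ _ => ?_) c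
      (by rw [supported_univ]; trivial)
    change h ⊗ₜ[k] ndProj k B p (single ⟨n, V⟩ 1) ∈ _; rw [ndProj, basisProj_single]
    split_ifs with hn
    · obtain ⟨rfl, hV⟩ := hn
      obtain ⟨z, -, hzd, hdz, hz⟩ := exists_positionMap_eq (V := V) hπ b q le_rfl h
      refine ⟨realize (spHom π V) z, ⟨⟨realize_mem_fil z, ?_⟩, ?_⟩, ?_⟩
      · have := realize_mem_degree hzd
        rwa [Nat.cast_add, add_comm] at this
      · change boundary k E (realize (spHom π V) z) ∈ 𝗦.fil (n - 1); rw [boundary_realize]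
        exact realize_mem_fil_of_miss hdz
      · refine (rTensor_frontBack_realize _ q hV z).trans ?_
        rw [hz]; rfl
    · rw [tmul_zero]; exact zero_mem _

lemma exists_of_frontBackClass_eq_zero {z : Chains k E}
    (hz : z ∈ 𝗦.almostCycles 1 ((p : ℤ), (q : ℤ)))
    (h : frontBackClass hπ k b q p z = 0) :
    ∃ w ∈ 𝗦.filGr ((p : ℤ), (q : ℤ) + 1), z - boundary k E w ∈ 𝗦.fil (p - 1) := by
  obtain ⟨⟨hzf, hzd⟩, hdz⟩ := hz
  suffices hs : z ∈ (𝗦.filGr ((p : ℤ), (q : ℤ) + 1)).map (boundary k E) ⊔ 𝗦.fil (p - 1) by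
    obtain ⟨_, ⟨w, hw, rfl⟩, f, hf, e⟩ := mem_sup.1 hs
    exact ⟨w, hw, by rw [← e, add_sub_cancel_left]; exact hf⟩
  refine mem_of_realize_partOver_mem hzf le_sup_right fun V hV => ?_
  have hd : boundary k E z ∈ 𝗦.fil (p - 1) := hdz
  have h1 := sboundary_partOver_sub_mem V hzf
  rw [partOver_eq_zero V hd, sub_zero] at h1
  have h2 := positionMap_partOver (fiberRetrAt hπ k b q) q hV hzf
  rw [show rTensor _ (fiberRetrAt hπ k b q) (frontBack k π p q z) = 0 from h, map_zero] at h2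
  obtain ⟨w, -, hwd, hw⟩ := exists_sub_sboundary_mem_miss hπ b q le_rfl (mem_low V _)
    (partOver_mem_degree V (m := q + p) (by rwa [Nat.cast_add, add_comm])) h1 h2
  refine mem_sup.2 ⟨_, ⟨realize (spHom π V) w, ⟨realize_mem_fil w, ?_⟩, rfl⟩, _,
    realize_mem_fil_of_miss hw, ?_⟩
  · have := realize_mem_degree hwd
    rwa [show ((q + p + 1 : ℕ) : ℤ) = (p : ℤ) + (q + 1) by push_cast; ring] at this
  · rw [boundary_realize, map_sub, add_sub_cancel]

end FirstPageHomology

/-! ### Chains over an edge of the base -/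

section Edge

def Sing.path (V : Sing 1 B) : Path V.initial (V (vertex 1)) where
  toFun t := V (stdSimplexHomeomorphUnitInterval.symm t)
  continuous_toFun := V.continuous.comp stdSimplexHomeomorphUnitInterval.symm.continuous
  source' := congrArg V (stdSimplexHomeomorphUnitInterval.symm_apply_eq.2 rfl)
  target' := congrArg V (stdSimplexHomeomorphUnitInterval.symm_apply_eq.2 rfl)

def toPathPullback (V : Sing 1 B) {n : ℕ} (x : (SimplexPull π V) _⦋n⦌) :
    Sing n (PathPullback π V.path) where
  toFun t := ⟨(stdSimplexHomeomorphUnitInterval (stdSimplex.map (spFst x) t), spSnd x t), by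
    have h := DFunLike.congr_fun (comp_spSnd x) t
    refine h.trans (congrArg V ?_)
    exact (Homeomorph.symm_apply_apply _ _).symm⟩
  continuous_toFun := by
    have := stdSimplex.continuous_map (S := ℝ) (spFst x)
    fun_prop

lemma toPathPullback_source (V : Sing 1 B) {n : ℕ} (x : (SimplexPull π V) _⦋n⦌)
    (h : ∀ a, spFst x a = 0) :
    ∃ β : Sing n (Fiber π V.initial), toPathPullback V x = (sourceIncl π V.path).comp β ∧
      spSnd x = (fiberIncl π V.initial).comp β := by
  have h0 : (spFst x : Fin (n + 1) → Fin 2) = fun _ => 0 := funext h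
  have hfib : ∀ t, π (spSnd x t) = V.initial := fun t => by
    refine (DFunLike.congr_fun (comp_spSnd x) t).trans (congrArg V ?_)
    refine (congrArg (fun f => stdSimplex.map f t) h0).trans (stdSimplex_map_const _ _)
  refine ⟨Sing.toFiber (spSnd x) hfib, ContinuousMap.ext fun t => Subtype.ext (Prod.ext ?_ rfl), rfl⟩
  refine (congrArg (fun f => stdSimplexHomeomorphUnitInterval (stdSimplex.map f t)) h0).trans ?_
  exact (congrArg _ (stdSimplex_map_const _ _)).trans stdSimplexHomeomorphUnitInterval_zero

lemma toPathPullback_target (V : Sing 1 B) {n : ℕ} (x : (SimplexPull π V) _⦋n⦌)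
    (h : ∀ a, spFst x a = 1) :
    ∃ β : Sing n (Fiber π (V (vertex 1))), toPathPullback V x = (targetIncl π V.path).comp β ∧
        spSnd x = (fiberIncl π (V (vertex 1))).comp β := by
  have h0 : (spFst x : Fin (n + 1) → Fin 2) = fun _ => 1 := funext h
  have hfib : ∀ t, π (spSnd x t) = V (vertex 1) := fun t => by
    refine (DFunLike.congr_fun (comp_spSnd x) t).trans (congrArg V ?_)
    refine (congrArg (fun f => stdSimplex.map f t) h0).trans (stdSimplex_map_const _ _)
  refine ⟨Sing.toFiber (spSnd x) hfib, ContinuousMap.ext fun t => Subtype.ext (Prod.ext ?_ rfl), rfl⟩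
  refine (congrArg (fun f => stdSimplexHomeomorphUnitInterval (stdSimplex.map f t)) h0).trans ?_
  exact (congrArg _ (stdSimplex_map_const _ _)).trans stdSimplexHomeomorphUnitInterval_one

lemma toPathPullback_spull (V : Sing 1 B) (m n : ℕ) (f : Fin (m + 1) →o Fin (n + 1))
    (x : (SimplexPull π V) _⦋n⦌) :
    toPathPullback V (spull x f) = (toPathPullback V x).pull f := by
  refine ContinuousMap.ext fun t => Subtype.ext (Prod.ext ?_ rfl)
  exact congrArg stdSimplexHomeomorphUnitInterval (map_comp_apply f (spFst x) t).symm

/-- The simplices over an edge, as simplices of the pullback along the path. -/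
def pathPullbackHom (π : C(E, B)) (V : Sing 1 B) : SimplexPull π V ⟶ SS (PathPullback π V.path) :=
  homToSS (fun _ => toPathPullback V) (toPathPullback_spull V)

variable (k)

lemma exists_fiber_chains (V : Sing 1 B) {q : ℕ} {c : SChains k (SimplexPull π V)}
    (hc : c ∈ supported k k (missSimplices π V 1 2))
    (hd : c ∈ supported k k ({s | s.1 = q} : Set (Σ n : ℕ, (SimplexPull π V) _⦋n⦌))) :
    ∃ x ∈ chainsOfDegree k (Fiber π V.initial) q, ∃ y ∈ chainsOfDegree k (Fiber π (V (vertex 1))) q,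
      realize (pathPullbackHom π V) c =
        chainsMap k (sourceIncl π V.path) x + chainsMap k (targetIncl π V.path) y ∧
      realize (spHom π V) c = chainsMap k (fiberIncl π _) x + chainsMap k (fiberIncl π _) y := by
  have hmem : c ∈ supported k k (missSimplices π V 1 2 ∩ {s | s.1 = q}) := by
    rw [Finsupp.supported_inter]; exact ⟨hc, hd⟩
  have := map_mem_of_single (LinearMap.prod (realize (pathPullbackHom π V)) (realize (spHom π V))) _
    ((chainsOfDegree k (Fiber π V.initial) q).map (LinearMap.prod
        (chainsMap k (sourceIncl π V.path)) (chainsMap k (fiberIncl π _))) ⊔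
      (chainsOfDegree k (Fiber π (V (vertex 1))) q).map (LinearMap.prod
        (chainsMap k (targetIncl π V.path)) (chainsMap k (fiberIncl π _))))
    (fun ⟨n, s⟩ ⟨⟨_, i, hi, hs⟩, hn⟩ => ?_) c hmem
  · refine (congrArg (· ∈ _) (Prod.ext (realize_schain (k := k) (pathPullbackHom π V) s)
      (realize_schain (k := k) (spHom π V) s) : _ =
        (simplexChain k (toPathPullback V s), simplexChain k (spSnd s)))).mpr ?_
    match i, hs, hi with
    | 1, hs, _ =>
      obtain ⟨β, h1, h2⟩ := toPathPullback_source V s fun a => Fin.ext (by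
        have : (spFst s a : ℕ) ≠ 1 := hs a
        change (spFst s a : ℕ) = 0
        omega)
      refine mem_sup_left ⟨simplexChain k β,
        simplexChain_mem_supported k _ (congrArg Nat.cast hn), ?_⟩
      rw [h1, h2, ← chainsMap_simplexChain, ← chainsMap_simplexChain]
      rfl
    | 0, hs, _ =>
      obtain ⟨β, h1, h2⟩ := toPathPullback_target V s fun a => Fin.ext (by
        have : (spFst s a : ℕ) ≠ 0 := hs a
        change (spFst s a : ℕ) = 1
        omega)
      refine mem_sup_right ⟨simplexChain k β,
        simplexChain_mem_supported k _ (congrArg Nat.cast hn), ?_⟩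
      rw [h1, h2, ← chainsMap_simplexChain, ← chainsMap_simplexChain]; rfl
  · obtain ⟨_, ⟨x, hx, rfl⟩, _, ⟨y, hy, rfl⟩, e⟩ := mem_sup.1 this
    exact ⟨x, hx, y, hy, (congrArg Prod.fst e).symm, (congrArg Prod.snd e).symm⟩

lemma disjoint_range_sourceIncl {x y : B} (γ : Path x y) {c : Chains k (Fiber π x)}
    {c' : Chains k (Fiber π y)}
    (h : chainsMap k (sourceIncl π γ) c + chainsMap k (targetIncl π γ) c' = 0) :
    c = 0 ∧ c' = 0 := by
  have h0 : ∀ c, chainsMap k (sourceIncl π γ) c ∈ supported k k ({s | (s.2 (vertex 0)).1.1 = 0} :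
        Set (Σ n : ℕ, Sing n (PathPullback π γ))) := fun c =>
    map_mem_of_single (chainsMap k (sourceIncl π γ)) Set.univ _ (fun s _ =>
      (congrArg (· ∈ _) (chainsMap_simplexChain (k := k) (sourceIncl π γ) s.2)).mpr
        (simplexChain_mem_supported k _ rfl)) c (by rw [supported_univ]; trivial)
  have h1 : ∀ c, chainsMap k (targetIncl π γ) c ∈ supported k k ({s | (s.2 (vertex 0)).1.1 = 1} :
        Set (Σ n : ℕ, Sing n (PathPullback π γ))) := fun c =>
    map_mem_of_single (chainsMap k (targetIncl π γ)) Set.univ _ (fun s _ =>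
      (congrArg (· ∈ _) (chainsMap_simplexChain (k := k) (targetIncl π γ) s.2)).mpr
        (simplexChain_mem_supported k _ rfl)) c (by rw [supported_univ]; trivial)
  have hd := (Finsupp.disjoint_supported_supported (M := k) (R := k)
    (s := ({s | (s.2 (vertex 0)).1.1 = 0} : Set (Σ n : ℕ, Sing n (PathPullback π γ))))
    (t := ({s | (s.2 (vertex 0)).1.1 = 1} : Set (Σ n : ℕ, Sing n (PathPullback π γ))))
    (Set.disjoint_left.2 fun s hs hs' => zero_ne_one (hs.symm.trans hs')))
  have hz : chainsMap k (sourceIncl π γ) c = 0 := by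
    refine (Submodule.disjoint_def.1 hd) _ (h0 c) ?_
    rw [eq_neg_of_add_eq_zero_left h]; exact neg_mem (h1 c')
  rw [hz, zero_add] at h
  refine ⟨chainsMap_injective (f := sourceIncl π γ) (fun e e' he => Subtype.ext ?_)
    (hz.trans (map_zero _).symm), chainsMap_injective (f := targetIncl π γ)
    (fun e e' he => Subtype.ext ?_) (h.trans (map_zero _).symm)⟩
  · exact congrArg (fun z : PathPullback π γ => z.1.2) he
  · exact congrArg (fun z : PathPullback π γ => z.1.2) he

variable [SimplyConnectedSpace B] (hπ : IsSerreFibration π) (b : B)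

lemma fiberRetrAt_boundary_realize (V : Sing 1 B) {q : ℕ} {c : SChains k (SimplexPull π V)}
    (hc : sboundary k _ c ∈ supported k k (missSimplices π V 1 2))
    (hd : c ∈ supported k k ({s | s.1 = q + 1} : Set (Σ n : ℕ, (SimplexPull π V) _⦋n⦌))) :
    fiberRetrAt hπ k b q (boundary k E (realize (spHom π V) c)) = 0 := by
  obtain ⟨x, hx, y, hy, h1, h2⟩ := exists_fiber_chains k V hc (sboundary_mem_degree hd)
  rw [← boundary_realize] at h1 h2
  have h3 := congrArg (boundary k _) h1
  rw [boundary_boundary, map_add, ← chainsMap_boundary, ← chainsMap_boundary] at h3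
  obtain ⟨hx', hy'⟩ := disjoint_range_sourceIncl k V.path h3.symm
  have hxc : x ∈ (singularChains k (Fiber π V.initial)).cycles q := ⟨hx', hx⟩
  have hyc : y ∈ (singularChains k (Fiber π (V (vertex 1)))).cycles q := ⟨hy', hy⟩
  rw [h2, map_add, fiberRetrAt_fiberIncl, fiberRetrAt_fiberIncl,
    homologyRetr_cycle ⟨x, hxc⟩, homologyRetr_cycle ⟨y, hyc⟩]
  have h4 := congrArg (homologyRetr k _ q) h1
  rw [homologyRetr_boundary, map_add,
    homologyRetr_cycle ⟨_, chainsMap_mem_cycles k (sourceIncl π V.path) q x hxc⟩,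
    homologyRetr_cycle ⟨_, chainsMap_mem_cycles k (targetIncl π V.path) q y hyc⟩] at h4
  have h5 : homologyMap k (sourceIncl π V.path) q
      ((singularChains k (Fiber π V.initial)).homologyClass q ⟨x, hxc⟩) =
      homologyMap k (targetIncl π V.path) q
        (-(singularChains k (Fiber π (V (vertex 1)))).homologyClass q ⟨y, hyc⟩) := by
    rw [map_neg]; exact eq_neg_of_add_eq_zero_left h4.symm
  rw [fiberTransport_eq_of_path hπ k b V.path q h5, map_neg, neg_add_cancel]

lemma fiberRetrAt_boundary_of_mem_fil_one {q : ℕ} {y : Chains k E}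
    (hy : y ∈ 𝗦.fil 1) (hyd : y ∈ chainsOfDegree k E (q + 1))
    (hdy : boundary k E y ∈ 𝗦.fil 0) :
    fiberRetrAt hπ k b q (boundary k E y) = 0 := by
  refine mem_of_realize_partOver_mem (p := 1)
    (S := ker (fiberRetrAt hπ k b q ∘ₗ boundary k E)) hy (fun c hc => ?_)
    fun V hV => ?_
  · exact fiberRetrAt_boundary hπ k b q hc
  · refine fiberRetrAt_boundary_realize k hπ b V ?_
      (partOver_mem_degree V (by rwa [Nat.cast_add, Nat.cast_one]))
    have h1 := sboundary_partOver_sub_mem V (p := 1) hy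
    rwa [partOver_eq_zero V (c := boundary k E y) (by simpa using hdy), sub_zero] at h1

end Edge

end

/-! ### The differential of the first page -/

section Slice

variable {A A' C C' : Type*} [AddCommGroup A] [Module k A] [AddCommGroup A'] [Module k A']
  [AddCommGroup C] [Module k C] [AddCommGroup C'] [Module k C']

def slice (l : C →ₗ[k] k) : A ⊗[k] C →ₗ[k] A := (trid k A).toLinearMap ∘ₗ lTensor A l

lemma slice_tmul (l : C →ₗ[k] k) (a : A) (c : C) : slice l (a ⊗ₜ[k] c) = l c • a := rid_tmul _ _

lemma slice_map (l : C' →ₗ[k] k) (f : A →ₗ[k] A') (g : C →ₗ[k] C') (t : A ⊗[k] C) :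
    slice l (tmap f g t) = f (slice (l ∘ₗ g) t) := by
  induction t using induction_on with
  | zero => simp only [map_zero]
  | add t t' h h' => simp only [map_add, h, h']
  | tmul a c => rw [map_tmul, slice_tmul, slice_tmul, map_smul]; rfl

lemma eq_zero_of_slice_eq_zero {ι : Type*} {t : A ⊗[k] (ι →₀ k)} (h : ∀ l, slice l t = 0) : t = 0 := by
  classical
  refine (finsuppScalarRight k k A ι).injective (Finsupp.ext fun i => ?_)
  rw [finsuppScalarRight_apply, map_zero]; exact h (lapply i)

end Slice

section DegreeProj

variable (k) (X)

open Classical in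
def degreeProj (n : ℤ) : Chains k X →ₗ[k] Chains k X :=
  basisProj fun s : (Σ n : ℕ, Sing n X) => (s.1 : ℤ) = n

variable {k X}

lemma degreeProj_simplexChain (m : ℤ) {n : ℕ} (α : Sing n X) :
    degreeProj k X m (simplexChain k α) = if (n : ℤ) = m then simplexChain k α else 0 := by
  classical
  exact (basisProj_single _ _).trans (if_congr Iff.rfl rfl rfl)

lemma degreeProj_boundary (n : ℤ) (c : Chains k X) :
    degreeProj k X n (boundary k X c) = boundary k X (degreeProj k X (n + 1) c) := by
  classical
  exact basisProj_boundary n c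

open Classical in
lemma ndProj_simplexChain (p : ℕ) {n : ℕ} (α : Sing n X) : ndProj k X p (simplexChain k α) =
      if n = p ∧ ¬ α.IsDegenerate then simplexChain k α else 0 :=
  (basisProj_single _ _).trans (if_congr Iff.rfl rfl rfl)

lemma ndProj_degenerate (p : ℕ) {e : Chains k X} (he : e ∈ degenerateChains k X) :
    ndProj k X p e = 0 := by
  classical
  exact basisProj_eq_zero _ he fun _ h h' => h'.2 h

lemma ndProj_boundary (p : ℕ) (c : Chains k X) :
    ndProj k X p (boundary k X (ndProj k X (p + 1) c)) = ndProj k X p (boundary k X c) := by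
  classical
  suffices h : ndProj k X p ∘ₗ boundary k X ∘ₗ ndProj k X (p + 1) =
      ndProj k X p ∘ₗ boundary k X from lcongr_fun h c
  refine chains_ext k fun n α => ?_
  change ndProj k X p (boundary k X (ndProj k X (p + 1) (simplexChain k α))) =
    ndProj k X p (boundary k X (simplexChain k α))
  rw [ndProj_simplexChain]
  split_ifs with h
  · rfl
  · rw [map_zero, map_zero]
    by_cases hd : α.IsDegenerate
    · exact (ndProj_degenerate p (boundary_mem_degenerateChains
        (simplexChain_mem_supported k α hd))).symm
    · match n, α, h, hd with
      | 0, α, _, _ => rw [boundary_simplexChain_zero, map_zero]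
      | n + 1, α, h, hd =>
        rw [boundary_simplexChain_succ, map_sum]
        refine (sum_eq_zero fun i _ => ?_).symm
        rw [map_smul, ndProj_simplexChain, if_neg fun h' => h ⟨by omega, hd⟩, smul_zero]

end DegreeProj

section FrontBackBoundary

lemma simplexChain_back_congr {X : Type u} [TopologicalSpace X] {n : ℕ} (α : Sing n X) {i j j' : ℕ}
    (h : i + j = n) (h' : j = j') :
    simplexChain k (α.back i j h) = simplexChain k (α.back i j' (h' ▸ h)) := by
  subst h'; rfl

lemma map_diagonal_simplexChain {X : Type u} [TopologicalSpace X] {A A' : Type*} [AddCommMonoid A]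
    [Module k A] [AddCommMonoid A'] [Module k A'] (f : Chains k X →ₗ[k] A) (g : Chains k X →ₗ[k] A')
    (i j : ℕ) (hf : ∀ (n : ℕ) (α : Sing n X), n ≠ i → f (simplexChain k α) = 0)
    (hg : ∀ (n : ℕ) (α : Sing n X), n ≠ j → g (simplexChain k α) = 0) {n : ℕ} (α : Sing n X) :
    tmap f g (diagonal k X (simplexChain k α)) =
      if h : i + j = n then f (simplexChain k (α.front i (by omega))) ⊗ₜ[k]
        g (simplexChain k (α.back i j h)) else 0 := by
  have e : diagonal k X (simplexChain k α) = ∑ a : Fin (n + 1),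
      simplexChain k (α.front a (by omega)) ⊗ₜ[k] simplexChain k (α.back a (n - a) (by omega)) :=
    (linearCombination_single k _ _).trans (one_smul _ _)
  rw [e, map_sum]; simp only [map_tmul]
  split_ifs with h
  · rw [sum_eq_single ⟨i, by omega⟩]
    · rw [simplexChain_back_congr α (j' := j) _ (by simp only; omega)]
    · intro a _ ha; rw [hf _ _ fun h => ha (Fin.ext h), zero_tmul]
    · exact fun h => absurd (mem_univ _) h
  · refine sum_eq_zero fun a _ => ?_
    by_cases ha : (a : ℕ) = i
    · rw [hg _ _ (by omega), tmul_zero]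
    · rw [hf _ _ ha, zero_tmul]

lemma frontBack_eq (p q : ℕ) (c : Chains k E) : frontBack k π p q c = tmap (degreeProj k E q)
      (ndProj k B p ∘ₗ chainsMap k π) (diagonal k E c) := by
  classical
  suffices h : frontBack k π p q = tmap (degreeProj k E q)
      (ndProj k B p ∘ₗ chainsMap k π) ∘ₗ diagonal k E from lcongr_fun h c
  refine chains_ext k fun n α => ?_
  refine (frontBack_simplexChain p q α).trans ((map_diagonal_simplexChain _ _ q p
    (fun m β hm => ?_) (fun m β hm => ?_) α).trans ?_).symm
  · rw [degreeProj_simplexChain, if_neg (by omega)]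
  · rw [lcomp_apply, chainsMap_simplexChain, ndProj_simplexChain, if_neg fun h => hm h.1]
  · split_ifs with h hd
    · rw [lcomp_apply, chainsMap_simplexChain, ndProj_simplexChain,
        if_neg fun h => h.2 hd, tmul_zero]
    · rw [lcomp_apply, chainsMap_simplexChain, ndProj_simplexChain,
        if_pos ⟨rfl, hd⟩, degreeProj_simplexChain, if_pos rfl]
    · rfl

lemma slice_frontBack_mem (p q : ℕ) (l : Chains k B →ₗ[k] k) {m : ℤ} {c : Chains k E}
    (hc : c ∈ 𝗦.fil m) :
    slice l (frontBack k π p q c) ∈ 𝗦.fil (m - p) := by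
  classical
  refine map_mem_of_single (slice l ∘ₗ frontBack k π p q) (serreSimplices π m) _
    (fun ⟨n, α⟩ hα => ?_) c hc
  refine (congrArg (fun t => slice l t ∈ _) (frontBack_simplexChain p q α)).mpr ?_
  split_ifs with h hd
  · rw [map_zero]; exact zero_mem _
  · rw [slice_tmul]
    refine Submodule.smul_mem _ _ (simplexChain_mem_supported k _
      ((mem_serreSimplices_iff π _ _).2 ?_))
    rw [Sing.not_isDegenerate_iff] at hd
    have h1 : (Sing.weight (π.comp α : Sing n B) : ℤ) ≤ m := (mem_serreSimplices_iff π _ _).1 hα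
    have h2 := Sing.weight_front_add_weight_back (π.comp α : Sing n B) q p h
    have h3 : Sing.weight (Sing.back (π.comp α : Sing n B) q p h) = p := hd
    change (Sing.weight (Sing.front (π.comp α : Sing n B) q (by omega)) : ℤ) ≤ _; omega
  · rw [map_zero]; exact zero_mem _

lemma slice_frontBack_mem_degree (p q : ℕ) (l : Chains k B →ₗ[k] k) (c : Chains k E) :
    slice l (frontBack k π p q c) ∈ chainsOfDegree k E q := by
  classical
  refine map_mem_of_single (slice l ∘ₗ frontBack k π p q) Set.univ _
    (fun ⟨n, α⟩ _ => ?_) c (by rw [supported_univ]; trivial)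
  refine (congrArg (fun t => slice l t ∈ _) (frontBack_simplexChain p q α)).mpr ?_
  split_ifs with h hd
  · rw [map_zero]; exact zero_mem _
  · rw [slice_tmul]; exact Submodule.smul_mem _ _ (simplexChain_mem_supported k _ rfl)
  · rw [map_zero]; exact zero_mem _

lemma frontBack_boundary (p q : ℕ) (c : Chains k E) : frontBack k π p q (boundary k E c) =
      rTensor _ (boundary k E) (frontBack k π p (q + 1) c) +
      (-1 : k) ^ q • lTensor _ (ndProj k B p ∘ₗ boundary k B) (frontBack k π (p + 1) q c) := by
  classical
  rw [frontBack_eq, frontBack_eq, frontBack_eq, diagonal_boundary]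
  generalize diagonal k E c = t
  induction t using induction_on with
  | zero => simp only [map_zero, smul_zero, add_zero]
  | add t t' h h' => simp only [map_add, smul_add, h, h']; abel
  | tmul x y =>
    simp only [tensorD, ladd_apply, map_tmul, idₗ_apply, map_add,
      rTensor_tmul, lTensor_tmul, lcomp_apply]
    rw [degreeProj_boundary, ndProj_boundary, chainsMap_boundary, Nat.cast_succ, smul_tmul']
    congr 2
    suffices h : degreeProj k E q ∘ₗ chainSgn k E = (-1 : k) ^ q • degreeProj k E q from
      lcongr_fun h x
    refine chains_ext k fun n α => ?_
    change degreeProj k E q (chainSgn k E (simplexChain k α)) =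
      (-1 : k) ^ q • degreeProj k E q (simplexChain k α)
    rw [chainSgn_simplexChain, map_smul, degreeProj_simplexChain]
    split_ifs with h
    · obtain rfl : n = q := Int.ofNat_inj.1 h
      rfl
    · rw [smul_zero, smul_zero]

variable [SimplyConnectedSpace B] (hπ) (b)

lemma frontBackClass_boundary (p q : ℕ) {z : Chains k E}
    (hz : z ∈ 𝗦.almostCycles 1 (((p + 1 : ℕ) : ℤ), (q : ℤ))) :
    frontBackClass hπ k b q p (boundary k E z) =
      (-1 : k) ^ q • lTensor _ (ndProj k B p ∘ₗ boundary k B)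
        (frontBackClass hπ k b q (p + 1) z) := by
  obtain ⟨⟨hzf, -⟩, hdz⟩ := hz
  have hf : z ∈ 𝗦.fil ((p + 1 : ℕ) : ℤ) := hzf
  have hd : boundary k E z ∈ 𝗦.fil p := by
    have : boundary k E z ∈ 𝗦.fil (((p + 1 : ℕ) : ℤ) - 1) := hdz
    rwa [Nat.cast_succ, add_sub_cancel_right] at this
  have key : rTensor _ (fiberRetrAt hπ k b q)
      (rTensor _ (boundary k E) (frontBack k π p (q + 1) z)) = 0 := by
    refine eq_zero_of_slice_eq_zero fun l => ?_
    have h0 := congrArg (slice l) (frontBack_boundary (π := π) p q z)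
    rw [map_add, rTensor, slice_map, comp_id] at h0; rw [rTensor, slice_map, rTensor, slice_map]
    simp only [comp_id]
    refine fiberRetrAt_boundary_of_mem_fil_one k hπ b ?_
      (slice_frontBack_mem_degree p (q + 1) l z) ?_
    · have := slice_frontBack_mem p (q + 1) l hf
      rwa [Nat.cast_succ, add_sub_cancel_left] at this
    · rw [← sub_eq_iff_eq_add.2 h0]
      refine sub_mem ?_ ?_
      · have := slice_frontBack_mem p q l hd
        rwa [sub_self] at this
      · rw [map_smul, lTensor, slice_map]
        refine Submodule.smul_mem _ _ ?_
        have := slice_frontBack_mem (p + 1) q (l ∘ₗ ndProj k B p ∘ₗ boundary k B) hf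
        rwa [sub_self] at this
  rw [frontBackClass, lcomp_apply, frontBack_boundary, map_add, key, zero_add, map_smul]; congr 1
  exact (lcongr_fun (LinearMap.rTensor_comp_lTensor _ _ _) _).trans
    (lcongr_fun (LinearMap.lTensor_comp_rTensor _ _ _) _).symm

lemma lTensor_frontBackClass (p q : ℕ) (c : Chains k E) :
    lTensor _ (ndProj k B p) (frontBackClass hπ k b q p c) = frontBackClass hπ k b q p c := by
  classical
  suffices h : lTensor _ (ndProj k B p) ∘ₗ frontBackClass hπ k b q p =
      frontBackClass hπ k b q p from lcongr_fun h c
  refine chains_ext k fun n α => ?_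
  change lTensor _ _ (rTensor _ _ (frontBack k π p q (simplexChain k α))) =
    rTensor _ _ (frontBack k π p q (simplexChain k α))
  rw [frontBack_simplexChain]
  split_ifs with h hd
  · simp only [map_zero]
  · rw [rTensor_tmul, lTensor_tmul, ndProj_simplexChain, if_pos ⟨rfl, hd⟩]
  · simp only [map_zero]

end FrontBackBoundary

/-! ### The second page -/

section Tensor

variable {A C C' D D' : Type*} [AddCommGroup A] [Module k A] [AddCommGroup C] [Module k C]
  [AddCommGroup C'] [Module k C'] [AddCommGroup D] [Module k D] [AddCommGroup D'] [Module k D']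

lemma exists_lTensor_eq (f : C →ₗ[k] D) (g : D' →ₗ[k] C) (h : ∀ c, f c = 0 → ∃ d, g d = c)
    {t : A ⊗[k] C} (ht : lTensor A f t = 0) : ∃ s, lTensor A g s = t := by
  obtain ⟨f', hf'⟩ := exists_generalized_inverse f
  obtain ⟨g', hg'⟩ := exists_generalized_inverse g
  refine ⟨lTensor A (g' ∘ₗ (idₗ - f' ∘ₗ f)) t, ?_⟩
  have e : g ∘ₗ g' ∘ₗ (idₗ - f' ∘ₗ f) = idₗ - f' ∘ₗ f := by
    refine lin_ext fun c => ?_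
    obtain ⟨d, hd⟩ := h ((idₗ - f' ∘ₗ f : C →ₗ[k] C) c) (by simp [hf'])
    rw [lcomp_apply, lcomp_apply, ← hd, hg']
  rw [← lcomp_apply, ← lTensor_comp, e, lTensor_sub,
    lsub_apply, lTensor_id, idₗ_apply, lTensor_comp,
    lcomp_apply, ht, map_zero, sub_zero]

lemma lTensor_prod_eq_zero {f : C →ₗ[k] D} {g : C →ₗ[k] D'} {t : A ⊗[k] C}
    (hf : lTensor A f t = 0) (hg : lTensor A g t = 0) :
    lTensor A (f.prod g) t = 0 := by
  have h : f.prod g = LinearMap.inl k D D' ∘ₗ f + LinearMap.inr k D D' ∘ₗ g := by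
    refine lin_ext fun c => Prod.ext ?_ ?_ <;> simp
  rw [h, LinearMap.lTensor_add, lTensor_comp, lTensor_comp,
    ladd_apply, lcomp_apply, lcomp_apply, hf, hg, map_zero, map_zero,
    add_zero]

end Tensor

section NormalizedHomology

lemma sub_ndProj_mem {p : ℕ} {c : Chains k X} (hc : c ∈ chainsOfDegree k X p) :
    c - ndProj k X p c ∈ degenerateChains k X := by
  classical
  have h : c - ndProj k X p c ∈ supported k k _ := sub_basisProj_mem _ hc
  intro s hs
  by_contra hd
  exact (h hs).2 ⟨Int.ofNat_inj.1 (h hs).1, hd⟩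

lemma ndProj_mem (p : ℕ) (c : Chains k X) : ndProj k X p c ∈ chainsOfDegree k X p := by
  classical
  have h : ndProj k X p c ∈ supported k k _ :=
    basisProj_mem (T := Set.univ) _ (by rw [supported_univ]; trivial)
  exact fun s hs => congrArg Nat.cast (h hs).2.1

variable (k X) in
def ndBoundary : ℕ → Chains k X →ₗ[k] Chains k X
  | 0 => 0
  | p + 1 => ndProj k X p ∘ₗ boundary k X

lemma boundary_mem_degenerateChains_of_ndBoundary {p : ℕ} {c : Chains k X}
    (hc : c ∈ chainsOfDegree k X p) (h : ndBoundary k X p c = 0) :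
    boundary k X c ∈ degenerateChains k X := by
  have hd := (singularChains k X).d_mem_gr p c hc
  match p, h with
  | 0, _ =>
    refine supported_mono (fun s hs => ?_) hd
    have : (s.1 : ℤ) = ((0 : ℕ) : ℤ) - 1 := hs
    omega
  | p + 1, h =>
    have h : ndProj k X p (boundary k X c) = 0 := h
    have hd' : boundary k X c ∈ chainsOfDegree k X p := by
      rwa [Nat.cast_succ, add_sub_cancel_right] at hd
    have := sub_ndProj_mem hd'
    rwa [h, sub_zero] at this

variable {A : Type*} [AddCommGroup A] [Module k A]

lemma exists_lTensor_boundary_eq {p : ℕ} {t : A ⊗[k] Chains k X}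
    (h1 : lTensor A (ndProj k X p) t = t)
    (h2 : lTensor A (ndBoundary k X p) t = 0)
    (h3 : lTensor A (homologyRetr k X p) t = 0) :
    ∃ s, lTensor A (ndProj k X p ∘ₗ boundary k X) s = t := by
  have h1' : lTensor A (idₗ - ndProj k X p) t = 0 := by
    rw [lTensor_sub, lsub_apply, h1, lTensor_id, idₗ_apply, sub_self]
  have h23 := lTensor_prod_eq_zero (f := ndBoundary k X p) (g := homologyRetr k X p) h2 h3
  have h123 := lTensor_prod_eq_zero (f := idₗ - ndProj k X p)
    (g := (ndBoundary k X p).prod (homologyRetr k X p)) h1' h23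
  refine exists_lTensor_eq _ _ (fun c hc => ?_) h123
  · obtain ⟨hc1, hc23⟩ := Prod.mk_eq_zero.1 hc
    obtain ⟨hc2, hc3⟩ := Prod.mk_eq_zero.1 hc23
    rw [lsub_apply, idₗ_apply] at hc1
    have hcd : c ∈ chainsOfDegree k X p := by
      have := ndProj_mem p c
      rwa [← sub_eq_zero.1 hc1] at this
    obtain ⟨s, -, hs⟩ := exists_sub_boundary_mem_degenerateChains hcd
      (boundary_mem_degenerateChains_of_ndBoundary hcd hc2) hc3
    refine ⟨s, ?_⟩
    have h := ndProj_degenerate p hs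
    rw [map_sub] at h; exact (sub_eq_zero.1 h).symm.trans (sub_eq_zero.1 hc1).symm

end NormalizedHomology

section SecondPage

variable [SimplyConnectedSpace B] (hπ) (k) (b) (p q : ℕ)

def secondPageClass : Chains k E →ₗ[k] 𝗛 (Fiber π b) q ⊗[k] 𝗛 B p :=
  lTensor _ (homologyRetr k B p) ∘ₗ frontBackClass hπ k b q p

variable {k p q}

lemma secondPageClass_surjective (h : 𝗛 (Fiber π b) q ⊗[k] 𝗛 B p) :
    ∃ z ∈ 𝗦.almostCycles 2 ((p : ℤ), (q : ℤ)), secondPageClass hπ k b p q z = h := by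
  obtain ⟨t, rfl⟩ := LinearMap.lTensor_surjective (𝗛 (Fiber π b) q)
    (homologyClass_surjective (k := k) (X := B) p) h
  set t' := lTensor (𝗛 (Fiber π b) q) ((singularChains k B).cycles p).subtype t with ht'
  obtain ⟨z, hz, hzt⟩ := exists_frontBackClass_eq (p := p) hπ b q t'
  have hcls : secondPageClass hπ k b p q z =
      lTensor _ ((singularChains k B).homologyClass p) t := by
    rw [secondPageClass, lcomp_apply, hzt, ht', ← lcomp_apply,
      ← lcomp_apply, ← lTensor_comp, ← lTensor_comp]
    congr 2
    refine lin_ext fun c => ?_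
    refine Eq.trans (b := homologyRetr k B p c) ?_ (homologyRetr_cycle c)
    have := homologyRetr_degenerate (p : ℤ) (sub_ndProj_mem c.2.2)
    rw [map_sub, sub_eq_zero] at this; exact this.symm
  obtain ⟨⟨hzf, hzd⟩, hdz⟩ := hz
  match p, t, z, hzf, hzd, hdz, hcls, hzt with
  | 0, t, z, hzf, hzd, hdz, hcls, hzt =>
    refine ⟨z, ⟨⟨hzf, hzd⟩, ?_⟩, hcls⟩
    have h0 : boundary k E z ∈ 𝗦.fil (((0 : ℕ) : ℤ) - 1) := hdz
    rw [(serre_hasWeights k π).fil_eq_bot (by simp), mem_bot] at h0; change boundary k E z ∈ 𝗦.fil _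
    rw [h0]
    exact zero_mem _
  | p + 1, t, z, hzf, hzd, hdz, hcls, hzt =>
    have h1 := frontBackClass_boundary hπ b p q ⟨⟨hzf, hzd⟩, hdz⟩
    have h2 : frontBackClass hπ k b q p (boundary k E z) = 0 := by
      rw [h1, hzt, ht', ← lcomp_apply, ← lcomp_apply, ← lTensor_comp, ← lTensor_comp]
      rw [show ((ndProj k B p ∘ₗ boundary k B) ∘ₗ ndProj k B (p + 1)) ∘ₗ
        ((singularChains k B).cycles (p + 1 : ℕ)).subtype = 0 from lin_ext fun c => ?_,
        LinearMap.lTensor_zero, lzero_apply, smul_zero]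
      have hc : boundary k B c = 0 := c.2.1
      refine (ndProj_boundary p (c : Chains k B)).trans ?_
      rw [hc, map_zero]; rfl
    have h3 : boundary k E z ∈ 𝗦.almostCycles 1 ((p : ℤ), (q : ℤ)) :=
      𝗦.d_mem_almostCycles 1 (x := (((p + 1 : ℕ) : ℤ), (q : ℤ))) (by simp)
        ⟨⟨hzf, hzd⟩, hdz⟩
    obtain ⟨w, hw, hzw⟩ := exists_of_frontBackClass_eq_zero hπ b q h3 h2
    refine ⟨z - w, ⟨⟨sub_mem hzf (𝗦.fil_mono (by simp) hw.1),
      sub_mem hzd ?_⟩, ?_⟩, ?_⟩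
    · have := hw.2
      rwa [show (p : ℤ) + (q + 1) = ((p + 1 : ℕ) : ℤ) + q by push_cast; ring] at this
    · change boundary k E (z - w) ∈ 𝗦.fil (((p + 1 : ℕ) : ℤ) - 2); rw [map_sub]
      rwa [show ((p + 1 : ℕ) : ℤ) - 2 = (p : ℤ) - 1 by push_cast; ring]
    · rw [map_sub, hcls, sub_eq_self, secondPageClass, lcomp_apply, frontBackClass,
        lcomp_apply, frontBack_eq_zero, map_zero, map_zero]
      have := hw.1
      rwa [show (p : ℤ) = ((p + 1 : ℕ) : ℤ) - 1 by push_cast; ring] at this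

lemma lTensor_ndBoundary_frontBackClass {z : Chains k E}
    (hz : z ∈ 𝗦.almostCycles 2 ((p : ℤ), (q : ℤ))) :
    lTensor _ (ndBoundary k B p) (frontBackClass hπ k b q p z) = 0 := by
  have hz1 := 𝗦.almostCycles_succ_le 1 _ hz
  match p, hz, hz1 with
  | 0, _, _ => rw [ndBoundary, LinearMap.lTensor_zero, lzero_apply]
  | p + 1, hz, hz1 =>
    have h1 := frontBackClass_boundary hπ b p q hz1
    rw [frontBackClass, lcomp_apply, frontBack_eq_zero, map_zero] at h1
    · have h2 := congrArg (fun t => (-1 : k) ^ q • t) h1.symm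
      rwa [smul_smul, ← mul_pow, neg_one_mul, neg_neg, one_pow, one_smul, smul_zero] at h2
    · have h2 : boundary k E z ∈ 𝗦.fil (((p + 1 : ℕ) : ℤ) - 2) := hz.2
      rwa [show ((p + 1 : ℕ) : ℤ) - 2 = (p : ℤ) - 1 by push_cast; ring] at h2

lemma mem_pageDenominator_of_secondPageClass_eq_zero {z : Chains k E}
    (hz : z ∈ 𝗦.almostCycles 2 ((p : ℤ), (q : ℤ)))
    (h : secondPageClass hπ k b p q z = 0) :
    z ∈ 𝗦.pageDenominator 2 ((p : ℤ), (q : ℤ)) := by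
  have hz1 := 𝗦.almostCycles_succ_le 1 _ hz
  obtain ⟨s, hs⟩ := exists_lTensor_boundary_eq (lTensor_frontBackClass hπ b p q z)
    (lTensor_ndBoundary_frontBackClass hπ b hz) h
  obtain ⟨y, hy, hys⟩ := exists_frontBackClass_eq (p := p + 1) hπ b q s
  have hdy := frontBackClass_boundary hπ b p q hy
  rw [hys, ← lcomp_apply (lTensor _ _), ← lTensor_comp,
    LinearMap.comp_assoc, show ndProj k B p ∘ₗ boundary k B ∘ₗ ndProj k B (p + 1) =
      ndProj k B p ∘ₗ boundary k B from
      lin_ext fun c => ndProj_boundary p c, hs] at hdy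
  have hyd : boundary k E y ∈ 𝗦.almostCycles 1 ((p : ℤ), (q : ℤ)) :=
    𝗦.d_mem_almostCycles 1 (by simp) hy
  obtain ⟨w, hw, hzw⟩ := exists_of_frontBackClass_eq_zero hπ b q
    (sub_mem hz1 (Submodule.smul_mem _ ((-1 : k) ^ q) hyd)) (by
      rw [map_sub, map_smul, hdy, smul_smul, ← mul_pow, neg_one_mul, neg_neg, one_pow, one_smul,
        sub_self])
  have e : boundary k E ((-1 : k) ^ q • y + w) + (z - (-1 : k) ^ q • boundary k E y -
      boundary k E w) = z := by
    rw [map_add, map_smul]; abel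
  have hdw : boundary k E w ∈ 𝗦.filGr ((p : ℤ), (q : ℤ)) := by
    refine ⟨𝗦.d_mem_fil _ _ hw.1, ?_⟩
    have := 𝗦.d_mem_gr _ _ hw.2
    rwa [show (p : ℤ) + (q + 1) - 1 = p + q by ring] at this
  rw [← e]
  refine Submodule.add_mem_sup ⟨?_, _, ?_, rfl⟩ ⟨hzw, ?_⟩
  · rw [map_add, map_smul]; exact add_mem (Submodule.smul_mem _ _ hyd.1) hdw
  · refine add_mem (Submodule.smul_mem _ _ ⟨?_, ?_⟩) ⟨𝗦.fil_mono (by simp) hw.1, ?_⟩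
    · have := hy.1.1
      simpa using this
    · have := hy.1.2
      simpa using this
    · have := hw.2
      simpa [add_assoc, add_comm, add_left_comm] using this
  · have : z - (-1 : k) ^ q • boundary k E y - boundary k E w ∈ 𝗦.gr ((p : ℤ) + q) :=
      sub_mem (sub_mem hz.1.2 (Submodule.smul_mem _ _ hyd.1.2)) hdw.2
    rwa [show (p : ℤ) + q = p - 1 + (q + 1) by ring] at this

end SecondPage

/-! ### The cup-one product with a cocycle -/

section CupOne

def auxJump (p i x : ℕ) : ℕ := if x ≤ i then x else x + p - 1

/-- The map `α ↦ ∑ i, (-1)^{(p+1)i} c(α ∘ [i, …, i + p]) α ∘ [0, …, i, i + p, …, n]`. -/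
def cupOne (c : Chains k X →ₗ[k] k) (p : ℕ) : Chains k X →ₗ[k] Chains k X :=
  linearCombination k fun s : (Σ n : ℕ, Sing n X) =>
    ∑ i ∈ range (s.1 + 1 - p), ((-1 : k) ^ ((p + 1) * i) *
      c (auxFace k s.2 p fun x => i + x)) • auxFace k s.2 (s.1 + 1 - p) (auxJump p i)

variable (c : Chains k X →ₗ[k] k) (p : ℕ)

lemma cupOne_simplexChain {n : ℕ} (α : Sing n X) : cupOne c p (simplexChain k α) =
    ∑ i ∈ range (n + 1 - p), ((-1 : k) ^ ((p + 1) * i) *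
      c (auxFace k α p fun x => i + x)) • auxFace k α (n + 1 - p) (auxJump p i) :=
  (linearCombination_single k _ _).trans (one_smul _ _)

lemma auxFace_pull {N n m : ℕ} (α : Sing N X) (g g' : ℕ → ℕ) (h : ∀ x ≤ m, g' x ≤ n) :
    auxFace k (α.pull fun i : Fin (n + 1) => Fin.ofNat (N + 1) (g i)) m g' =
      auxFace k α m (g ∘ g') := by
  unfold auxFace; rw [Sing.pull_pull]; congr 2
  funext a
  simp only [Function.comp_apply, Fin.val_ofNat]
  rw [Nat.mod_eq_of_lt (Nat.lt_succ_of_le (h a (by omega)))]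

lemma cupOne_auxFace {N n : ℕ} (α : Sing N X) (g : ℕ → ℕ) : cupOne c p (auxFace k α n g) =
    ∑ i ∈ range (n + 1 - p), ((-1 : k) ^ ((p + 1) * i) *
      c (auxFace k α p fun x => g (i + x))) • auxFace k α (n + 1 - p) (g ∘ auxJump p i) := by
  refine (cupOne_simplexChain c p _).trans (sum_congr rfl fun i hi => ?_)
  have hi' := mem_range.1 hi
  rw [auxFace_pull α g _ (by omega), auxFace_pull α g _ fun x hx => by
    unfold auxJump; split_ifs <;> omega]
  rfl

variable (q : ℕ) (α : Sing (p + q) X)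

local notation "𝗲" => (-1 : k)
local notation "𝗮" g:max => c (auxFace k α p g)
local notation "𝗯" g:max => auxFace k α q g

lemma cupOne_boundary : cupOne c p (boundary k X (simplexChain k α)) = ∑ i ∈ range q,
      ∑ l ∈ range (p + q + 1), (𝗲 ^ ((p + 1) * i + l) * 𝗮 (fun x => auxSkip l (i + x))) •
          𝗯 (auxSkip l ∘ auxJump p i) := by
  rw [simplexChain_eq_auxFace]
  generalize hN : p + q = N at α
  match N, hN, α with
  | 0, hN, α =>
    obtain rfl : q = 0 := by omega
    rw [boundary_auxFace_zero, map_zero]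
    rfl
  | m + 1, hN, α =>
    rw [boundary_auxFace_succ, map_sum, sum_comm]
    refine sum_congr rfl fun l _ => ?_
    rw [map_smul, cupOne_auxFace, smul_sum]; rw [show m + 1 - p = q by omega]
    refine sum_congr rfl fun i _ => ?_
    rw [smul_smul, ← mul_assoc, ← pow_add, add_comm l]; rfl

lemma boundary_cupOne (hc : ∀ x, c (boundary k X x) = 0) :
    boundary k X (cupOne c p (simplexChain k α)) =
      𝗲 ^ (p + 1) • cupOne c p (boundary k X (simplexChain k α)) +
      𝗮 id • 𝗯 (fun x => p + x) -
      (𝗲 ^ (p * q) * 𝗮 (q + ·)) • 𝗯 id := by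
  have hcoc : ∀ i, 𝗮 (i + 1 + ·) + 𝗲 ^ (p + 1) * 𝗮 (i + ·) = -∑ l ∈ range p, 𝗲 ^ (l + 1) *
        𝗮 (fun x => auxSkip (i + 1 + l) (i + x)) := by
    intro i
    have h := hc (auxFace k α (p + 1) fun x => i + x)
    rw [boundary_auxFace_succ, map_sum, sum_range_succ, sum_range_succ'] at h
    simp only [map_smul, smul_eq_mul, pow_zero, one_mul] at h
    rw [auxFace_congr α (m := p) (g := (fun x => i + x) ∘ auxSkip 0) (g' := fun x => i + 1 + x)
        (fun x _ => by simp only [Function.comp_apply, auxSkip]; split_ifs <;> omega),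
      auxFace_congr α (m := p) (g := (fun x => i + x) ∘ auxSkip (p + 1)) (g' := fun x => i + x)
        (fun x _ => by simp only [Function.comp_apply, auxSkip]; split_ifs <;> omega)] at h
    rw [eq_neg_iff_add_eq_zero, ← h, sum_congr rfl fun l _ => by
      rw [auxFace_congr α (m := p) (g := fun x => auxSkip (i + 1 + l) (i + x))
        (g' := (fun x => i + x) ∘ auxSkip (l + 1))
        (fun x _ => by simp only [Function.comp_apply, auxSkip]; split_ifs <;> omega)]]
    ring
  rw [cupOne_boundary, cupOne_simplexChain, show p + q + 1 - p = q + 1 by omega, map_sum]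
  -- the terms of the boundary, by the position of the omitted vertex
  have hsplit : ∀ i ∈ range (q + 1), boundary k X ((𝗲 ^ ((p + 1) * i) * 𝗮 (i + ·)) •
        auxFace k α (q + 1) (auxJump p i)) =
      ∑ j ∈ range i, (𝗲 ^ ((p + 1) * i + j) * 𝗮 (i + ·)) • 𝗯 (auxJump p i ∘ auxSkip j) +
      ∑ j ∈ range (q - i), (𝗲 ^ ((p + 1) * i + (i + 2 + j)) *
        𝗮 (i + ·)) • 𝗯 (auxJump p i ∘ auxSkip (i + 2 + j)) +
      ((𝗲 ^ (p * i) * 𝗮 (i + ·)) • 𝗯 (auxJump p i ∘ auxSkip i) -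
      (𝗲 ^ (p * i) * 𝗮 (i + ·)) • 𝗯 (auxJump p i ∘ auxSkip (i + 1))) := by
    intro i hi
    have hi' := mem_range.1 hi
    rw [map_smul, boundary_auxFace_succ, smul_sum, show q + 2 = i + 2 + (q - i) by omega,
      Finset.sum_range_add, sum_range_succ, sum_range_succ]
    have e : ∀ j, 𝗲 ^ ((p + 1) * i) * 𝗮 (i + ·) * 𝗲 ^ j =
        𝗲 ^ ((p + 1) * i + j) * 𝗮 (i + ·) := fun j => by ring
    simp only [smul_smul, e]
    rw [show (p + 1) * i + i = p * i + 2 * i by ring,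
      show (p + 1) * i + (i + 1) = p * i + 2 * i + 1 by ring, pow_add, pow_succ, pow_add,
      pow_mul 𝗲 2, neg_one_sq, one_pow, mul_one, mul_neg_one, neg_mul, neg_smul]
    abel
  rw [sum_congr rfl hsplit, sum_add_distrib, sum_add_distrib,
    sum_range_succ' (fun i => ∑ j ∈ range i, _), range_zero,
    sum_empty, add_zero, sum_range_succ (fun i => ∑ j ∈ range (q - i), _),
    Nat.sub_self, range_zero, sum_empty, add_zero, sum_sub_distrib,
    sum_range_succ' (fun i => (𝗲 ^ (p * i) * _) • 𝗯 (auxJump p i ∘ auxSkip i)),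
    sum_range_succ (fun i => (𝗲 ^ (p * i) * _) • 𝗯 (auxJump p i ∘ auxSkip (i + 1)))]
  have ha : 𝗯 (auxJump p 0 ∘ auxSkip 0) = 𝗯 (fun x => p + x) :=
    auxFace_congr α fun x _ => by simp only [Function.comp_apply, auxSkip, auxJump]; split_ifs <;> omega
  have hb : 𝗯 (auxJump p q ∘ auxSkip (q + 1)) = 𝗯 id :=
    auxFace_congr α fun x _ => by simp only [Function.comp_apply, auxSkip, auxJump, id]; split_ifs <;> omega
  have hz : (auxFace k α p fun x => 0 + x) = auxFace k α p id :=
    auxFace_congr α fun x _ => Nat.zero_add x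
  rw [ha, hb, hz, mul_zero, pow_zero, one_mul]
  suffices key : ∀ i ∈ range q, 𝗲 ^ (p + 1) • ∑ l ∈ range (p + q + 1), (𝗲 ^ ((p + 1) * i + l) *
        𝗮 (fun x => auxSkip l (i + x))) • 𝗯 (auxSkip l ∘ auxJump p i) =
      ∑ j ∈ range (i + 1), (𝗲 ^ ((p + 1) * (i + 1) + j) *
        𝗮 (i + 1 + ·)) • 𝗯 (auxJump p (i + 1) ∘ auxSkip j) +
      ∑ j ∈ range (q - i), (𝗲 ^ ((p + 1) * i + (i + 2 + j)) *
        𝗮 (i + ·)) • 𝗯 (auxJump p i ∘ auxSkip (i + 2 + j)) +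
      ((𝗲 ^ (p * (i + 1)) * 𝗮 (i + 1 + ·)) • 𝗯 (auxJump p (i + 1) ∘ auxSkip (i + 1)) -
      (𝗲 ^ (p * i) * 𝗮 (i + ·)) • 𝗯 (auxJump p i ∘ auxSkip (i + 1))) by
    rw [smul_sum, sum_congr rfl key, sum_add_distrib, sum_add_distrib, sum_sub_distrib]; abel
  intro i hi
  have hi' := mem_range.1 hi
  rw [show p + q + 1 = i + 1 + p + (q - i) by omega, Finset.sum_range_add, Finset.sum_range_add,
    smul_add, smul_add, smul_sum (s := range (i + 1)),
    smul_sum (s := range (q - i))]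
  have h1 : ∀ j ∈ range (i + 1), 𝗲 ^ (p + 1) • ((𝗲 ^ ((p + 1) * i + j) *
      𝗮 (fun x => auxSkip j (i + x))) • 𝗯 (auxSkip j ∘ auxJump p i)) =
      (𝗲 ^ ((p + 1) * (i + 1) + j) * 𝗮 (i + 1 + ·)) • 𝗯 (auxJump p (i + 1) ∘ auxSkip j) := by
    intro j hj
    have hj' := mem_range.1 hj
    rw [smul_smul, ← mul_assoc, ← pow_add,
      show p + 1 + ((p + 1) * i + j) = (p + 1) * (i + 1) + j by ring]
    refine congrArg₂ (fun a b : Chains k X => (𝗲 ^ _ * c a) • b)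
      (auxFace_congr α fun x _ => ?_) (auxFace_congr α fun x _ => ?_)
    · simp only [auxSkip]; split_ifs <;> omega
    · simp only [Function.comp_apply, auxSkip, auxJump]; split_ifs <;> omega
  have h2 : ∀ j ∈ range (q - i), 𝗲 ^ (p + 1) • ((𝗲 ^ ((p + 1) * i + (i + 1 + p + j)) *
        𝗮 (fun x => auxSkip (i + 1 + p + j) (i + x))) • 𝗯 (auxSkip (i + 1 + p + j) ∘ auxJump p i)) =
      (𝗲 ^ ((p + 1) * i + (i + 2 + j)) * 𝗮 (i + ·)) • 𝗯 (auxJump p i ∘ auxSkip (i + 2 + j)) := by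
    intro j hj
    rw [smul_smul, ← mul_assoc, ← pow_add, show p + 1 + ((p + 1) * i + (i + 1 + p + j)) =
      (p + 1) * i + (i + 2 + j) + 2 * p by ring, pow_add, pow_mul 𝗲 2, neg_one_sq, one_pow,
      mul_one]
    refine congrArg₂ (fun a b : Chains k X => (𝗲 ^ _ * c a) • b)
      (auxFace_congr α fun x _ => ?_) (auxFace_congr α fun x _ => ?_)
    · simp only [auxSkip]; split_ifs <;> omega
    · simp only [Function.comp_apply, auxSkip, auxJump]; split_ifs <;> omega
  rw [sum_congr rfl h1, sum_congr rfl h2]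
  have h3 : ∀ l ∈ range p, 𝗯 (auxSkip (i + 1 + l) ∘ auxJump p i) =
      𝗯 (auxJump p i ∘ auxSkip (i + 1)) := by
    intro l hl
    have hl' := mem_range.1 hl
    refine auxFace_congr α fun x _ => ?_
    simp only [Function.comp_apply, auxSkip, auxJump]; split_ifs <;> omega
  have h4 : 𝗯 (auxJump p (i + 1) ∘ auxSkip (i + 1)) = 𝗯 (auxJump p i ∘ auxSkip (i + 1)) := by
    refine auxFace_congr α fun x _ => ?_
    simp only [Function.comp_apply, auxSkip, auxJump]; split_ifs <;> omega
  have h6 : ∑ l ∈ range p, (𝗲 ^ ((p + 1) * i + (i + 1 + l)) *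
      𝗮 (fun x => auxSkip (i + 1 + l) (i + x))) • 𝗯 (auxSkip (i + 1 + l) ∘ auxJump p i) =
      (∑ l ∈ range p, 𝗲 ^ ((p + 1) * i + (i + 1 + l)) * 𝗮 (fun x => auxSkip (i + 1 + l) (i + x))) •
          𝗯 (auxJump p i ∘ auxSkip (i + 1)) := by
    rw [Finset.sum_smul]; exact sum_congr rfl fun l hl => by rw [h3 l hl]
  have h5 : 𝗲 ^ (p + 1) * ∑ l ∈ range p, 𝗲 ^ ((p + 1) * i + (i + 1 + l)) *
      𝗮 (fun x => auxSkip (i + 1 + l) (i + x)) =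
      𝗲 ^ (p * (i + 1)) * 𝗮 (i + 1 + ·) - 𝗲 ^ (p * i) * 𝗮 (i + ·) := by
    have e : 𝗲 ^ (p * (i + 1)) * 𝗮 (i + 1 + ·) - 𝗲 ^ (p * i) * 𝗮 (i + ·) = 𝗲 ^ (p * (i + 1)) *
        (𝗮 (i + 1 + ·) + 𝗲 ^ (p + 1) * 𝗮 (i + ·)) := by
      rw [mul_add (𝗲 ^ (p * (i + 1))), ← mul_assoc, ← pow_add,
        show p * (i + 1) + (p + 1) = p * i + 2 * p + 1 by ring,
        pow_succ, pow_add, pow_mul 𝗲 2, neg_one_sq, one_pow]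
      ring
    rw [e, hcoc, mul_neg, Finset.mul_sum, Finset.mul_sum, ← sum_neg_distrib]
    refine sum_congr rfl fun l _ => ?_
    rw [← mul_assoc, ← mul_assoc, ← pow_add, ← pow_add, ← neg_mul,
      show p + 1 + ((p + 1) * i + (i + 1 + l)) = p * (i + 1) + (l + 1) + 2 * i + 1 by ring,
      pow_succ, pow_add _ _ (2 * i), pow_mul 𝗲 2, neg_one_sq, one_pow]
    ring
  rw [h6, smul_smul, h4, ← sub_smul, h5]; abel

end CupOne

/-! ### Symmetry of the comultiplication of the second page -/

section Symmetry

variable {c : Chains k E →ₗ[k] k} {p : ℕ}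

lemma auxFace_eq {X : Type u} [TopologicalSpace X] {m n : ℕ} (α : Sing n X) (g : ℕ →o ℕ)
    (h : ∀ x ≤ m, g x ≤ n) : auxFace k α m g = simplexChain k (α.pull (clampHom m n g)) := by
  unfold auxFace; congr 2
  funext a
  refine Fin.ext ?_
  have := h a (by omega)
  change g a % (n + 1) = min (g a) n; rw [Nat.mod_eq_of_lt (by omega), min_eq_left this]

def addHom (i : ℕ) : ℕ →o ℕ where
  toFun x := i + x
  monotone' _ _ h := Nat.add_le_add_left h i

def jumpHom (p i : ℕ) : ℕ →o ℕ where
  toFun := auxJump p i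
  monotone' x y h := by unfold auxJump; split_ifs <;> omega

variable (hc : ∀ α : Sing p E, Sing.IsDegenerate (π.comp α : Sing p B) → c (simplexChain k α) = 0)
include hc

lemma cupOne_eq_zero {z : Chains k E} (hz : z ∈ 𝗦.fil (p - 1)) : cupOne c p z = 0 := by
  refine eq_on_of_single (cupOne c p) 0 (serreSimplices π (p - 1)) (fun ⟨n, α⟩ hα => ?_) z hz
  refine (cupOne_simplexChain c p α).trans (sum_eq_zero fun i hi => ?_)
  have hi' := mem_range.1 hi
  have h1 : Sing.weight (π.comp α : Sing n B) ≤ (p : ℤ) - 1 := (mem_serreSimplices_iff π _ _).1 hα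
  have h2 := Sing.weight_pull_le (π.comp α : Sing n B) (clampHom p n (addHom i))
  rw [show (fun x => i + x) = addHom i from rfl, auxFace_eq α _ fun x hx =>
    show i + x ≤ n by omega, hc, mul_zero, zero_smul]
  rw [Sing.isDegenerate_iff]; change Sing.weight (Sing.pull (π.comp α : Sing n B) _) < p; omega

lemma cupOne_mem_fil_one {z : Chains k E} (hz : z ∈ 𝗦.fil p) : cupOne c p z ∈ 𝗦.fil 1 := by
  refine map_mem_of_single (cupOne c p) (serreSimplices π p) _ (fun ⟨n, α⟩ hα => ?_) z hz
  have hw := (mem_serreSimplices_iff π p _).1 hα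
  by_cases hlt : serreWeight π ⟨n, α⟩ < p
  · have h0 := cupOne_eq_zero hc (z := simplexChain k α) (simplexChain_mem_supported k _
      ((mem_serreSimplices_iff π _ ⟨n, α⟩).2 (by omega)))
    exact (congrArg (· ∈ 𝗦.fil 1) h0).mpr (zero_mem _)
  obtain ⟨V, hV, s, -, e⟩ : ∃ V : Sing p B, ¬ V.IsDegenerate ∧ ∃ s : Fin (n + 1) →o Fin (p + 1),
      Surjective s ∧ (π.comp α : Sing n B) = V.pull s :=
    exists_isOver (α := ⟨n, α⟩) (by omega)
  refine (congrArg (· ∈ _) (cupOne_simplexChain c p α)).mpr (sum_mem fun i hi => ?_)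
  have hi' := mem_range.1 hi
  rw [show (fun x => i + x) = addHom i from rfl, auxFace_eq α _ fun x hx =>
    show i + x ≤ n by omega]
  by_cases hd : Sing.IsDegenerate (π.comp (α.pull (clampHom p n (addHom i))) : Sing p B)
  · rw [hc _ hd, mul_zero, zero_smul]; exact zero_mem _
  have e' : ∀ {m : ℕ} (f : Fin (m + 1) →o Fin (n + 1)),
      (π.comp (α.pull f) : Sing m B) = V.pull (s.comp f) := fun f =>
    (congrArg (fun W : Sing n B => W.pull f) e).trans (Sing.pull_pull _ _ _)
  rw [e'] at hd
  have hid := Sing.eq_id_of_not_isDegenerate _ hd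
  have hs : ∀ x ≤ p, ∀ h : i + x < n + 1, (s ⟨i + x, h⟩ : ℕ) = x := fun x hx h => by
    refine Eq.trans ?_ (congrArg Fin.val (congrFun hid ⟨x, by omega⟩))
    exact congrArg (fun a => (s a : ℕ)) (Fin.ext (min_eq_left (by change i + x ≤ n; omega)).symm)
  rw [show auxJump p i = jumpHom p i from rfl, auxFace_eq α _ fun x hx => by
    change auxJump p i x ≤ n; unfold auxJump; split_ifs <;> omega]
  refine Submodule.smul_mem _ _ (simplexChain_mem_supported k _
    ((mem_serreSimplices_iff π _ _).2 ?_))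
  let t : Fin (n + 1 - p + 1) →o Fin 2 := ⟨fun a => if (a : ℕ) ≤ i then 0 else 1, fun a b h => by
      have h' : (a : ℕ) ≤ b := h
      dsimp only
      split_ifs
      · exact le_rfl
      · exact Fin.zero_le _
      · omega
      · exact le_rfl⟩
  have e2 : (π.comp (α.pull (clampHom (n + 1 - p) n (jumpHom p i))) : Sing (n + 1 - p) B) =
      (V.pull ![0, Fin.last p]).pull t := by
    rw [e', Sing.pull_pull]
    refine congrArg V.pull (funext fun a => Fin.ext ?_)
    change (s ⟨min (auxJump p i a) n, _⟩ : ℕ) = (![0, Fin.last p] (if (a : ℕ) ≤ i then 0 else 1)).val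
    have ha := a.2
    split_ifs with h
    · have h0 := hs 0 (Nat.zero_le p) (by omega)
      have h1 : s ⟨min (auxJump p i a) n, by omega⟩ ≤ s ⟨i + 0, by omega⟩ :=
        s.monotone (Fin.mk_le_mk.2 (by unfold auxJump; rw [if_pos h]; omega))
      have h1' : (s ⟨min (auxJump p i a) n, by omega⟩ : ℕ) ≤ s ⟨i + 0, by omega⟩ := h1
      exact Nat.le_zero.1 (h1'.trans h0.le)
    · have h0 := hs p le_rfl (by omega)
      have h1 : s ⟨i + p, by omega⟩ ≤ s ⟨min (auxJump p i a) n, by omega⟩ :=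
        s.monotone (Fin.mk_le_mk.2 (by unfold auxJump; rw [if_neg h]; omega))
      have h1' : (s ⟨i + p, by omega⟩ : ℕ) ≤ s ⟨min (auxJump p i a) n, by omega⟩ := h1
      have h2 := (s ⟨min (auxJump p i a) n, by omega⟩).2
      exact le_antisymm (Nat.lt_succ_iff.1 h2) (h0.ge.trans h1')
  change (Sing.weight (π.comp (α.pull (clampHom (n + 1 - p) n (jumpHom p i))) :
    Sing (n + 1 - p) B) : ℤ) ≤ 1
  rw [e2]
  exact_mod_cast (Sing.weight_pull_le _ t).trans (Sing.factorsThrough_self _).weight_le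

omit hc in
lemma auxFace_front {X : Type u} [TopologicalSpace X] {n m : ℕ} (α : Sing n X) (h : m ≤ n) :
    auxFace k α m id = simplexChain k (α.front m h) := by
  unfold auxFace; congr 2
  funext a
  exact Fin.ext (Nat.mod_eq_of_lt (show (a : ℕ) < n + 1 by omega))

omit hc in
lemma auxFace_back {X : Type u} [TopologicalSpace X] {n i j : ℕ} (α : Sing n X) (h : i + j = n) :
    auxFace k α j (fun x => i + x) = simplexChain k (α.back i j h) := by
  unfold auxFace; congr 2
  funext a
  exact Fin.ext (Nat.mod_eq_of_lt (show i + (a : ℕ) < n + 1 by omega))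

omit hc in
lemma boundary_cupOne_sub (hd : ∀ x, c (boundary k E x) = 0) {q : ℕ} (α : Sing (p + q) E) :
    boundary k E (cupOne c p (simplexChain k α)) -
      (-1 : k) ^ (p + 1) • cupOne c p (boundary k E (simplexChain k α)) =
    c (simplexChain k (α.front p (by omega))) • simplexChain k (α.back p q rfl) -
      ((-1 : k) ^ (p * q) * c (simplexChain k (α.back q p (add_comm q p)))) •
        simplexChain k (α.front q (by omega)) := by
  rw [boundary_cupOne c p q α hd, auxFace_front α (Nat.le_add_right p q), auxFace_back α rfl,
    auxFace_front α (Nat.le_add_left q p), auxFace_back α (add_comm q p)]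
  abel

lemma boundary_cupOne_mem (hd : ∀ x, c (boundary k E x) = 0) {q : ℕ} {z : Chains k E}
    (hz : z ∈ 𝗦.filGr ((p : ℤ), (q : ℤ))) :
    boundary k E (cupOne c p z) - (-1 : k) ^ (p + 1) • cupOne c p (boundary k E z) ∈ 𝗦.fil 0 := by
  rw [(serre_hasWeights k π).filGr_eq] at hz
  refine map_mem_of_single (boundary k E ∘ₗ cupOne c p -
    (-1 : k) ^ (p + 1) • (cupOne c p ∘ₗ boundary k E)) _ _ (fun ⟨n, α⟩ hα => ?_) z hz
  obtain ⟨hw, hn⟩ := hα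
  obtain rfl : n = p + q := by
    have : (n : ℤ) = p + q := hn
    omega
  have hw : (Sing.weight (π.comp α : Sing (p + q) B) : ℤ) ≤ p := hw
  refine (congrArg (· ∈ _) (boundary_cupOne_sub hd α)).mpr (sub_mem ?_ ?_)
  · by_cases h : Sing.IsDegenerate (π.comp (α.front p (by omega)) : Sing p B)
    · rw [hc _ h, zero_smul]; exact zero_mem _
    · refine Submodule.smul_mem _ _ (simplexChain_mem_supported k _
        ((mem_serreSimplices_iff π _ _).2 ?_))
      rw [Sing.not_isDegenerate_iff] at h
      have h2 := Sing.weight_front_add_weight_back (π.comp α : Sing (p + q) B) p q rfl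
      have h3 : Sing.weight (Sing.front (π.comp α : Sing (p + q) B) p (by omega)) = p := h
      change (Sing.weight (Sing.back (π.comp α : Sing (p + q) B) p q rfl) : ℤ) ≤ 0; omega
  · by_cases h : Sing.IsDegenerate (π.comp (α.back q p (add_comm q p)) : Sing p B)
    · rw [hc _ h, mul_zero, zero_smul]; exact zero_mem _
    · refine Submodule.smul_mem _ _ (simplexChain_mem_supported k _
        ((mem_serreSimplices_iff π _ _).2 ?_))
      rw [Sing.not_isDegenerate_iff] at h
      have h2 := Sing.weight_front_add_weight_back (π.comp α : Sing (p + q) B) q p (add_comm q p)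
      have h3 : Sing.weight (Sing.back (π.comp α : Sing (p + q) B) q p (add_comm q p)) = p := h
      change (Sing.weight (Sing.front (π.comp α : Sing (p + q) B) q (by omega)) : ℤ) ≤ 0; omega

omit hc in
lemma cupOne_mem_degree {q : ℕ} {z : Chains k E} (hz : z ∈ chainsOfDegree k E (p + q)) :
    cupOne c p z ∈ chainsOfDegree k E (q + 1) := by
  refine map_mem_of_single (cupOne c p) _ _ (fun ⟨n, α⟩ hn => ?_) z hz
  have hn : (n : ℤ) = p + q := hn
  refine (congrArg (· ∈ _) (cupOne_simplexChain c p α)).mpr (sum_mem fun i hi => ?_)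
  refine Submodule.smul_mem _ _ (simplexChain_mem_supported k _ ?_)
  change ((n + 1 - p : ℕ) : ℤ) = q + 1; omega

variable [SimplyConnectedSpace B] (hπ : IsSerreFibration π) (b : B)

lemma fiberRetrAt_symm (hd : ∀ x, c (boundary k E x) = 0) {q : ℕ} {z : Chains k E}
    (hz : z ∈ 𝗦.almostCycles 1 ((p : ℤ), (q : ℤ))) :
    fiberRetrAt hπ k b q (boundary k E (cupOne c p z) -
      (-1 : k) ^ (p + 1) • cupOne c p (boundary k E z)) = 0 := by
  have h1 := boundary_cupOne_mem hc hd hz.1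
  have h2 : boundary k E z ∈ 𝗦.fil (p - 1) := hz.2
  rw [cupOne_eq_zero hc h2, smul_zero, sub_zero] at h1 ⊢
  exact fiberRetrAt_boundary_of_mem_fil_one k hπ b (cupOne_mem_fil_one hc hz.1.1)
    (cupOne_mem_degree hz.1.2) h1

end Symmetry

section SecondPageSymmetry

variable [SimplyConnectedSpace B] (hπ) (k) (b)

lemma homologyRetr_simplexChain_of_ne {X : Type u} [TopologicalSpace X] {n p : ℕ} (h : n ≠ p)
    (α : Sing n X) : homologyRetr k X p (simplexChain k α) = 0 :=
  homologyRetr_of_ne (m := n) (by omega) (simplexChain_mem_supported k α rfl)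

lemma fiberRetrAt_simplexChain_of_ne {n : ℕ} {q : ℤ} (h : (n : ℤ) ≠ q) (α : Sing n E) :
    fiberRetrAt hπ k b q (simplexChain k α) = 0 := by
  by_cases h0 : serreWeight π ⟨n, α⟩ = 0
  · have e : chainsMap k (fiberIncl π _) (simplexChain k
      (α.toFiber ((serreWeight_eq_zero_iff ⟨n, α⟩).1 h0))) = simplexChain k α :=
      chainsMap_simplexChain k _ _
    rw [← e, fiberRetrAt_fiberIncl, homologyRetr_of_ne h
      (simplexChain_mem_supported k _ rfl), map_zero]
  · exact fiberRetrAt_eq_zero hπ k b q (simplexChain_mem_supported k _ h0)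

lemma secondPageClass_eq (p q : ℕ) (z : Chains k E) : secondPageClass hπ k b p q z =
    tmap (fiberRetrAt hπ k b q) (homologyRetr k B p ∘ₗ chainsMap k π) (diagonal k E z) := by
  classical
  suffices h : secondPageClass hπ k b p q = tmap (fiberRetrAt hπ k b q)
      (homologyRetr k B p ∘ₗ chainsMap k π) ∘ₗ diagonal k E from lcongr_fun h z
  refine chains_ext k fun n α => ?_
  change lTensor _ _ (rTensor _ _ (frontBack k π p q (simplexChain k α))) = _
  refine Eq.trans ?_ (map_diagonal_simplexChain _ _ q p
    (fun m β hm => fiberRetrAt_simplexChain_of_ne hπ k b (by omega) β)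
    (fun m β hm => ?_) α).symm
  · rw [frontBack_simplexChain]
    split_ifs with h hdeg
    · rw [lcomp_apply, chainsMap_simplexChain, show homologyRetr k B p
        (simplexChain k (π.comp (α.back q p h) : Sing p B)) = 0 from
        homologyRetr_degenerate _ (simplexChain_mem_supported k _ hdeg),
        tmul_zero, map_zero, map_zero]
    · rw [rTensor_tmul, lTensor_tmul, lcomp_apply, chainsMap_simplexChain]
    · rw [map_zero, map_zero]
  · rw [lcomp_apply, chainsMap_simplexChain, homologyRetr_simplexChain_of_ne k hm]

lemma ext_of_slice {A C : Type*} [AddCommGroup A] [Module k A] [AddCommGroup C] [Module k C]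
    {t t' : A ⊗[k] C} (h : ∀ l : C →ₗ[k] k, slice l t = slice l t') : t = t' := by
  let e := (Module.Free.chooseBasis k C).repr
  refine (LinearEquiv.lTensor A e).injective (sub_eq_zero.1 (eq_zero_of_slice_eq_zero fun l => ?_))
  have h1 := h (l ∘ₗ e.toLinearMap)
  rw [map_sub, sub_eq_zero]
  have h2 : ∀ t, slice l (LinearEquiv.lTensor A e t) = slice (l ∘ₗ e.toLinearMap) t := fun t =>
    (slice_map l idₗ e.toLinearMap t).trans rfl
  rw [h2, h2, h1]

lemma comm_secondPageClass {p q : ℕ} {z : Chains k E}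
    (hz : z ∈ 𝗦.almostCycles 1 ((p : ℤ), (q : ℤ))) :
    tcomm k _ _ (tmap (homologyRetr k B p ∘ₗ chainsMap k π)
      (fiberRetrAt hπ k b q) (diagonal k E z)) =
      (-1 : k) ^ (p * q) • secondPageClass hπ k b p q z := by
  refine ext_of_slice k fun l => ?_
  set c : Chains k E →ₗ[k] k := l ∘ₗ homologyRetr k B p ∘ₗ chainsMap k π with hcdef
  have hc : ∀ α : Sing p E, Sing.IsDegenerate (π.comp α : Sing p B) → c (simplexChain k α) = 0 :=
    fun α hα => by
      rw [hcdef, lcomp_apply, lcomp_apply, chainsMap_simplexChain,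
        show homologyRetr k B p (simplexChain k (π.comp α : Sing p B)) = 0 from
        homologyRetr_degenerate _ (simplexChain_mem_supported k _ hα), map_zero]
  have hd : ∀ x, c (boundary k E x) = 0 := fun x => by
    rw [hcdef, lcomp_apply, lcomp_apply, chainsMap_boundary, homologyRetr_boundary, map_zero]
  have hne : ∀ (n : ℕ) (α : Sing n E), n ≠ p →
      (homologyRetr k B p ∘ₗ chainsMap k π) (simplexChain k α) = 0 := fun n α hn => by
    rw [lcomp_apply, chainsMap_simplexChain, homologyRetr_simplexChain_of_ne k hn]
  have hne' : ∀ (n : ℕ) (α : Sing n E), n ≠ q → fiberRetrAt hπ k b q (simplexChain k α) = 0 :=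
    fun n α hn => fiberRetrAt_simplexChain_of_ne hπ k b (by omega) α
  have h0 := fiberRetrAt_symm hc hπ b hd hz
  rw [secondPageClass_eq, map_smul, ← sub_eq_zero, ← h0]
  refine eq_on_of_single (slice l ∘ₗ (tcomm k _ _).toLinearMap ∘ₗ
      tmap (homologyRetr k B p ∘ₗ chainsMap k π) (fiberRetrAt hπ k b q) ∘ₗ diagonal k E -
      (-1 : k) ^ (p * q) • (slice l ∘ₗ tmap (fiberRetrAt hπ k b q)
        (homologyRetr k B p ∘ₗ chainsMap k π) ∘ₗ diagonal k E))
    (fiberRetrAt hπ k b q ∘ₗ (boundary k E ∘ₗ cupOne c p -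
      (-1 : k) ^ (p + 1) • (cupOne c p ∘ₗ boundary k E))) _ (fun ⟨n, α⟩ hn => ?_) z hz.1.2
  obtain rfl : n = p + q := by
    have : (n : ℤ) = p + q := hn
    omega
  refine Eq.trans ?_ (congrArg (fiberRetrAt hπ k b q) (boundary_cupOne_sub hd α)).symm
  change slice l (tcomm k _ _ (tmap (homologyRetr k B p ∘ₗ chainsMap k π) (fiberRetrAt hπ k b q)
    (diagonal k E (simplexChain k α)))) - (-1 : k) ^ (p * q) • slice l (tmap (fiberRetrAt hπ k b q)
        (homologyRetr k B p ∘ₗ chainsMap k π) (diagonal k E (simplexChain k α))) = _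
  rw [map_diagonal_simplexChain _ _ p q hne hne' α, map_diagonal_simplexChain _ _ q p hne' hne α,
    dif_pos rfl, dif_pos (add_comm q p), comm_tmul, slice_tmul, slice_tmul, map_sub,
    map_smul, map_smul, smul_smul]
  rfl

end SecondPageSymmetry

/-! ### Maps out of the pages of a spectral sequence -/

namespace FilteredDGModule

section PageFunctional

variable {C : Type w} [AddCommGroup C] [Module k C] (M : FilteredDGModule k C)

/-- Linear maps on a filtered complex, indexed by the bidegrees, which induce linear maps on the
first three pages of its spectral sequence and kill the first two differentials. -/
def IsPageFunctional {A : Type*} [AddCommMonoid A] [Module k A] (φ : ℤ × ℤ → C →ₗ[k] A) : Prop :=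
  (∀ y, ∀ c ∈ M.filGr (y.1 + 1, y.2), M.d c ∈ M.fil y.1 → φ y (M.d c) = 0) ∧
    ∀ y, ∀ c ∈ M.filGr (y.1 - 1, y.2 + 1), φ y c = 0

variable {M} {A : Type*} [AddCommMonoid A] [Module k A] {φ : ℤ × ℤ → C →ₗ[k] A}

lemma IsPageFunctional.exists_page (h : M.IsPageFunctional φ) {r : ℕ} (hr : r ≤ 2) :
    ∃ f : TotalPage M.spectralSequence r →ₗ[k] A, ∀ x (z : M.almostCycles r x),
      f (M.cls r x z) = φ x z := by
  let _ : AddCommGroup A := Module.addCommMonoidToAddCommGroup k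
  refine ⟨M.ofPages r fun x => liftQ _ ((φ x).comp (subtype _)) ?_,
    fun x z => M.ofPages_incl r _ x _⟩
  rintro ⟨c, hc⟩ hcd
  obtain ⟨_, ⟨hb1, y, hy, rfl⟩, e, he, hbe⟩ := mem_sup.1 (show c ∈ M.pageDenominator r x from hcd)
  change φ x c = 0; rw [← hbe, map_add, h.2 x e he, add_zero]
  refine h.1 x y (M.filGr_mono ?_ ?_ hy) hb1.1
  · simp only; omega
  · simp only; ring

lemma IsPageFunctional.apply_totalPageD (h : M.IsPageFunctional φ) {r : ℕ} (hr : r ≤ 1)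
    {f : TotalPage M.spectralSequence r →ₗ[k] A}
    (hf : ∀ x (z : M.almostCycles r x), f (M.cls r x z) = φ x z)
    (c : TotalPage M.spectralSequence r) : f (totalPageD M.spectralSequence r c) = 0 := by
  suffices h : f ∘ₗ totalPageD M.spectralSequence r = 0 from lcongr_fun h c
  refine M.total_ext r fun x z => ?_
  rw [lcomp_apply, M.totalPageD_cls r rfl, hf]
  have hz := M.d_mem_almostCycles r rfl z.2
  refine h.1 _ z (M.filGr_mono ?_ ?_ z.2.1) hz.1.1
  · simp only [Prod.fst_add]; omega
  · simp only [Prod.fst_add, Prod.snd_add]; ring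

lemma apply_totalPageClass {r : ℕ} {f : TotalPage M.spectralSequence r →ₗ[k] A}
    {fH : TotalPage M.spectralSequence (r + 1) →ₗ[k] A}
    (hf : ∀ x (z : M.almostCycles r x), f (M.cls r x z) = φ x z)
    (hfH : ∀ x (z : M.almostCycles (r + 1 : ℕ) x), fH (M.cls (r + 1) x z) = φ x z)
    (z : TotalPageCycles M.spectralSequence r) :
    fH (totalPageClass M.spectralSequence r z) = f (totalPageCyclesIncl M.spectralSequence r z) := by
  let F := fH ∘ₗ totalPageClass M.spectralSequence r
  let G := f ∘ₗ totalPageCyclesIncl M.spectralSequence r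
  change F z = G z
  refine M.cycles_induction r (P := fun z => F z = G z) (fun x z => ?_)
    ((map_zero F).trans (map_zero G).symm) (fun a b ha hb => ?_) z
  · change fH (totalPageClass M.spectralSequence r _) =
      f (totalPageCyclesIncl M.spectralSequence r _)
    rw [M.totalPageClass_toCycles, M.totalPageCyclesIncl_toCycles, hfH, hf]
  · rw [map_add, map_add, ha, hb]

variable {A' : Type*} [AddCommMonoid A'] [Module k A'] {ψ : ℤ × ℤ → C →ₗ[k] A'}

lemma IsPageFunctional.map_comul (hφ : M.IsPageFunctional φ) (hψ : M.IsPageFunctional ψ)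
    (S : CoalgebraStructure M.spectralSequence)
    {f₀ : TotalPage M.spectralSequence 0 →ₗ[k] A} {f₂ : TotalPage M.spectralSequence 2 →ₗ[k] A}
    {g₀ : TotalPage M.spectralSequence 0 →ₗ[k] A'} {g₂ : TotalPage M.spectralSequence 2 →ₗ[k] A'}
    (hf₀ : ∀ x (z : M.almostCycles (0 : ℕ) x), f₀ (M.cls 0 x z) = φ x z)
    (hf₂ : ∀ x (z : M.almostCycles (2 : ℕ) x), f₂ (M.cls 2 x z) = φ x z)
    (hg₀ : ∀ x (z : M.almostCycles (0 : ℕ) x), g₀ (M.cls 0 x z) = ψ x z)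
    (hg₂ : ∀ x (z : M.almostCycles (2 : ℕ) x), g₂ (M.cls 2 x z) = ψ x z)
    (x : ℤ × ℤ) (z : M.almostCycles (2 : ℕ) x)
    (hz : (z : C) ∈ M.almostCycles (0 : ℕ) x) :
    tmap f₂ g₂ ((S.coalgebra 2).comul (M.cls 2 x z)) =
      tmap f₀ g₀ ((S.coalgebra 0).comul (M.cls 0 x ⟨z, hz⟩)) := by
  obtain ⟨f₁, hf₁⟩ := hφ.exists_page (r := 1) (by omega)
  obtain ⟨g₁, hg₁⟩ := hψ.exists_page (r := 1) (by omega)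
  have step : ∀ (r : ℕ) (_ : r ≤ 1) {f : TotalPage M.spectralSequence r →ₗ[k] A}
      {fH : TotalPage M.spectralSequence (r + 1) →ₗ[k] A}
      {g : TotalPage M.spectralSequence r →ₗ[k] A'}
      {gH : TotalPage M.spectralSequence (r + 1) →ₗ[k] A'}
      (_ : ∀ x (z : M.almostCycles r x), f (M.cls r x z) = φ x z)
      (_ : ∀ x (z : M.almostCycles (r + 1 : ℕ) x), fH (M.cls (r + 1) x z) = φ x z)
      (_ : ∀ x (z : M.almostCycles r x), g (M.cls r x z) = ψ x z)
      (_ : ∀ x (z : M.almostCycles (r + 1 : ℕ) x), gH (M.cls (r + 1) x z) = ψ x z)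
      (z : M.almostCycles (r + 1 : ℕ) x),
      tmap fH gH ((S.coalgebra (r + 1)).comul (M.cls (r + 1) x z)) = tmap f g ((S.coalgebra r).comul
          (M.cls r x ⟨z, M.almostCycles_succ_le' r x z.2⟩)) := by
    intro r hr f fH g gH hf hfH hg hgH z
    have := (S.comul_succ r).map_apply (hφ.apply_totalPageD hr hf) (hψ.apply_totalPageD hr hg)
      (apply_totalPageClass hf hfH) (apply_totalPageClass hg hgH) (M.toCycles r x z)
    rwa [M.totalPageClass_toCycles, M.totalPageCyclesIncl_toCycles] at this
  exact (step 1 le_rfl hf₁ hf₂ hg₁ hg₂ z).trans (step 0 (by omega) hf₀ hf₁ hg₀ hg₁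
    ⟨z, M.almostCycles_succ_le' 1 x z.2⟩)

end PageFunctional

section Lead

variable {ι : Type u} {M : FilteredDGModule k (ι →₀ k)} {wt deg : ι → ℤ} (hM : M.HasWeights wt deg)
  {A A' : Type*} [AddCommMonoid A] [Module k A] [AddCommMonoid A'] [Module k A'] {φ : ℤ × ℤ → (ι →₀
  k) →ₗ[k] A} {f : TotalPage M.spectralSequence 0 →ₗ[k] A} (hf : ∀ x (z : M.almostCycles (0 : ℕ) x),
  f (M.cls 0 x z) = φ x z)
include hM hf

lemma HasWeights.apply_leadAt_single (a : ℤ) (i : ι) : f (leadAt M wt deg 0 a (single i 1)) =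
      if wt i = a then φ (a, deg i - a) (single i 1) else 0 := by
  split_ifs with h
  · subst h
    have hi := hM.single_mem i
    have := hM.leadAt_cls 0 (x := (wt i, deg i - wt i))
      ⟨_, IsWeightedCoalgebra.mem_almostCycles_zero hi⟩
    rw [← hf _ ⟨_, IsWeightedCoalgebra.mem_almostCycles_zero hi⟩, ← this]
  · rw [leadAt, lcomp_apply, wtProj, basisProj_single, if_neg h, map_zero, map_zero]

end Lead

end FilteredDGModule

/-! ### The maps from the second page to the homology of the base and of the fiber -/

section Functionals

variable (k)

lemma eq_zero_of_mem_chainsOfDegree_neg {X : Type u} [TopologicalSpace X] {n : ℤ} (hn : n < 0)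
    {c : Chains k X} (hc : c ∈ chainsOfDegree k X n) : c = 0 := by
  rw [← mem_bot k, ← Finsupp.supported_empty]
  refine supported_mono (fun s hs => ?_) hc
  have : (s.1 : ℤ) = n := hs
  omega

lemma filGr_eq_supported (x : ℤ × ℤ) : 𝗦.filGr x =
    supported k k {s | serreWeight π s ≤ x.1 ∧ (s.1 : ℤ) = x.1 + x.2} :=
  (serre_hasWeights k π).filGr_eq x

def baseRetr (π : C(E, B)) : Chains k E →ₗ[k] 𝗧 B := totalRetr k B ∘ₗ chainsMap k π

lemma baseRetr_simplexChain {n : ℕ} (α : Sing n E) (h : serreWeight π ⟨n, α⟩ < n) :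
    baseRetr k π (simplexChain k α) = 0 := by
  rw [baseRetr, lcomp_apply, chainsMap_simplexChain]
  refine totalRetr_simplexChain_of_isDegenerate ?_
  rw [Sing.isDegenerate_iff]; exact Int.ofNat_lt.1 h

lemma baseRetr_boundary (c : Chains k E) : baseRetr k π (boundary k E c) = 0 := by
  rw [baseRetr, lcomp_apply, chainsMap_boundary, totalRetr_boundary]

lemma homologyCounit_baseRetr (c : Chains k E) :
    homologyCounit k B (baseRetr k π c) = augmentation k E c := by
  rw [baseRetr, lcomp_apply, homologyCounit_totalRetr, augmentation_chainsMap]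

/-- The map from chains of `E` to the homology of the base, on the bidegrees `(p, 0)`. -/
def baseFunctional (π : C(E, B)) (x : ℤ × ℤ) : Chains k E →ₗ[k] 𝗧 B :=
  if x.2 = 0 then baseRetr k π else 0

lemma baseFunctional_isPage : 𝗦.IsPageFunctional (baseFunctional k π) := by
  refine ⟨fun y c _ _ => ?_, fun y c hc => ?_⟩
  · unfold baseFunctional
    split_ifs
    · exact baseRetr_boundary k c
    · rfl
  · unfold baseFunctional
    split_ifs with hy
    · rw [filGr_eq_supported] at hc
      refine eq_on_of_single (baseRetr k π) 0 _ (fun ⟨n, α⟩ hα => ?_) c hc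
      obtain ⟨h1, h2⟩ : serreWeight π ⟨n, α⟩ ≤ y.1 - 1 ∧ (n : ℤ) = y.1 - 1 + (y.2 + 1) := hα
      exact baseRetr_simplexChain k α (by omega)
    · rfl

lemma homologyComul_baseRetr {p q : ℤ} {c : Chains k E}
    (hc : c ∈ 𝗦.almostCycles (2 : ℕ) (p, q)) (hq : q = 0) :
    homologyComul k B (baseRetr k π c) = tmap (baseRetr k π) (baseRetr k π) (diagonal k E c) := by
  rw [baseRetr, lcomp_apply, homologyComul_totalRetr, diagonal_chainsMap, tmap_comp, lcomp_apply]
  subst hq; rw [← chainsMap_boundary]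
  have h1 : boundary k E c ∈ 𝗦.filGr (p - 2, 1) := by
    refine ⟨hc.2, ?_⟩
    have h2 : boundary k E c ∈ _ := (singularChains k E).d_mem_gr _ _ hc.1.2
    have e : (p, (0 : ℤ)).1 + (p, (0 : ℤ)).2 - 1 = p - 2 + 1 := by simp only; ring
    rwa [e] at h2
  rw [filGr_eq_supported] at h1
  refine map_mem_of_single (chainsMap k π) _ (degenerateChains k B) (fun ⟨n, α⟩ hα => ?_) _ h1
  obtain ⟨h1, h2⟩ : serreWeight π ⟨n, α⟩ ≤ p - 2 ∧ (n : ℤ) = p - 2 + 1 := hα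
  have h3 : ((Sing.weight (π.comp α : Sing n B) : ℕ) : ℤ) ≤ p - 2 := h1
  refine (congrArg (· ∈ degenerateChains k B) (chainsMap_simplexChain k π α)).mpr
    (simplexChain_mem_supported k _ ?_)
  change Sing.IsDegenerate (π.comp α : Sing n B); rw [Sing.isDegenerate_iff]; omega

variable [SimplyConnectedSpace B] (hπ : IsSerreFibration π) (b : B)

lemma fiberRetr_of_mem {n : ℤ} {c : Chains k E} (hc : c ∈ chainsOfDegree k E n) :
    fiberRetr hπ k b c = lof k ℤ (fun n => 𝗛 (Fiber π b) n) n (fiberRetrAt hπ k b n c) := by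
  refine eq_on_of_single (fiberRetr hπ k b)
    (lof k ℤ (fun n => 𝗛 (Fiber π b) n) n ∘ₗ fiberRetrAt hπ k b n)
    _ (fun ⟨m, α⟩ hα => ?_) c hc
  obtain rfl : (m : ℤ) = n := hα
  refine DFinsupp.ext fun l => ?_
  by_cases hl : l = m
  · subst hl; exact (lof_apply k _ _).symm
  · refine (fiberRetrAt_simplexChain_of_ne hπ k b (Ne.symm hl) α).trans ?_
    exact (DFinsupp.single_eq_of_ne hl).symm

lemma fiberRetr_boundary_of_mem_fil_one {n : ℤ} {y : Chains k E}
    (hy : y ∈ 𝗦.fil 1) (hyd : y ∈ chainsOfDegree k E (n + 1))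
    (hdy : boundary k E y ∈ 𝗦.fil 0) :
    fiberRetr hπ k b (boundary k E y) = 0 := by
  have hd : boundary k E y ∈ chainsOfDegree k E (n + 1 - 1) := (singularChains k E).d_mem_gr _ _ hyd
  rw [add_sub_cancel_right] at hd
  rcases lt_or_ge n 0 with hn | hn
  · rw [eq_zero_of_mem_chainsOfDegree_neg k hn hd, map_zero]
  · obtain ⟨q, rfl⟩ := Int.eq_ofNat_of_zero_le hn
    rw [fiberRetr_of_mem k hπ b hd, fiberRetrAt_boundary_of_mem_fil_one k hπ b hy hyd hdy, map_zero]

/-- The map from chains of `E` to the homology of the fiber, on the bidegrees `(0, q)`. -/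
def fiberFunctional (x : ℤ × ℤ) : Chains k E →ₗ[k] 𝗧 (Fiber π b) :=
  if x.1 = 0 then fiberRetr hπ k b else 0

lemma fiberFunctional_isPage : 𝗦.IsPageFunctional (fiberFunctional k hπ b) := by
  refine ⟨fun y c hc hdc => ?_, fun y c hc => ?_⟩
  · unfold fiberFunctional
    split_ifs with hy
    · refine fiberRetr_boundary_of_mem_fil_one k hπ b (n := y.2) ?_ ?_ ?_
      · have h := hc.1
        rwa [hy, zero_add] at h
      · have h := hc.2
        rwa [hy, zero_add, add_comm] at h
      · rwa [hy] at hdc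
    · rfl
  · unfold fiberFunctional
    split_ifs with hy
    · have h := hc.1
      rw [(serre_hasWeights k π).fil_eq_bot (by simp only; omega)] at h
      rw [(mem_bot k).1 h, map_zero]
    · rfl

omit [SimplyConnectedSpace B] in
open Classical in
lemma basisProj_fiberIncl (x y : B) (c : Chains k (Fiber π y)) :
    basisProj (fun s : (Σ n : ℕ, Sing n E) => π (s.2 (vertex 0)) = x)
      (chainsMap k (fiberIncl π y) c) = if y = x then chainsMap k (fiberIncl π y) c else 0 := by
  suffices h : basisProj (fun s : (Σ n : ℕ, Sing n E) => π (s.2 (vertex 0)) = x) ∘ₗ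
      chainsMap k (fiberIncl π y) = if y = x then chainsMap k (fiberIncl π y) else 0 by
    refine (lcongr_fun h c).trans ?_
    split_ifs <;> rfl
  refine chains_ext k fun n α => ?_
  rw [lcomp_apply, chainsMap_simplexChain, simplexChain, basisProj_single]
  have h : π (((fiberIncl π y).comp α) (vertex 0)) = y := (α _).2
  simp only [h]
  split_ifs
  · exact (chainsMap_simplexChain k _ α).symm
  · rfl

lemma homologyComul_fiberRetr {c : Chains k E} (hc : c ∈ 𝗦.fil 0) (hd : boundary k E c = 0) :
    homologyComul k (Fiber π b) (fiberRetr hπ k b c) =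
      tmap (fiberRetr hπ k b) (fiberRetr hπ k b) (diagonal k E c) := by
  classical
  let key : (Σ n : ℕ, Sing n E) → B := fun s => π (s.2 (vertex 0))
  refine mem_of_basisProj_mem key c (eqLocus (homologyComul k (Fiber π b) ∘ₗ fiberRetr hπ k b)
    (tmap (fiberRetr hπ k b) (fiberRetr hπ k b) ∘ₗ diagonal k E))
    fun x => ?_
  obtain ⟨c', hc'⟩ : basisProj (fun s => key s = x) c ∈
      LinearMap.range (chainsMap k (fiberIncl π x)) := by
    refine mem_of_fiber k (basisProj fun s => key s = x) _ (fun y d => ?_) c hc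
    rw [basisProj_fiberIncl]
    split_ifs with h
    · subst h; exact ⟨d, rfl⟩
    · exact zero_mem _
  have hd' : boundary k E (basisProj (fun s => key s = x) c) = 0 := by
    have := mem_of_fiber k (boundary k E ∘ₗ basisProj (fun s => key s = x) -
      basisProj (fun s => key s = x) ∘ₗ boundary k E) ⊥ (fun y d => ?_) c hc
    · rw [mem_bot, lsub_apply, lcomp_apply, lcomp_apply, hd, map_zero, sub_zero] at this; exact this
    · rw [mem_bot, lsub_apply, lcomp_apply, lcomp_apply,
        ← chainsMap_boundary, basisProj_fiberIncl, basisProj_fiberIncl, sub_eq_zero]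
      split_ifs
      · exact (chainsMap_boundary k _ d).symm
      · exact map_zero _
  have hd'' : boundary k _ c' = 0 := by
    refine chainsMap_injective (f := fiberIncl π x) Subtype.val_injective ?_
    rw [chainsMap_boundary, hc', hd', map_zero]
  rw [LinearMap.mem_eqLocus, ← hc', lcomp_apply, lcomp_apply,
    fiberRetr_fiberIncl, homologyComul_totalFiberTransport,
    homologyComul_totalRetr (hd''.symm ▸ zero_mem _), diagonal_chainsMap,
    map_map, map_map]
  have e : fiberRetr hπ k b ∘ₗ chainsMap k (fiberIncl π x) =
      totalFiberTransport hπ k b x ∘ₗ totalRetr k _ :=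
    lin_ext fun c => fiberRetr_fiberIncl hπ k b c
  rw [e]

end Functionals

/-! ### The comultiplication of the second page in terms of the base and the fiber -/

namespace FilteredDGModule

section Lead

variable {ι : Type u} {M : FilteredDGModule k (ι →₀ k)} {wt deg : ι → ℤ} {A A' : Type*}
  [AddCommMonoid A] [Module k A] [AddCommMonoid A'] [Module k A']

lemma map_leadTensor (f : TotalPage M.spectralSequence 0 →ₗ[k] A)
    (g : TotalPage M.spectralSequence 0 →ₗ[k] A') (p : ℤ) (t : (ι →₀ k) ⊗[k] (ι →₀ k)) :
    tmap f g (leadTensor M wt deg 0 p t) = ∑ a ∈ Icc 0 p, tmap (f ∘ₗ leadAt M wt deg 0 a)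
        (g ∘ₗ leadAt M wt deg 0 (p - a)) t := by
  rw [leadTensor, LinearMap.sum_apply, map_sum]; exact sum_congr rfl fun a _ => map_map _ _ _ _ _

end Lead

end FilteredDGModule

section Degrees

lemma diagonal_simplexChain {n : ℕ} (α : Sing n X) : diagonal k X (simplexChain k α) =
    ∑ j : Fin (n + 1), simplexChain k (α.front j (by omega)) ⊗ₜ[k]
      simplexChain k (α.back j (n - j) (by omega)) :=
  (linearCombination_single k _ _).trans (one_smul _ _)

lemma sum_map_degreeProj_diagonal (p : ℤ) {n : ℕ} (α : Sing n X) :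
    ∑ a ∈ Icc 0 p, tmap (degreeProj k X a) (degreeProj k X (p - a))
      (diagonal k X (simplexChain k α)) =
      if (n : ℤ) = p then diagonal k X (simplexChain k α) else 0 := by
  simp only [diagonal_simplexChain, map_sum, map_tmul, degreeProj_simplexChain]; rw [sum_comm]
  split_ifs with h
  · refine sum_congr rfl fun j _ => ?_
    have hj := j.2
    rw [sum_eq_single (j : ℤ), if_pos rfl, if_pos (by omega)]
    · intro a _ ha; rw [if_neg (Ne.symm ha), zero_tmul]
    · intro hj'; exact absurd (mem_Icc.2 ⟨by omega, by omega⟩) hj'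
  · refine sum_eq_zero fun j _ => sum_eq_zero fun a _ => ?_
    have hj := j.2
    by_cases ha : ((j : ℕ) : ℤ) = a
    · rw [if_neg (show ¬ ((n - j : ℕ) : ℤ) = p - a by omega), tmul_zero]
    · rw [if_neg ha, zero_tmul]

lemma map_degreeProj_left_diagonal {p q : ℤ} {c : Chains k X}
    (hc : c ∈ chainsOfDegree k X (p + q)) :
    tmap (degreeProj k X p) idₗ (diagonal k X c) =
      tmap (degreeProj k X p) (degreeProj k X q) (diagonal k X c) := by
  refine eq_on_of_single (tmap (degreeProj k X p) idₗ ∘ₗ diagonal k X)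
    (tmap (degreeProj k X p) (degreeProj k X q) ∘ₗ diagonal k X) _
    (fun ⟨n, α⟩ hα => ?_) c hc
  have hα : (n : ℤ) = p + q := hα
  change tmap (degreeProj k X p) idₗ (diagonal k X (simplexChain k α)) =
    tmap (degreeProj k X p) (degreeProj k X q) (diagonal k X (simplexChain k α))
  simp only [diagonal_simplexChain, map_sum, map_tmul, degreeProj_simplexChain, idₗ_apply]
  refine sum_congr rfl fun j _ => ?_
  have hj := j.2
  by_cases h : ((j : ℕ) : ℤ) = p
  · rw [if_pos (show ((n - j : ℕ) : ℤ) = q by omega)]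
  · rw [if_neg h, zero_tmul, zero_tmul]

lemma map_degreeProj_right_diagonal {p q : ℤ} {c : Chains k X}
    (hc : c ∈ chainsOfDegree k X (p + q)) :
    tmap idₗ (degreeProj k X p) (diagonal k X c) =
      tmap (degreeProj k X q) (degreeProj k X p) (diagonal k X c) := by
  refine eq_on_of_single (tmap idₗ (degreeProj k X p) ∘ₗ diagonal k X)
    (tmap (degreeProj k X q) (degreeProj k X p) ∘ₗ diagonal k X) _
    (fun ⟨n, α⟩ hα => ?_) c hc
  have hα : (n : ℤ) = p + q := hα
  change tmap idₗ (degreeProj k X p) (diagonal k X (simplexChain k α)) =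
    tmap (degreeProj k X q) (degreeProj k X p) (diagonal k X (simplexChain k α))
  simp only [diagonal_simplexChain, map_sum, map_tmul, degreeProj_simplexChain, idₗ_apply]
  refine sum_congr rfl fun j _ => ?_
  have hj := j.2
  by_cases h : ((n - j : ℕ) : ℤ) = p
  · rw [if_pos (show ((j : ℕ) : ℤ) = q by omega)]
  · rw [if_neg h, tmul_zero, tmul_zero]

end Degrees

section Lead

variable (k π) in
abbrev serreLead (a : ℤ) : Chains k E →ₗ[k] TotalPage 𝗦.spectralSequence 0 :=
  FilteredDGModule.leadAt 𝗦 (serreWeight π) (fun s => (s.1 : ℤ)) 0 a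

lemma apply_leadAt_of_baseFunctional {g : TotalPage 𝗦.spectralSequence 0 →ₗ[k] 𝗧 B}
    (hg : ∀ x (z : 𝗦.almostCycles (0 : ℕ) x), g (𝗦.cls 0 x z) = baseFunctional k π x z)
    (a : ℤ) : g ∘ₗ serreLead π k a = baseRetr k π ∘ₗ degreeProj k E a := by
  refine chains_ext k fun n α => ?_
  refine ((serre_hasWeights k π).apply_leadAt_single hg a ⟨n, α⟩).trans ?_
  rw [lcomp_apply, degreeProj_simplexChain]
  have hw : serreWeight π ⟨n, α⟩ ≤ n := by
    exact Int.ofNat_le.2 (Sing.factorsThrough_self (π.comp α : Sing n B)).weight_le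
  by_cases hn : (n : ℤ) = a
  · rw [if_pos hn]
    split_ifs with h
    · rw [baseFunctional, if_pos (by simp only; omega)]
      rfl
    · exact (baseRetr_simplexChain k α (by omega)).symm
  · rw [if_neg hn, map_zero]
    split_ifs with h
    · rw [baseFunctional, if_neg (by simp only; omega), lzero_apply]
    · rfl

variable [SimplyConnectedSpace B]

lemma apply_leadAt_of_fiberFunctional {f : TotalPage 𝗦.spectralSequence 0 →ₗ[k] 𝗧 (Fiber π b)}
    (hf : ∀ x (z : 𝗦.almostCycles (0 : ℕ) x), f (𝗦.cls 0 x z) = fiberFunctional k hπ b x z)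
    (a : ℤ) : f ∘ₗ serreLead π k a = if a = 0 then fiberRetr hπ k b else 0 := by
  refine chains_ext k fun n α => ?_
  refine ((serre_hasWeights k π).apply_leadAt_single hf a ⟨n, α⟩).trans ?_
  rw [fiberFunctional]; simp only
  split_ifs with h ha
  · rfl
  · rfl
  · refine (fiberRetr_eq_zero hπ k b (simplexChain_mem_supported k _ ?_)).symm
    exact fun h' => h (h'.trans ‹a = 0›.symm)
  · rfl

end Lead

/-! ### The identification of the second page as a coalgebra -/

section Swap

variable {D H K : Type*} [AddCommMonoid D] [Module k D] [AddCommMonoid H] [Module k H]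
  [AddCommMonoid K] [Module k K]

lemma assoc_map_comul {Δ : D →ₗ[k] D ⊗[k] D}
    (hco : ∀ y, assoc k D D D (Δ.rTensor D (Δ y)) = Δ.lTensor D (Δ y)) (d : D) :
    lTensor D (assoc k D D D).symm.toLinearMap (assoc k D D (D ⊗[k] D) (tmap Δ Δ (Δ d))) =
      lTensor D (Δ.rTensor D) (Δ.lTensor D (Δ d)) := by
  have pentagon : ∀ v : (D ⊗[k] D) ⊗[k] (D ⊗[k] D), lTensor D (assoc k D D D).symm.toLinearMap
        (assoc k D D (D ⊗[k] D) v) =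
      assoc k D (D ⊗[k] D) D (rTensor D (assoc k D D D).toLinearMap
          ((assoc k (D ⊗[k] D) D D).symm v)) := by
    intro v
    refine lcongr_fun (f := lTensor D (assoc k D D D).symm.toLinearMap
      ∘ₗ (assoc k D D (D ⊗[k] D)).toLinearMap)
      (g := (assoc k D (D ⊗[k] D) D).toLinearMap ∘ₗ rTensor D (assoc k D D D).toLinearMap ∘ₗ
          (assoc k (D ⊗[k] D) D D).symm.toLinearMap) ?_ v
    ext a b c d
    rfl
  have h1 : tmap Δ Δ (Δ d) = Δ.rTensor (D ⊗[k] D) (assoc k D D D (Δ.rTensor D (Δ d))) := by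
    rw [hco]; exact (lcongr_fun (LinearMap.rTensor_comp_lTensor (f := Δ) (g := Δ)) (Δ d)).symm
  have h2 : ∀ w : (D ⊗[k] D) ⊗[k] D, (assoc k (D ⊗[k] D) D D).symm
      (Δ.rTensor (D ⊗[k] D) (assoc k D D D w)) =
      rTensor D (Δ.rTensor D) w := by
    intro w
    refine lcongr_fun (f := (assoc k (D ⊗[k] D) D D).symm.toLinearMap ∘ₗ
      Δ.rTensor (D ⊗[k] D) ∘ₗ (assoc k D D D).toLinearMap)
      (g := rTensor D (Δ.rTensor D)) ?_ w
    ext a b c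
    rfl
  have h3 : ∀ w : (D ⊗[k] D) ⊗[k] D, assoc k D (D ⊗[k] D) D (rTensor D (Δ.lTensor D) w) =
      lTensor D (Δ.rTensor D) (assoc k D D D w) := by
    intro w
    refine lcongr_fun (f := (assoc k D (D ⊗[k] D) D).toLinearMap ∘ₗ rTensor D (Δ.lTensor D))
      (g := lTensor D (Δ.rTensor D) ∘ₗ (assoc k D D D).toLinearMap) ?_ w
    ext a b c
    rfl
  have h4 : ((assoc k D D D).toLinearMap ∘ₗ Δ.rTensor D) ∘ₗ Δ = Δ.lTensor D ∘ₗ Δ := lin_ext hco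
  rw [pentagon, h1, h2, ← lcomp_apply (rTensor D _), ← rTensor_comp,
    ← lcomp_apply (rTensor D _), ← rTensor_comp, h4,
    rTensor_comp, lcomp_apply, h3, hco]

def middleSwap (σ : H ⊗[k] K →ₗ[k] K ⊗[k] H) :
    (H ⊗[k] H) ⊗[k] (K ⊗[k] K) →ₗ[k] (H ⊗[k] K) ⊗[k] (H ⊗[k] K) :=
  (assoc k _ _ _).symm.toLinearMap ∘ₗ lTensor _ ((assoc k _ _ _).toLinearMap ∘ₗ
      rTensor _ σ ∘ₗ (assoc k _ _ _).symm.toLinearMap) ∘ₗ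
    (assoc k _ _ _).toLinearMap

lemma middleSwap_map_comul {Δ : D →ₗ[k] D ⊗[k] D}
    (hco : ∀ y, assoc k D D D (Δ.rTensor D (Δ y)) = Δ.lTensor D (Δ y))
    {g : D →ₗ[k] H} {f : D →ₗ[k] K} {σ : H ⊗[k] K →ₗ[k] K ⊗[k] H}
    (hσ : ∀ d, σ (tmap g f (Δ d)) = tmap f g (Δ d)) (d : D) :
    middleSwap σ (tmap (tmap g g) (tmap f f) (tmap Δ Δ (Δ d))) = tmap (tmap g f) (tmap g f)
        (tmap Δ Δ (Δ d)) := by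
  have h1 : middleSwap σ ∘ₗ tmap (tmap g g) (tmap f f) =
      (assoc k H K (H ⊗[k] K)).symm.toLinearMap ∘ₗ lTensor H (assoc k K H K).toLinearMap ∘ₗ
        tmap g (tmap (σ ∘ₗ tmap g f) f) ∘ₗ
        lTensor D (assoc k D D D).symm.toLinearMap ∘ₗ
        (assoc k D D (D ⊗[k] D)).toLinearMap := by
    ext a b c d
    rfl
  have h2 : tmap (tmap g f) (tmap g f) = (assoc k H K (H ⊗[k] K)).symm.toLinearMap ∘ₗ
        lTensor H (assoc k K H K).toLinearMap ∘ₗ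
        tmap g (tmap (tmap f g) f) ∘ₗ
        lTensor D (assoc k D D D).symm.toLinearMap ∘ₗ
        (assoc k D D (D ⊗[k] D)).toLinearMap := by
    ext a b c d
    rfl
  have h3 : tmap g (tmap (σ ∘ₗ tmap g f) f) ∘ₗ lTensor D (Δ.rTensor D) =
      tmap g (tmap (tmap f g) f) ∘ₗ
      lTensor D (Δ.rTensor D) := by
    ext a b c
    exact congrArg (fun t => g a ⊗ₜ[k] (t ⊗ₜ[k] f c)) (hσ b)
  have h4 := congrArg (fun F => (assoc k H K (H ⊗[k] K)).symm
    (lTensor H (assoc k K H K).toLinearMap (F (Δ.lTensor D (Δ d))))) h3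
  have h5 := assoc_map_comul hco d
  refine (lcongr_fun h1 _).trans (Eq.trans ?_ (lcongr_fun h2 _).symm)
  simp only [lcomp_apply, coe_coe] at h4 ⊢; rw [h5]; exact h4

end Swap

/-! ### The standard identification -/

section Represented

variable {A : Type*} [AddCommGroup A] [Module k A]

variable (k X) in
def normalizedCycles (p : ℕ) : Submodule k (Chains k X) :=
  chainsOfDegree k X p ⊓ (degenerateChains k X).comap (boundary k X)

lemma mem_normalizedCycles {p : ℕ} {c : Chains k X} (h1 : ndProj k X p c = c)
    (h2 : ndBoundary k X p c = 0) : c ∈ normalizedCycles k X p := by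
  have hcd : c ∈ chainsOfDegree k X p := by
    have := ndProj_mem p c
    rwa [h1] at this
  exact ⟨hcd, boundary_mem_degenerateChains_of_ndBoundary hcd h2⟩

lemma exists_lTensor_subtype_eq {C D D' : Type*} [AddCommGroup C] [Module k C] [AddCommGroup D]
    [Module k D] [AddCommGroup D'] [Module k D'] {f : C →ₗ[k] D} {f' : C →ₗ[k] D'}
    {N : Submodule k C} (h : ∀ c, f c = 0 → f' c = 0 → c ∈ N) {t : A ⊗[k] C}
    (hf : lTensor A f t = 0) (hf' : lTensor A f' t = 0) :
    ∃ s, lTensor A N.subtype s = t :=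
  exists_lTensor_eq (f.prod f') N.subtype
    (fun c hc => ⟨⟨c, h c (Prod.mk_eq_zero.1 hc).1 (Prod.mk_eq_zero.1 hc).2⟩, rfl⟩)
    (lTensor_prod_eq_zero hf hf')

lemma exists_normalizedCycles {p : ℕ} {t : A ⊗[k] Chains k X} (h1 : lTensor A (ndProj k X p) t = t)
    (h2 : lTensor A (ndBoundary k X p) t = 0) :
    ∃ s, lTensor A (normalizedCycles k X p).subtype s = t := by
  have h1' : lTensor A (idₗ - ndProj k X p) t = 0 := by
    rw [lTensor_sub, lsub_apply, h1, lTensor_id, idₗ_apply, sub_self]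
  have h : ∀ c, (idₗ - ndProj k X p : Chains k X →ₗ[k] Chains k X) c = 0 → ndBoundary k X p c = 0 →
      c ∈ normalizedCycles k X p := fun c hc1 hc2 =>
    mem_normalizedCycles (sub_eq_zero.1 hc1).symm hc2
  exact exists_lTensor_subtype_eq h h1' h2

variable (k X) in
def normalizeCycle (p : ℕ) : normalizedCycles k X p →ₗ[k] (singularChains k X).cycles p :=
  (normalize k X ∘ₗ (normalizedCycles k X p).subtype).codRestrict _ fun c =>
    normalize_mem_cycles (mem_inf.1 c.2).1 (Submodule.mem_comap.1 (mem_inf.1 c.2).2)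

variable (k X) in
def normalizeDegenerate : Chains k X →ₗ[k] degenerateChains k X :=
  (normalize k X - idₗ).codRestrict _ fun c => by
    rw [lsub_apply, idₗ_apply, ← neg_sub]; exact neg_mem (sub_normalize_mem c)

lemma rTensor_comm {A M N : Type*} [AddCommMonoid A] [Module k A] [AddCommMonoid M]
    [AddCommMonoid N] [Module k M] [Module k N]
    (f : M →ₗ[k] N) (t : A ⊗[k] M) : rTensor A f (tcomm k A M t) = tcomm k A N (lTensor A f t) :=
  map_comm _ _ t

lemma isRepresentedBy_comm {p : ℕ} {t : A ⊗[k] Chains k X} (h1 : lTensor A (ndProj k X p) t = t)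
    (h2 : lTensor A (ndBoundary k X p) t = 0) :
    IsRepresentedBy k X p (tcomm k _ _ (lTensor A (homologyRetr k X p) t)) (tcomm k _ _ t) := by
  obtain ⟨s, rfl⟩ := exists_normalizedCycles h1 h2
  refine ⟨tcomm k _ _ (lTensor A (normalizeCycle k X p) s),
    tcomm k _ _ (lTensor A (normalizeDegenerate k X)
      (lTensor A (normalizedCycles k X p).subtype s)), ?_, ?_⟩
  · have h : (subtype _) ∘ₗ normalizeCycle k X p = (normalizedCycles k X p).subtype +
        (subtype _) ∘ₗ normalizeDegenerate k X ∘ₗ (normalizedCycles k X p).subtype :=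
      lin_ext fun c => (add_sub_cancel (c : Chains k X) (normalize k X c)).symm
    rw [rTensor_comm, rTensor_comm, ← map_add, ← lTensor_comp_apply,
      ← lTensor_comp_apply, ← lTensor_comp_apply, h, LinearMap.lTensor_add,
      ladd_apply, LinearMap.comp_assoc]
  · have h : (singularChains k X).homologyClass p ∘ₗ normalizeCycle k X p =
        homologyRetr k X p ∘ₗ (normalizedCycles k X p).subtype :=
      lin_ext fun c => homologyClass_normalize (mem_inf.1 c.2).1
        (Submodule.mem_comap.1 (mem_inf.1 c.2).2)
    rw [rTensor_comm, ← lTensor_comp_apply, h, lTensor_comp_apply]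

lemma IsRepresentedBy.smul {p : ℤ} {h : 𝗛 X p ⊗[k] A} {c : Chains k X ⊗[k] A}
    (hc : IsRepresentedBy k X p h c) (a : k) : IsRepresentedBy k X p (a • h) (a • c) := by
  obtain ⟨t, e, h1, rfl⟩ := hc
  exact ⟨a • t, a • e, by rw [map_smul, map_smul, h1, smul_add], map_smul _ _ _⟩

end Represented

section LocalCycles

variable {p q : ℕ}

lemma coefficient_frontBack_mem (V : Sing p B) {c : Chains k E}
    (hc : c ∈ 𝗦.fil p) : coefficient V (frontBack k π p q c) ∈
      LinearMap.range (chainsMap k (fiberIncl π V.initial)) := by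
  classical
  refine map_mem_of_single (coefficient V ∘ₗ frontBack k π p q) (serreSimplices π p) _
    (fun ⟨n, α⟩ hα => ?_) c hc
  change coefficient V (frontBack k π p q (simplexChain k α)) ∈ _; rw [frontBack_simplexChain]
  split_ifs with h hd
  · rw [map_zero]; exact zero_mem _
  · rw [coefficient_tmul]
    split_ifs with hV
    · have hw := (mem_serreSimplices_iff π p _).1 hα
      have h1 := Sing.weight_front_add_weight_back (π.comp α : Sing n B) q p h
      have h2 : Sing.weight (Sing.back (π.comp α : Sing n B) q p h) = p :=
        (Sing.not_isDegenerate_iff _).1 hd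
      have h3 : ((Sing.weight (π.comp α : Sing n B) : ℕ) : ℤ) ≤ p := hw
      have h4 : serreWeight π ⟨q, α.front q (by omega)⟩ = 0 := by
        change ((Sing.weight (Sing.front (π.comp α : Sing n B) q (by omega)) : ℕ) : ℤ) = 0; omega
      have h5 := (serreWeight_eq_zero_iff _).1 h4
      have h6 : ∀ t, π (α.front q (by omega) t) = V.initial := by
        intro t
        have h7 : π (α.front q (by omega) (vertex (Fin.last q))) =
            Sing.initial (π.comp (α.back q p h) : Sing p B) := by
          change π (α (stdSimplex.map _ (vertex _))) = π (α (stdSimplex.map _ (vertex _)))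
          rw [map_vertex, map_vertex]; rfl
        rw [← hV, ← h7]; exact (h5 t).trans (h5 _).symm
      refine ⟨simplexChain k (Sing.toFiber (α.front q (by omega)) h6), ?_⟩
      rw [chainsMap_simplexChain]; rfl
    · exact zero_mem _
  · rw [map_zero]; exact zero_mem _

lemma rTensor_boundary_frontBack {z : Chains k E} (hz : z ∈ 𝗦.almostCycles 2 ((p : ℤ), (q : ℤ))) :
    rTensor _ (boundary k E) (frontBack k π p q z) = 0 := by
  match q, hz with
  | 0, _ =>
    have h : boundary k E ∘ₗ degreeProj k E ((0 : ℕ) : ℤ) = 0 := by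
      refine chains_ext k fun n α => ?_
      rw [lcomp_apply, degreeProj_simplexChain]
      split_ifs with h
      · obtain rfl : n = 0 := by omega
        exact boundary_simplexChain_zero α
      · exact map_zero _
    rw [frontBack_eq, rTensor, map_map, h, map_zero_left, lzero_apply]
  | q + 1, hz =>
    have h1 := frontBack_boundary (π := π) p q z
    rw [frontBack_eq_zero, frontBack_eq_zero (p := p + 1), map_zero, smul_zero, add_zero] at h1
    · exact h1.symm
    · have := hz.1.1
      rwa [Nat.cast_succ, add_sub_cancel_right]
    · exact 𝗦.fil_mono (by simp only; omega) hz.2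

lemma exists_localCycles {z : Chains k E} (hz : z ∈ 𝗦.almostCycles 2 ((p : ℤ), (q : ℤ))) :
    ∃ u : LocalCycles k π p q, localCyclesIncl k π p q u = frontBack k π p q z := by
  classical
  let F := finsuppScalarRight k k (Chains k E) (Σ n : ℕ, Sing n B)
  have hF : frontBack k π p q z = F.symm (F (frontBack k π p q z)) := (F.symm_apply_apply _).symm
  change _ ∈ LinearMap.range (localCyclesIncl k π p q)
  rw [hF, ← Finsupp.sum_single (F (frontBack k π p q z)), Finsupp.sum, map_sum]
  refine sum_mem ?_
  rintro ⟨n, V⟩ -; rw [finsuppScalarRight_symm_apply_single]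
  have hs : F (frontBack k π p q z) ⟨n, V⟩ =
      slice (lapply (⟨n, V⟩ : Σ n : ℕ, Sing n B)) (frontBack k π p q z) :=
    finsuppScalarRight_apply _ _
  rw [hs]
  by_cases hn : n = p
  · subst hn
    obtain ⟨c, hc⟩ := coefficient_frontBack_mem (q := q) V hz.1.1
    have hc' : chainsMap k (fiberIncl π V.initial) c =
      slice (lapply (⟨n, V⟩ : Σ n : ℕ, Sing n B)) (frontBack k π n q z) := hc
    have hinj : Function.Injective (fiberIncl π V.initial) := Subtype.val_injective
    have hd : boundary k _ c = 0 := by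
      refine chainsMap_injective hinj ?_
      have h := slice_map (lapply (⟨n, V⟩ : Σ n : ℕ, Sing n B)) (boundary k E)
        idₗ (frontBack k π n q z)
      rw [comp_id] at h; rw [chainsMap_boundary, hc', ← h, map_zero]
      exact (congrArg _ (rTensor_boundary_frontBack hz)).trans (map_zero _)
    have hdeg : c ∈ chainsOfDegree k _ q := mem_chainsOfDegree_of_chainsMap hinj
      (hc' ▸ slice_frontBack_mem_degree n q _ z)
    refine ⟨lof k _ (fun V : Sing n B => (singularChains k (Fiber π V.initial)).cycles q)
      V ⟨c, hd, hdeg⟩, ?_⟩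
    rw [localCyclesIncl, toModule_lof, ← hc']; rfl
  · have h0 : slice (lapply (⟨n, V⟩ : Σ n : ℕ, Sing n B)) (frontBack k π p q z) = 0 := by
      rw [frontBack_eq, slice_map]
      have h : lapply (⟨n, V⟩ : Σ n : ℕ, Sing n B) ∘ₗ ndProj k B p ∘ₗ
          chainsMap k π = 0 := lin_ext fun c =>
        (Finsupp.mem_supported' k _).1 (ndProj_mem p (chainsMap k π c)) ⟨n, V⟩
          fun h' => hn (Int.ofNat_inj.1 h')
      rw [h]
      have h2 : slice (A := Chains k E) (0 : Chains k E →ₗ[k] k) = 0 := by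
        refine text' fun a c => ?_
        rw [slice_tmul, lzero_apply, zero_smul]; rfl
      rw [h2, lzero_apply, map_zero]
    rw [h0, zero_tmul]; exact zero_mem _

variable [SimplyConnectedSpace B] (hπ)

variable (b) in
lemma localCyclesClass_eq (u : LocalCycles k π p q) :
    localCyclesClass k π b (fiberTransport hπ k b) p q u = tcomm k _ _
      (rTensor _ (fiberRetrAt hπ k b q) (localCyclesIncl k π p q u)) := by
  classical
  suffices h : localCyclesClass k π b (fiberTransport hπ k b) p q = (tcomm k _ _).toLinearMap ∘ₗ
        rTensor _ (fiberRetrAt hπ k b q) ∘ₗ localCyclesIncl k π p q from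
    lcongr_fun h u
  refine linearMap_ext _ fun V => lin_ext fun c => ?_
  rw [lcomp_apply, lcomp_apply, lcomp_apply, lcomp_apply,
    localCyclesClass, localCyclesIncl, toModule_lof, toModule_lof]
  simp only [lcomp_apply, LinearMap.flip_apply, mk_apply,
    rTensor_tmul, comm_tmul, coe_coe, Submodule.subtype_apply]
  rw [fiberRetrAt_fiberIncl, homologyRetr_cycle]

theorem isStandardIdentification {Φ : SecondPageIso k π b}
    (hΦ : ∀ (p q : ℕ) (z : 𝗦.almostCycles (2 : ℕ) ((p : ℤ), (q : ℤ))),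
      Φ (p, q) (𝗦.pageMk (2 : ℕ) _ z) =
        (-1 : k) ^ (p * q) • tcomm k _ _ (secondPageClass hπ k b p q z)) :
    IsStandardIdentification k π b Φ := by
  refine ⟨fiberTransport hπ k b, isFiberTransport_fiberTransport hπ k b, fun p q z => ?_⟩
  obtain ⟨u, hu⟩ := exists_localCycles z.2
  refine ⟨u, hu, ?_⟩
  rw [hΦ, localCyclesClass_eq, hu]
  exact (isRepresentedBy_comm (lTensor_frontBackClass hπ b p q (z : Chains k E))
    (lTensor_ndBoundary_frontBackClass hπ b z.2)).smul _

end LocalCycles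

/-! ### The maps from the second page to the base and the fiber are maps of coalgebras -/

section SecondPageMaps

local notation "𝗜" => lof k ℤ (fun n => SingularHomology k (Fiber π b) n)
local notation "𝗝" => lof k ℤ (fun n => SingularHomology k B n)

lemma baseRetr_comp_degreeProj (p : ℤ) : baseRetr k π ∘ₗ degreeProj k E p =
    𝗝 p ∘ₗ homologyRetr k B p ∘ₗ chainsMap k π := by
  refine chains_ext k fun n α => ?_
  simp only [lcomp_apply, degreeProj_simplexChain, baseRetr]
  split_ifs with h
  · subst h; rw [chainsMap_simplexChain, totalRetr_simplexChain]
  · rw [map_zero, map_zero, chainsMap_simplexChain, homologyRetr_of_ne h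
      (simplexChain_mem_supported k _ rfl), map_zero]

lemma mem_degree_of_mem_almostCycles {r : ℤ} {x : ℤ × ℤ} {c : Chains k E}
    (hc : c ∈ 𝗦.almostCycles r x) : c ∈ chainsOfDegree k E (x.1 + x.2) :=
  hc.1.2

lemma subsingleton_singularHomology_neg {n : ℤ} (hn : n < 0) : Subsingleton (𝗛 B n) := by
  refine subsingleton_of_forall_eq 0 fun h => ?_
  obtain ⟨z, rfl⟩ := homologyClass_surjective n h
  rw [show z = 0 from Subtype.ext (eq_zero_of_mem_chainsOfDegree_neg k hn z.2.2), map_zero]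

lemma pageMk_eq_zero_of_neg {r : ℤ} {x : ℤ × ℤ} (hx : x.1 < 0 ∨ x.2 < 0)
    (z : 𝗦.almostCycles r x) : 𝗦.pageMk r x z = 0 := by
  refine 𝗦.pageMk_eq_zero r x z ?_
  rcases hx with hx | hx
  · have h0 := z.2.1.1
    rw [(serre_hasWeights k π).fil_eq_bot hx] at h0; rw [(mem_bot k).1 h0]; exact zero_mem _
  · refine 𝗦.lower_le_pageDenominator r x ?_
    have h0 := z.2.1
    rw [filGr_eq_supported] at h0 ⊢
    refine supported_mono (fun s hs => ?_) h0
    obtain ⟨h1, h2⟩ : serreWeight π s ≤ x.1 ∧ (s.1 : ℤ) = x.1 + x.2 := hs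
    have hw : serreWeight π s ≤ s.1 :=
      Int.ofNat_le.2 (Sing.factorsThrough_self (π.comp s.2 : Sing s.1 B)).weight_le
    exact ⟨by simp only; omega, by simp only; omega⟩

variable (k π b) in
abbrev HomologyTensor (x : ℤ × ℤ) : Type (max u v) := 𝗛 B x.1 ⊗[k] 𝗛 (Fiber π b) x.2

variable (k π b) in
abbrev homologyTensorEquiv : 𝗧 B ⊗[k] 𝗧 (Fiber π b) ≃ₗ[k] ⨁ x : ℤ × ℤ, HomologyTensor π k b x :=
  TensorProduct.directSum k k (fun n => 𝗛 B n) (fun n => 𝗛 (Fiber π b) n)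

lemma homologyTensorEquiv_map_lof (x : ℤ × ℤ) (w : HomologyTensor π k b x) :
    homologyTensorEquiv π k b (tmap (𝗝 x.1) (𝗜 x.2) w) =
      lof k (ℤ × ℤ) (HomologyTensor π k b) x w := by
  induction w using induction_on with
  | zero => simp only [map_zero]
  | add a b ha hb => simp only [map_add, ha, hb]
  | tmul a c => exact directSum_lof_tmul_lof k k x.1 a x.2 c

lemma gradedComm_map_lof (p q : ℕ) (w : 𝗛 B p ⊗[k] 𝗛 (Fiber π b) q) : gradedComm k (fun n => 𝗛 B n)
      (fun n => 𝗛 (Fiber π b) n)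
      (tmap (𝗝 p) (𝗜 q) w) =
    (-1 : k) ^ (p * q) • tmap (𝗜 q) (𝗝 p) (tcomm k _ _ w) := by
  induction w using induction_on with
  | zero => simp only [map_zero, smul_zero]
  | add a b ha hb => simp only [map_add, ha, hb, smul_add]
  | tmul a c =>
    rw [map_tmul, gradedComm_of_tmul_of, comm_tmul,
      map_tmul, mul_comm p q, ← Nat.cast_mul, uzpow_natCast, Units.smul_def,
      ← Int.cast_smul_eq_zsmul k]
    congr 1; simp

variable [SimplyConnectedSpace B] {S : CoalgebraStructure (serreFiltration k π).spectralSequence}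
  (hS : ∀ x (z : (serreFiltration k π).almostCycles (0 : ℕ) x), (S.coalgebra 0).comul
  ((serreFiltration k π).cls 0 x z) = FilteredDGModule.leadTensor (serreFiltration k π) (serreWeight
  π) (fun s => s.1) 0 x.1 (diagonal k E z)) {f : TotalPage (serreFiltration k π).spectralSequence 2
  →ₗ[k] TotalSingularHomology k (Fiber π b)} {g : TotalPage (serreFiltration k π).spectralSequence 2
  →ₗ[k] TotalSingularHomology k B} (hf : ∀ x (z : (serreFiltration k π).almostCycles (2 : ℕ) x), f
  ((serreFiltration k π).cls 2 x z) = fiberFunctional k hπ b x z) (hg : ∀ x (z : (serreFiltration k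
  π).almostCycles (2 : ℕ) x), g ((serreFiltration k π).cls 2 x z) = baseFunctional k π x z)

lemma fiberRetr_comp_degreeProj (q : ℤ) : fiberRetr hπ k b ∘ₗ degreeProj k E q =
    𝗜 q ∘ₗ fiberRetrAt hπ k b q := by
  refine chains_ext k fun n α => ?_
  simp only [lcomp_apply, degreeProj_simplexChain]
  split_ifs with h
  · exact fiberRetr_of_mem k hπ b (simplexChain_mem_supported k _ h)
  · rw [map_zero, fiberRetrAt_simplexChain_of_ne hπ k b h, map_zero]

include hS hf hg in
lemma map_comul_base_fiber (x : ℤ × ℤ) (z : 𝗦.almostCycles (2 : ℕ) x) :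
    tmap g f ((S.coalgebra 2).comul (𝗦.cls 2 x z)) = tmap (𝗝 x.1) (𝗜 x.2)
        (tmap (homologyRetr k B x.1 ∘ₗ chainsMap k π)
          (fiberRetrAt hπ k b x.2) (diagonal k E z)) := by
  obtain ⟨f₀, hf₀⟩ := (fiberFunctional_isPage k hπ b).exists_page (r := 0) (by omega)
  obtain ⟨g₀, hg₀⟩ := (baseFunctional_isPage k (π := π)).exists_page (r := 0) (by omega)
  refine ((baseFunctional_isPage k).map_comul (fiberFunctional_isPage k hπ b) S
    hg₀ hg hf₀ hf x z (FilteredDGModule.IsWeightedCoalgebra.mem_almostCycles_zero z.2.1)).trans ?_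
  refine (congrArg (tmap g₀ f₀) (hS x _)).trans ?_
  rw [FilteredDGModule.map_leadTensor]
  have e : ∑ a ∈ Icc 0 x.1, tmap (g₀ ∘ₗ serreLead π k a)
      (f₀ ∘ₗ serreLead π k (x.1 - a)) (diagonal k E z) =
      tmap (baseRetr k π ∘ₗ degreeProj k E x.1) (fiberRetr hπ k b) (diagonal k E z) := by
    simp only [apply_leadAt_of_baseFunctional hg₀, apply_leadAt_of_fiberFunctional hf₀]
    rw [sum_eq_single x.1, if_pos (sub_self _)]
    · intro a _ ha; rw [if_neg (sub_ne_zero.2 (Ne.symm ha)), map_zero_right, lzero_apply]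
    · intro hx
      have hx : x.1 < 0 := by
        by_contra h
        exact hx (mem_Icc.2 ⟨by omega, le_rfl⟩)
      have h0 := z.2.1.1
      rw [(serre_hasWeights k π).fil_eq_bot hx] at h0; rw [(mem_bot k).1 h0, map_zero, map_zero]
  refine e.trans ?_
  rw [← comp_id (fiberRetr hπ k b), tmap_comp, lcomp_apply,
    map_degreeProj_left_diagonal (mem_degree_of_mem_almostCycles z.2), map_map,
    fiberRetr_comp_degreeProj, baseRetr_comp_degreeProj, map_map]

include hS hf hg in
lemma map_comul_fiber_base (x : ℤ × ℤ) (z : 𝗦.almostCycles (2 : ℕ) x) :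
    tmap f g ((S.coalgebra 2).comul (𝗦.cls 2 x z)) = tmap (𝗜 x.2) (𝗝 x.1)
        (tmap (fiberRetrAt hπ k b x.2)
          (homologyRetr k B x.1 ∘ₗ chainsMap k π) (diagonal k E z)) := by
  obtain ⟨f₀, hf₀⟩ := (fiberFunctional_isPage k hπ b).exists_page (r := 0) (by omega)
  obtain ⟨g₀, hg₀⟩ := (baseFunctional_isPage k (π := π)).exists_page (r := 0) (by omega)
  refine ((fiberFunctional_isPage k hπ b).map_comul (baseFunctional_isPage k) S
    hf₀ hf hg₀ hg x z (FilteredDGModule.IsWeightedCoalgebra.mem_almostCycles_zero z.2.1)).trans ?_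
  refine (congrArg (tmap f₀ g₀) (hS x _)).trans ?_
  rw [FilteredDGModule.map_leadTensor]
  have e : ∑ a ∈ Icc 0 x.1, tmap (f₀ ∘ₗ serreLead π k a)
      (g₀ ∘ₗ serreLead π k (x.1 - a)) (diagonal k E z) =
      tmap (fiberRetr hπ k b) (baseRetr k π ∘ₗ degreeProj k E x.1) (diagonal k E z) := by
    simp only [apply_leadAt_of_baseFunctional hg₀, apply_leadAt_of_fiberFunctional hf₀]
    rw [sum_eq_single 0, if_pos rfl, sub_zero]
    · intro a _ ha; rw [if_neg ha, map_zero_left, lzero_apply]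
    · intro hx
      have hx : x.1 < 0 := by
        by_contra h
        exact hx (mem_Icc.2 ⟨le_rfl, by omega⟩)
      have h0 := z.2.1.1
      rw [(serre_hasWeights k π).fil_eq_bot hx] at h0; rw [(mem_bot k).1 h0, map_zero, map_zero]
  refine e.trans ?_
  rw [← comp_id (fiberRetr hπ k b), tmap_comp, lcomp_apply,
    map_degreeProj_right_diagonal (mem_degree_of_mem_almostCycles z.2), map_map,
    fiberRetr_comp_degreeProj, baseRetr_comp_degreeProj, map_map]

include hS hf in
lemma homologyComul_secondPage_fiber (d : TotalPage 𝗦.spectralSequence 2) :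
    homologyComul k (Fiber π b) (f d) = tmap f f ((S.coalgebra 2).comul d) := by
  suffices h : homologyComul k (Fiber π b) ∘ₗ f = tmap f f ∘ₗ (S.coalgebra 2).comul from
    lcongr_fun h d
  refine 𝗦.total_ext 2 fun x z => ?_
  obtain ⟨f₀, hf₀⟩ := (fiberFunctional_isPage k hπ b).exists_page (r := 0) (by omega)
  refine Eq.trans ?_ (((fiberFunctional_isPage k hπ b).map_comul
    (fiberFunctional_isPage k hπ b) S hf₀ hf hf₀ hf x z
    (FilteredDGModule.IsWeightedCoalgebra.mem_almostCycles_zero z.2.1)).trans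
    (congrArg (tmap f₀ f₀) (hS x _))).symm
  rw [FilteredDGModule.map_leadTensor, lcomp_apply, hf]
  change _ = ∑ a ∈ Icc 0 x.1, tmap (f₀ ∘ₗ serreLead π k a)
      (f₀ ∘ₗ serreLead π k (x.1 - a)) (diagonal k E z)
  simp only [apply_leadAt_of_fiberFunctional hf₀]; rw [fiberFunctional]
  split_ifs with hx
  · have hz := z.2.1.1
    have hdz : boundary k E z ∈ 𝗦.fil (x.1 - (2 : ℕ)) := z.2.2
    rw [(serre_hasWeights k π).fil_eq_bot (by omega)] at hdz; rw [hx] at hz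
    rw [homologyComul_fiberRetr k hπ b hz ((mem_bot k).1 hdz), hx,
      Finset.Icc_self, Finset.sum_singleton, if_pos rfl, if_pos (sub_self _)]
  · rw [lzero_apply, map_zero]
    refine (sum_eq_zero fun a _ => ?_).symm
    by_cases ha : a = 0
    · rw [if_neg (show ¬ x.1 - a = 0 by omega), map_zero_right, lzero_apply]
    · rw [if_neg ha, map_zero_left, lzero_apply]

omit [SimplyConnectedSpace B] in
include hS hg in
lemma homologyComul_secondPage_base (d : TotalPage 𝗦.spectralSequence 2) :
    homologyComul k B (g d) = tmap g g ((S.coalgebra 2).comul d) := by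
  suffices h : homologyComul k B ∘ₗ g = tmap g g ∘ₗ (S.coalgebra 2).comul from
    lcongr_fun h d
  refine 𝗦.total_ext 2 fun x z => ?_
  obtain ⟨g₀, hg₀⟩ := (baseFunctional_isPage k (π := π)).exists_page (r := 0) (by omega)
  refine Eq.trans ?_ (((baseFunctional_isPage k).map_comul
    (baseFunctional_isPage k) S hg₀ hg hg₀ hg x z
    (FilteredDGModule.IsWeightedCoalgebra.mem_almostCycles_zero z.2.1)).trans
    (congrArg (tmap g₀ g₀) (hS x _))).symm
  rw [FilteredDGModule.map_leadTensor, lcomp_apply, hg]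
  change _ = ∑ a ∈ Icc 0 x.1, tmap (g₀ ∘ₗ serreLead π k a)
      (g₀ ∘ₗ serreLead π k (x.1 - a)) (diagonal k E z)
  simp only [apply_leadAt_of_baseFunctional hg₀, tmap_comp, lcomp_apply]
  have e : ∑ a ∈ Icc 0 x.1, tmap (degreeProj k E a) (degreeProj k E (x.1 - a))
      (diagonal k E z) = if x.2 = 0 then diagonal k E z else 0 := by
    have h := eq_on_of_single (∑ a ∈ Icc 0 x.1, tmap (degreeProj k E a)
      (degreeProj k E (x.1 - a)) ∘ₗ diagonal k E) (if x.2 = 0 then diagonal k E else 0) _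
      (fun ⟨n, α⟩ hα => ?_) z (mem_degree_of_mem_almostCycles z.2)
    · have hα : (n : ℤ) = x.1 + x.2 := hα
      rw [LinearMap.sum_apply]
      refine (sum_map_degreeProj_diagonal x.1 α).trans ?_
      by_cases hx : x.2 = 0
      · rw [if_pos (by omega), if_pos hx]; rfl
      · rw [if_neg (by omega), if_neg hx]; rfl
    · rw [LinearMap.sum_apply] at h
      refine h.trans ?_
      split_ifs <;> rfl
  rw [← map_sum, e, baseFunctional]
  split_ifs with hx
  · exact homologyComul_baseRetr k (p := x.1) (q := x.2) z.2 hx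
  · rw [lzero_apply, map_zero, map_zero]

variable (hε : ∀ (r : ℕ) x (z : (serreFiltration k π).almostCycles r x), (S.coalgebra r).counit
  ((serreFiltration k π).cls r x z) = if x = 0 then augmentation k E z else 0)

include hf hε in
lemma homologyCounit_secondPage_fiber (d : TotalPage 𝗦.spectralSequence 2) :
    homologyCounit k (Fiber π b) (f d) = (S.coalgebra 2).counit d := by
  suffices h : homologyCounit k (Fiber π b) ∘ₗ f = (S.coalgebra 2).counit from
    lcongr_fun h d
  refine 𝗦.total_ext 2 fun x z => ?_
  rw [lcomp_apply, hf]
  refine Eq.trans ?_ (hε 2 x z).symm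
  have hz := z.2.1.1
  have hzd := mem_degree_of_mem_almostCycles z.2
  rw [fiberFunctional]
  split_ifs with hx h0 h0
  · rw [hx] at hz; rw [homologyCounit_fiberRetr hπ k b hz]
  · rw [hx] at hz; rw [homologyCounit_fiberRetr hπ k b hz, augmentation_of_mem k _ _ _ hzd]; intro h
    exact h0 (Prod.ext hx (by rw [hx, zero_add] at h; exact h))
  · exact absurd (congrArg Prod.fst h0) hx
  · rw [lzero_apply, map_zero]

omit [SimplyConnectedSpace B] in
include hg hε in
lemma homologyCounit_secondPage_base (d : TotalPage 𝗦.spectralSequence 2) :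
    homologyCounit k B (g d) = (S.coalgebra 2).counit d := by
  suffices h : homologyCounit k B ∘ₗ g = (S.coalgebra 2).counit from
    lcongr_fun h d
  refine 𝗦.total_ext 2 fun x z => ?_
  rw [lcomp_apply, hg]
  refine Eq.trans ?_ (hε 2 x z).symm
  have hzd := mem_degree_of_mem_almostCycles z.2
  rw [baseFunctional]
  split_ifs with hx h0 h0
  · exact homologyCounit_baseRetr k _
  · rw [homologyCounit_baseRetr, augmentation_of_mem k _ _ _ hzd]; intro h
    exact h0 (Prod.ext (by rw [hx, add_zero] at h; exact h) hx)
  · exact absurd (congrArg Prod.snd h0) hx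
  · rw [lzero_apply, map_zero]

include hS hf hg

lemma gradedComm_comul (d : TotalPage 𝗦.spectralSequence 2) : gradedComm k (fun n => 𝗛 B n)
      (fun n => 𝗛 (Fiber π b) n)
      (tmap g f ((S.coalgebra 2).comul d)) =
      tmap f g ((S.coalgebra 2).comul d) := by
  suffices h : (gradedComm k (fun n => 𝗛 B n) (fun n => 𝗛 (Fiber π b) n)).toLinearMap ∘ₗ
      tmap g f ∘ₗ (S.coalgebra 2).comul =
      tmap f g ∘ₗ (S.coalgebra 2).comul from lcongr_fun h d
  refine 𝗦.total_ext 2 fun x z => ?_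
  by_cases hx : x.1 < 0 ∨ x.2 < 0
  · rw [FilteredDGModule.cls_apply, pageMk_eq_zero_of_neg hx, map_zero, map_zero, map_zero]
  obtain ⟨p, hp⟩ := Int.eq_ofNat_of_zero_le (not_lt.1 (not_or.1 hx).1)
  obtain ⟨q, hq⟩ := Int.eq_ofNat_of_zero_le (not_lt.1 (not_or.1 hx).2)
  obtain rfl : x = ((p : ℤ), (q : ℤ)) := Prod.ext hp hq
  change gradedComm k (fun n => 𝗛 B n) (fun n => 𝗛 (Fiber π b) n)
      (tmap g f ((S.coalgebra 2).comul (𝗦.cls 2 _ z))) =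
      tmap f g ((S.coalgebra 2).comul (𝗦.cls 2 _ z))
  rw [map_comul_base_fiber hS hf hg, map_comul_fiber_base hS hf hg, ← secondPageClass_eq]
  have hz : (z : Chains k E) ∈ 𝗦.almostCycles 1 ((p : ℤ), (q : ℤ)) := 𝗦.almostCycles_succ_le 1 _ z.2
  refine (gradedComm_map_lof p q _).trans ?_
  rw [comm_secondPageClass hπ k b hz, map_smul, smul_smul, ← mul_pow, neg_one_mul, neg_neg,
    one_pow, one_smul]

lemma directSum_comul (p q : ℕ) (z : 𝗦.almostCycles (2 : ℕ) ((p : ℤ), (q : ℤ))) :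
    tmap g f ((S.coalgebra 2).comul (𝗦.cls 2 _ z)) = tmap (𝗝 p) (𝗜 q)
        ((-1 : k) ^ (p * q) • tcomm k _ _ (secondPageClass hπ k b p q z)) := by
  have hz : (z : Chains k E) ∈ 𝗦.almostCycles 1 ((p : ℤ), (q : ℤ)) := 𝗦.almostCycles_succ_le 1 _ z.2
  rw [map_comul_base_fiber hS hf hg, ← map_smul (tcomm k _ _), ← comm_secondPageClass hπ k b hz]
  congr 1; exact ((tcomm k _ _).symm_apply_apply _).symm

omit hS hf hg in
variable (S f g) in
/-- A component of the map from the second page to `H_*(B; k) ⊗ H_*(F; k)`. -/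
def secondPageComponent (x : ℤ × ℤ) : 𝗦.Page (2 : ℕ) x →ₗ[k] HomologyTensor π k b x :=
  component k (ℤ × ℤ) (HomologyTensor π k b) x ∘ₗ
    (homologyTensorEquiv π k b).toLinearMap ∘ₗ tmap g f ∘ₗ (S.coalgebra 2).comul ∘ₗ 𝗦.incl 2 x

lemma homologyTensorEquiv_comul_incl (x : ℤ × ℤ) (c : 𝗦.Page (2 : ℕ) x) :
    homologyTensorEquiv π k b (tmap g f ((S.coalgebra 2).comul (𝗦.incl 2 x c))) =
      lof k (ℤ × ℤ) (HomologyTensor π k b) x (secondPageComponent S f g x c) := by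
  obtain ⟨z, rfl⟩ := mkQ_surjective _ c
  have h1 := (congrArg (homologyTensorEquiv π k b) (map_comul_base_fiber hS hf hg x z)).trans
    (homologyTensorEquiv_map_lof x _)
  refine h1.trans (congrArg (lof k (ℤ × ℤ) (HomologyTensor π k b) x) ?_)
  have h2 := congrArg (component k (ℤ × ℤ) (HomologyTensor π k b) x) h1
  rw [component.lof_self] at h2; exact h2.symm

lemma secondPageComponent_pageMk (p q : ℕ) (z : 𝗦.almostCycles (2 : ℕ) ((p : ℤ), (q : ℤ))) :
    secondPageComponent S f g (p, q) (𝗦.pageMk (2 : ℕ) _ z) =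
      (-1 : k) ^ (p * q) • tcomm k _ _ (secondPageClass hπ k b p q z) := by
  have h1 := (congrArg (homologyTensorEquiv π k b) (directSum_comul hS hf hg p q z)).trans
    (homologyTensorEquiv_map_lof ((p : ℤ), (q : ℤ)) _)
  have h2 := congrArg (component k (ℤ × ℤ) (HomologyTensor π k b) (p, q)) h1
  rw [component.lof_self] at h2; exact h2

lemma secondPageComponent_bijective (x : ℤ × ℤ) : Bijective (secondPageComponent S f g x) := by
  by_cases hx : x.1 < 0 ∨ x.2 < 0
  · have : Subsingleton (HomologyTensor π k b x) := by
      rcases hx with hx | hx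
      · have := subsingleton_singularHomology_neg (k := k) (B := B) hx
        infer_instance
      · have := subsingleton_singularHomology_neg (k := k) (B := Fiber π b) hx
        infer_instance
    refine ⟨(injective_iff_map_eq_zero _).2 fun c _ => ?_, fun y => ⟨0, Subsingleton.elim _ _⟩⟩
    obtain ⟨z, rfl⟩ := mkQ_surjective _ c
    exact pageMk_eq_zero_of_neg hx z
  obtain ⟨p, hp⟩ := Int.eq_ofNat_of_zero_le (not_lt.1 (not_or.1 hx).1)
  obtain ⟨q, hq⟩ := Int.eq_ofNat_of_zero_le (not_lt.1 (not_or.1 hx).2)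
  obtain rfl : x = ((p : ℤ), (q : ℤ)) := Prod.ext hp hq
  have hs : ∀ t : HomologyTensor π k b (p, q),
      (-1 : k) ^ (p * q) • (-1 : k) ^ (p * q) • t = t := fun t => by
    rw [smul_smul, ← mul_pow, neg_one_mul, neg_neg, one_pow, one_smul]
  have hcomp := secondPageComponent_pageMk hS hf hg p q
  refine ⟨(injective_iff_map_eq_zero _).2 fun c hc => ?_, fun y => ?_⟩
  · obtain ⟨z, rfl⟩ := mkQ_surjective _ c
    have h1 := (hcomp z).symm.trans hc
    have h2 := hs (tcomm k _ _ (secondPageClass hπ k b p q z))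
    rw [h1, smul_zero] at h2
    have h3 : secondPageClass hπ k b p q z = 0 :=
      (tcomm k _ _).injective (h2.symm.trans (map_zero _).symm)
    exact 𝗦.pageMk_eq_zero _ _ z (mem_pageDenominator_of_secondPageClass_eq_zero hπ b z.2 h3)
  · obtain ⟨z, hz, hzy⟩ := secondPageClass_surjective hπ b
      ((tcomm k _ _).symm ((-1 : k) ^ (p * q) • y))
    refine ⟨𝗦.pageMk (2 : ℕ) _ ⟨z, hz⟩, (hcomp ⟨z, hz⟩).trans ?_⟩
    rw [hzy, LinearEquiv.apply_symm_apply]; exact hs y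

theorem exists_secondPageIso : ∃ Φ : SecondPageIso k π b,
    (∀ d, secondPageEquiv k π b Φ d = tmap g f ((S.coalgebra 2).comul d)) ∧
    ∀ (p q : ℕ) (z : 𝗦.almostCycles (2 : ℕ) ((p : ℤ), (q : ℤ))), Φ (p, q) (𝗦.pageMk (2 : ℕ) _ z) =
        (-1 : k) ^ (p * q) • tcomm k _ _ (secondPageClass hπ k b p q z) := by
  let Φ : SecondPageIso k π b := fun x =>
    ofBijective (secondPageComponent S f g x) (secondPageComponent_bijective hS hf hg x)
  refine ⟨Φ, fun d => ?_, secondPageComponent_pageMk hS hf hg⟩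
  suffices h : (secondPageEquiv k π b Φ).toLinearMap =
      tmap g f ∘ₗ (S.coalgebra 2).comul from lcongr_fun h d
  refine linearMap_ext _ fun x => lin_ext fun c => ?_
  refine (homologyTensorEquiv π k b).injective
    ((?_ : _ = _).trans (homologyTensorEquiv_comul_incl hS hf hg x c).symm)
  refine ((homologyTensorEquiv π k b).apply_symm_apply _).trans ?_
  exact DFinsupp.mapRange_single (hf := fun i => (Φ i).map_zero)

lemma tensorHomologyComul_map (d : TotalPage 𝗦.spectralSequence 2) :
    tensorHomologyComul k B (Fiber π b) (tmap g f ((S.coalgebra 2).comul d)) =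
      tmap (tmap g f) (tmap g f) (tmap (S.coalgebra 2).comul (S.coalgebra 2).comul
          ((S.coalgebra 2).comul d)) := by
  refine .trans ?_ (middleSwap_map_comul (S.coalgebra 2).coassoc_apply
    (gradedComm_comul hS hf hg) d)
  refine congrArg (middleSwap (gradedComm k (fun n => 𝗛 B n)
    fun n => 𝗛 (Fiber π b) n).toLinearMap) ?_
  refine (lcongr_fun (tmap_comp _ _ _ _) _).symm.trans ?_
  refine .trans ?_ (lcongr_fun (tmap_comp _ _ _ _) _)
  refine congrArg₂ (fun a c => tmap a c ((S.coalgebra 2).comul d)) ?_ ?_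
  · exact lin_ext (homologyComul_secondPage_base hS hg)
  · exact lin_ext (homologyComul_secondPage_fiber hS hf)

omit hS in
include hε in
lemma tensorHomologyCounit_map (d : TotalPage 𝗦.spectralSequence 2) :
    tensorHomologyCounit k B (Fiber π b) (tmap g f ((S.coalgebra 2).comul d)) =
      (S.coalgebra 2).counit d := by
  have h1 : homologyCounit k B ∘ₗ g = (S.coalgebra 2).counit :=
    lin_ext (homologyCounit_secondPage_base hg hε)
  have h2 : homologyCounit k (Fiber π b) ∘ₗ f = (S.coalgebra 2).counit :=
    lin_ext (homologyCounit_secondPage_fiber hf hε)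
  have h3 : tmap (S.coalgebra 2).counit (S.coalgebra 2).counit
      ((S.coalgebra 2).comul d) = (1 : k) ⊗ₜ[k] (S.coalgebra 2).counit d := by
    have h := lcongr_fun (S.coalgebra 2).rTensor_counit_comp_comul d
    refine .trans ?_ (congrArg (lTensor k (S.coalgebra 2).counit) h)
    exact lcongr_fun (LinearMap.lTensor_comp_rTensor _ _ _).symm _
  refine (congrArg (tlid k k) (lcongr_fun (tmap_comp _ _ _ _) _).symm).trans ?_
  rw [h1, h2, h3, lid_tmul, one_smul]

variable {Φ : SecondPageIso k π b} (hΦ : ∀ d, secondPageEquiv k π b Φ d = tmap g f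
  ((S.coalgebra 2).comul d))

include hΦ in
lemma map_secondPageEquiv_comul (d : TotalPage 𝗦.spectralSequence 2) :
    tmap (secondPageEquiv k π b Φ).toLinearMap (secondPageEquiv k π b Φ).toLinearMap
      ((S.coalgebra 2).comul d) =
    tensorHomologyComul k B (Fiber π b) (secondPageEquiv k π b Φ d) := by
  refine .trans ?_ ((tensorHomologyComul_map hS hf hg d).symm.trans
    (congrArg (tensorHomologyComul k B (Fiber π b)) (hΦ d).symm))
  have h : (secondPageEquiv k π b Φ).toLinearMap = tmap g f ∘ₗ (S.coalgebra 2).comul := lin_ext hΦ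
  refine .trans (congrArg (fun l => tmap l l ((S.coalgebra 2).comul d)) h) ?_
  exact lcongr_fun (tmap_comp _ _ _ _) _

omit hS in
include hε hΦ in
lemma counit_eq_tensorHomologyCounit (d : TotalPage 𝗦.spectralSequence 2) :
    (S.coalgebra 2).counit d = tensorHomologyCounit k B (Fiber π b) (secondPageEquiv k π b Φ d) :=
  (tensorHomologyCounit_map hf hg hε d).symm.trans
    (congrArg (tensorHomologyCounit k B (Fiber π b)) (hΦ d).symm)

end SecondPageMaps

end SerreCoalgebra

end

/-- Let `k` be a field and `π : E → B` a Serre fibration with `B` simply connected, with fiber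
`F = π⁻¹(b)`. The homological Serre spectral sequence of `π` with coefficients in `k` is a spectral
sequence of `k`-coalgebras, with comultiplication on `E^0` induced by the Alexander--Whitney
diagonal, and the standard identification `E^2 ≅ H_*(B; k) ⊗ H_*(F; k)` is an isomorphism onto the
tensor product of the coalgebras `H_*(B; k)` and `H_*(F; k)`. -/
theorem mainTheorem1 {k : Type v} [Field k] {E B : Type u} [TopologicalSpace E]
    [TopologicalSpace B] [SimplyConnectedSpace B] (π : C(E, B)) (hπ : IsSerreFibration π) (b : B) :
    ∃ S : CoalgebraStructure (serreSpectralSequence k π),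
      IsInducedByDiagonal k π S ∧
      ∃ Φ : SecondPageIso k π b,
        IsStandardIdentification k π b Φ ∧
        (∀ x, TensorProduct.map (secondPageEquiv k π b Φ).toLinearMap
            (secondPageEquiv k π b Φ).toLinearMap ((S.coalgebra 2).comul x) =
          tensorHomologyComul k B (Fiber π b) (secondPageEquiv k π b Φ x)) ∧
        ∀ x, (S.coalgebra 2).counit x =
          tensorHomologyCounit k B (Fiber π b) (secondPageEquiv k π b Φ x) := by
  obtain ⟨S, hS, hε⟩ := (serre_isWeightedCoalgebra k π).exists_coalgebraStructure
  obtain ⟨f, hf⟩ := (fiberFunctional_isPage k hπ b).exists_page (r := 2) le_rfl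
  obtain ⟨g, hg⟩ := (baseFunctional_isPage k (π := π)).exists_page (r := 2) le_rfl
  obtain ⟨Φ, hΦ, hΦ'⟩ := exists_secondPageIso hS hf hg
  exact ⟨S, isInducedByDiagonal_of_comul k π S hS hε, Φ, isStandardIdentification hπ hΦ',
    map_secondPageEquiv_comul hS hf hg hΦ, counit_eq_tensorHomologyCounit hf hg hε hΦ⟩
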